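/- **Model.** Fix $m\ge 0$, $d_1,\dots,d_m>1$, $\gamma\in(0,\infty)$ and a sequence $p=p_n$ with $n/p_n\to\gamma$. For $\lambda_1,\dots,\lambda_m$ with $0\le\lambda_j\le\sqrt{d_j}$ and $\mu\ge 0$ put $a_j=d_j+\lambda_j\sqrt{d_j}$, $b_j=d_j-\lambda_j\sqrt{d_j}$. Let $\sigma$ be uniform on $\{-1,+1\}^n$. Given $\sigma$, let $A^{(1)},\dots,A^{(m)}$ be independent adjacency matrices of random graphs on $[n]$, where in the $j$-th graph each pair $\{s,t\}$ is an edge independently with probability $a_j/n$ if $\sigma_s=\sigma_t$ and $b_j/n$ if $\sigma_s\ne\sigma_t$ (clamped to $[0,1]$, which matters only for small $n$). Independently of these, let $u\sim N(0,I_p)$, let $R_1,\dots,R_n$ be i.i.d. $N(0,I_p)$ independent of $u$, and let $B_i=\sqrt{\mu/n}\,\sigma_i u+R_i$. Under $H_0$, $(\lambda_1,\dots,\lambda_m,\mu)=0$; under $H_1$, $(\lambda_1,\dots,\lambda_m,\mu)\neq 0$ is fixed. **Factor graph.** Its vertices are the variable nodes $1,\dots,n$, a factor node for each network $j\in[m]$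 and each pair $s<t$, joined to $s$ and to $t$ by edges of weight $A^{(j)}_{st}$, and $p$ covariate factor nodes, the $v$-th joined to every variable node $i$ by an edge of weight $B_{iv}$. A wedge of a cycle is a pair of consecutive edges of the cycle at a common factor node. For $K=(k_1,\dots,k_m,\ell)\in\mathbb{Z}_{\ge0}^{m+1}$ let $$Y_K=\frac1{n^\ell}\sum_{\omega}\prod_{e\in E(\omega)}\mathrm{weight}(e),$$ summed over the (simple) cycles $\omega$ of the factor graph with exactly $k_j$ wedges at factor nodes of network $j$, for all $j$, and $\ell$ covariate wedges. Let $k=k_1+\dots+k_m+\ell$. Call $K$ admissible if $k\ge2$ and $K$ is not $k_j=2=k$ for a single $j$; these are the types for which such cycles exist for large $n$. For all other types $Y_K\equiv0$. Put $$c_K=\frac1{2k}\,\frac{k!}{\ell!\,k_1!\cdots k_m!},\qquad \sigma_K^2(g)=\frac{c_K}{g^{\ell}}\prod_{j=1}^m d_j^{k_j},\qquad \mu_K(g)=c_K\prod_{j=1}^m(\lambda_j\sqrt{d_j})^{k_j}\Big(\frac{\mu}{g}\Big)^{\ell}.$$ **Theorem.** Let $K$ be an admissible type. As $n\to\infty$: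 1. Under $H_0$: if $\ell=0$ then $Y_K\overset{d}{\to}\mathrm{Poi}\big(c_K\prod_j d_j^{k_j}\big)$; if $\ell>0$ then $Y_K/\sigma_K(\gamma)\overset{d}{\to}N(0,1)$. 2. Under $H_1$: if $\ell=0$ then $Y_K\overset{d}{\to}\mathrm{Poi}\big(c_K\{\prod_j d_j^{k_j}+\prod_j(\lambda_j\sqrt{d_j})^{k_j}\}\big)$; if $\ell>0$ then $(Y_K-\mu_K(\gamma))/\sigma_K(\gamma)\overset{d}{\to}N(0,1)$. 3. Under $H_0$ and under $H_1$ the statistics are asymptotically independent: for pairwise distinct admissible types $K_1,\dots,K_r$, the vector of the statistics (normalized as above when $\ell>0$) converges in distribution to the product of the limit laws above. 4. Under $H_0$ and under $H_1$ these approximations hold uniformly for $k=O(\log^{1/4}n)$, in the following sense. Let $(\gamma_n)$ be any real sequence with $\gamma_n-n/p_n=O(n^{-a})$ for some $a>0$; for example $\gamma_n=n/p_n$, or $\gamma_n=\gamma$ if $n/p_n-\gamma=O(n^{-a})$. For all $r\in\mathbb{N}$, $C\in\mathbb{R}$ and $\varepsilon>0$ there is $N$ such that for all $n\ge N$ and all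 pairwise distinct admissible types $K_1,\dots,K_r$, each of size $k\le C(\log n)^{1/4}$, the joint law of the $r$ statistics (those with $\ell>0$ being normalized as above with $\gamma_n$ in place of $\gamma$) and the product of the corresponding laws ($\mathrm{Poi}$ with the mean above if $\ell=0$, $N(0,1)$ if $\ell>0$) are at distance at most $\varepsilon$ in the bounded Lipschitz metric, i.e. $|\int F\,dP-\int F\,dQ|\le\varepsilon$ for every $F:\mathbb{R}^r\to[-1,1]$ that is $1$-Lipschitz for the sup norm. -/

import Mathlib

open MeasureTheory ProbabilityTheory Filter Asymptotics
open scoped Topology ENNReal NNReal Nat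

namespace CycleStat

/-- Unordered pairs `i < j` of subjects. -/
abbrev Pair (n : ℕ) : Type := {e : Fin n × Fin n // e.1 < e.2}

/-- The sample space: the labels `σ` (`true` is `+1`, `false` is `-1`) and the edge indicators of
the `m` networks; the latent Gaussian vector `u` and the noise matrix `R`. -/
abbrev Sample (m n p : ℕ) : Type :=
  ((Fin n → Bool) × (Fin m → Pair n → Bool)) × ((Fin p → ℝ) × (Fin n → Fin p → ℝ))

/-- The value `+1` or `-1` of a label. -/
def spin (b : Bool) : ℝ := if b then 1 else -1

/-- The probability of an edge between two subjects with labels `s`, `t`: `a / n` if `s = t` and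
`b / n` if `s ≠ t`, where `a = d + lam * √d` and `b = d - lam * √d`.
It is clamped to `[0, 1]`, which for `0 ≤ b` only has an effect when `n < a`. -/
noncomputable def edgeProb (n : ℕ) (d lam : ℝ) (s t : Bool) : unitInterval :=
  Set.projIcc 0 1 zero_le_one
    ((if s = t then d + lam * √d else d - lam * √d) / (n : ℝ))

/-- The joint law of the labels and the networks: the labels are uniform on `{-1, +1}^n`, and given
the labels all the edges of all the networks are independent. -/
noncomputable def graphLaw (m n : ℕ) (d lam : Fin m → ℝ) :
    Measure ((Fin n → Bool) × (Fin m → Pair n → Bool)) :=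
  ∑ σ : Fin n → Bool, ((2 : ℝ≥0∞) ^ n)⁻¹ •
    (Measure.dirac σ).prod (Measure.pi fun r : Fin m => Measure.pi fun e : Pair n =>
      bernoulliMeasure true false (edgeProb n (d r) (lam r) (σ e.1.1) (σ e.1.2)))

/-- The law of the model: `u` and `R` have independent standard Gaussian entries, and are
independent of the labels and the networks. -/
noncomputable def modelLaw (m n p : ℕ) (d lam : Fin m → ℝ) : Measure (Sample m n p) :=
  (graphLaw m n d lam).prod
    ((Measure.pi fun _ : Fin p => gaussianReal 0 1).prod
      (Measure.pi fun _ : Fin n => Measure.pi fun _ : Fin p => gaussianReal 0 1))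

instance graphLaw_isProb (m n : ℕ) (d lam : Fin m → ℝ) :
    IsProbabilityMeasure (graphLaw m n d lam) := by
  constructor
  simp only [graphLaw, Measure.finsetSum_apply, Measure.smul_apply, measure_univ, smul_eq_mul,
    mul_one, Finset.sum_const, Finset.card_univ, Fintype.card_fun, Fintype.card_bool,
    Fintype.card_fin, nsmul_eq_mul]
  push_cast
  exact ENNReal.mul_inv_cancel (by positivity) (by finiteness)

instance modelLaw_isProb (m n p : ℕ) (d lam : Fin m → ℝ) :
    IsProbabilityMeasure (modelLaw m n p d lam) := by
  unfold modelLaw; infer_instance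

/-- The adjacency entry `A^{(r)}_{ij}` for the pair `e = {i, j}`. -/
def adj {m n p : ℕ} (x : Sample m n p) (r : Fin m) (e : Pair n) : ℝ :=
  if x.1.2 r e then 1 else 0

/-- The covariate entry `B_{ij} = √(μ/n) σ_i u_j + R_{ij}`. -/
noncomputable def covariate {m n p : ℕ} (mu : ℝ) (x : Sample m n p) (i : Fin n) (j : Fin p) : ℝ :=
  √(mu / n) * spin (x.1.1 i) * x.2.1 j + x.2.2 i j

/-- Factor nodes: one for each network `r` and pair `i < j`, and one for each covariate. -/
abbrev FactorNode (m n p : ℕ) : Type := (Fin m × Pair n) ⊕ Fin p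

/-- Vertices of the factor graph: the `n` variable nodes and the factor nodes. -/
abbrev Vertex (m n p : ℕ) : Type := Fin n ⊕ FactorNode m n p

/-- Incidence of a variable node and a factor node: the node of a pair is incident to the two
members of the pair, the node of a covariate is incident to every variable node. -/
def Incident {m n p : ℕ} (i : Fin n) : FactorNode m n p → Prop
  | .inl f => i = f.2.1.1 ∨ i = f.2.1.2
  | .inr _ => True

/-- The factor graph. -/
def factorGraph (m n p : ℕ) : SimpleGraph (Vertex m n p) :=
  SimpleGraph.fromRel fun x y => ∃ i f, x = Sum.inl i ∧ y = Sum.inr f ∧ Incident i f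

/-- The edge of the factor graph between a variable node and a factor node. -/
abbrev edge {m n p : ℕ} (i : Fin n) (f : FactorNode m n p) : Sym2 (Vertex m n p) :=
  s(Sum.inl i, Sum.inr f)

/-- The weight of the edge between `i` and a factor node. -/
noncomputable def weight {m n p : ℕ} (mu : ℝ) (x : Sample m n p) (i : Fin n) :
    FactorNode m n p → ℝ
  | .inl f => adj x f.1 f.2
  | .inr j => covariate mu x i j

/-- A cycle type `K = ((k_1, …, k_m), ℓ)`. -/
abbrev CycleType (m : ℕ) : Type := (Fin m → ℕ) × ℕ

/-- `k = k_1 + ⋯ + k_m + ℓ`. -/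
def size {m : ℕ} (K : CycleType m) : ℕ := ∑ j, K.1 j + K.2

/-- The cycle types that occur in the factor graph (when `n`, `p` are large): a cycle has at least
two wedges, and as a network has only one factor node for each pair of subjects, the two wedges of
a cycle of size two are not wedges of the same network. -/
def Admissible {m : ℕ} (K : CycleType m) : Prop :=
  2 ≤ size K ∧ (size K = 2 → ∀ j, K.1 j ≤ 1)

open Classical in
/-- The cycles of the factor graph, as sets of edges, with `k_r` wedges of each network `r` and `ℓ`
covariate wedges. A wedge consists of two edges at the same factor node. -/
noncomputable def cycles (m n p : ℕ) (K : CycleType m) : Finset (Finset (Sym2 (Vertex m n p))) :=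
  Finset.univ.filter fun S =>
    (∃ (v : Vertex m n p) (c : (factorGraph m n p).Walk v v),
      c.IsCycle ∧ ∀ e, e ∈ S ↔ e ∈ c.edges) ∧
    (∀ r : Fin m, (Finset.univ.filter fun q : Fin n × Pair n =>
      edge q.1 (Sum.inl (r, q.2)) ∈ S).card = 2 * K.1 r) ∧
    (Finset.univ.filter fun q : Fin n × Fin p => edge q.1 (Sum.inr q.2) ∈ S).card = 2 * K.2

open Classical in
/-- The cycle statistic `Y_{k_1, …, k_m, ℓ}`: the sum over the cycles of the product of the weights
of all their edges, divided by `n ^ ℓ`. -/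
noncomputable def cycleStat {m n p : ℕ} (mu : ℝ) (K : CycleType m) (x : Sample m n p) : ℝ :=
  ((n : ℝ) ^ K.2)⁻¹ * ∑ S ∈ cycles m n p K,
    ∏ q : Fin n × FactorNode m n p with edge q.1 q.2 ∈ S, weight mu x q.1 q.2

/-- `(1 / 2k) * k! / (ℓ! k_1! ⋯ k_m!)`. -/
noncomputable def coeff {m : ℕ} (K : CycleType m) : ℝ :=
  1 / (2 * (size K : ℝ)) * ((size K)! / ((K.2)! * ∏ j, ((K.1 j)! : ℝ)))

/-- The Poisson mean under the null hypothesis (for `ℓ = 0`). -/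
noncomputable def nullRate {m : ℕ} (d : Fin m → ℝ) (K : CycleType m) : ℝ :=
  coeff K * ∏ j, d j ^ K.1 j

/-- The Poisson mean under the alternative (for `ℓ = 0`). -/
noncomputable def altRate {m : ℕ} (d lam : Fin m → ℝ) (K : CycleType m) : ℝ :=
  coeff K * (∏ j, d j ^ K.1 j + ∏ j, (lam j * √(d j)) ^ K.1 j)

/-- The Gaussian mean under the alternative (for `ℓ > 0`). -/
noncomputable def altMean {m : ℕ} (d lam : Fin m → ℝ) (mu γ : ℝ) (K : CycleType m) : ℝ :=
  coeff K * (∏ j, (lam j * √(d j)) ^ K.1 j) * (mu / γ) ^ K.2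

/-- The Gaussian standard deviation under both hypotheses (for `ℓ > 0`). -/
noncomputable def stdDev {m : ℕ} (d : Fin m → ℝ) (γ : ℝ) (K : CycleType m) : ℝ :=
  √(coeff K / γ ^ K.2 * ∏ j, d j ^ K.1 j)

/-- The Poisson law with mean `a ≥ 0`, as a law on `ℝ`. -/
noncomputable def poissonReal (a : ℝ) : Measure ℝ :=
  (poissonMeasure a.toNNReal).map (Nat.cast : ℕ → ℝ)

instance poissonReal_isProb (a : ℝ) : IsProbabilityMeasure (poissonReal a) := by
  unfold poissonReal; infer_instance

/-- The statistic itself if `ℓ = 0`, the statistic centred at `c` and divided by `s` if `ℓ > 0`. -/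
noncomputable def normStat {m n p : ℕ} (mu c s : ℝ) (K : CycleType m) (x : Sample m n p) : ℝ :=
  if K.2 = 0 then cycleStat mu K x else (cycleStat mu K x - c) / s

/-- The Poisson law with mean `a` if `ℓ = 0`, the standard Gaussian law if `ℓ > 0`. -/
noncomputable def limitLaw {m : ℕ} (a : ℝ) (K : CycleType m) : Measure ℝ :=
  if K.2 = 0 then poissonReal a else gaussianReal 0 1

instance limitLaw_isProb {m : ℕ} (a : ℝ) (K : CycleType m) :
    IsProbabilityMeasure (limitLaw a K) := by
  unfold limitLaw; split_ifs <;> infer_instance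

/-- `P` and `Q` are at distance at most `ε` in the bounded Lipschitz metric, which metrizes weak
convergence of probability measures. -/
def BLClose {r : ℕ} (P Q : Measure (Fin r → ℝ)) (ε : ℝ) : Prop :=
  ∀ F : (Fin r → ℝ) → ℝ, LipschitzWith 1 F → (∀ y, |F y| ≤ 1) →
    |∫ y, F y ∂P - ∫ y, F y ∂Q| ≤ ε

end CycleStat

/-!
The theorem is reduced to one estimate, `exists_blClose`: for all cycle types of size at most `k`
the bounded Lipschitz distance between the joint law and the product of the limit laws is at most
`2 ε + M X ^ (13 k) √δ`. Here `M` depends on the number of types and on `ε` only, the scale `X` is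
proportional to `k + 1`, and `δ` bounds both `1 / n` and the relative error of the number that
replaces `n / p`. For fixed types the error term vanishes in the limit because `δ → 0`; for
`k = O(log^{1/4} n)` it vanishes because `X ^ (13 k) = exp (O(log^{1/2} n))` is smaller than any
power of `n`. The null hypothesis is the case `λ = 0`, `μ = 0` of the estimate, in which the signal
terms are zero since a cycle has at least one wedge.

*Counting.* A cycle is a closed word of variable and factor nodes, determined up to rotation and
reflection. Hence the number of cycles of a type is `c_K` times the falling factorials
`(n)_k (p)_ℓ` (`card_loops`), which gives the means and variances (`integral_edgeInd_loop`,
`IsScale.card_loops_mul_sq`, `IsScale.card_loops_mul_signal`). All errors come from cycles that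
meet. A union of cycles has at most as many nodes, among the subjects and the covariates, as it has
edges of the networks and covariate links together, and fewer if two different cycles meet
(`MinDegTwo.card_supp_lt`). Each node can be chosen in `O(n)` ways, and in second moments each edge
and each covariate link of the union contributes a factor `1 / n`, so that the sum over pairs or
quadruples of meeting cycles is `X ^ O(k) / n`.

*Covariate wedges.* The weight of a cycle with `ℓ > 0` is split into the part without the signal and
the rest. The rest has the mean `μ_K` and a small variance (`IsScale.integral_sq_signalPart_le`).
For fixed networks the part without the signal is a homogeneous polynomial of independent Gaussian
variables `R`. Interpolating between a vector `P` of such polynomials and a Gaussian vector `Z`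
along `cos θ Z + sin θ P`, and integrating by parts, one finds that the law of `P` is close to that
of `Z` as soon as the inner products of the gradients of `P` are close to constants
(`SmoothTest.abs_sub_le_of_gradients`). Their second moments involve quadruples of cycles, and they
concentrate by the counting argument (`IsScale.integral_abs_gradError_le`). The resulting Gaussian
vector is the same for all networks, and so it is independent of them.

*Cycles in the networks.* The numbers of cycles with `ℓ = 0` are sums of indicators of which those of
cycles without common nodes are independent. Replacing the indicators one by one by independent
Poisson variables changes the law by the sum over meeting cycles of their joint probabilities
(`abs_classSum_sub_le`), which is small again by counting (`IsScale.abs_countPart_sub_le`). The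
Gaussian vector is carried along as an independent summand, so this yields the joint limit.

The Gaussian comparison needs test functions with bounded second derivatives; Lipschitz functions
are approximated by such functions by convolution with a bump function (`exists_smoothTest`).
-/

namespace CycleStat

/-! ### Labelled cycles of the factor graph -/

/-- The walk `g 0, g 1, …, g N` along a sequence of successively adjacent vertices. -/
def walkAlong {V : Type*} {G : SimpleGraph V} (g : ℕ → V) (h : ∀ t, G.Adj (g t) (g (t + 1))) :
    (N : ℕ) → G.Walk (g 0) (g N)
  | 0 => SimpleGraph.Walk.nil
  | N + 1 => (walkAlong g h N).concat (h N)

lemma walkAlong_edges {V : Type*} {G : SimpleGraph V} (g : ℕ → V)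
    (h : ∀ t, G.Adj (g t) (g (t + 1))) (N : ℕ) :
    (walkAlong g h N).edges = (List.range N).map fun t => s(g t, g (t + 1)) := by
  induction N with
  | zero => rfl
  | succ N ih => rw [walkAlong, SimpleGraph.Walk.edges_concat, ih, List.range_succ]; simp

lemma walkAlong_support {V : Type*} {G : SimpleGraph V} (g : ℕ → V)
    (h : ∀ t, G.Adj (g t) (g (t + 1))) (N : ℕ) :
    (walkAlong g h N).support = (List.range (N + 1)).map g := by
  induction N with
  | zero => rfl
  | succ N ih =>
    rw [walkAlong, SimpleGraph.Walk.support_concat, ih, List.range_succ (n := N + 1)]; simp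

/-- Incidences between a variable node and a factor node; cycles are encoded as finite sets of
these. -/
abbrev Link (m n p : ℕ) : Type := Fin n × FactorNode m n p

variable {m n p : ℕ}

lemma factorGraph_adj (x y : Vertex m n p) : (factorGraph m n p).Adj x y ↔
    ∃ i f, Incident i f ∧ ((x = Sum.inl i ∧ y = Sum.inr f) ∨ (y = Sum.inl i ∧ x = Sum.inr f)) := by
  unfold factorGraph
  rw [SimpleGraph.fromRel_adj]
  constructor
  · rintro ⟨-, ⟨i, f, h1, h2, h3⟩ | ⟨i, f, h1, h2, h3⟩⟩
    exacts [⟨i, f, h3, Or.inl ⟨h1, h2⟩⟩, ⟨i, f, h3, Or.inr ⟨h1, h2⟩⟩]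
  · rintro ⟨i, f, h3, ⟨rfl, rfl⟩ | ⟨rfl, rfl⟩⟩
    · exact ⟨by simp, Or.inl ⟨i, f, rfl, rfl, h3⟩⟩
    · exact ⟨by simp, Or.inr ⟨i, f, rfl, rfl, h3⟩⟩

/-- The `t`-th pair of links of a labelled cycle `i 0, f 0, i 1, f 1, …`: the factor node `f t`
with `i t` and with `i (t + 1)`. -/
def linkAt {k : ℕ} (i : ZMod k → Fin n) (f : ZMod k → FactorNode m n p) :
    ZMod k × Bool → Link m n p
  | (t, false) => (i t, f t)
  | (t, true) => (i (t + 1), f t)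

open Classical in
/-- The set of links of a labelled cycle. -/
noncomputable def loop {k : ℕ} [NeZero k] (i : ZMod k → Fin n) (f : ZMod k → FactorNode m n p) :
    Finset (Link m n p) :=
  Finset.univ.image (linkAt i f)

/-- A labelled simple cycle: the variable nodes `i 0, …, i (k - 1)` are distinct, so are the
factor nodes `f 0, …, f (k - 1)`, and `f t` is incident to `i t` and `i (t + 1)`. -/
structure IsLabelled {k : ℕ} (i : ZMod k → Fin n) (f : ZMod k → FactorNode m n p) : Prop where
  inj_var : Function.Injective i
  inj_factor : Function.Injective f
  incident : ∀ t, Incident (i t) (f t)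
  incident_succ : ∀ t, Incident (i (t + 1)) (f t)

lemma mem_loop {k : ℕ} [NeZero k] {i : ZMod k → Fin n} {f : ZMod k → FactorNode m n p}
    {q : Link m n p} : q ∈ loop i f ↔ ∃ t, (q.1 = i t ∨ q.1 = i (t + 1)) ∧ q.2 = f t := by
  unfold loop
  simp only [Finset.mem_image, Finset.mem_univ, true_and, Prod.exists, Bool.exists_bool, linkAt]
  constructor
  · rintro ⟨t, rfl | rfl⟩
    exacts [⟨t, Or.inl rfl, rfl⟩, ⟨t, Or.inr rfl, rfl⟩]
  · rintro ⟨t, h | h, h'⟩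
    exacts [⟨t, Or.inl (Prod.ext h.symm h'.symm)⟩, ⟨t, Or.inr (Prod.ext h.symm h'.symm)⟩]

lemma zmod_ne_add_one {k : ℕ} (hk : 2 ≤ k) (t : ZMod k) : t ≠ t + 1 := by
  have : Fact (1 < k) := ⟨hk⟩
  simp

lemma IsLabelled.var_ne {k : ℕ} (hk : 2 ≤ k) {i : ZMod k → Fin n}
    {f : ZMod k → FactorNode m n p} (h : IsLabelled i f) (t : ZMod k) : i t ≠ i (t + 1) :=
  fun e => zmod_ne_add_one hk t (h.inj_var e)

lemma IsLabelled.linkAt_injective {k : ℕ} (hk : 2 ≤ k) {i : ZMod k → Fin n}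
    {f : ZMod k → FactorNode m n p} (h : IsLabelled i f) : Function.Injective (linkAt i f) := by
  rintro ⟨t, b⟩ ⟨s, c⟩ e
  have hf : f t = f s := by
    have := congrArg Prod.snd e
    cases b <;> cases c <;> exact this
  obtain rfl := h.inj_factor hf
  have hi := congrArg Prod.fst e
  cases b <;> cases c
  · rfl
  · exact absurd hi (h.var_ne hk t)
  · exact absurd hi.symm (h.var_ne hk t)
  · rfl

lemma zmod_val_succ_cases {k : ℕ} [NeZero k] (t : ZMod k) :
    ((t + 1).val = t.val + 1 ∧ t.val + 1 < k) ∨ ((t + 1).val = 0 ∧ t.val + 1 = k) := by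
  have h1 : (t + 1).val = (t.val + 1) % k := by
    rw [ZMod.val_add, ZMod.val_one_eq_one_mod, Nat.add_mod_mod]
  have h2 := t.val_lt
  rcases lt_or_eq_of_le (Nat.succ_le_of_lt h2) with h | h
  · exact Or.inl ⟨by rw [h1, Nat.mod_eq_of_lt h], h⟩
  · exact Or.inr ⟨by rw [h1, show t.val + 1 = k from h, Nat.mod_self], h⟩

/-- Every cycle of the factor graph has a labelling. -/
lemma exists_labelled_of_isCycle {v : Vertex m n p} (c : (factorGraph m n p).Walk v v)
    (hc : c.IsCycle) : ∃ k : ℕ, ∃ _ : NeZero k, 2 ≤ k ∧ ∃ (i : ZMod k → Fin n)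
      (f : ZMod k → FactorNode m n p), IsLabelled i f ∧
      ∀ q : Link m n p, edge q.1 q.2 ∈ c.edges ↔ q ∈ loop i f := by
  -- it suffices to consider walks that start at a variable node
  wlog hv : ∃ a, v = Sum.inl a generalizing v
  · have hlen := hc.three_le_length
    have hadj := c.adj_getVert_succ (i := 0) (by omega)
    rw [SimpleGraph.Walk.getVert_zero] at hadj
    have hmem : c.getVert 1 ∈ c.support := c.getVert_mem_support 1
    obtain ⟨a, ha⟩ : ∃ a, c.getVert 1 = Sum.inl a := by
      rw [factorGraph_adj] at hadj
      obtain ⟨i, f, -, ⟨h, -⟩ | ⟨h, -⟩⟩ := hadj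
      · exact absurd ⟨i, h⟩ hv
      · exact ⟨i, h⟩
    obtain ⟨k, hk0, hk, i, f, h1, h2⟩ := this (c.rotate _ hmem) (hc.rotate _) ⟨a, ha⟩
    refine ⟨k, hk0, hk, i, f, h1, fun q => ?_⟩
    rw [← h2, (c.rotate_edges _ hmem).mem_iff]
  obtain ⟨a, rfl⟩ := hv
  set g := c.getVert with hg
  set N := c.length with hN
  have hN3 : 3 ≤ N := hc.three_le_length
  have hadj : ∀ t < N, (factorGraph m n p).Adj (g t) (g (t + 1)) :=
    fun t ht => c.adj_getVert_succ ht
  have g0 : g 0 = Sum.inl a := c.getVert_zero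
  have gN : g N = Sum.inl a := c.getVert_length
  -- the walk alternates between variable nodes and factor nodes
  have alt : ∀ t, (2 * t ≤ N → ∃ b, g (2 * t) = Sum.inl b) ∧
      (2 * t + 1 ≤ N → ∃ b, g (2 * t + 1) = Sum.inr b) := by
    have step : ∀ t < N, (∃ b, g t = Sum.inl b) → ∃ b, g (t + 1) = Sum.inr b := by
      rintro t ht ⟨b, hb⟩
      obtain ⟨i, f, -, ⟨-, h⟩ | ⟨-, h⟩⟩ := (factorGraph_adj _ _).1 (hadj t ht)
      · exact ⟨f, h⟩
      · rw [hb] at h; exact absurd h (by simp)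
    have step' : ∀ t < N, (∃ b, g t = Sum.inr b) → ∃ b, g (t + 1) = Sum.inl b := by
      rintro t ht ⟨b, hb⟩
      obtain ⟨i, f, -, ⟨h, -⟩ | ⟨h, -⟩⟩ := (factorGraph_adj _ _).1 (hadj t ht)
      · rw [hb] at h; exact absurd h (by simp)
      · exact ⟨i, h⟩
    intro t
    induction t with
    | zero => exact ⟨fun _ => ⟨a, g0⟩, fun h => step 0 (by omega) ⟨a, g0⟩⟩
    | succ t ih =>
      have h1 : 2 * (t + 1) ≤ N → ∃ b, g (2 * (t + 1)) = Sum.inl b := fun h =>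
        step' (2 * t + 1) (by omega) (ih.2 (by omega))
      exact ⟨h1, fun h => step _ (by omega) (h1 (by omega))⟩
  obtain ⟨k, hk⟩ : ∃ k, N = 2 * k := by
    by_contra hodd
    push Not at hodd
    obtain ⟨t, ht⟩ : ∃ t, N = 2 * t + 1 := ⟨N / 2, by have := hodd (N / 2); omega⟩
    obtain ⟨b, hb⟩ := (alt t).2 ht.ge
    rw [← ht, gN] at hb
    exact absurd hb (by simp)
  have hk2 : 2 ≤ k := by omega
  have hk0 : NeZero k := ⟨by omega⟩
  have hI : ∀ t : ZMod k, ∃ b, g (2 * t.val) = Sum.inl b := fun t =>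
    (alt _).1 (by have := t.val_lt; omega)
  have hF : ∀ t : ZMod k, ∃ b, g (2 * t.val + 1) = Sum.inr b := fun t =>
    (alt _).2 (by have := t.val_lt; omega)
  choose I hI using hI
  choose F hF using hF
  have hsucc : ∀ t : ZMod k, g (2 * t.val + 2) = Sum.inl (I (t + 1)) := by
    intro t
    rcases zmod_val_succ_cases t with ⟨h, -⟩ | ⟨h, h'⟩
    · rw [← hI, h]; rfl
    · rw [← hI, h, show 2 * t.val + 2 = N by omega, gN, ← g0]
  refine ⟨k, hk0, hk2, I, F, ⟨?_, ?_, ?_, ?_⟩, fun q => ?_⟩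
  · intro s t e
    have : g (2 * s.val) = g (2 * t.val) := by rw [hI, hI, e]
    have := hc.getVert_injOn' (by simp only [Set.mem_ofPred_eq]; have := s.val_lt; omega)
      (by simp only [Set.mem_ofPred_eq]; have := t.val_lt; omega) this
    exact ZMod.val_injective k (by omega)
  · intro s t e
    have : g (2 * s.val + 1) = g (2 * t.val + 1) := by rw [hF, hF, e]
    have := hc.getVert_injOn' (by simp only [Set.mem_ofPred_eq]; have := s.val_lt; omega)
      (by simp only [Set.mem_ofPred_eq]; have := t.val_lt; omega) this
    exact ZMod.val_injective k (by omega)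
  · intro t
    obtain ⟨i, f, h, ⟨h1, h2⟩ | ⟨h1, h2⟩⟩ := (factorGraph_adj _ _).1
      (hadj (2 * t.val) (by have := t.val_lt; omega))
    · rw [hI] at h1; rw [hF] at h2
      obtain rfl := Sum.inl_injective h1; obtain rfl := Sum.inr_injective h2
      exact h
    · rw [hF] at h1; exact absurd h1 (by simp)
  · intro t
    obtain ⟨i, f, h, ⟨h1, h2⟩ | ⟨h1, h2⟩⟩ := (factorGraph_adj _ _).1
      (hadj (2 * t.val + 1) (by have := t.val_lt; omega))
    · rw [hF] at h1; exact absurd h1 (by simp)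
    · rw [hsucc] at h1; rw [hF] at h2
      obtain rfl := Sum.inl_injective h1; obtain rfl := Sum.inr_injective h2
      exact h
  · rw [SimpleGraph.Walk.mk_mem_edges_iff_exists, mem_loop]
    constructor
    · rintro ⟨t, ht, e⟩
      rcases Nat.even_or_odd' t with ⟨s, rfl | rfl⟩
      · have hs : s < k := by change 2 * s < N at ht; omega
        have hv : ((s : ℕ) : ZMod k).val = s := ZMod.val_cast_of_lt hs
        have h1 := hI s; have h2 := hF s
        rw [hv] at h1 h2
        change s(g _, g _) = _ at e
        rw [h1, h2, Sym2.eq_iff] at e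
        rcases e with ⟨e1, e2⟩ | ⟨e1, e2⟩
        · exact ⟨s, Or.inl (Sum.inl_injective e1).symm, (Sum.inr_injective e2).symm⟩
        · exact absurd e1 (by simp)
      · have hs : s < k := by change 2 * s + 1 < N at ht; omega
        have hv : ((s : ℕ) : ZMod k).val = s := ZMod.val_cast_of_lt hs
        have h1 := hsucc s; have h2 := hF s
        rw [hv] at h1 h2
        change s(g _, g _) = _ at e
        rw [h1, h2, Sym2.eq_iff] at e
        rcases e with ⟨e1, e2⟩ | ⟨e1, e2⟩
        · exact absurd e1 (by simp)
        · exact ⟨s, Or.inr (Sum.inl_injective e2).symm, (Sum.inr_injective e1).symm⟩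
    · rintro ⟨t, h | h, h'⟩
      · refine ⟨2 * t.val, by have := t.val_lt; change _ < N; omega, ?_⟩
        change s(g _, g _) = _
        rw [hI, hF, h, h']
      · refine ⟨2 * t.val + 1, by have := t.val_lt; change _ < N; omega, ?_⟩
        change s(g _, g _) = _
        rw [hsucc, hF, h, h', Sym2.eq_swap]

/-- Every labelled cycle is a cycle of the factor graph. -/
lemma IsLabelled.exists_isCycle {k : ℕ} [NeZero k] (hk : 2 ≤ k) {i : ZMod k → Fin n}
    {f : ZMod k → FactorNode m n p} (h : IsLabelled i f) :
    ∃ (v : Vertex m n p) (c : (factorGraph m n p).Walk v v), c.IsCycle ∧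
      ∀ e, e ∈ c.edges ↔ ∃ q ∈ loop i f, e = edge q.1 q.2 := by
  let g : ℕ → Vertex m n p := fun t =>
    if t % 2 = 0 then Sum.inl (i ((t / 2 : ℕ) : ZMod k)) else Sum.inr (f ((t / 2 : ℕ) : ZMod k))
  have ge : ∀ t, g (2 * t) = Sum.inl (i (t : ZMod k)) := fun t => by simp [g]
  have go : ∀ t, g (2 * t + 1) = Sum.inr (f (t : ZMod k)) := fun t => by
    simp [g, show (2 * t + 1) / 2 = t by omega]
  have ge' : ∀ t, g (2 * t + 1 + 1) = Sum.inl (i ((t : ZMod k) + 1)) := fun t => by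
    rw [show 2 * t + 1 + 1 = 2 * (t + 1) by ring, ge]; push_cast; rfl
  have hadj : ∀ t, (factorGraph m n p).Adj (g t) (g (t + 1)) := by
    intro t
    rw [factorGraph_adj]
    rcases Nat.even_or_odd' t with ⟨s, rfl | rfl⟩
    · exact ⟨_, _, h.incident s, Or.inl ⟨ge s, go s⟩⟩
    · exact ⟨_, _, h.incident_succ s, Or.inr ⟨ge' s, go s⟩⟩
  have hcl : g (2 * k) = g 0 := by
    rw [ge, show (0 : ℕ) = 2 * 0 by rfl, ge]; simp
  have castInj : ∀ s t : ℕ, s < k → t < k → ((s : ZMod k) = t) → s = t := by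
    intro s t hs ht e
    rw [ZMod.natCast_eq_natCast_iff'] at e
    rwa [Nat.mod_eq_of_lt hs, Nat.mod_eq_of_lt ht] at e
  have ginj : ∀ s t : ℕ, s < 2 * k → t < 2 * k → g s = g t → s = t := by
    intro s t hs ht e
    rcases Nat.even_or_odd' s with ⟨s, rfl | rfl⟩ <;> rcases Nat.even_or_odd' t with ⟨t, rfl | rfl⟩
    · rw [ge, ge] at e
      rw [castInj s t (by omega) (by omega) (h.inj_var (Sum.inl_injective e))]
    · rw [ge, go] at e; exact absurd e (by simp)
    · rw [go, ge] at e; exact absurd e (by simp)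
    · rw [go, go] at e
      rw [castInj s t (by omega) (by omega) (h.inj_factor (Sum.inr_injective e))]
  have hmem : ∀ e, e ∈ (walkAlong g hadj (2 * k)).edges ↔ ∃ q ∈ loop i f, e = edge q.1 q.2 := by
    intro e
    rw [walkAlong_edges]
    simp only [List.mem_map, List.mem_range, mem_loop]
    constructor
    · rintro ⟨t, ht, rfl⟩
      rcases Nat.even_or_odd' t with ⟨s, rfl | rfl⟩
      · exact ⟨(i s, f s), ⟨s, Or.inl rfl, rfl⟩, by rw [ge, go]⟩
      · exact ⟨(i (s + 1), f s), ⟨s, Or.inr rfl, rfl⟩, by rw [ge', go, Sym2.eq_swap]⟩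
    · rintro ⟨q, ⟨t, h1 | h1, h2⟩, rfl⟩
      · refine ⟨2 * t.val, by have := t.val_lt; omega, ?_⟩
        rw [ge, go, h1, h2]; simp
      · refine ⟨2 * t.val + 1, by have := t.val_lt; omega, ?_⟩
        rw [ge', go, h1, h2, Sym2.eq_swap]; simp
  refine ⟨g 0, (walkAlong g hadj (2 * k)).copy rfl hcl, ?_, fun e => by
    rw [SimpleGraph.Walk.edges_copy]; exact hmem e⟩
  have hsupp : ((walkAlong g hadj (2 * k)).copy rfl hcl).support.tail.Nodup := by
    rw [SimpleGraph.Walk.support_copy, walkAlong_support, List.range_succ_eq_map]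
    simp only [List.map_cons, List.tail_cons, List.map_map]
    refine List.Nodup.map_on ?_ List.nodup_range
    intro s hs t ht e
    simp only [List.mem_range] at hs ht
    simp only [Function.comp, Nat.succ_eq_add_one] at e
    -- the last vertex of the walk is the first one
    have key : ∀ s < 2 * k, g (s + 1) = g (if s + 1 = 2 * k then 0 else s + 1) := by
      intro s _
      split_ifs with h1
      · rw [h1, hcl]
      · rfl
    rw [key s hs, key t ht] at e
    have := ginj _ _ (by split_ifs <;> omega) (by split_ifs <;> omega) e
    split_ifs at this <;> omega
  refine { edges_nodup := ?_, ne_nil := ?_, support_nodup := hsupp }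
  · rw [SimpleGraph.Walk.edges_copy, walkAlong_edges]
    refine List.Nodup.map_on ?_ List.nodup_range
    intro s hs t ht e
    simp only [List.mem_range] at hs ht
    have hd : ∀ s < 2 * k, ∃ u : ZMod k × Bool, s(g s, g (s + 1)) =
        edge (linkAt i f u).1 (linkAt i f u).2 ∧ s = 2 * u.1.val + u.2.toNat := by
      intro s hs
      rcases Nat.even_or_odd' s with ⟨s, rfl | rfl⟩
      · exact ⟨(s, false), by rw [ge, go]; rfl, by
          simp [ZMod.val_cast_of_lt (show s < k by omega)]⟩
      · exact ⟨(s, true), by rw [ge', go, Sym2.eq_swap]; rfl, by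
          simp [ZMod.val_cast_of_lt (show s < k by omega)]⟩
    obtain ⟨u, hu, hu'⟩ := hd s hs
    obtain ⟨w, hw, hw'⟩ := hd t ht
    rw [hu, hw, Sym2.eq_iff] at e
    rcases e with ⟨e1, e2⟩ | ⟨e1, e2⟩
    · have := h.linkAt_injective hk (Prod.ext (Sum.inl_injective e1) (Sum.inr_injective e2))
      rw [hu', hw', this]
    · exact absurd e1 (by simp)
  · intro hnil
    have := congrArg SimpleGraph.Walk.edges hnil
    rw [SimpleGraph.Walk.edges_copy, walkAlong_edges] at this
    simp at this
    omega

end CycleStat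

namespace CycleStat

variable {m n p : ℕ}

open Classical in
/-- The links whose edge belongs to a set of edges of the factor graph. -/
noncomputable def linkSet (S : Finset (Sym2 (Vertex m n p))) : Finset (Link m n p) :=
  Finset.univ.filter fun q => edge q.1 q.2 ∈ S

open Classical in
/-- The cycles of type `K`, as sets of links. -/
noncomputable def loops (m n p : ℕ) (K : CycleType m) : Finset (Finset (Link m n p)) :=
  (cycles m n p K).image linkSet

/-- The network or the covariate to which a factor node belongs. -/
def kind : FactorNode m n p → Fin m ⊕ Fin p := Sum.map Prod.fst id

/-- A set of links with `2 k_r` links at factor nodes of network `r` for every `r`, and `2 ℓ` links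
at covariate nodes. -/
def HasType (E : Finset (Link m n p)) (K : CycleType m) : Prop :=
  (∀ r : Fin m, (E.filter fun q => kind q.2 = Sum.inl r).card = 2 * K.1 r) ∧
    (E.filter fun q => (kind q.2).isRight).card = 2 * K.2

lemma edge_injective {q q' : Link m n p} (h : edge q.1 q.2 = edge q'.1 q'.2) : q = q' := by
  rw [Sym2.eq_iff] at h
  rcases h with ⟨h1, h2⟩ | ⟨h1, h2⟩
  · exact Prod.ext (Sum.inl_injective h1) (Sum.inr_injective h2)
  · exact absurd h1 (by simp)

lemma mem_linkSet {S : Finset (Sym2 (Vertex m n p))} {q : Link m n p} :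
    q ∈ linkSet S ↔ edge q.1 q.2 ∈ S := by simp [linkSet]

open Classical in
lemma hasType_linkSet {S : Finset (Sym2 (Vertex m n p))} {K : CycleType m} :
    HasType (linkSet S) K ↔
    (∀ r : Fin m, (Finset.univ.filter fun q : Fin n × Pair n =>
      edge q.1 (Sum.inl (r, q.2)) ∈ S).card = 2 * K.1 r) ∧
    (Finset.univ.filter fun q : Fin n × Fin p => edge q.1 (Sum.inr q.2) ∈ S).card = 2 * K.2 := by
  unfold HasType
  have h1 : ∀ r : Fin m, ((linkSet S).filter fun q => kind q.2 = Sum.inl r).card =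
      (Finset.univ.filter fun q : Fin n × Pair n => edge q.1 (Sum.inl (r, q.2)) ∈ S).card := by
    intro r
    symm
    refine Finset.card_nbij (fun q => (q.1, Sum.inl (r, q.2))) ?_ ?_ ?_
    · intro q hq
      rw [Finset.mem_coe, Finset.mem_filter] at hq ⊢
      exact ⟨mem_linkSet.2 hq.2, rfl⟩
    · intro q _ q' _ h; simpa [Prod.ext_iff] using h
    · rintro ⟨a, ⟨r', e⟩ | v⟩ hq <;> rw [Finset.mem_coe, Finset.mem_filter] at hq
      · simp only [mem_linkSet, kind, Sum.map_inl, Sum.inl.injEq] at hq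
        obtain ⟨hq, rfl⟩ := hq
        exact ⟨(a, e), by simpa using hq, rfl⟩
      · simp [kind] at hq
  have h2 : ((linkSet S).filter fun q => (kind q.2).isRight).card =
      (Finset.univ.filter fun q : Fin n × Fin p => edge q.1 (Sum.inr q.2) ∈ S).card := by
    symm
    refine Finset.card_nbij (fun q => (q.1, Sum.inr q.2)) ?_ ?_ ?_
    · intro q hq
      rw [Finset.mem_coe, Finset.mem_filter] at hq ⊢
      exact ⟨mem_linkSet.2 hq.2, rfl⟩
    · intro q _ q' _ h; simpa [Prod.ext_iff] using h
    · rintro ⟨a, ⟨r', e⟩ | v⟩ hq <;> rw [Finset.mem_coe, Finset.mem_filter] at hq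
      · simp [kind] at hq
      · simp only [mem_linkSet] at hq
        exact ⟨(a, v), by simpa using hq.1, rfl⟩
  simp only [h1, h2]

lemma IsLabelled.card_filter {k : ℕ} [NeZero k] (hk : 2 ≤ k) {i : ZMod k → Fin n}
    {f : ZMod k → FactorNode m n p} (h : IsLabelled i f) (Q : FactorNode m n p → Prop)
    [DecidablePred Q] : ((loop i f).filter fun q => Q q.2).card =
      2 * (Finset.univ.filter fun t => Q (f t)).card := by
  classical
  unfold loop
  rw [Finset.filter_image, Finset.card_image_of_injective _ (h.linkAt_injective hk)]
  have : (Finset.univ.filter fun x : ZMod k × Bool => Q (linkAt i f x).2) =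
      (Finset.univ.filter fun t => Q (f t)) ×ˢ (Finset.univ : Finset Bool) := by
    ext ⟨t, b⟩
    rw [Finset.mem_filter]
    cases b <;> simp [linkAt]
  rw [this, Finset.card_product, mul_comm]; simp

lemma IsLabelled.card_loop {k : ℕ} [NeZero k] (hk : 2 ≤ k) {i : ZMod k → Fin n}
    {f : ZMod k → FactorNode m n p} (h : IsLabelled i f) : (loop i f).card = 2 * k := by
  have := h.card_filter hk (fun _ => True)
  simpa using this

lemma HasType.card {E : Finset (Link m n p)} {K : CycleType m} (h : HasType E K) :
    E.card = 2 * size K := by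
  classical
  have h1 := Finset.card_eq_sum_card_fiberwise (f := fun q : Link m n p =>
    (Sum.elim some (fun _ => none) (kind q.2) : Option (Fin m))) (s := E) (t := Finset.univ)
    (fun _ _ => Finset.mem_coe.2 (Finset.mem_univ _))
  rw [h1, Fintype.sum_option]
  have h2 : ∀ r, (E.filter fun q : Link m n p => (Sum.elim some (fun _ => none) (kind q.2) :
      Option (Fin m)) = some r).card = 2 * K.1 r := by
    intro r
    rw [← h.1 r]
    congr 1; ext q; rcases hq : kind q.2 <;> simp [hq]
  have h3 : (E.filter fun q : Link m n p => (Sum.elim some (fun _ => none) (kind q.2) :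
      Option (Fin m)) = none).card = 2 * K.2 := by
    rw [← h.2]
    congr 1; ext q; rcases hq : kind q.2 <;> simp [hq]
  rw [h3, Finset.sum_congr rfl fun r _ => h2 r, size, ← Finset.mul_sum]; ring

/-- The labelled cycles of type `K`. -/
def IsLabelledOf (K : CycleType m) (i : ZMod (size K) → Fin n)
    (f : ZMod (size K) → FactorNode m n p) [NeZero (size K)] : Prop :=
  IsLabelled i f ∧ HasType (loop i f) K

lemma mem_loops {K : CycleType m} (hK : 2 ≤ size K) [NeZero (size K)] {E : Finset (Link m n p)} :
    E ∈ loops m n p K ↔ ∃ i f, IsLabelledOf K i f ∧ E = loop i f := by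
  classical
  unfold loops cycles
  simp only [Finset.mem_image, Finset.mem_filter, Finset.mem_univ, true_and]
  constructor
  · rintro ⟨S, ⟨⟨v, c, hc, hS⟩, h1⟩, rfl⟩
    have ht : HasType (linkSet S) K := hasType_linkSet.2 ⟨fun r => by convert h1.1 r, by
      convert h1.2⟩
    obtain ⟨k, hk0, hk, i, f, hl, hm⟩ := exists_labelled_of_isCycle c hc
    have hE : linkSet S = loop i f := by
      ext q; rw [mem_linkSet, hS, hm]
    have hkk : k = size K := by
      have := ht.card
      rw [hE, hl.card_loop hk] at this
      omega
    subst hkk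
    exact ⟨i, f, ⟨hl, by convert hE ▸ ht⟩, by convert hE⟩
  · rintro ⟨i, f, ⟨hl, ht⟩, rfl⟩
    obtain ⟨v, c, hc, hm⟩ := hl.exists_isCycle hK
    have hE : linkSet c.edges.toFinset = loop i f := by
      ext q
      rw [mem_linkSet, List.mem_toFinset, hm]
      exact ⟨fun ⟨q', h1, h2⟩ => edge_injective h2 ▸ h1, fun h => ⟨q, h, rfl⟩⟩
    have := hasType_linkSet.1 (hE ▸ ht)
    exact ⟨c.edges.toFinset, ⟨⟨v, c, hc, fun e => List.mem_toFinset⟩, fun r => by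
      convert this.1 r, by convert this.2⟩, hE⟩

lemma hasType_of_mem_loops {K : CycleType m} (hK : 2 ≤ size K) {E : Finset (Link m n p)}
    (h : E ∈ loops m n p K) : HasType E K := by
  have : NeZero (size K) := ⟨by omega⟩
  obtain ⟨i, f, h', rfl⟩ := (mem_loops hK).1 h
  exact h'.2

lemma linkSet_injOn_cycles (K : CycleType m) :
    Set.InjOn (linkSet (m := m) (n := n) (p := p)) (cycles m n p K) := by
  classical
  have key : ∀ S ∈ cycles m n p K, ∀ e ∈ S, ∃ q : Link m n p, e = edge q.1 q.2 := by
    intro S hS e he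
    simp only [cycles, Finset.mem_filter] at hS
    obtain ⟨-, ⟨v, c, -, hc⟩, -⟩ := hS
    have := c.edges_subset_edgeSet ((hc e).1 he)
    induction e with
    | _ x y =>
      rw [SimpleGraph.mem_edgeSet, factorGraph_adj] at this
      obtain ⟨i, f, -, ⟨rfl, rfl⟩ | ⟨rfl, rfl⟩⟩ := this
      · exact ⟨(i, f), rfl⟩
      · exact ⟨(i, f), Sym2.eq_swap⟩
  intro S hS S' hS' h
  ext e
  constructor
  · intro he
    obtain ⟨q, rfl⟩ := key S hS e he
    exact mem_linkSet.1 (h ▸ mem_linkSet.2 he)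
  · intro he
    obtain ⟨q, rfl⟩ := key S' hS' e he
    exact mem_linkSet.1 (h.symm ▸ mem_linkSet.2 he)

lemma cycleStat_eq (mu : ℝ) (K : CycleType m) (x : Sample m n p) :
    cycleStat mu K x = ((n : ℝ) ^ K.2)⁻¹ * ∑ E ∈ loops m n p K,
      ∏ q ∈ E, weight mu x q.1 q.2 := by
  classical
  unfold cycleStat loops
  rw [Finset.sum_image (linkSet_injOn_cycles K)]
  congr 1

/-! ### Counting cycles -/

lemma IsLabelled.eq_of_loop_eq {k : ℕ} [NeZero k] (hk : 2 ≤ k) {i i' : ZMod k → Fin n}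
    {f f' : ZMod k → FactorNode m n p} (h : IsLabelled i f) (h' : IsLabelled i' f')
    (he : loop i f = loop i' f') (h0 : i 0 = i' 0) (h1 : f 0 = f' 0) : i = i' ∧ f = f' := by
  have key : ∀ s : ℕ, i s = i' s ∧ f s = f' s := by
    intro s
    induction s with
    | zero => simpa using ⟨h0, h1⟩
    | succ s ih =>
      push_cast
      have e1 : i' ((s : ZMod k) + 1) = i ((s : ZMod k) + 1) := by
        obtain ⟨t, ht, ht'⟩ := mem_loop.1 (he ▸ mem_loop.2 ⟨s, Or.inr rfl, rfl⟩ :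
          ((i' ((s : ZMod k) + 1), f' s) : Link m n p) ∈ loop i f)
        simp only at ht ht'
        obtain rfl := h.inj_factor (ih.2.trans ht')
        rcases ht with ht | ht
        · rw [ih.1] at ht
          exact absurd ht.symm (h'.var_ne hk _)
        · exact ht
      refine ⟨e1.symm, ?_⟩
      obtain ⟨t, ht, ht'⟩ := mem_loop.1 (he ▸ mem_loop.2 ⟨(s : ZMod k) + 1, Or.inl rfl, rfl⟩ :
          ((i' ((s : ZMod k) + 1), f' ((s : ZMod k) + 1)) : Link m n p) ∈ loop i f)
      simp only [e1] at ht ht'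
      rcases ht with ht | ht
      · rw [ht', h.inj_var ht]
      · have : t = s := by simpa using (h.inj_var ht).symm
        rw [this, ih.2] at ht'
        exact absurd (h'.inj_factor ht').symm (zmod_ne_add_one hk _)
  constructor <;> funext t
  · simpa using (key t.val).1
  · simpa using (key t.val).2

lemma IsLabelled.rotate {k : ℕ} [NeZero k] {i : ZMod k → Fin n}
    {f : ZMod k → FactorNode m n p} (h : IsLabelled i f) (c : ZMod k) :
    IsLabelled (fun t => i (t + c)) (fun t => f (t + c)) ∧
      loop (fun t => i (t + c)) (fun t => f (t + c)) = loop i f := by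
  refine ⟨⟨fun s t e => by simpa using h.inj_var e, fun s t e => by simpa using h.inj_factor e,
    fun t => h.incident _, fun t => ?_⟩, ?_⟩
  · have := h.incident_succ (t + c)
    rwa [show t + c + 1 = t + 1 + c by ring] at this
  · ext q
    rw [mem_loop, mem_loop]
    constructor
    · rintro ⟨t, h1, h2⟩
      exact ⟨t + c, by rwa [show t + c + 1 = t + 1 + c by ring], h2⟩
    · rintro ⟨t, h1, h2⟩
      exact ⟨t - c, by rwa [show t - c + 1 + c = t + 1 by ring, sub_add_cancel],
        by rwa [sub_add_cancel]⟩

lemma IsLabelled.reflect {k : ℕ} [NeZero k] {i : ZMod k → Fin n}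
    {f : ZMod k → FactorNode m n p} (h : IsLabelled i f) (c : ZMod k) :
    IsLabelled (fun t => i (c + 1 - t)) (fun t => f (c - t)) ∧
      loop (fun t => i (c + 1 - t)) (fun t => f (c - t)) = loop i f := by
  refine ⟨⟨fun s t e => by simpa using h.inj_var e, fun s t e => by simpa using h.inj_factor e,
    fun t => ?_, fun t => ?_⟩, ?_⟩
  · have := h.incident_succ (c - t)
    rwa [show c - t + 1 = c + 1 - t by ring] at this
  · have := h.incident (c - t)
    rwa [show c - t = c + 1 - (t + 1) by ring] at this ⊢
  · ext q
    rw [mem_loop, mem_loop]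
    constructor
    · rintro ⟨t, h1, h2⟩
      refine ⟨c - t, ?_, h2⟩
      rw [show c - t + 1 = c + 1 - t by ring]
      rw [show c + 1 - (t + 1) = c - t by ring] at h1
      exact h1.symm
    · rintro ⟨t, h1, h2⟩
      refine ⟨c - t, ?_, by rwa [sub_sub_cancel]⟩
      rw [show c + 1 - (c - t) = t + 1 by ring, show c + 1 - (c - t + 1) = t by ring]
      exact h1.symm

open Classical in
/-- A cycle of size `k` has `2 k` labellings: one for each choice of the first link. -/
lemma card_labellings {K : CycleType m} (hK : 2 ≤ size K) [NeZero (size K)]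
    {E : Finset (Link m n p)} (hE : E ∈ loops m n p K) :
    (Finset.univ.filter fun x : (ZMod (size K) → Fin n) × (ZMod (size K) → FactorNode m n p) =>
      IsLabelledOf K x.1 x.2 ∧ loop x.1 x.2 = E).card = 2 * size K := by
  rw [← (hasType_of_mem_loops hK hE).card]
  obtain ⟨i, f, ⟨hl, ht⟩, rfl⟩ := (mem_loops hK).1 hE
  refine Finset.card_nbij (fun x => (x.1 0, x.2 0)) ?_ ?_ ?_
  · rintro ⟨i', f'⟩ h
    simp only [Finset.coe_filter, Finset.mem_univ, true_and, Set.mem_ofPred_eq] at h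
    simp only [Finset.mem_coe]
    rw [← h.2]
    exact mem_loop.2 ⟨0, Or.inl rfl, rfl⟩
  · rintro ⟨i1, f1⟩ h1 ⟨i2, f2⟩ h2 e
    simp only [Finset.coe_filter, Finset.mem_univ, true_and, Set.mem_ofPred_eq] at h1 h2
    obtain ⟨rfl, rfl⟩ := h1.1.1.eq_of_loop_eq hK h2.1.1 (h1.2.trans h2.2.symm)
      (congrArg Prod.fst e) (congrArg Prod.snd e)
    rfl
  · rintro ⟨a, b⟩ hq
    obtain ⟨t, h1 | h1, h2⟩ := mem_loop.1 (Finset.mem_coe.1 hq)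
    · obtain ⟨h3, h4⟩ := hl.rotate t
      refine ⟨(fun s => i (s + t), fun s => f (s + t)), ?_, ?_⟩
      · simp only [Finset.coe_filter, Finset.mem_univ, true_and, Set.mem_ofPred_eq]
        exact ⟨⟨h3, h4 ▸ ht⟩, h4⟩
      · simp only at h1 h2
        simp [h1, h2]
    · obtain ⟨h3, h4⟩ := hl.reflect t
      refine ⟨(fun s => i (t + 1 - s), fun s => f (t - s)), ?_, ?_⟩
      · simp only [Finset.coe_filter, Finset.mem_univ, true_and, Set.mem_ofPred_eq]
        exact ⟨⟨h3, h4 ▸ ht⟩, h4⟩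
      · simp only at h1 h2
        simp [h1, h2]

/-- Two distinct subjects form a pair, in one of the two orders. -/
lemma exists_pair {a b : Fin n} (h : a ≠ b) : ∃ e : Pair n, ∀ c, (c = e.1.1 ∨ c = e.1.2) ↔
    (c = a ∨ c = b) := by
  rcases lt_or_gt_of_ne h with h | h
  · exact ⟨⟨(a, b), h⟩, fun c => Iff.rfl⟩
  · exact ⟨⟨(b, a), h⟩, fun c => or_comm⟩

lemma pair_ext {e e' : Pair n} (h : ∀ c, (c = e.1.1 ∨ c = e.1.2) ↔ (c = e'.1.1 ∨ c = e'.1.2)) :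
    e = e' := by
  obtain ⟨⟨a, b⟩, hab⟩ := e
  obtain ⟨⟨a', b'⟩, hab'⟩ := e'
  simp only at h hab hab'
  have h1 := (h a).1 (Or.inl rfl)
  have h2 := (h b).1 (Or.inr rfl)
  have h3 := (h a').2 (Or.inl rfl)
  have : a = a' ∧ b = b' := by
    rcases h1 with rfl | rfl <;> rcases h2 with rfl | rfl
    · exact absurd hab (lt_irrefl _)
    · exact ⟨rfl, rfl⟩
    · exact absurd hab' (lt_asymm hab)
    · exact absurd hab (lt_irrefl _)
  simp [this.1, this.2]

/-- The number of functions with prescribed fibre sizes is a multinomial coefficient. -/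
lemma card_functions_with_fibers {α β : Type*} [Fintype α] [DecidableEq α] [Fintype β]
    [DecidableEq β] (c : β → ℕ) (hc : ∑ b, c b = Fintype.card α) :
    (Finset.univ.filter fun f : α → β =>
      ∀ b, (Finset.univ.filter fun a => f a = b).card = c b).card * ∏ b, (c b)! =
      (Fintype.card α)! := by
  classical
  obtain ⟨f0, hf0⟩ : ∃ f : α → β, ∀ b, (Finset.univ.filter fun a => f a = b).card = c b := by
    have e : α ≃ Σ b, Fin (c b) := Fintype.equivOfCardEq (by simp [hc])
    refine ⟨fun a => (e a).1, fun b => ?_⟩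
    rw [← Fintype.card_subtype]
    have e2 : {a // (e a).1 = b} ≃ Fin (c b) :=
      (e.subtypeEquiv (fun a => Iff.rfl)).trans (Equiv.sigmaSubtype b)
    rw [Fintype.card_congr e2, Fintype.card_fin]
  -- the permutations are mapped onto these functions by composition with one of them
  have hmaps : ∀ g ∈ (Finset.univ : Finset (Equiv.Perm α)), f0 ∘ g ∈ Finset.univ.filter
      fun f : α → β => ∀ b, (Finset.univ.filter fun a => f a = b).card = c b := by
    intro g _
    simp only [Finset.mem_filter, Finset.mem_univ, true_and]
    intro b
    rw [← hf0 b]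
    exact Finset.card_equiv g (by simp)
  rw [← Fintype.card_perm, ← Finset.card_univ, Finset.card_eq_sum_card_fiberwise hmaps,
    ← smul_eq_mul, ← Finset.sum_const]
  refine Finset.sum_congr rfl fun f hf => ?_
  simp only [Finset.mem_filter, Finset.mem_univ, true_and] at hf
  obtain ⟨g, hg⟩ : ∃ g : Equiv.Perm α, f0 ∘ g = f := by
    have e1 : ∀ b, {a // f a = b} ≃ {a // f0 a = b} := fun b =>
      Fintype.equivOfCardEq (by rw [Fintype.card_subtype, Fintype.card_subtype, hf, hf0])
    refine ⟨((Equiv.sigmaFiberEquiv f).symm.trans (Equiv.sigmaCongrRight e1)).trans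
      (Equiv.sigmaFiberEquiv f0), ?_⟩
    funext a
    exact (e1 (f a) ⟨a, rfl⟩).2
  have h1 := DomMulAct.stabilizer_card f0
  simp only [Fintype.card_subtype, hf0] at h1
  rw [← h1]
  refine Finset.card_equiv (Equiv.mulRight g) fun h => ?_
  simp only [Finset.mem_filter, Finset.mem_univ, true_and, Equiv.coe_mulRight, Equiv.Perm.coe_mul,
    ← hg]
  constructor
  · intro e; rw [← Function.comp_assoc, e]
  · intro e
    funext a
    have := congrFun e (g.symm a)
    simpa using this

/-- The sequences of networks and covariates along labelled cycles of type `K`. -/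
def kindWords (p : ℕ) (K : CycleType m) [NeZero (size K)] :
    Finset (ZMod (size K) → Fin m ⊕ Fin p) :=
  Finset.univ.filter fun w => (∀ r, (Finset.univ.filter fun t => w t = Sum.inl r).card = K.1 r) ∧
    (Finset.univ.filter fun t => (w t).isRight).card = K.2 ∧
    ∀ s t, (w s).isRight → w s = w t → s = t

lemma card_kindWords (p : ℕ) (K : CycleType m) [NeZero (size K)] :
    (kindWords p K).card * ((K.2)! * ∏ r, (K.1 r)!) = (size K)! * p.descFactorial K.2 := by
  classical
  let V : (ZMod (size K) → Fin m ⊕ Fin p) → Finset (Fin p) := fun w =>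
    Finset.univ.filter fun v => ∃ t, w t = Sum.inr v
  have hmaps : ∀ w ∈ kindWords p K,
      V w ∈ Finset.powersetCard K.2 (Finset.univ : Finset (Fin p)) := by
    intro w hw
    simp only [kindWords, Finset.mem_filter, Finset.mem_univ, true_and] at hw
    rw [Finset.mem_powersetCard]
    refine ⟨Finset.subset_univ _, ?_⟩
    rw [← hw.2.1]
    symm
    refine Finset.card_bij (fun t ht => (w t).getRight (by simpa using ht)) ?_ ?_ ?_
    · intro t ht
      rw [Finset.mem_filter]
      exact ⟨Finset.mem_univ _, t, by simp⟩
    · intro s hs t ht e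
      refine hw.2.2 s t (by simpa using hs) ?_
      rw [← Sum.inr_getRight (w s) (by simpa using hs), e, Sum.inr_getRight]
    · intro v hv
      obtain ⟨t, ht⟩ : ∃ t, w t = Sum.inr v := by simpa [V] using hv
      exact ⟨t, by simp [ht], by simp [ht]⟩
  rw [Finset.card_eq_sum_card_fiberwise hmaps]
  have key : ∀ U ∈ Finset.powersetCard K.2 (Finset.univ : Finset (Fin p)),
      ((kindWords p K).filter fun w => V w = U).card * ∏ r, (K.1 r)! = (size K)! := by
    intro U hU
    rw [Finset.mem_powersetCard] at hU
    have := card_functions_with_fibers (α := ZMod (size K))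
      (Sum.elim K.1 (fun v => if v ∈ U then 1 else 0)) (by
        rw [Fintype.sum_sum_type, ZMod.card]; simp [hU.2, size])
    rw [Fintype.prod_sum_type] at this
    simp only [Sum.elim_inl, Sum.elim_inr, ZMod.card] at this
    have h1 : ∏ x : Fin p, (if x ∈ U then 1 else 0)! = 1 :=
      Finset.prod_eq_one fun x _ => by split_ifs <;> rfl
    rw [h1, mul_one] at this
    rw [← this]
    congr 2
    ext w
    simp only [kindWords, Finset.mem_filter, Finset.mem_univ, true_and, Sum.forall, Sum.elim_inl,
      Sum.elim_inr]
    constructor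
    · rintro ⟨⟨h4, h2, h3⟩, rfl⟩
      refine ⟨h4, fun v => ?_⟩
      split_ifs with hv
      · obtain ⟨t, ht⟩ : ∃ t, w t = Sum.inr v := by simpa [V] using hv
        rw [Finset.card_eq_one]
        refine ⟨t, ?_⟩
        ext s
        simp only [Finset.mem_filter, Finset.mem_univ, true_and, Finset.mem_singleton]
        exact ⟨fun hs => h3 s t (by simp [hs]) (hs.trans ht.symm), fun hs => hs ▸ ht⟩
      · rw [Finset.card_eq_zero, Finset.filter_eq_empty_iff]
        intro t _ ht
        exact hv (by simpa [V] using ⟨t, ht⟩)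
    · rintro ⟨h1, h2⟩
      have hV : V w = U := by
        ext v
        have := h2 v
        simp only [V, Finset.mem_filter, Finset.mem_univ, true_and]
        constructor
        · rintro ⟨t, ht⟩
          by_contra hv
          rw [if_neg hv, Finset.card_eq_zero, Finset.filter_eq_empty_iff] at this
          exact this (Finset.mem_univ t) ht
        · intro hv
          rw [if_pos hv] at this
          obtain ⟨t, ht⟩ := Finset.card_pos.1 (this ▸ Nat.one_pos)
          exact ⟨t, by simpa using ht⟩
      have h3 : ∀ s t, (w s).isRight → w s = w t → s = t := by
        intro s t hs e
        obtain ⟨v, hv⟩ := Sum.isRight_iff.1 hs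
        refine Finset.card_le_one.1 ((h2 v).trans_le (by split_ifs <;> simp)) s (by simpa using hv)
          t (by simpa using e ▸ hv)
      refine ⟨⟨h1, ?_, h3⟩, hV⟩
      rw [← hU.2, ← hV]
      refine Finset.card_bij (fun t ht => (w t).getRight (by simpa using ht)) ?_ ?_ ?_
      · intro t ht
        rw [Finset.mem_filter]
        exact ⟨Finset.mem_univ _, t, by simp⟩
      · intro s hs t ht e
        refine h3 s t (by simpa using hs) ?_
        rw [← Sum.inr_getRight (w s) (by simpa using hs), e, Sum.inr_getRight]
      · intro v hv
        obtain ⟨t, ht⟩ : ∃ t, w t = Sum.inr v := by simpa [V] using hv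
        exact ⟨t, by simp [ht], by simp [ht]⟩
  rw [mul_comm (K.2)!, ← mul_assoc, Finset.sum_mul, Finset.sum_congr rfl key, Finset.sum_const,
    Finset.card_powersetCard, Finset.card_univ, Fintype.card_fin,
    Nat.descFactorial_eq_factorial_mul_choose]
  simp only [smul_eq_mul]
  ring

/-- A labelled cycle is determined by its variable nodes and the kinds of its factor nodes. -/
lemma IsLabelled.factor_ext {k : ℕ} (hk : 2 ≤ k) {i : ZMod k → Fin n}
    {f f' : ZMod k → FactorNode m n p} (h : IsLabelled i f) (h' : IsLabelled i f')
    (e : (fun t => kind (f t)) = fun t => kind (f' t)) : f = f' := by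
  funext t
  have et := congrFun e t
  have h1 := h.incident t
  have h2 := h.incident_succ t
  have h3 := h'.incident t
  have h4 := h'.incident_succ t
  have hne := h.var_ne hk t
  rcases hfs : f t with ⟨r, a⟩ | a <;> rcases hft : f' t with ⟨r', b⟩ | b <;>
    simp only [kind, hfs, hft, Sum.map_inl, Sum.map_inr, Sum.inl.injEq, Sum.inr.injEq, id,
      reduceCtorEq] at et h1 h2 h3 h4 ⊢
  · simp only [Incident] at h1 h2 h3 h4
    rw [et, pair_ext (e := a) (e' := b)]
    intro c
    grind
  · exact et

open Classical in
/-- The labellings of the cycles of a type: the variable nodes are an injective word, and the word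
of the factor nodes is determined by their kinds and, for the covariates, by their indices.
Admissibility is needed for the factor nodes of a network to be distinct. -/
lemma card_labelled {K : CycleType m} (hK : Admissible K) [NeZero (size K)] :
    (Finset.univ.filter fun x : (ZMod (size K) → Fin n) × (ZMod (size K) → FactorNode m n p) =>
      IsLabelledOf K x.1 x.2).card = n.descFactorial (size K) * (kindWords p K).card := by
  have hinj : (Finset.univ.filter fun i : ZMod (size K) → Fin n => Function.Injective i).card =
      n.descFactorial (size K) := by
    rw [← Fintype.card_subtype, Fintype.card_congr (Equiv.subtypeInjectiveEquivEmbedding _ _),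
      Fintype.card_embedding_eq, ZMod.card, Fintype.card_fin]
  rw [← hinj, ← Finset.card_product]
  have hcard : ∀ (i : ZMod (size K) → Fin n) (f : ZMod (size K) → FactorNode m n p),
      IsLabelled i f → (HasType (loop i f) K ↔
      (∀ r, (Finset.univ.filter fun t => kind (f t) = Sum.inl r).card = K.1 r) ∧
      (Finset.univ.filter fun t => (kind (f t)).isRight).card = K.2) := by
    intro i f h
    unfold HasType
    refine and_congr (forall_congr' fun r => ?_) ?_
    · rw [h.card_filter hK.1 fun q => kind q = Sum.inl r]; omega
    · rw [h.card_filter hK.1 fun q => (kind q).isRight]; omega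
  refine Finset.card_bij (fun x _ => (x.1, fun t => kind (x.2 t))) ?_ ?_ ?_
  · rintro ⟨i, f⟩ h
    simp only [Finset.mem_filter, Finset.mem_univ, true_and] at h
    obtain ⟨h1, h2⟩ := h
    rw [hcard i f h1] at h2
    simp only [Finset.mem_product, Finset.mem_filter, Finset.mem_univ, true_and, kindWords]
    refine ⟨h1.inj_var, h2.1, h2.2, fun s t hs e => h1.inj_factor ?_⟩
    rcases hfs : f s with a | a <;> rcases hft : f t with b | b <;> simp [kind, hfs, hft] at hs e ⊢
    exact e
  · rintro ⟨i, f⟩ h ⟨i', f'⟩ h' e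
    simp only [Finset.mem_filter, Finset.mem_univ, true_and] at h h'
    simp only [Prod.mk.injEq] at e
    obtain ⟨rfl, e⟩ := e
    rw [h.1.factor_ext hK.1 h'.1 e]
  · rintro ⟨i, w⟩ h
    simp only [Finset.mem_product, Finset.mem_filter, Finset.mem_univ, true_and, kindWords] at h
    obtain ⟨hi, h1, h2, h3⟩ := h
    have hex : ∀ t, ∃ q : FactorNode m n p, kind q = w t ∧ Incident (i t) q ∧
        Incident (i (t + 1)) q ∧ ∀ r e, q = Sum.inl (r, e) → ∀ c, (c = e.1.1 ∨ c = e.1.2) ↔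
          (c = i t ∨ c = i (t + 1)) := by
      intro t
      rcases hw : w t with r | v
      · obtain ⟨e, he⟩ := exists_pair (fun h => zmod_ne_add_one hK.1 t (hi h) :
          i t ≠ i (t + 1))
        refine ⟨Sum.inl (r, e), rfl, (he _).2 (Or.inl rfl), (he _).2 (Or.inr rfl), ?_⟩
        rintro r' e' h
        simp only [Sum.inl.injEq, Prod.mk.injEq] at h
        exact h.2 ▸ he
      · exact ⟨Sum.inr v, rfl, trivial, trivial, by simp⟩
    choose f hf1 hf2 hf3 hf4 using hex
    have hf : IsLabelled i f := by
      refine ⟨hi, fun s t e => ?_, hf2, hf3⟩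
      have ew : w s = w t := by rw [← hf1, ← hf1, e]
      rcases hs : f s with ⟨r, a⟩ | v
      · by_contra hne
        have hc := fun c => (hf4 s r a hs c).symm.trans (hf4 t r a (e ▸ hs) c)
        have c1 := (hc (i s)).1 (Or.inl rfl)
        have c2 := (hc (i (s + 1))).1 (Or.inr rfl)
        -- two factor nodes of one network at the same pair: the cycle has size two
        have e1 : s = t + 1 := by
          rcases c1 with c1 | c1
          · exact absurd (hi c1) hne
          · exact hi c1
        have e2 : s + 1 = t := by
          rcases c2 with c2 | c2
          · exact hi c2
          · exact absurd (by simpa using hi c2) hne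
        have h20 : ((2 : ℕ) : ZMod (size K)) = 0 := by
          push_cast
          calc (2 : ZMod (size K)) = (t + 1) + 1 - t := by ring
            _ = s + 1 - t := by rw [← e1]
            _ = 0 := by rw [e2]; ring
        rw [ZMod.natCast_eq_zero_iff] at h20
        have hk2 : size K = 2 := le_antisymm (Nat.le_of_dvd (by norm_num) h20) hK.1
        have hle := hK.2 hk2 r
        have h1r := h1 r
        have hs' : w s = Sum.inl r := by rw [← hf1, hs]; rfl
        exact hne (Finset.card_le_one.1 (h1r.trans_le hle) s (by simpa using hs') t
          (by simpa using ew ▸ hs'))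
      · exact h3 s t (by rw [← hf1, hs]; rfl) ew
    refine ⟨(i, f), ?_, ?_⟩
    · simp only [Finset.mem_filter, Finset.mem_univ, true_and]
      refine ⟨hf, (hcard i f hf).2 ?_⟩
      simp only [hf1]
      exact ⟨h1, h2⟩
    · simp only [hf1]

/-- The number of cycles of type `K` is `c_K (n)_k (p)_ℓ`. -/
lemma card_loops {K : CycleType m} (hK : Admissible K) :
    ((loops m n p K).card : ℝ) =
      coeff K * (n.descFactorial (size K) * p.descFactorial K.2) := by
  classical
  have : NeZero (size K) := ⟨by have := hK.1; omega⟩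
  have h1 := card_labelled (n := n) (p := p) hK
  have hmaps : ∀ x ∈ (Finset.univ.filter fun x : (ZMod (size K) → Fin n) ×
      (ZMod (size K) → FactorNode m n p) => IsLabelledOf K x.1 x.2),
      loop x.1 x.2 ∈ loops m n p K := by
    intro x hx
    simp only [Finset.mem_filter, Finset.mem_univ, true_and] at hx
    exact (mem_loops hK.1).2 ⟨_, _, hx, rfl⟩
  rw [Finset.card_eq_sum_card_fiberwise hmaps] at h1
  simp only [Finset.filter_filter] at h1
  rw [Finset.sum_congr rfl fun E hE => card_labellings hK.1 hE, Finset.sum_const, smul_eq_mul] at h1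
  have h2 := card_kindWords p K
  have h3 : (loops m n p K).card * (2 * size K) * ((K.2)! * ∏ r, (K.1 r)!) =
      (size K)! * (n.descFactorial (size K) * p.descFactorial K.2) := by
    rw [h1, mul_assoc, h2]; ring
  have h4 : ((loops m n p K).card : ℝ) * (2 * size K) * ((K.2)! * ∏ r, ((K.1 r)! : ℝ)) =
      (size K)! * (n.descFactorial (size K) * p.descFactorial K.2) := by
    exact_mod_cast h3
  have h5 : (0 : ℝ) < 2 * size K := by have := hK.1; positivity
  have h6 : (0 : ℝ) < (K.2)! * ∏ r, ((K.1 r)! : ℝ) := by positivity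
  have h7 : coeff K * ((2 * size K) * ((K.2)! * ∏ r, ((K.1 r)! : ℝ))) = (size K)! := by
    have h8 : (size K : ℝ) ≠ 0 := fun h => by simp [h] at h5
    rw [coeff]; field_simp
  refine mul_right_cancel₀ (mul_pos h5 h6).ne' ?_
  rw [← mul_assoc, h4, ← h7]; ring

end CycleStat

namespace CycleStat

variable {m n p : ℕ}

/-! ### Supports of cycles and of their unions -/

/-- The variable nodes of a set of links. -/
def varSet (E : Finset (Link m n p)) : Finset (Fin n) := E.image Prod.fst

open Classical in
/-- The network factor nodes of a set of links. -/
noncomputable def netSet (E : Finset (Link m n p)) : Finset (Fin m × Pair n) :=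
  Finset.univ.filter fun f : Fin m × Pair n => ∃ i : Fin n, ((i, Sum.inl f) : Link m n p) ∈ E

open Classical in
/-- The covariate links of a set of links. -/
noncomputable def covSet (E : Finset (Link m n p)) : Finset (Fin n × Fin p) :=
  Finset.univ.filter fun q : Fin n × Fin p => ((q.1, Sum.inr q.2) : Link m n p) ∈ E

/-- The covariate factor nodes of a set of links. -/
noncomputable def colSet (E : Finset (Link m n p)) : Finset (Fin p) := (covSet E).image Prod.snd

/-- The variable nodes and the covariate factor nodes of a set of links. -/
noncomputable def supp (E : Finset (Link m n p)) : Finset (Fin n ⊕ Fin p) :=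
  (varSet E).disjSum (colSet E)

lemma mem_varSet {E : Finset (Link m n p)} {i : Fin n} : i ∈ varSet E ↔ ∃ f, (i, f) ∈ E := by
  simp [varSet]

lemma mem_netSet {E : Finset (Link m n p)} {f : Fin m × Pair n} :
    f ∈ netSet E ↔ ∃ i, (i, Sum.inl f) ∈ E := by simp only [netSet, Finset.mem_filter_univ]

lemma mem_covSet {E : Finset (Link m n p)} {q : Fin n × Fin p} :
    q ∈ covSet E ↔ (q.1, Sum.inr q.2) ∈ E := by simp only [covSet, Finset.mem_filter_univ]

lemma mem_colSet {E : Finset (Link m n p)} {v : Fin p} :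
    v ∈ colSet E ↔ ∃ i, (i, Sum.inr v) ∈ E := by
  simp only [colSet, Finset.mem_image, mem_covSet, Prod.exists, exists_eq_right]

lemma varSet_union (E E' : Finset (Link m n p)) : varSet (E ∪ E') = varSet E ∪ varSet E' :=
  Finset.image_union _ _

lemma netSet_union (E E' : Finset (Link m n p)) : netSet (E ∪ E') = netSet E ∪ netSet E' := by
  ext; simp [mem_netSet, exists_or]

lemma covSet_union (E E' : Finset (Link m n p)) : covSet (E ∪ E') = covSet E ∪ covSet E' := by
  ext; simp [mem_covSet]

lemma colSet_union (E E' : Finset (Link m n p)) : colSet (E ∪ E') = colSet E ∪ colSet E' := by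
  rw [colSet, covSet_union, Finset.image_union]; rfl

lemma supp_union (E E' : Finset (Link m n p)) : supp (E ∪ E') = supp E ∪ supp E' := by
  ext x; rcases x with x | x <;> simp [supp, varSet_union, colSet_union]

lemma card_supp (E : Finset (Link m n p)) : (supp E).card = (varSet E).card + (colSet E).card :=
  Finset.card_disjSum _ _

/-- Every node of the set of links has degree at least two, and the links are incidences of the
factor graph. This is the case for unions of cycles. -/
structure MinDegTwo (U : Finset (Link m n p)) : Prop where
  var : ∀ q ∈ U, 2 ≤ (U.filter fun q' => q'.1 = q.1).card
  factor : ∀ q ∈ U, 2 ≤ (U.filter fun q' => q'.2 = q.2).card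
  incident : ∀ q ∈ U, Incident q.1 q.2

lemma MinDegTwo.union {U U' : Finset (Link m n p)} (h : MinDegTwo U) (h' : MinDegTwo U') :
    MinDegTwo (U ∪ U') := by
  constructor
  · intro q hq
    rcases Finset.mem_union.1 hq with hq | hq
    · exact (h.var q hq).trans (Finset.card_le_card
        (Finset.filter_subset_filter _ Finset.subset_union_left))
    · exact (h'.var q hq).trans (Finset.card_le_card
        (Finset.filter_subset_filter _ Finset.subset_union_right))
  · intro q hq
    rcases Finset.mem_union.1 hq with hq | hq
    · exact (h.factor q hq).trans (Finset.card_le_card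
        (Finset.filter_subset_filter _ Finset.subset_union_left))
    · exact (h'.factor q hq).trans (Finset.card_le_card
        (Finset.filter_subset_filter _ Finset.subset_union_right))
  · intro q hq
    rcases Finset.mem_union.1 hq with hq | hq
    · exact h.incident q hq
    · exact h'.incident q hq

lemma MinDegTwo.net_deg {U : Finset (Link m n p)} (h : MinDegTwo U) {f : Fin m × Pair n}
    (hf : f ∈ netSet U) : (U.filter fun q => q.2 = Sum.inl f).card = 2 := by
  obtain ⟨i, hi⟩ := mem_netSet.1 hf
  refine le_antisymm ?_ (h.factor _ hi)
  have hsub : (U.filter fun q => q.2 = Sum.inl f) ⊆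
      {((f.2.1.1, Sum.inl f) : Link m n p), (f.2.1.2, Sum.inl f)} := by
    rintro ⟨a, b⟩ hq
    obtain ⟨hq, rfl⟩ := Finset.mem_filter.1 hq
    rcases h.incident _ hq with ha | ha <;> simp only at ha <;> simp [ha]
  exact (Finset.card_le_card hsub).trans Finset.card_le_two

lemma image_snd (U : Finset (Link m n p)) :
    U.image Prod.snd = (netSet U).disjSum (colSet U) := by
  ext x
  rcases x with x | x
  · simp [mem_netSet]
  · simp [mem_colSet]

lemma MinDegTwo.card_eq {U : Finset (Link m n p)} (h : MinDegTwo U) :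
    U.card = 2 * (netSet U).card + (covSet U).card := by
  rw [Finset.card_eq_sum_card_image Prod.snd U, image_snd, Finset.sum_disjSum,
    Finset.sum_congr rfl fun f hf => h.net_deg hf, Finset.sum_const, smul_eq_mul, mul_comm]
  congr 1
  rw [colSet, Finset.card_eq_sum_card_image Prod.snd (covSet U)]
  refine Finset.sum_congr rfl fun v _ => ?_
  symm
  refine Finset.card_bij (fun q _ => (q.1, Sum.inr q.2)) ?_ ?_ ?_
  · intro q hq
    obtain ⟨h1, rfl⟩ := Finset.mem_filter.1 hq
    exact Finset.mem_filter.2 ⟨mem_covSet.1 h1, rfl⟩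
  · intro q _ q' _ e; simpa [Prod.ext_iff] using e
  · rintro ⟨a, b⟩ hq
    obtain ⟨h1, rfl⟩ := Finset.mem_filter.1 hq
    exact ⟨(a, v), Finset.mem_filter.2 ⟨mem_covSet.2 h1, rfl⟩, rfl⟩

lemma MinDegTwo.two_mul_var_le {U : Finset (Link m n p)} (h : MinDegTwo U) :
    2 * (varSet U).card ≤ U.card ∧ (2 * (varSet U).card = U.card →
      ∀ q ∈ U, (U.filter fun q' => q'.1 = q.1).card = 2) := by
  have hle : ∀ i ∈ varSet U, 2 ≤ (U.filter fun q => q.1 = i).card := by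
    intro i hi
    obtain ⟨f, hf⟩ := mem_varSet.1 hi
    exact h.var _ hf
  have hsum : U.card = ∑ i ∈ varSet U, (U.filter fun q => q.1 = i).card :=
    Finset.card_eq_sum_card_image Prod.fst U
  have h2 : 2 * (varSet U).card = ∑ i ∈ varSet U, 2 := by simp [mul_comm]
  rw [hsum, h2]
  refine ⟨Finset.sum_le_sum hle, fun e q hq => ?_⟩
  exact ((Finset.sum_eq_sum_iff_of_le hle).1 e q.1 (Finset.mem_image_of_mem _ hq)).symm

lemma MinDegTwo.two_mul_factor_le {U : Finset (Link m n p)} (h : MinDegTwo U) :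
    2 * ((netSet U).card + (colSet U).card) ≤ U.card ∧
      (2 * ((netSet U).card + (colSet U).card) = U.card →
      ∀ q ∈ U, (U.filter fun q' => q'.2 = q.2).card = 2) := by
  have hle : ∀ f ∈ U.image Prod.snd, 2 ≤ (U.filter fun q => q.2 = f).card := by
    intro i hi
    obtain ⟨q, hq, rfl⟩ := Finset.mem_image.1 hi
    exact h.factor _ hq
  have hsum : U.card = ∑ i ∈ U.image Prod.snd, (U.filter fun q => q.2 = i).card :=
    Finset.card_eq_sum_card_image Prod.snd U
  have h2 : 2 * ((netSet U).card + (colSet U).card) = ∑ i ∈ U.image Prod.snd, 2 := by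
    rw [Finset.sum_const, image_snd, Finset.card_disjSum]; simp [mul_comm]
  rw [hsum, h2]
  refine ⟨Finset.sum_le_sum hle, fun e q hq => ?_⟩
  exact ((Finset.sum_eq_sum_iff_of_le hle).1 e q.2 (Finset.mem_image_of_mem _ hq)).symm

/-- The Euler characteristic of a union of cycles is at most zero. -/
lemma MinDegTwo.card_supp_le {U : Finset (Link m n p)} (h : MinDegTwo U) :
    (supp U).card ≤ (netSet U).card + (covSet U).card := by
  have := h.card_eq
  have := h.two_mul_var_le.1
  have := h.two_mul_factor_le.1
  rw [card_supp]
  omega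

/-- A connected two-regular set of links. -/
structure IsRing (E : Finset (Link m n p)) : Prop where
  nonempty : E.Nonempty
  incident : ∀ q ∈ E, Incident q.1 q.2
  var : ∀ q ∈ E, (E.filter fun q' => q'.1 = q.1).card = 2
  factor : ∀ q ∈ E, (E.filter fun q' => q'.2 = q.2).card = 2
  connected : ∀ T ⊆ E, T.Nonempty →
    (∀ q ∈ T, ∀ q' ∈ E, (q'.1 = q.1 ∨ q'.2 = q.2) → q' ∈ T) → T = E

lemma IsRing.minDegTwo {E : Finset (Link m n p)} (h : IsRing E) : MinDegTwo E :=
  ⟨fun q hq => (h.var q hq).ge, fun q hq => (h.factor q hq).ge, h.incident⟩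

/-- In a two-regular set of links, cycles that share a node are equal. -/
lemma IsRing.eq_of_regular {U E E' : Finset (Link m n p)}
    (hv : ∀ q ∈ U, (U.filter fun q' => q'.1 = q.1).card = 2)
    (hf : ∀ q ∈ U, (U.filter fun q' => q'.2 = q.2).card = 2)
    (h : IsRing E) (h' : IsRing E') (hE : E ⊆ U) (hE' : E' ⊆ U)
    (hd : ¬ Disjoint (supp E) (supp E')) : E = E' := by
  -- a cycle contains all the links of `U` at each of its nodes
  have full : ∀ {E : Finset (Link m n p)}, IsRing E → E ⊆ U → ∀ q ∈ E, ∀ q' ∈ U,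
      (q'.1 = q.1 ∨ q'.2 = q.2) → q' ∈ E := by
    intro E h hE q hq q' hq' e
    rcases e with e | e
    · have : (E.filter fun q' => q'.1 = q.1) = U.filter fun q' => q'.1 = q.1 :=
        Finset.eq_of_subset_of_card_le (Finset.filter_subset_filter _ hE)
          (by rw [h.var q hq, hv q (hE hq)])
      exact (Finset.mem_filter.1 (this ▸ Finset.mem_filter.2 ⟨hq', e⟩)).1
    · have : (E.filter fun q' => q'.2 = q.2) = U.filter fun q' => q'.2 = q.2 :=
        Finset.eq_of_subset_of_card_le (Finset.filter_subset_filter _ hE)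
          (by rw [h.factor q hq, hf q (hE hq)])
      exact (Finset.mem_filter.1 (this ▸ Finset.mem_filter.2 ⟨hq', e⟩)).1
  have hne : (E ∩ E').Nonempty := by
    rw [Finset.not_disjoint_iff] at hd
    obtain ⟨x, hx, hx'⟩ := hd
    rcases x with x | x
    · simp only [supp, Finset.inl_mem_disjSum, mem_varSet] at hx hx'
      obtain ⟨f, hf1⟩ := hx
      obtain ⟨g, hg⟩ := hx'
      exact ⟨_, Finset.mem_inter.2 ⟨full h hE _ hf1 _ (hE' hg) (Or.inl rfl), hg⟩⟩
    · simp only [supp, Finset.inr_mem_disjSum, mem_colSet] at hx hx'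
      obtain ⟨f, hf1⟩ := hx
      obtain ⟨g, hg⟩ := hx'
      exact ⟨_, Finset.mem_inter.2 ⟨full h hE _ hf1 _ (hE' hg) (Or.inr rfl), hg⟩⟩
  have e1 := h.connected _ Finset.inter_subset_left hne fun q hq q' hq' e =>
    Finset.mem_inter.2 ⟨hq', full h' hE' q (Finset.mem_inter.1 hq).2 q' (hE hq') e⟩
  have e2 := h'.connected _ Finset.inter_subset_right hne fun q hq q' hq' e =>
    Finset.mem_inter.2 ⟨full h hE q (Finset.mem_inter.1 hq).1 q' (hE' hq') e, hq'⟩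
  exact e1.symm.trans e2

/-- The Euler characteristic of a union of cycles is negative if two distinct ones among them
share a node. -/
lemma MinDegTwo.card_supp_lt {U E E' : Finset (Link m n p)} (hU : MinDegTwo U)
    (h : IsRing E) (h' : IsRing E') (hE : E ⊆ U) (hE' : E' ⊆ U) (hne : E ≠ E')
    (hd : ¬ Disjoint (supp E) (supp E')) :
    (supp U).card + 1 ≤ (netSet U).card + (covSet U).card := by
  by_contra hlt
  have h1 := hU.card_eq
  have h2 := hU.two_mul_var_le
  have h3 := hU.two_mul_factor_le
  rw [card_supp] at hlt
  exact hne (IsRing.eq_of_regular (h2.2 (by omega)) (h3.2 (by omega)) h h' hE hE' hd)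

lemma IsLabelled.isRing {k : ℕ} [NeZero k] (hk : 2 ≤ k) {i : ZMod k → Fin n}
    {f : ZMod k → FactorNode m n p} (h : IsLabelled i f) : IsRing (loop i f) := by
  classical
  have mem1 : ∀ t, (i t, f t) ∈ loop i f := fun t => mem_loop.2 ⟨t, Or.inl rfl, rfl⟩
  have mem2 : ∀ t, (i (t + 1), f t) ∈ loop i f := fun t => mem_loop.2 ⟨t, Or.inr rfl, rfl⟩
  refine ⟨⟨_, mem1 0⟩, ?_, ?_, ?_, ?_⟩
  · rintro ⟨a, b⟩ hq
    obtain ⟨t, rfl | rfl, rfl⟩ := mem_loop.1 hq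
    exacts [h.incident t, h.incident_succ t]
  · have key : ∀ t, ((loop i f).filter fun q' => q'.1 = i (t + 1)).card = 2 := by
      intro t
      rw [Finset.card_eq_two]
      refine ⟨(i (t + 1), f t), (i (t + 1), f (t + 1)), ?_, ?_⟩
      · intro e
        exact zmod_ne_add_one hk t (h.inj_factor (congrArg Prod.snd e))
      · ext ⟨a, b⟩
        simp only [Finset.mem_filter, Finset.mem_insert, Finset.mem_singleton, Prod.mk.injEq]
        constructor
        · rintro ⟨hq, rfl⟩
          obtain ⟨s, e | e, rfl⟩ := mem_loop.1 hq
          · simp [h.inj_var e]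
          · have : t = s := by simpa using h.inj_var e
            simp [this]
        · rintro (⟨rfl, rfl⟩ | ⟨rfl, rfl⟩)
          exacts [⟨mem2 _, rfl⟩, ⟨mem1 _, rfl⟩]
    rintro ⟨a, b⟩ hq
    obtain ⟨t, rfl | rfl, rfl⟩ := mem_loop.1 hq
    · have := key (t - 1)
      rwa [sub_add_cancel] at this
    · exact key t
  · rintro ⟨a, b⟩ hq
    obtain ⟨t, -, rfl⟩ := mem_loop.1 hq
    rw [Finset.card_eq_two]
    refine ⟨(i t, f t), (i (t + 1), f t), ?_, ?_⟩
    · intro e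
      exact h.var_ne hk t (congrArg Prod.fst e)
    · ext ⟨a', b'⟩
      simp only [Finset.mem_filter, Finset.mem_insert, Finset.mem_singleton, Prod.mk.injEq]
      constructor
      · rintro ⟨hq, rfl⟩
        obtain ⟨s, e, e'⟩ := mem_loop.1 hq
        simp only at e e'
        rw [← h.inj_factor e'] at e
        simpa using e
      · rintro (⟨rfl, rfl⟩ | ⟨rfl, rfl⟩)
        exacts [⟨mem1 _, rfl⟩, ⟨mem2 _, rfl⟩]
  · intro T hT hne hcl
    obtain ⟨⟨a, b⟩, hq⟩ := hne
    obtain ⟨t, ht, rfl⟩ := mem_loop.1 (hT hq)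
    have key : ∀ s : ℕ, (i (t + s), f (t + s)) ∈ T ∧ (i (t + s + 1), f (t + s)) ∈ T := by
      intro s
      induction s with
      | zero =>
        simp only [Nat.cast_zero, add_zero]
        exact ⟨hcl _ hq _ (mem1 t) (Or.inr rfl), hcl _ hq _ (mem2 t) (Or.inr rfl)⟩
      | succ s ih =>
        push_cast
        rw [← add_assoc]
        have := hcl _ ih.2 _ (mem1 _) (Or.inl rfl)
        exact ⟨this, hcl _ this _ (mem2 _) (Or.inr rfl)⟩
    refine Finset.Subset.antisymm hT ?_
    rintro ⟨a', b'⟩ hq'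
    obtain ⟨s, e, rfl⟩ := mem_loop.1 hq'
    have := key (s - t).val
    simp only [ZMod.natCast_val, ZMod.cast_id', id, add_sub_cancel] at this
    rcases e with rfl | rfl
    exacts [this.1, this.2]

lemma isRing_of_mem_loops {K : CycleType m} (hK : 2 ≤ size K) {E : Finset (Link m n p)}
    (h : E ∈ loops m n p K) : IsRing E := by
  have : NeZero (size K) := ⟨by omega⟩
  obtain ⟨i, f, h', rfl⟩ := (mem_loops hK).1 h
  exact h'.1.isRing hK

lemma card_supp_le {K : CycleType m} (hK : 2 ≤ size K) {E : Finset (Link m n p)}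
    (h : E ∈ loops m n p K) : (supp E).card ≤ 2 * size K := by
  have h1 := (isRing_of_mem_loops hK h).minDegTwo
  rw [← (hasType_of_mem_loops hK h).card, h1.card_eq]
  have := h1.card_supp_le
  omega

/-- Cycles of different types are different. -/
lemma ne_of_mem_loops {K K' : CycleType m} (hK : 2 ≤ size K) (hK' : 2 ≤ size K') (hne : K ≠ K')
    {E E' : Finset (Link m n p)} (h : E ∈ loops m n p K) (h' : E' ∈ loops m n p K') : E ≠ E' := by
  rintro rfl
  have h1 := hasType_of_mem_loops hK h
  have h2 := hasType_of_mem_loops hK' h'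
  apply hne
  refine Prod.ext (funext fun r => ?_) ?_
  · have := (h1.1 r).symm.trans (h2.1 r); omega
  · have := h1.2.symm.trans h2.2; omega

/-! ### Counting tuples of cycles -/

/-- The letters of the second kind in a word. -/
def freeLetters {κ α β : Type*} [Fintype κ] [Fintype β] [DecidableEq α] [DecidableEq β]
    (f : κ → α ⊕ β) : Finset β :=
  Finset.univ.filter fun b => ∃ t, f t = Sum.inr b

/-- A letter of the second kind costs a factor `w` the first time that it occurs outside `B`. Hence
each position of a word contributes at most `|α| + |β| w` for a letter of the first kind or a new
letter, and at most `|B| + N` for a letter that has been paid for. -/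
lemma sum_words_le {α β : Type*} [Fintype α] [Fintype β] [DecidableEq α] [DecidableEq β]
    {w : ℝ} (hw : 0 ≤ w) (N : ℕ) : ∀ B : Finset β,
    ∑ f : Fin N → α ⊕ β, w ^ (freeLetters f \ B).card ≤
      (Fintype.card α + Fintype.card β * w + (B.card + N : ℕ)) ^ N := by
  induction N with
  | zero => intro B; simp [freeLetters]
  | succ N ih =>
    intro B
    set X : ℝ := Fintype.card α + Fintype.card β * w + (B.card + (N + 1) : ℕ) with hX
    have hX0 : 0 ≤ X := by positivity
    rw [← (Fin.consEquiv fun _ => α ⊕ β).sum_comp, Fintype.sum_prod_type, Fintype.sum_sum_type]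
    have hcons : ∀ (b : β) (f : Fin N → α ⊕ β),
        freeLetters (Fin.cons (Sum.inr b) f : Fin (N + 1) → α ⊕ β) = insert b (freeLetters f) := by
      intro b f; ext c; simp [freeLetters, Fin.exists_fin_succ, eq_comm]
    have hcons' : ∀ (a : α) (f : Fin N → α ⊕ β),
        freeLetters (Fin.cons (Sum.inl a) f : Fin (N + 1) → α ⊕ β) = freeLetters f := by
      intro b f; ext c; simp [freeLetters, Fin.exists_fin_succ]
    have b1 : ∀ B' : Finset β, B'.card ≤ B.card + 1 →
        ∑ f : Fin N → α ⊕ β, w ^ (freeLetters f \ B').card ≤ X ^ N := by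
      intro B' hB'
      refine (ih B').trans (pow_le_pow_left₀ (by positivity) ?_ N)
      rw [hX]
      have : ((B'.card + N : ℕ) : ℝ) ≤ (B.card + (N + 1) : ℕ) := by exact_mod_cast by omega
      linarith
    have e1 : ∀ a : α, ∑ f : Fin N → α ⊕ β, w ^ (freeLetters ((Fin.consEquiv fun _ => α ⊕ β)
        (Sum.inl a, f)) \ B).card ≤ X ^ N := by
      intro a
      change ∑ f : Fin N → α ⊕ β, w ^ (freeLetters (Fin.cons (Sum.inl a) f :
        Fin (N + 1) → α ⊕ β) \ B).card ≤ X ^ N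
      simp only [hcons']
      exact b1 B (by omega)
    have e2 : ∀ b : β, ∑ f : Fin N → α ⊕ β, w ^ (freeLetters ((Fin.consEquiv fun _ => α ⊕ β)
        (Sum.inr b, f)) \ B).card ≤ (w + if b ∈ B then 1 else 0) * X ^ N := by
      intro b
      change ∑ f : Fin N → α ⊕ β, w ^ (freeLetters (Fin.cons (Sum.inr b) f :
        Fin (N + 1) → α ⊕ β) \ B).card ≤ _
      simp only [hcons]
      split_ifs with hb
      · have : ∀ f : Fin N → α ⊕ β, insert b (freeLetters f) \ B = freeLetters f \ B := fun f =>
          Finset.insert_sdiff_of_mem _ hb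
        simp only [this]
        refine (b1 B (by omega)).trans (le_mul_of_one_le_left (by positivity) (by linarith))
      · have : ∀ f : Fin N → α ⊕ β, (insert b (freeLetters f) \ B).card =
            (freeLetters f \ insert b B).card + 1 := by
          intro f
          rw [show insert b (freeLetters f) \ B = insert b (freeLetters f \ insert b B) by
            ext c; simp only [Finset.mem_sdiff, Finset.mem_insert]
            by_cases hc : c = b
            · simp [hc, hb]
            · simp [hc], Finset.card_insert_of_notMem (by simp)]
        simp only [this, pow_succ]
        rw [← Finset.sum_mul, add_zero, mul_comm]
        exact mul_le_mul_of_nonneg_left (b1 _ (Finset.card_insert_le _ _)) hw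
    refine (add_le_add (Finset.sum_le_sum fun a _ => e1 a)
      (Finset.sum_le_sum fun b _ => e2 b)).trans ?_
    rw [← Finset.sum_mul, Finset.sum_add_distrib, Finset.sum_const, Finset.sum_const]
    simp only [Finset.card_univ, nsmul_eq_mul, Finset.sum_ite_mem, Finset.univ_inter,
      Finset.sum_const, mul_one]
    rw [← add_mul, pow_succ', ← add_assoc]
    refine mul_le_mul_of_nonneg_right ?_ (by positivity)
    rw [hX]; push_cast; linarith

lemma sum_words_le' {κ α β : Type*} [Fintype κ] [DecidableEq κ] [Fintype α] [Fintype β]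
    [DecidableEq α] [DecidableEq β] {w : ℝ} (hw : 0 ≤ w) (B : Finset β) :
    ∑ f : κ → α ⊕ β, w ^ (freeLetters f \ B).card ≤
      (Fintype.card α + Fintype.card β * w + (B.card + Fintype.card κ : ℕ)) ^ Fintype.card κ := by
  refine le_of_eq_of_le ?_ (sum_words_le hw (Fintype.card κ) B)
  refine Fintype.sum_equiv ((Fintype.equivFin κ).arrowCongr (Equiv.refl _)) _ _ fun f => ?_
  congr 2
  congr 1
  ext b
  simp only [freeLetters, Finset.mem_filter_univ, Equiv.arrowCongr_apply, Equiv.coe_refl,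
    Function.comp, id]
  exact ⟨fun ⟨t, ht⟩ => ⟨Fintype.equivFin κ t, by simpa using ht⟩, fun ⟨t, ht⟩ => ⟨_, ht⟩⟩

/-- Weighted by `w` to the number of nodes outside `B`, the cycles of a type are few: they are
encoded by words of variable nodes and kinds of factor nodes. -/
lemma sum_loops_le {K : CycleType m} (hK : 2 ≤ size K) {w : ℝ} (hw : 0 ≤ w)
    (B : Finset (Fin n ⊕ Fin p)) {M : ℕ} (hM : B.card + 2 * size K ≤ M) :
    ∑ E ∈ loops m n p K, w ^ (B ∪ supp E).card ≤
      w ^ B.card * (m + (n + p) * w + M) ^ (2 * size K) := by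
  classical
  have : NeZero (size K) := ⟨by omega⟩
  let code : (ZMod (size K) → Fin n) → (ZMod (size K) → FactorNode m n p) →
      ZMod (size K) × Bool → Fin m ⊕ (Fin n ⊕ Fin p) := fun i f x =>
    if x.2 then Sum.inr (Sum.inl (i x.1)) else Sum.map id Sum.inr (kind (f x.1))
  have hex : ∀ E, E ∈ loops m n p K → ∃ c, ∃ i f, IsLabelled i f ∧ E = loop i f ∧ c = code i f := by
    intro E hE
    obtain ⟨i, f, h, h'⟩ := (mem_loops hK).1 hE
    exact ⟨_, i, f, h.1, h', rfl⟩
  choose c hc using hex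
  have hletters : ∀ E hE, freeLetters (c E hE) = supp E := by
    intro E hE
    obtain ⟨i, f, -, e1, e2⟩ := hc E hE
    rw [e2]
    ext b
    simp only [freeLetters, Finset.mem_filter_univ, supp]
    rcases b with a | v
    · rw [Finset.inl_mem_disjSum, mem_varSet]
      constructor
      · rintro ⟨⟨t, _ | _⟩, ht⟩
        · simp only [code] at ht
          rcases hk : kind (f t) with r | v <;> simp [hk] at ht
        · simp only [code, if_true, Sum.inr.injEq, Sum.inl.injEq] at ht
          exact ⟨f t, e1 ▸ mem_loop.2 ⟨t, Or.inl ht.symm, rfl⟩⟩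
      · rintro ⟨q, hq⟩
        obtain ⟨t, h | h, -⟩ := mem_loop.1 (e1 ▸ hq)
        · exact ⟨(t, true), by simp only at h; simp [code, h]⟩
        · exact ⟨(t + 1, true), by simp only at h; simp [code, h]⟩
    · rw [Finset.inr_mem_disjSum, mem_colSet]
      constructor
      · rintro ⟨⟨t, _ | _⟩, ht⟩
        · simp only [code] at ht
          rcases hk : f t with r | v'
          · simp [hk, kind] at ht
          · simp only [hk, kind, Sum.map_inr, id, Bool.false_eq_true, if_false, Sum.inr.injEq] at ht
            exact ⟨i t, e1 ▸ mem_loop.2 ⟨t, Or.inl rfl, by rw [hk, ht]⟩⟩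
        · simp [code] at ht
      · rintro ⟨j, hj⟩
        obtain ⟨t, -, h⟩ := mem_loop.1 (e1 ▸ hj)
        simp only at h
        exact ⟨(t, false), by simp [code, ← h, kind]⟩
  have hinj : ∀ E hE E' hE', c E hE = c E' hE' → E = E' := by
    intro E hE E' hE' e
    obtain ⟨i, f, h, e1, e2⟩ := hc E hE
    obtain ⟨i', f', h', e1', e2'⟩ := hc E' hE'
    rw [e2, e2'] at e
    have hi : i = i' := by
      funext t
      simpa [code] using congrFun e (t, true)
    subst hi
    have hf : f = f' := by
      refine h.factor_ext hK h' (funext fun t => ?_)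
      have := congrFun e (t, false)
      simp only [code, Bool.false_eq_true, if_false] at this
      exact (Function.Injective.sumMap Function.injective_id Sum.inr_injective) this
    rw [e1, e1', hf]
  have hterm : ∀ E : Finset (Link m n p),
      w ^ (B ∪ supp E).card = w ^ B.card * w ^ (supp E \ B).card := by
    intro E
    rw [← pow_add, ← Finset.union_sdiff_self_eq_union,
      Finset.card_union_of_disjoint Finset.disjoint_sdiff]
  simp only [hterm]
  rw [← Finset.mul_sum]
  refine mul_le_mul_of_nonneg_left ?_ (by positivity)
  have hcard : Fintype.card (ZMod (size K) × Bool) = 2 * size K := by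
    rw [Fintype.card_prod, ZMod.card, Fintype.card_bool, mul_comm]
  calc ∑ E ∈ loops m n p K, w ^ (supp E \ B).card
      = ∑ E ∈ (loops m n p K).attach, w ^ (freeLetters (c E.1 E.2) \ B).card := by
        rw [← Finset.sum_attach]
        exact Finset.sum_congr rfl fun E _ => by rw [hletters]
    _ = ∑ f ∈ (loops m n p K).attach.image fun E => c E.1 E.2,
          w ^ (freeLetters f \ B).card := by
        rw [Finset.sum_image]
        intro E _ E' _ e
        exact Subtype.ext (hinj _ _ _ _ e)
    _ ≤ ∑ f, w ^ (freeLetters f \ B).card :=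
        Finset.sum_le_univ_sum_of_nonneg fun f => by positivity
    _ ≤ _ := sum_words_le' hw B
    _ ≤ _ := by
        rw [hcard]
        refine pow_le_pow_left₀ (by positivity) ?_ _
        have : ((B.card + 2 * size K : ℕ) : ℝ) ≤ M := by exact_mod_cast hM
        simp only [Fintype.card_sum, Fintype.card_fin]
        push_cast at this ⊢
        linarith

end CycleStat

namespace CycleStat

variable {m n p : ℕ}

/-! ### The law of the labels and the networks -/

/-- The labels and the networks. -/
abbrev Graph (m n : ℕ) : Type := (Fin n → Bool) × (Fin m → Pair n → Bool)

/-- The indicator that all the edges in `T` are present. -/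
def edgeInd (T : Finset (Fin m × Pair n)) (y : Graph m n) : ℝ :=
  ∏ f ∈ T, if y.2 f.1 f.2 then 1 else 0

lemma edgeInd_nonneg (T : Finset (Fin m × Pair n)) (y : Graph m n) : 0 ≤ edgeInd T y :=
  Finset.prod_nonneg fun f _ => by split_ifs <;> norm_num

lemma edgeInd_eq_zero_or_one (T : Finset (Fin m × Pair n)) (y : Graph m n) :
    edgeInd T y = 0 ∨ edgeInd T y = 1 := by
  unfold edgeInd
  by_cases h : ∀ f ∈ T, y.2 f.1 f.2 = true
  · right; exact Finset.prod_eq_one fun f hf => by simp [h f hf]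
  · push Not at h
    obtain ⟨f, hf, hf'⟩ := h
    left; exact Finset.prod_eq_zero hf (by simp [hf'])

lemma edgeInd_mul (T T' : Finset (Fin m × Pair n)) (y : Graph m n) :
    edgeInd T y * edgeInd T' y = edgeInd (T ∪ T') y := by
  unfold edgeInd
  by_cases h : ∀ f ∈ T ∪ T', y.2 f.1 f.2 = true
  · rw [Finset.prod_eq_one fun f hf => by simp [h f (Finset.mem_union_left _ hf)],
      Finset.prod_eq_one fun f hf => by simp [h f (Finset.mem_union_right _ hf)],
      Finset.prod_eq_one fun f hf => by simp [h f hf], one_mul]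
  · push Not at h
    obtain ⟨f, hf, hf'⟩ := h
    rw [Finset.prod_eq_zero hf (by simp [hf'])]
    rcases Finset.mem_union.1 hf with h1 | h1
    · rw [Finset.prod_eq_zero h1 (by simp [hf']), zero_mul]
    · rw [mul_comm, Finset.prod_eq_zero h1 (by simp [hf']), zero_mul]

lemma integral_graphLaw (d lam : Fin m → ℝ) (f : Graph m n → ℝ) :
    ∫ y, f y ∂(graphLaw m n d lam) = ((2 : ℝ) ^ n)⁻¹ * ∑ σ : Fin n → Bool,
      ∫ A, f (σ, A) ∂(Measure.pi fun r : Fin m => Measure.pi fun e : Pair n =>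
      bernoulliMeasure true false (edgeProb n (d r) (lam r) (σ e.1.1) (σ e.1.2))) := by
  unfold graphLaw
  rw [integral_finsetSum_measure fun σ _ => Integrable.of_finite.smul_measure (by simp),
    Finset.mul_sum]
  refine Finset.sum_congr rfl fun σ _ => ?_
  rw [integral_smul_measure, Measure.dirac_prod, integral_map (by fun_prop)
    (Measurable.of_discrete.aestronglyMeasurable)]
  simp

/-- Given the labels, the edges in `T` are present with the product of their probabilities. -/
lemma integral_edgeInd_mul (d lam : Fin m → ℝ) (T : Finset (Fin m × Pair n))
    (h : (Fin n → Bool) → ℝ) :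
    ∫ y, edgeInd T y * h y.1 ∂(graphLaw m n d lam) = ((2 : ℝ) ^ n)⁻¹ * ∑ σ : Fin n → Bool,
      (∏ f ∈ T, (edgeProb n (d f.1) (lam f.1) (σ f.2.1.1) (σ f.2.1.2) : ℝ)) * h σ := by
  rw [integral_graphLaw]
  congr 1
  refine Finset.sum_congr rfl fun σ _ => ?_
  simp only []
  rw [integral_mul_const]
  congr 1
  have h1 : ∀ A : Fin m → Pair n → Bool, edgeInd T ((σ, A) : Graph m n) =
      ∏ r, ∏ e, if (r, e) ∈ T then (if A r e then (1 : ℝ) else 0) else 1 := by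
    intro A
    rw [← Fintype.prod_prod_type' (f := fun r e =>
      if (r, e) ∈ T then (if A r e then (1 : ℝ) else 0) else 1), Finset.prod_ite_mem,
      Finset.univ_inter]
    rfl
  simp only [h1]
  rw [integral_fintype_prod_eq_prod (fun r (A : Pair n → Bool) =>
    ∏ e, if (r, e) ∈ T then (if A e then (1 : ℝ) else 0) else 1)]
  conv_rhs => rw [← Finset.univ_inter T, ← Finset.prod_ite_mem, Fintype.prod_prod_type]
  refine Finset.prod_congr rfl fun r _ => ?_
  rw [integral_fintype_prod_eq_prod (fun e (a : Bool) =>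
    if (r, e) ∈ T then (if a then (1 : ℝ) else 0) else 1)]
  refine Finset.prod_congr rfl fun e _ => ?_
  rw [integral_bernoulliMeasure]
  by_cases h : (r, e) ∈ T <;> simp [h]

lemma spin_mul_self (b : Bool) : spin b * spin b = 1 := by cases b <;> simp [spin]

lemma abs_spin (b : Bool) : |spin b| = 1 := by cases b <;> simp [spin]

lemma spin_not (b : Bool) : spin (!b) = -spin b := by cases b <;> simp [spin]

lemma mul_sqrt_le {d lam : ℝ} (hd : 0 ≤ d) (hl : lam ≤ √d) : lam * √d ≤ d := by
  calc lam * √d ≤ √d * √d := mul_le_mul_of_nonneg_right hl (Real.sqrt_nonneg _)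
    _ = d := Real.mul_self_sqrt hd

/-- For large `n` the probability of an edge is `(d + λ √d σ_s σ_t) / n`. -/
lemma edgeProb_eq {d lam : ℝ} (hd : 0 ≤ d) (hl0 : 0 ≤ lam) (hl : lam ≤ √d) (hn0 : 0 < n)
    (hn : 2 * d ≤ n) (s t : Bool) :
    (edgeProb n d lam s t : ℝ) = (d + lam * √d * (spin s * spin t)) / n := by
  have h1 := mul_sqrt_le hd hl
  have h2 : 0 ≤ lam * √d := by positivity
  have hn0' : (0 : ℝ) < n := by exact_mod_cast hn0
  have e : (if s = t then d + lam * √d else d - lam * √d) =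
      d + lam * √d * (spin s * spin t) := by
    cases s <;> cases t <;> simp [spin, sub_eq_add_neg]
  unfold edgeProb
  rw [e, Set.projIcc_of_mem zero_le_one (x := (d + lam * √d * (spin s * spin t)) / n)]
  have h3 : -(lam * √d) ≤ lam * √d * (spin s * spin t) ∧
      lam * √d * (spin s * spin t) ≤ lam * √d := by
    cases s <;> cases t <;> simp [spin] <;> linarith
  exact ⟨div_nonneg (by linarith) hn0'.le, (div_le_one hn0').2 (by linarith)⟩

lemma edgeProb_le {d lam : ℝ} (hd : 0 ≤ d) (hl0 : 0 ≤ lam) (hl : lam ≤ √d) (hn0 : 0 < n)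
    (hn : 2 * d ≤ n) (s t : Bool) : (edgeProb n d lam s t : ℝ) ≤ 2 * d / n := by
  rw [edgeProb_eq hd hl0 hl hn0 hn]
  have h1 := mul_sqrt_le hd hl
  have h2 : 0 ≤ lam * √d := by positivity
  have h3 : lam * √d * (spin s * spin t) ≤ lam * √d := by
    cases s <;> cases t <;> simp [spin] <;> linarith
  gcongr
  linarith

/-- The edges in `T` are present with probability at most `(D / n) ^ |T|`. -/
lemma integral_edgeInd_mul_le {d lam : Fin m → ℝ} (hd : ∀ j, 0 ≤ d j) (hl0 : ∀ j, 0 ≤ lam j)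
    (hl : ∀ j, lam j ≤ √(d j)) {D : ℝ} (hD : ∀ j, 2 * d j ≤ D) (hn0 : 0 < n) (hn : D ≤ n)
    (T : Finset (Fin m × Pair n)) {h : (Fin n → Bool) → ℝ} {C : ℝ} (hC : ∀ σ, |h σ| ≤ C) :
    |∫ y, edgeInd T y * h y.1 ∂(graphLaw m n d lam)| ≤ (D / n) ^ T.card * C := by
  rw [integral_edgeInd_mul]
  have h1 : ∀ σ : Fin n → Bool, |(∏ f ∈ T, (edgeProb n (d f.1) (lam f.1) (σ f.2.1.1)
      (σ f.2.1.2) : ℝ)) * h σ| ≤ (D / n) ^ T.card * C := by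
    intro σ
    rw [abs_mul, Finset.abs_prod]
    have hC0 : 0 ≤ C := (abs_nonneg _).trans (hC σ)
    have h2 : ∏ f ∈ T, |(edgeProb n (d f.1) (lam f.1) (σ f.2.1.1) (σ f.2.1.2) : ℝ)| ≤
        (D / n) ^ T.card := by
      refine (Finset.prod_le_prod (fun _ _ => abs_nonneg _) fun f _ => ?_).trans
        (Finset.prod_const _).le
      rw [abs_of_nonneg (edgeProb n (d f.1) (lam f.1) (σ f.2.1.1) (σ f.2.1.2)).2.1]
      refine (edgeProb_le (hd _) (hl0 _) (hl _) hn0 ((hD _).trans hn) _ _).trans ?_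
      have := hD f.1
      gcongr
    exact mul_le_mul h2 (hC σ) (abs_nonneg _)
      ((Finset.prod_nonneg fun _ _ => abs_nonneg _).trans h2)
  rw [abs_mul, abs_of_nonneg (by positivity)]
  calc ((2 : ℝ) ^ n)⁻¹ * _ ≤ ((2 : ℝ) ^ n)⁻¹ * ∑ σ : Fin n → Bool, (D / n) ^ T.card * C := by
        gcongr
        exact (Finset.abs_sum_le_sum_abs _ _).trans (Finset.sum_le_sum fun σ _ => h1 σ)
    _ = _ := by
        rw [Finset.sum_const, Finset.card_univ, Fintype.card_fun, Fintype.card_bool,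
          Fintype.card_fin, nsmul_eq_mul]
        push_cast
        field_simp

/-! ### Independence of disjoint parts of the networks -/

/-- Independent Bernoulli variables from which the labels and the networks can be built: a label
for each subject, and for each pair one indicator for the case that the labels are different and
one for the case that they are equal. -/
abbrev Coin (m n : ℕ) : Type := Fin n ⊕ (Fin m × Pair n × Bool)

/-- The parameters of the Bernoulli variables. -/
noncomputable def coinProb (d lam : Fin m → ℝ) : Coin m n → unitInterval
  | .inl _ => ⟨1 / 2, by norm_num, by norm_num⟩
  | .inr q => edgeProb n (d q.1) (lam q.1) q.2.2 true

/-- The labels and the networks built from the Bernoulli variables. -/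
def graphOfCoins (x : Coin m n → Bool) : Graph m n :=
  (fun i => x (Sum.inl i), fun r e =>
    x (Sum.inr (r, e, x (Sum.inl e.1.1) == x (Sum.inl e.1.2))))

/-- The joint law of the Bernoulli variables. -/
noncomputable def coinLaw (d lam : Fin m → ℝ) : Measure (Coin m n → Bool) :=
  Measure.pi fun c => bernoulliMeasure true false (coinProb d lam c)

lemma graphLaw_eq_map (d lam : Fin m → ℝ) :
    graphLaw m n d lam = (coinLaw d lam).map graphOfCoins := by
  refine Measure.ext_of_singleton fun ⟨σ, A⟩ => ?_
  rw [Measure.map_apply Measurable.of_discrete (measurableSet_singleton _)]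
  have hpre : graphOfCoins ⁻¹' {((σ, A) : Graph m n)} = Set.univ.pi fun c : Coin m n =>
      Sum.elim (fun i => ({σ i} : Set Bool)) (fun q => if q.2.2 = (σ q.2.1.1.1 == σ q.2.1.1.2) then
        ({A q.1 q.2.1} : Set Bool) else Set.univ) c := by
    ext x
    simp only [Set.mem_preimage, Set.mem_singleton_iff, graphOfCoins, Prod.mk.injEq, Set.mem_pi,
      Set.mem_univ, true_imp_iff, Sum.forall, Sum.elim_inl, Sum.elim_inr]
    constructor
    · rintro ⟨h1, h2⟩
      refine ⟨fun i => congrFun h1 i, fun ⟨r, e, b⟩ => ?_⟩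
      have := congrFun (congrFun h2 r) e
      rw [show x (Sum.inl e.1.1) = σ e.1.1 from congrFun h1 _,
        show x (Sum.inl e.1.2) = σ e.1.2 from congrFun h1 _] at this
      split_ifs with hb
      · simp only at hb
        rw [hb]; exact this
      · trivial
    · rintro ⟨h1, h2⟩
      have h1' : ∀ i, x (Sum.inl i) = σ i := h1
      refine ⟨funext h1, funext fun r => funext fun e => ?_⟩
      rw [h1', h1']
      have := h2 (r, e, σ e.1.1 == σ e.1.2)
      simpa using this
  rw [hpre, coinLaw, Measure.pi_pi, Fintype.prod_sum_type]
  simp only [Sum.elim_inl, Sum.elim_inr]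
  simp only [graphLaw, Measure.finsetSum_apply, Measure.smul_apply, smul_eq_mul]
  have hs : ({((σ, A) : Graph m n)} : Set (Graph m n)) = {σ} ×ˢ {A} := by
    ext ⟨a, b⟩; simp
  rw [Finset.sum_eq_single σ]
  · rw [hs, Measure.prod_prod]
    simp only [Measure.dirac_apply, Set.mem_singleton_iff, Set.indicator_of_mem, Pi.one_apply,
      one_mul]
    congr 1
    · have : ∀ i : Fin n, bernoulliMeasure true false (coinProb d lam (Sum.inl i : Coin m n))
          {σ i} = 2⁻¹ := by
        intro i
        rw [bernoulliMeasure_def]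
        have e1 : (unitInterval.toNNReal (coinProb d lam (Sum.inl i : Coin m n))) = 2⁻¹ := by
          ext; simp [coinProb]
        have e2 : (unitInterval.toNNReal (unitInterval.symm (coinProb d lam
            (Sum.inl i : Coin m n)))) = 2⁻¹ := by
          ext; simp [coinProb]; norm_num
        cases σ i <;> simp [e1, e2]
      simp only [this, Finset.prod_const, Finset.card_univ, Fintype.card_fin]
      rw [ENNReal.inv_pow]
    · have hA : ({A} : Set (Fin m → Pair n → Bool)) = Set.univ.pi fun r => Set.univ.pi fun e =>
          {A r e} := by
        ext B; simp [Set.mem_pi, funext_iff]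
      rw [hA, Measure.pi_pi, Fintype.prod_prod_type]
      refine Finset.prod_congr rfl fun r _ => ?_
      rw [Measure.pi_pi, Fintype.prod_prod_type]
      refine Finset.prod_congr rfl fun e _ => ?_
      rw [Fintype.prod_bool]
      rcases hb : (σ e.1.1 == σ e.1.2) with _ | _
      · simp only [Bool.true_eq_false, if_false, measure_univ, one_mul, if_true]
        congr 2
        simp only [coinProb, edgeProb]
        simp at hb
        simp [hb]
      · simp only [Bool.false_eq_true, if_false, measure_univ, mul_one, if_true]
        congr 2
        simp only [coinProb, edgeProb]
        simp at hb
        simp [hb]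
  · intro τ _ hτ
    rw [hs, Measure.prod_prod, Measure.dirac_apply, Set.indicator_of_notMem (by simpa using hτ),
      zero_mul, mul_zero]
  · exact fun h => absurd (Finset.mem_univ _) h

/-- Functions of the labels and the networks on two disjoint sets of subjects are independent. -/
lemma integral_mul_of_separated (d lam : Fin m → ℝ) (U : Finset (Fin n)) (g h : Graph m n → ℝ)
    (hg : ∀ y y' : Graph m n, (∀ i ∈ U, y.1 i = y'.1 i) →
      (∀ r (e : Pair n), e.1.1 ∈ U → e.1.2 ∈ U → y.2 r e = y'.2 r e) → g y = g y')
    (hh : ∀ y y' : Graph m n, (∀ i, i ∉ U → y.1 i = y'.1 i) →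
      (∀ r (e : Pair n), e.1.1 ∉ U → e.1.2 ∉ U → y.2 r e = y'.2 r e) → h y = h y') :
    ∫ y, g y * h y ∂(graphLaw m n d lam) =
      (∫ y, g y ∂(graphLaw m n d lam)) * ∫ y, h y ∂(graphLaw m n d lam) := by
  classical
  let S : Finset (Coin m n) := Finset.univ.filter fun c => match c with
    | .inl i => i ∈ U
    | .inr q => q.2.1.1.1 ∈ U ∧ q.2.1.1.2 ∈ U
  have hS1 : ∀ i, (Sum.inl i : Coin m n) ∈ S ↔ i ∈ U := fun i => by simp [S]
  have hS2 : ∀ q, (Sum.inr q : Coin m n) ∈ S ↔ q.2.1.1.1 ∈ U ∧ q.2.1.1.2 ∈ U :=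
    fun i => by simp [S]
  have hindep : iIndepFun (fun (c : Coin m n) (x : Coin m n → Bool) => x c)
      (coinLaw (n := n) d lam) :=
    iIndepFun_pi (X := fun _ => id) fun _ => aemeasurable_id
  have h2 := hindep.indepFun_finset S Sᶜ disjoint_compl_right fun c => measurable_pi_apply c
  let ext (V : Finset (Coin m n)) (z : V → Bool) (c : Coin m n) : Bool :=
    if hc : c ∈ V then z ⟨c, hc⟩ else false
  have hext : ∀ (V : Finset (Coin m n)) (x : Coin m n → Bool), ∀ c ∈ V,
      ext V (fun c => x c) c = x c := fun V x c hc => by simp [ext, hc]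
  have h3 := h2.comp (Measurable.of_discrete (f := fun z => g (graphOfCoins (ext S z))))
    (Measurable.of_discrete (f := fun z => h (graphOfCoins (ext Sᶜ z))))
  have e1 : ((fun z => g (graphOfCoins (ext S z))) ∘ fun (a : Coin m n → Bool) (i : S) => a i) =
      fun x => g (graphOfCoins x) := by
    funext x
    refine hg _ _ (fun i hi => hext S x _ ((hS1 i).2 hi)) fun r e h1 h2 => ?_
    simp only [graphOfCoins]
    rw [hext S x _ ((hS1 _).2 h1), hext S x _ ((hS1 _).2 h2), hext S x _ ((hS2 _).2 ⟨h1, h2⟩)]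
  have e2 : ((fun z => h (graphOfCoins (ext Sᶜ z))) ∘ fun (a : Coin m n → Bool)
      (i : (Sᶜ : Finset (Coin m n))) => a i) = fun x => h (graphOfCoins x) := by
    funext x
    have hc1 : ∀ i, i ∉ U → (Sum.inl i : Coin m n) ∈ Sᶜ := fun i hi => by
      rw [Finset.mem_compl, hS1]; exact hi
    refine hh _ _ (fun i hi => hext Sᶜ x _ (hc1 i hi)) fun r e h1 h2 => ?_
    simp only [graphOfCoins]
    rw [hext Sᶜ x _ (hc1 _ h1), hext Sᶜ x _ (hc1 _ h2), hext Sᶜ x _ (by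
      rw [Finset.mem_compl, hS2]; exact fun hc => h1 hc.1)]
  rw [e1, e2] at h3
  have h4 := h3.integral_fun_mul_eq_mul_integral Measurable.of_discrete.aestronglyMeasurable
    Measurable.of_discrete.aestronglyMeasurable
  rw [graphLaw_eq_map, integral_map Measurable.of_discrete.aemeasurable
    Measurable.of_discrete.aestronglyMeasurable, integral_map Measurable.of_discrete.aemeasurable
    Measurable.of_discrete.aestronglyMeasurable, integral_map Measurable.of_discrete.aemeasurable
    Measurable.of_discrete.aestronglyMeasurable]
  exact h4

end CycleStat

namespace CycleStat

variable {m n p : ℕ}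

/-! ### Products along a cycle -/

lemma prod_covSet {M : Type*} [CommMonoid M] (E : Finset (Link m n p)) (h : Fin n × Fin p → M) :
    ∏ q ∈ covSet E, h q = ∏ l ∈ E, Sum.elim (fun _ => 1) (fun v => h (l.1, v)) l.2 := by
  refine Finset.prod_of_injOn (fun q => (q.1, Sum.inr q.2)) ?_ ?_ ?_ ?_
  · intro q _ q' _ e; simpa [Prod.ext_iff] using e
  · intro q hq; exact mem_covSet.1 hq
  · rintro ⟨a, b | b⟩ hl hl'
    · rfl
    · exact absurd ⟨(a, b), mem_covSet.2 hl, rfl⟩ hl'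
  · intro q _; rfl

section
variable {k : ℕ} [NeZero k] {i : ZMod k → Fin n} {f : ZMod k → FactorNode m n p}

lemma IsLabelled.prod_loop {M : Type*} [CommMonoid M] (hk : 2 ≤ k) (h : IsLabelled i f)
    (G : Link m n p → M) : ∏ l ∈ loop i f, G l = ∏ t, G (i t, f t) * G (i (t + 1), f t) := by
  classical
  unfold loop
  rw [Finset.prod_image fun _ _ _ _ e => h.linkAt_injective hk e, Fintype.prod_prod_type]
  refine Finset.prod_congr rfl fun t _ => ?_
  rw [Fintype.prod_bool, mul_comm]
  rfl

lemma IsLabelled.prod_netSet {M : Type*} [CommMonoid M] (h : IsLabelled i f)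
    (g : Fin m × Pair n → M) :
    ∏ x ∈ netSet (loop i f), g x = ∏ t, Sum.elim g (fun _ => 1) (f t) := by
  classical
  have h1 : (loop i f).image Prod.snd = Finset.univ.image f := by
    ext x
    simp only [Finset.mem_image, Finset.mem_univ, true_and]
    constructor
    · rintro ⟨l, hl, rfl⟩
      obtain ⟨t, -, ht⟩ := mem_loop.1 hl
      exact ⟨t, ht.symm⟩
    · rintro ⟨t, rfl⟩
      exact ⟨(i t, f t), mem_loop.2 ⟨t, Or.inl rfl, rfl⟩, rfl⟩
  rw [← Finset.prod_image (f := Sum.elim g fun _ => 1) (fun _ _ _ _ e => h.inj_factor e), ← h1,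
    image_snd, Finset.prod_disjSum]
  simp

lemma IsLabelled.prod_covSet {M : Type*} [CommMonoid M] (hk : 2 ≤ k) (h : IsLabelled i f)
    (g : Fin n × Fin p → M) :
    ∏ x ∈ covSet (loop i f), g x =
      ∏ t, Sum.elim (fun _ => 1) (fun v => g (i t, v) * g (i (t + 1), v)) (f t) := by
  rw [CycleStat.prod_covSet, h.prod_loop hk]
  refine Finset.prod_congr rfl fun t _ => ?_
  rcases f t with a | a <;> simp

end

/-- The members of the pair of a network factor node of a cycle are its two neighbours. -/
lemma IsLabelled.pair_mul {k : ℕ} {i : ZMod k → Fin n} {f : ZMod k → FactorNode m n p}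
    (hk : 2 ≤ k) (h : IsLabelled i f) {t : ZMod k} {r : Fin m} {e : Pair n}
    (ht : f t = Sum.inl (r, e)) (s : Fin n → ℝ) :
    s e.1.1 * s e.1.2 = s (i t) * s (i (t + 1)) := by
  have h1 := h.incident t
  have h2 := h.incident_succ t
  have h3 := h.var_ne hk t
  rw [ht] at h1 h2
  simp only [Incident] at h1 h2
  rcases h1 with h1 | h1 <;> rcases h2 with h2 | h2
  · exact absurd (h1.trans h2.symm) h3
  · rw [h1, h2]
  · rw [h1, h2, mul_comm]
  · exact absurd (h1.trans h2.symm) h3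

/-- Along a cycle of type `K`, a quantity that depends on the network only has the product
`∏ r, y r ^ k_r * c ^ ℓ`. -/
lemma IsLabelledOf.prod_kind {K : CycleType m} [NeZero (size K)] (hK : 2 ≤ size K)
    {i : ZMod (size K) → Fin n} {f : ZMod (size K) → FactorNode m n p} (h : IsLabelledOf K i f)
    (y : Fin m → ℝ) (c : ℝ) :
    ∏ t, Sum.elim (fun x : Fin m × Pair n => y x.1) (fun _ => c) (f t) =
      (∏ r, y r ^ K.1 r) * c ^ K.2 := by
  classical
  let κ : ZMod (size K) → Option (Fin m) := fun t => Sum.elim some (fun _ => none) (kind (f t))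
  have h1 : ∀ t, Sum.elim (fun x : Fin m × Pair n => y x.1) (fun _ => c) (f t) =
      (κ t).elim c y := by
    intro t
    rcases hf : f t with x | x <;> simp [κ, hf, kind]
  rw [Finset.prod_congr rfl fun t _ => h1 t, ← Finset.prod_fiberwise' Finset.univ κ
    (fun o => o.elim c y), Fintype.prod_option, mul_comm]
  simp only [Finset.prod_const, Option.elim]
  congr 1
  · refine Finset.prod_congr rfl fun r _ => ?_
    congr 1
    have := (h.1.card_filter hK fun q => kind q = Sum.inl r).symm.trans (h.2.1 r)
    rw [← Nat.eq_of_mul_eq_mul_left two_pos this]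
    congr 1; ext t
    rw [Finset.mem_filter, Finset.mem_filter]
    rcases hf : f t with x | x <;> simp [κ, hf, kind]
  · congr 1
    have := (h.1.card_filter hK fun q => (kind q).isRight).symm.trans h.2.2
    rw [← Nat.eq_of_mul_eq_mul_left two_pos this]
    congr 1; ext t
    rw [Finset.mem_filter, Finset.mem_filter]
    rcases hf : f t with x | x <;> simp [κ, hf, kind]

lemma card_covSet {K : CycleType m} (hK : 2 ≤ size K) {E : Finset (Link m n p)}
    (hE : E ∈ loops m n p K) : (covSet E).card = 2 * K.2 := by
  rw [← (hasType_of_mem_loops hK hE).2]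
  refine Finset.card_bij (fun q _ => (q.1, Sum.inr q.2)) ?_ ?_ ?_
  · intro q hq
    exact Finset.mem_filter.2 ⟨mem_covSet.1 hq, rfl⟩
  · intro q _ q' _ e; simpa [Prod.ext_iff] using e
  · rintro ⟨a, b | b⟩ hq
    · simp [kind] at hq
    · exact ⟨(a, b), mem_covSet.2 (Finset.mem_filter.1 hq).1, rfl⟩

lemma card_netSet {K : CycleType m} (hK : 2 ≤ size K) {E : Finset (Link m n p)}
    (hE : E ∈ loops m n p K) : (netSet E).card = ∑ r, K.1 r := by
  have h1 := (isRing_of_mem_loops hK hE).minDegTwo.card_eq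
  rw [card_covSet hK hE, (hasType_of_mem_loops hK hE).card, size] at h1
  omega

lemma prod_weight {K : CycleType m} (hK : 2 ≤ size K) {E : Finset (Link m n p)}
    (hE : E ∈ loops m n p K) (mu : ℝ) (x : Sample m n p) :
    ∏ q ∈ E, weight mu x q.1 q.2 =
      edgeInd (netSet E) x.1 * ∏ q ∈ covSet E, covariate mu x q.1 q.2 := by
  have : NeZero (size K) := ⟨by omega⟩
  obtain ⟨i, f, h, rfl⟩ := (mem_loops hK).1 hE
  rw [edgeInd, h.1.prod_loop hK, h.1.prod_netSet, h.1.prod_covSet hK, ← Finset.prod_mul_distrib]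
  refine Finset.prod_congr rfl fun t _ => ?_
  rcases f t with a | a
  · simp only [weight, adj, Sum.elim_inl, mul_one]
    split_ifs <;> simp
  · simp [weight]

/-! ### Averages over the labels -/

/-- Flipping one label. -/
def flipAt (j : Fin n) (σ : Fin n → Bool) : Fin n → Bool := Function.update σ j (!σ j)

lemma flipAt_involutive (j : Fin n) : Function.Involutive (flipAt j) := by
  intro σ; funext a
  by_cases h : a = j
  · subst h; simp [flipAt]
  · simp [flipAt, h]

/-- The average of a product of `σ_{i t} σ_{i (t + 1)}` over some of the steps of a cycle vanishes
unless none or all of the steps are taken. -/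
lemma sum_prod_spin_eq_zero {k : ℕ} [NeZero k] (hk : 2 ≤ k) {i : ZMod k → Fin n}
    (hi : Function.Injective i) {U : Finset (ZMod k)} (h0 : U.Nonempty) (h1 : U ≠ Finset.univ) :
    ∑ σ : Fin n → Bool, ∏ t ∈ U, (spin (σ (i t)) * spin (σ (i (t + 1)))) = 0 := by
  obtain ⟨t, ht, ht'⟩ : ∃ t ∈ U, t + 1 ∉ U := by
    by_contra hcon
    push Not at hcon
    apply h1
    obtain ⟨t0, ht0⟩ := h0
    have key : ∀ s : ℕ, t0 + s ∈ U := by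
      intro s
      induction s with
      | zero => simpa using ht0
      | succ s ih =>
        have := hcon _ ih
        push_cast
        rwa [← add_assoc]
    refine Finset.eq_univ_of_forall fun s => ?_
    have := key (s - t0).val
    simpa using this
  have hflip : ∀ σ : Fin n → Bool,
      ∏ s ∈ U, (spin (flipAt (i (t + 1)) σ (i s)) * spin (flipAt (i (t + 1)) σ (i (s + 1)))) =
        -∏ s ∈ U, (spin (σ (i s)) * spin (σ (i (s + 1)))) := by
    intro σ
    have hne : ∀ s, s ≠ t + 1 → flipAt (i (t + 1)) σ (i s) = σ (i s) := fun s hs => by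
      simp [flipAt, hi.ne hs]
    rw [← Finset.mul_prod_erase U _ ht, ← Finset.mul_prod_erase U (fun s =>
      spin (σ (i s)) * spin (σ (i (s + 1)))) ht, ← neg_mul]
    congr 1
    · rw [hne t (zmod_ne_add_one hk t), ← mul_neg, ← spin_not]
      simp [flipAt]
    · refine Finset.prod_congr rfl fun s hs => ?_
      obtain ⟨h1, h2⟩ := Finset.mem_erase.1 hs
      rw [hne s (fun e => ht' (e ▸ h2)), hne (s + 1) (fun e => h1 (by simpa using e))]
  have := Equiv.sum_comp (flipAt_involutive (i (t + 1))).toPerm fun σ : Fin n → Bool =>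
    ∏ t ∈ U, (spin (σ (i t)) * spin (σ (i (t + 1))))
  simp only [Function.Involutive.coe_toPerm, hflip, Finset.sum_neg_distrib] at this
  linarith

/-- The trace of a product of transfer matrices of the labels around a cycle. -/
lemma average_prod_cycle {k : ℕ} [NeZero k] (hk : 2 ≤ k) {i : ZMod k → Fin n}
    (hi : Function.Injective i) (a b : ZMod k → ℝ) :
    ((2 : ℝ) ^ n)⁻¹ * ∑ σ : Fin n → Bool, ∏ t, (a t + b t * (spin (σ (i t)) * spin (σ (i (t + 1)))))
      = ∏ t, a t + ∏ t, b t := by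
  classical
  have hcard : ∑ σ : Fin n → Bool, (1 : ℝ) = 2 ^ n := by simp
  simp only [Finset.prod_add]
  rw [Finset.sum_comm, Finset.sum_eq_add (Finset.univ : Finset (ZMod k)) (∅ : Finset (ZMod k))]
  · have hall : ∀ σ : Fin n → Bool,
        ∏ t : ZMod k, (spin (σ (i t)) * spin (σ (i (t + 1)))) = 1 := by
      intro σ
      have e := Equiv.prod_comp (Equiv.addRight (1 : ZMod k)) (fun t => spin (σ (i t)))
      simp only [Equiv.coe_addRight] at e
      rw [Finset.prod_mul_distrib, e, ← Finset.prod_mul_distrib]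
      exact Finset.prod_eq_one fun t _ => spin_mul_self _
    simp only [Finset.sdiff_self, Finset.prod_empty, mul_one, Finset.sdiff_empty, one_mul,
      Finset.prod_mul_distrib (f := b), hall]
    rw [Finset.sum_const, Finset.sum_const, Finset.card_univ, Fintype.card_fun, Fintype.card_bool,
      Fintype.card_fin]
    simp only [nsmul_eq_mul]
    push_cast
    field_simp
  · exact Finset.univ_nonempty.ne_empty
  · intro T _ hT
    have hz := sum_prod_spin_eq_zero (n := n) hk hi (U := Finset.univ \ T)
      (by rw [Finset.sdiff_nonempty]; exact fun h => hT.1 (Finset.univ_subset_iff.1 h))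
      (fun h => hT.2 (by
        rw [← Finset.compl_eq_univ_sdiff, Finset.compl_eq_univ_iff] at h
        exact h))
    simp only [Finset.prod_mul_distrib (f := b)]
    rw [← Finset.mul_sum, ← Finset.mul_sum, hz, mul_zero, mul_zero]
  · intro h; exact absurd (Finset.mem_powerset.2 (Finset.subset_univ _)) h
  · intro h; exact absurd (Finset.mem_powerset.2 (Finset.subset_univ _)) h

section
variable {d lam : Fin m → ℝ} {K : CycleType m} {E : Finset (Link m n p)}

/-- Averaging a product of factors `α + β σ_s σ_t` over the labels leaves two terms, the products of
the `α` and of the `β`, since in any other expansion term some label has odd degree. If there are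
covariate wedges, only one of the two terms survives, which one depending on whether the labels at
the ends of the covariate links are included. -/
lemma average_loop (hK : 2 ≤ size K) (hE : E ∈ loops m n p K) (α β : Fin m → ℝ) :
    (((2 : ℝ) ^ n)⁻¹ * ∑ σ : Fin n → Bool, (∏ x ∈ netSet E,
        (α x.1 + β x.1 * (spin (σ x.2.1.1) * spin (σ x.2.1.2))))
      = ∏ r, α r ^ K.1 r + (∏ r, β r ^ K.1 r) * 0 ^ K.2) ∧
    (((2 : ℝ) ^ n)⁻¹ * ∑ σ : Fin n → Bool, (∏ x ∈ netSet E,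
        (α x.1 + β x.1 * (spin (σ x.2.1.1) * spin (σ x.2.1.2)))) * ∏ q ∈ covSet E, spin (σ q.1)
      = (∏ r, α r ^ K.1 r) * 0 ^ K.2 + ∏ r, β r ^ K.1 r) := by
  have : NeZero (size K) := ⟨by omega⟩
  obtain ⟨i, f, h, rfl⟩ := (mem_loops hK).1 hE
  have key := fun a0 b0 : ℝ => average_prod_cycle (n := n) hK h.1.inj_var
    (fun t => Sum.elim (fun x : Fin m × Pair n => α x.1) (fun _ => a0) (f t))
    (fun t => Sum.elim (fun x : Fin m × Pair n => β x.1) (fun _ => b0) (f t))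
  simp only [h.prod_kind hK] at key
  constructor
  · have e := key 1 0
    rw [one_pow, mul_one] at e
    rw [← e]
    congr 1
    refine Finset.sum_congr rfl fun σ _ => ?_
    rw [h.1.prod_netSet]
    refine Finset.prod_congr rfl fun t _ => ?_
    rcases ht : f t with ⟨r, e⟩ | v
    · simp [h.1.pair_mul hK ht fun j => spin (σ j)]
    · simp
  · have e := key 0 1
    rw [one_pow, mul_one] at e
    rw [← e]
    congr 1
    refine Finset.sum_congr rfl fun σ _ => ?_
    rw [h.1.prod_netSet, h.1.prod_covSet hK, ← Finset.prod_mul_distrib]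
    refine Finset.prod_congr rfl fun t _ => ?_
    rcases ht : f t with ⟨r, e⟩ | v
    · simp [h.1.pair_mul hK ht fun j => spin (σ j)]
    · simp

/-- The probability that the network part of a cycle is present, and the mean of its product with
the labels of the covariate links. -/
lemma integral_edgeInd_loop (hd : ∀ j, 0 ≤ d j) (hl0 : ∀ j, 0 ≤ lam j)
    (hl : ∀ j, lam j ≤ √(d j)) (hn0 : 0 < n) (hn : ∀ j, 2 * d j ≤ n) (hK : 2 ≤ size K)
    (hE : E ∈ loops m n p K) :
    (∫ y, edgeInd (netSet E) y ∂(graphLaw m n d lam) =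
      (∏ r, d r ^ K.1 r + (∏ r, (lam r * √(d r)) ^ K.1 r) * 0 ^ K.2) / n ^ (∑ r, K.1 r)) ∧
    (∫ y, edgeInd (netSet E) y * ∏ q ∈ covSet E, spin (y.1 q.1) ∂(graphLaw m n d lam) =
      ((∏ r, d r ^ K.1 r) * 0 ^ K.2 + ∏ r, (lam r * √(d r)) ^ K.1 r) / n ^ (∑ r, K.1 r)) := by
  have h1 : ∀ σ : Fin n → Bool,
      ∏ x ∈ netSet E, (edgeProb n (d x.1) (lam x.1) (σ x.2.1.1) (σ x.2.1.2) : ℝ) =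
        (∏ x ∈ netSet E, (d x.1 + lam x.1 * √(d x.1) * (spin (σ x.2.1.1) * spin (σ x.2.1.2)))) /
          n ^ (∑ r, K.1 r) := by
    intro σ
    rw [← card_netSet hK hE, ← Finset.prod_const, ← Finset.prod_div_distrib]
    exact Finset.prod_congr rfl fun x _ => edgeProb_eq (hd _) (hl0 _) (hl _) hn0 (hn _) _ _
  obtain ⟨h2, h3⟩ := average_loop hK hE d (fun r => lam r * √(d r))
  constructor
  · have := integral_edgeInd_mul d lam (netSet E) (fun _ => 1)
    simp only [mul_one] at this
    rw [this, ← h2]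
    simp only [h1]
    rw [← Finset.sum_div, mul_div_assoc]
  · have := integral_edgeInd_mul d lam (netSet E) (fun σ => ∏ q ∈ covSet E, spin (σ q.1))
    rw [this, ← h3]
    simp only [h1, div_mul_eq_mul_div]
    rw [← Finset.sum_div, mul_div_assoc]

end

end CycleStat

namespace CycleStat

variable {m n p : ℕ}

/-! ### Sums over tuples of cycles that meet -/

/-- A bound for the Gaussian moments of order at most eight. -/
noncomputable def gaussBound : ℝ := ∫ x, (1 + x ^ 2) ^ 4 ∂(gaussianReal 0 1)

/-- The parameters are in the range where all the estimates hold, with a common scale `X`: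
cycles have size at most `k`, the parameters of the model and the number of letters that are
available for each step of a cycle are at most `X`, and `X ≤ n`. -/
structure IsScale (d lam : Fin m → ℝ) (mu : ℝ) (n p k : ℕ) (X : ℝ) : Prop where
  two_le : 2 ≤ X
  gauss_le : gaussBound ≤ X
  le_n : X ≤ n
  n_le : n ≤ X * p
  one_lt_d : ∀ j, 1 < d j
  d_le : ∀ j, 2 * d j ≤ X
  lam_nonneg : ∀ j, 0 ≤ lam j
  lam_le : ∀ j, lam j ≤ √(d j)
  mu_nonneg : 0 ≤ mu
  mu_le : mu ≤ X
  letters : m + (n + p) * (n : ℝ)⁻¹ + (8 * k : ℕ) ≤ X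

section
variable {d lam : Fin m → ℝ} {mu : ℝ} {k : ℕ} {X : ℝ}

lemma IsScale.one_le (h : IsScale d lam mu n p k X) : 1 ≤ X := by linarith [h.two_le]

lemma IsScale.n_pos (h : IsScale d lam mu n p k X) : 0 < n := by
  have : (0 : ℝ) < n := by linarith [h.one_le, h.le_n]
  exact_mod_cast this

lemma IsScale.p_pos (h : IsScale d lam mu n p k X) : 0 < p := by
  rcases Nat.eq_zero_or_pos p with hp | hp
  · have h1 := h.n_le
    have h2 : (0 : ℝ) < n := by exact_mod_cast h.n_pos
    rw [hp, Nat.cast_zero, mul_zero] at h1; linarith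
  · exact hp

lemma IsScale.inv_nonneg (_ : IsScale d lam mu n p k X) : 0 ≤ (n : ℝ)⁻¹ := by positivity

lemma IsScale.inv_le_one (h : IsScale d lam mu n p k X) : (n : ℝ)⁻¹ ≤ 1 := by
  have : (1 : ℝ) ≤ n := h.one_le.trans h.le_n
  exact inv_le_one_of_one_le₀ this

lemma IsScale.d_nonneg (h : IsScale d lam mu n p k X) (j : Fin m) : 0 ≤ d j := by
  linarith [h.one_lt_d j]

lemma IsScale.pow_le_pow (h : IsScale d lam mu n p k X) {a b : ℕ} (hab : a ≤ b) : X ^ a ≤ X ^ b :=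
  pow_le_pow_right₀ h.one_le hab

lemma IsScale.pos (h : IsScale d lam mu n p k X) : 0 < X := zero_lt_one.trans_le h.one_le

lemma IsScale.integral_edgeInd_mul_le (h : IsScale d lam mu n p k X)
    (T : Finset (Fin m × Pair n)) {g : (Fin n → Bool) → ℝ} {C : ℝ} (hC : ∀ σ, |g σ| ≤ C) :
    |∫ y, edgeInd T y * g y.1 ∂(graphLaw m n d lam)| ≤
      X ^ T.card * (n : ℝ)⁻¹ ^ T.card * C := by
  have := CycleStat.integral_edgeInd_mul_le h.d_nonneg h.lam_nonneg h.lam_le h.d_le h.n_pos h.le_n T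
    hC
  rwa [div_eq_mul_inv, mul_pow] at this

lemma IsScale.integral_edgeInd_le (h : IsScale d lam mu n p k X)
    (T : Finset (Fin m × Pair n)) :
    ∫ y, edgeInd T y ∂(graphLaw m n d lam) ≤ X ^ T.card * (n : ℝ)⁻¹ ^ T.card := by
  have := h.integral_edgeInd_mul_le T (g := fun _ => 1) (C := 1) (by simp)
  simp only [mul_one] at this
  exact (le_abs_self _).trans this

/-- The order of magnitude of the contribution of a union of cycles. -/
noncomputable def unionWeight (U : Finset (Link m n p)) : ℝ :=
  (n : ℝ)⁻¹ ^ ((netSet U).card + (covSet U).card)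

lemma unionWeight_nonneg (U : Finset (Link m n p)) : 0 ≤ unionWeight U := by
  unfold unionWeight; positivity

/-- Attaching a cycle to a given set of nodes costs only a power of the scale. -/
lemma IsScale.sum_supp_le (h : IsScale d lam mu n p k X) {K : CycleType m} (hK : 2 ≤ size K)
    (hk : size K ≤ k) (B : Finset (Fin n ⊕ Fin p)) (hB : B.card ≤ 6 * k) :
    ∑ E ∈ loops m n p K, (n : ℝ)⁻¹ ^ (B ∪ supp E).card ≤ (n : ℝ)⁻¹ ^ B.card * X ^ (2 * k) := by
  refine (sum_loops_le hK h.inv_nonneg B (M := 8 * k) (by omega)).trans ?_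
  refine mul_le_mul_of_nonneg_left ?_ (by positivity)
  exact (pow_le_pow_left₀ (by positivity) h.letters _).trans (h.pow_le_pow (by omega))

lemma IsScale.unionWeight_le (h : IsScale d lam mu n p k X) {U : Finset (Link m n p)}
    (hU : MinDegTwo U) : unionWeight U ≤ (n : ℝ)⁻¹ ^ (supp U).card :=
  pow_le_pow_of_le_one h.inv_nonneg h.inv_le_one hU.card_supp_le

/-- The extra factor `1 / n` for unions of cycles that meet without being equal, from which all the
estimates derive their smallness. -/
lemma IsScale.unionWeight_le' (h : IsScale d lam mu n p k X) {U E E' : Finset (Link m n p)}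
    (hU : MinDegTwo U) (hE : IsRing E) (hE' : IsRing E') (hEU : E ⊆ U) (hEU' : E' ⊆ U)
    (hne : E ≠ E') (hd : ¬ Disjoint (supp E) (supp E')) :
    unionWeight U ≤ (n : ℝ)⁻¹ * (n : ℝ)⁻¹ ^ (supp U).card := by
  rw [← pow_succ']
  exact pow_le_pow_of_le_one h.inv_nonneg h.inv_le_one
    (hU.card_supp_lt hE hE' hEU hEU' hne hd)

lemma IsScale.sum_unionWeight_le (h : IsScale d lam mu n p k X) {K : CycleType m}
    (hK : 2 ≤ size K) (hk : size K ≤ k) :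
    ∑ E ∈ loops m n p K, unionWeight E ≤ X ^ (2 * k) := by
  have := h.sum_supp_le hK hk ∅ (by simp)
  simp only [Finset.empty_union, Finset.card_empty, pow_zero, one_mul] at this
  exact (Finset.sum_le_sum fun E hE =>
    h.unionWeight_le (isRing_of_mem_loops hK hE).minDegTwo).trans this

lemma card_supp_union_le {E E' : Finset (Link m n p)} {a b : ℕ} (h : (supp E).card ≤ a)
    (h' : (supp E').card ≤ b) : (supp E ∪ supp E').card ≤ a + b :=
  (Finset.card_union_le _ _).trans (add_le_add h h')

open Classical in
/-- Pairs of distinct cycles that meet are rarer than pairs of cycles by a factor of `n`. -/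
lemma IsScale.sum_pair_le (h : IsScale d lam mu n p k X) {K K' : CycleType m}
    (hK : 2 ≤ size K) (hk : size K ≤ k) (hK' : 2 ≤ size K') (hk' : size K' ≤ k) :
    ∑ E ∈ loops m n p K, ∑ E' ∈ loops m n p K',
      (if E ≠ E' ∧ ¬ Disjoint (supp E) (supp E') then unionWeight (E ∪ E') else 0) ≤
      (n : ℝ)⁻¹ * X ^ (4 * k) := by
  calc _ ≤ ∑ E ∈ loops m n p K, ∑ E' ∈ loops m n p K',
        (n : ℝ)⁻¹ * (n : ℝ)⁻¹ ^ (supp E ∪ supp E').card := by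
        refine Finset.sum_le_sum fun E hE => Finset.sum_le_sum fun E' hE' => ?_
        have r := isRing_of_mem_loops hK hE
        have r' := isRing_of_mem_loops hK' hE'
        split_ifs with hc
        · rw [← supp_union]
          exact h.unionWeight_le' (r.minDegTwo.union r'.minDegTwo) r r' Finset.subset_union_left
            Finset.subset_union_right hc.1 hc.2
        · positivity
    _ ≤ ∑ E ∈ loops m n p K, (n : ℝ)⁻¹ * ((n : ℝ)⁻¹ ^ (supp E).card * X ^ (2 * k)) := by
        refine Finset.sum_le_sum fun E hE => ?_
        rw [← Finset.mul_sum]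
        refine mul_le_mul_of_nonneg_left (h.sum_supp_le hK' hk' _ ?_) h.inv_nonneg
        have := card_supp_le hK hE
        omega
    _ ≤ (n : ℝ)⁻¹ * (X ^ (2 * k) * X ^ (2 * k)) := by
        rw [← Finset.mul_sum, ← Finset.sum_mul]
        have := h.sum_supp_le hK hk ∅ (by simp)
        simp only [Finset.empty_union, Finset.card_empty, pow_zero, one_mul] at this
        have := h.pos
        gcongr
    _ = _ := by rw [← pow_add]; congr 2; omega

open Classical in
/-- Quadruples of cycles of which the first two are distinct and meet. -/
lemma IsScale.sum_quadruple_le (h : IsScale d lam mu n p k X) {K K' : CycleType m}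
    (hK : 2 ≤ size K) (hk : size K ≤ k) (hK' : 2 ≤ size K') (hk' : size K' ≤ k) :
    ∑ E₁ ∈ loops m n p K, ∑ E₂ ∈ loops m n p K', ∑ E₃ ∈ loops m n p K, ∑ E₄ ∈ loops m n p K',
      (if E₁ ≠ E₂ ∧ ¬ Disjoint (supp E₁) (supp E₂) then unionWeight (E₁ ∪ E₂ ∪ E₃ ∪ E₄) else 0) ≤
      (n : ℝ)⁻¹ * X ^ (8 * k) := by
  have hX := h.pos
  have e8 : X ^ (8 * k) = X ^ (2 * k) * X ^ (2 * k) * X ^ (2 * k) * X ^ (2 * k) := by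
    rw [← pow_add, ← pow_add, ← pow_add]; congr 1; omega
  calc _ ≤ ∑ E₁ ∈ loops m n p K, ∑ E₂ ∈ loops m n p K', ∑ E₃ ∈ loops m n p K,
        ∑ E₄ ∈ loops m n p K',
        (n : ℝ)⁻¹ * (n : ℝ)⁻¹ ^ (supp E₁ ∪ supp E₂ ∪ supp E₃ ∪ supp E₄).card := by
        refine Finset.sum_le_sum fun E₁ h₁ => Finset.sum_le_sum fun E₂ h₂ =>
          Finset.sum_le_sum fun E₃ h₃ => Finset.sum_le_sum fun E₄ h₄ => ?_
        have r₁ := isRing_of_mem_loops hK h₁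
        have r₂ := isRing_of_mem_loops hK' h₂
        have r₃ := (isRing_of_mem_loops hK h₃).minDegTwo
        have r₄ := (isRing_of_mem_loops hK' h₄).minDegTwo
        split_ifs with hc
        · rw [← supp_union, ← supp_union, ← supp_union]
          refine h.unionWeight_le' (((r₁.minDegTwo.union r₂.minDegTwo).union r₃).union r₄) r₁ r₂
            ?_ ?_ hc.1 hc.2 <;> intro x hx <;> simp [hx]
        · positivity
    _ ≤ ∑ E₁ ∈ loops m n p K, ∑ E₂ ∈ loops m n p K', ∑ E₃ ∈ loops m n p K,
        (n : ℝ)⁻¹ * ((n : ℝ)⁻¹ ^ (supp E₁ ∪ supp E₂ ∪ supp E₃).card * X ^ (2 * k)) := by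
        refine Finset.sum_le_sum fun E₁ h₁ => Finset.sum_le_sum fun E₂ h₂ =>
          Finset.sum_le_sum fun E₃ h₃ => ?_
        rw [← Finset.mul_sum]
        refine mul_le_mul_of_nonneg_left (h.sum_supp_le hK' hk' _ ?_) h.inv_nonneg
        have a := card_supp_union_le (card_supp_le hK h₁) (card_supp_le hK' h₂)
        have b := Finset.card_union_le (supp E₁ ∪ supp E₂) (supp E₃)
        have c := card_supp_le hK h₃
        omega
    _ ≤ ∑ E₁ ∈ loops m n p K, ∑ E₂ ∈ loops m n p K',
        (n : ℝ)⁻¹ * (((n : ℝ)⁻¹ ^ (supp E₁ ∪ supp E₂).card * X ^ (2 * k)) * X ^ (2 * k)) := by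
        refine Finset.sum_le_sum fun E₁ h₁ => Finset.sum_le_sum fun E₂ h₂ => ?_
        rw [← Finset.mul_sum, ← Finset.sum_mul]
        refine mul_le_mul_of_nonneg_left (mul_le_mul_of_nonneg_right
          (h.sum_supp_le hK hk _ ?_) (by positivity)) h.inv_nonneg
        have a := card_supp_union_le (card_supp_le hK h₁) (card_supp_le hK' h₂)
        omega
    _ ≤ ∑ E₁ ∈ loops m n p K, (n : ℝ)⁻¹ *
        ((((n : ℝ)⁻¹ ^ (supp E₁).card * X ^ (2 * k)) * X ^ (2 * k)) * X ^ (2 * k)) := by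
        refine Finset.sum_le_sum fun E₁ h₁ => ?_
        rw [← Finset.mul_sum, ← Finset.sum_mul, ← Finset.sum_mul]
        refine mul_le_mul_of_nonneg_left (mul_le_mul_of_nonneg_right (mul_le_mul_of_nonneg_right
          (h.sum_supp_le hK' hk' _ ?_) (by positivity)) (by positivity)) h.inv_nonneg
        have a := card_supp_le hK h₁
        omega
    _ ≤ _ := by
        rw [e8, ← Finset.mul_sum, ← Finset.sum_mul, ← Finset.sum_mul, ← Finset.sum_mul]
        have := h.sum_supp_le hK hk ∅ (by simp)
        simp only [Finset.empty_union, Finset.card_empty, pow_zero, one_mul] at this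
        gcongr

open Classical in
/-- A sum over pairs of cycles that meet, in which the diagonal terms are smaller than their
`unionWeight` by a factor of `n`. -/
lemma IsScale.sum_meet_le (h : IsScale d lam mu n p k X) {K K' : CycleType m}
    (hK : 2 ≤ size K) (hk : size K ≤ k) (hK' : 2 ≤ size K') (hk' : size K' ≤ k)
    {a : Finset (Link m n p) → Finset (Link m n p) → ℝ} {A : ℝ} (hA : 0 ≤ A)
    (h1 : ∀ E ∈ loops m n p K, E ∈ loops m n p K' →
      a E E ≤ A * ((n : ℝ)⁻¹ * unionWeight E))
    (h2 : ∀ E ∈ loops m n p K, ∀ E' ∈ loops m n p K', E ≠ E' → ¬ Disjoint (supp E) (supp E') →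
      a E E' ≤ A * unionWeight (E ∪ E')) :
    ∑ E ∈ loops m n p K, ∑ E' ∈ loops m n p K',
      (if ¬ Disjoint (supp E) (supp E') then a E E' else 0) ≤
      2 * A * ((n : ℝ)⁻¹ * X ^ (4 * k)) := by
  calc _ ≤ ∑ E ∈ loops m n p K, ∑ E' ∈ loops m n p K',
        ((if E = E' then A * ((n : ℝ)⁻¹ * unionWeight E) else 0) + A *
          (if E ≠ E' ∧ ¬ Disjoint (supp E) (supp E') then unionWeight (E ∪ E') else 0)) := by
        refine Finset.sum_le_sum fun E hE => Finset.sum_le_sum fun E' hE' => ?_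
        have u := unionWeight_nonneg (E ∪ E')
        have u' := unionWeight_nonneg E
        by_cases he : E = E'
        · subst he
          simp only [ne_eq, not_true_eq_false, false_and, if_false, if_true, mul_zero, add_zero]
          split_ifs
          · positivity
          · exact h1 E hE hE'
        · by_cases hd : Disjoint (supp E) (supp E')
          · simp [he, hd]
          · simpa [he, hd] using h2 E hE E' hE' he hd
    _ ≤ A * ((n : ℝ)⁻¹ * X ^ (2 * k)) + A * ((n : ℝ)⁻¹ * X ^ (4 * k)) := by
        simp only [Finset.sum_add_distrib, ← Finset.mul_sum]
        refine add_le_add ?_ (mul_le_mul_of_nonneg_left (h.sum_pair_le hK hk hK' hk') hA)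
        have : ∀ E ∈ loops m n p K, (∑ E' ∈ loops m n p K',
            if E = E' then A * ((n : ℝ)⁻¹ * unionWeight E) else 0) ≤
            A * ((n : ℝ)⁻¹ * unionWeight E) := by
          intro E hE
          have u' := unionWeight_nonneg E
          rw [Finset.sum_ite_eq]
          split_ifs
          · exact le_rfl
          · positivity
        refine (Finset.sum_le_sum this).trans ?_
        rw [← Finset.mul_sum, ← Finset.mul_sum]
        have := h.sum_unionWeight_le hK hk
        gcongr
    _ ≤ _ := by
        have := h.pow_le_pow (show 2 * k ≤ 4 * k by omega)
        have : A * ((n : ℝ)⁻¹ * X ^ (2 * k)) ≤ A * ((n : ℝ)⁻¹ * X ^ (4 * k)) := by gcongr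
        linarith

end

/-- The second moment method for a sum of nonnegatively correlated-in-mean variables: variables
which are not related are uncorrelated. -/
lemma integral_sq_sum_sub_le {Ω τ : Type*} [MeasurableSpace Ω] {P : Measure Ω}
    [IsProbabilityMeasure P] (S : Finset τ) (Z : τ → Ω → ℝ) (μ : τ → ℝ) (c : ℝ)
    (rel : τ → τ → Prop) [DecidableRel rel]
    (hZ : ∀ s ∈ S, Integrable (Z s) P)
    (hZZ : ∀ s ∈ S, ∀ t ∈ S, Integrable (fun x => Z s x * Z t x) P)
    (hμ : ∀ s ∈ S, ∫ x, Z s x ∂P = μ s) (hμ0 : ∀ s ∈ S, 0 ≤ μ s)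
    (hrel : ∀ s ∈ S, ∀ t ∈ S, ¬ rel s t → ∫ x, Z s x * Z t x ∂P = μ s * μ t) :
    ∫ x, (∑ s ∈ S, Z s x - c) ^ 2 ∂P ≤ (∑ s ∈ S, μ s - c) ^ 2 +
      ∑ s ∈ S, ∑ t ∈ S, if rel s t then |∫ x, Z s x * Z t x ∂P| else 0 := by
  have e : ∀ x, (∑ s ∈ S, Z s x - c) ^ 2 =
      (∑ s ∈ S, ∑ t ∈ S, Z s x * Z t x) - 2 * c * ∑ s ∈ S, Z s x + c ^ 2 := by
    intro x
    rw [← Finset.sum_mul_sum]; ring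
  have i1 : Integrable (fun x => ∑ s ∈ S, ∑ t ∈ S, Z s x * Z t x) P :=
    integrable_finsetSum _ fun s hs => integrable_finsetSum _ fun t ht => hZZ s hs t ht
  have i2 : Integrable (fun x => 2 * c * ∑ s ∈ S, Z s x) P :=
    (integrable_finsetSum _ fun s hs => hZ s hs).const_mul _
  have i5 : Integrable (fun x => (∑ s ∈ S, ∑ t ∈ S, Z s x * Z t x) - 2 * c * ∑ s ∈ S, Z s x) P :=
    i1.sub i2
  simp only [e]
  rw [integral_add i5 (integrable_const _), integral_sub i1 i2, integral_const_mul,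
    integral_finsetSum _ hZ, integral_finsetSum _ fun s hs =>
      integrable_finsetSum _ fun t ht => hZZ s hs t ht, Finset.sum_congr rfl hμ]
  have i3 : ∑ s ∈ S, ∫ x, ∑ t ∈ S, Z s x * Z t x ∂P =
      ∑ s ∈ S, ∑ t ∈ S, ∫ x, Z s x * Z t x ∂P :=
    Finset.sum_congr rfl fun s hs => integral_finsetSum _ fun t ht => hZZ s hs t ht
  rw [i3]
  have i4 : ∑ s ∈ S, ∑ t ∈ S, ∫ x, Z s x * Z t x ∂P ≤ ∑ s ∈ S, ∑ t ∈ S, (μ s * μ t +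
      if rel s t then |∫ x, Z s x * Z t x ∂P| else 0) := by
    refine Finset.sum_le_sum fun s hs => Finset.sum_le_sum fun t ht => ?_
    split_ifs with hr
    · have := mul_nonneg (hμ0 s hs) (hμ0 t ht)
      linarith [le_abs_self (∫ x, Z s x * Z t x ∂P)]
    · rw [hrel s hs t ht hr, add_zero]
  simp only [Finset.sum_add_distrib, ← Finset.sum_mul_sum] at i4
  simp only [integral_const, probReal_univ, smul_eq_mul, one_mul]
  nlinarith [i4]

end CycleStat

namespace CycleStat

/-! ### Gaussian integration by parts for multi-affine functions -/

section
variable {κ : Type*} [DecidableEq κ]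

/-- The slope of a function that is affine in the coordinate `e`. -/
def slope (P : (κ → ℝ) → ℝ) (e : κ) (x : κ → ℝ) : ℝ :=
  P (Function.update x e 1) - P (Function.update x e 0)

/-- Functions that are affine in each coordinate. -/
def MultiAffine (P : (κ → ℝ) → ℝ) : Prop :=
  ∀ x e s, P (Function.update x e s) = P (Function.update x e 0) + s * slope P e x

lemma slope_update (P : (κ → ℝ) → ℝ) (e : κ) (x : κ → ℝ) (s : ℝ) :
    slope P e (Function.update x e s) = slope P e x := by
  simp [slope]

lemma MultiAffine.hasDerivAt {P : (κ → ℝ) → ℝ} (h : MultiAffine P) (x : κ → ℝ) (e : κ) (s : ℝ) :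
    HasDerivAt (fun s => P (Function.update x e s)) (slope P e x) s := by
  have : (fun s => P (Function.update x e s)) =
      fun s => P (Function.update x e 0) + s * slope P e x := funext fun s => h x e s
  rw [this]
  simpa using ((hasDerivAt_id s).mul_const (slope P e x)).const_add (P (Function.update x e 0))

lemma measurable_update_pair {α : Type*} [MeasurableSpace α] (e : κ) :
    Measurable fun q : (κ → α) × α => Function.update q.1 e q.2 := by
  refine measurable_pi_lambda _ fun i => ?_
  by_cases hi : i = e
  · subst hi; simpa using measurable_snd
  · simp only [Function.update_of_ne hi]
    exact (measurable_pi_apply i).comp measurable_fst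

lemma MultiAffine.combination {Z P : (κ → ℝ) → ℝ} (hZ : MultiAffine Z) (hP : MultiAffine P)
    (y a b : ℝ) : MultiAffine (fun x => y + a * Z x + b * P x) := by
  intro x e s
  simp only [slope]
  rw [hZ x e s, hP x e s]
  simp only [slope]
  ring

lemma slope_combination (Z P : (κ → ℝ) → ℝ) (y a b : ℝ) (e : κ) (x : κ → ℝ) :
    slope (fun x => y + a * Z x + b * P x) e x = a * slope Z e x + b * slope P e x := by
  simp only [slope]; ring

end

section
variable {κ : Type*} [Fintype κ] [DecidableEq κ]

/-- Resampling one coordinate of a vector with independent coordinates. -/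
lemma map_update_pi {α : Type*} [MeasurableSpace α] (μ μ' : κ → Measure α)
    [∀ i, IsProbabilityMeasure (μ i)] [∀ i, IsProbabilityMeasure (μ' i)] (e : κ)
    (h : ∀ i, i ≠ e → μ' i = μ i) :
    ((Measure.pi μ').prod (μ e)).map (fun q => Function.update q.1 e q.2) = Measure.pi μ := by
  have hm := measurable_update_pair (α := α) e
  refine (Measure.pi_eq fun s hs => ?_).symm
  rw [Measure.map_apply hm (MeasurableSet.univ_pi hs)]
  have : (fun q : (κ → α) × α => Function.update q.1 e q.2) ⁻¹' (Set.univ.pi s) =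
      (Set.univ.pi (Function.update s e Set.univ)) ×ˢ s e := by
    ext q
    simp only [Set.mem_preimage, Set.mem_univ_pi, Set.mem_prod]
    constructor
    · intro hq
      refine ⟨fun i => ?_, by simpa using hq e⟩
      by_cases hi : i = e
      · subst hi; simp
      · simpa [hi] using hq i
    · rintro ⟨hq, hq'⟩ i
      by_cases hi : i = e
      · subst hi; simpa using hq'
      · simpa [hi] using hq i
  rw [this, Measure.prod_prod, Measure.pi_pi, ← Finset.prod_erase_mul _ _ (Finset.mem_univ e),
    ← Finset.prod_erase_mul (a := e) _ (fun i => (μ i) (s i)) (Finset.mem_univ e)]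
  simp only [Function.update_self, measure_univ, mul_one]
  congr 1
  refine Finset.prod_congr rfl fun i hi => ?_
  have hi' := (Finset.mem_erase.1 hi).1
  rw [Function.update_of_ne hi', h i hi']

lemma integral_update_pi {α : Type*} [MeasurableSpace α] (μ μ' : κ → Measure α)
    [∀ i, IsProbabilityMeasure (μ i)] [∀ i, IsProbabilityMeasure (μ' i)] (e : κ)
    (h : ∀ i, i ≠ e → μ' i = μ i) {f : (κ → α) → ℝ} (hf : Integrable f (Measure.pi μ)) :
    ∫ x, f x ∂(Measure.pi μ) = ∫ x, ∫ s, f (Function.update x e s) ∂(μ e) ∂(Measure.pi μ') := by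
  have hm := measurable_update_pair (α := α) e
  have hf' := hf
  rw [← map_update_pi μ μ' e h] at hf' ⊢
  rw [integral_map hm.aemeasurable hf'.1, integral_prod]
  exact (integrable_map_measure hf'.1 hm.aemeasurable).1 hf'

/-- Gaussian integration by parts on the line. -/
lemma integral_id_mul_gaussian {h h' : ℝ → ℝ} (hd : ∀ s, HasDerivAt h (h' s) s) {C C' : ℝ}
    (hC : ∀ s, |h s| ≤ C) (hC' : ∀ s, |h' s| ≤ C') :
    ∫ s, s * h s ∂(gaussianReal 0 1) = ∫ s, h' s ∂(gaussianReal 0 1) := by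
  have hv : (1 : ℝ≥0) ≠ 0 := one_ne_zero
  rw [integral_gaussianReal_eq_integral_smul hv, integral_gaussianReal_eq_integral_smul hv]
  have hder : ∀ s, HasDerivAt (gaussianPDFReal 0 1) (-(s * gaussianPDFReal 0 1 s)) s := by
    intro s
    rw [gaussianPDFReal_def]
    have h1 : HasDerivAt (fun x : ℝ => -(x - 0) ^ 2 / (2 * ((1 : ℝ≥0) : ℝ))) (-s) s := by
      have := (((hasDerivAt_id s).sub_const 0).pow 2).neg.div_const (2 * ((1 : ℝ≥0) : ℝ))
      refine this.congr_deriv ?_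
      simp; ring
    refine (h1.exp.const_mul _).congr_deriv ?_
    simp; ring
  have hcont : Continuous h := continuous_iff_continuousAt.2 fun s => (hd s).continuousAt
  have hmeas' : Measurable h' := by
    have : h' = deriv h := funext fun s => (hd s).deriv.symm
    rw [this]; exact measurable_deriv h
  have i0 := integrable_gaussianPDFReal 0 1
  have i1 : Integrable (fun s : ℝ => s * gaussianPDFReal 0 1 s) := by
    have h1 := (memLp_id_gaussianReal (μ := 0) (v := 1) 1).integrable (by simp)
    rw [gaussianReal_of_var_ne_zero _ hv, integrable_withDensity_iff (measurable_gaussianPDF _ _)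
      (ae_of_all _ fun _ => gaussianPDF_lt_top)] at h1
    simpa [gaussianPDF, ENNReal.toReal_ofReal (gaussianPDFReal_nonneg 0 1 _)] using h1
  have key := integral_mul_deriv_eq_deriv_mul_of_integrable (u := h) (u' := h')
    (v := gaussianPDFReal 0 1) (v' := fun s => -(s * gaussianPDFReal 0 1 s))
    (fun x _ => hd x) (fun x _ => hder x)
    (i1.neg.bdd_mul hcont.aestronglyMeasurable (ae_of_all _ hC))
    (i0.bdd_mul hmeas'.aestronglyMeasurable (ae_of_all _ hC'))
    (i0.bdd_mul hcont.aestronglyMeasurable (ae_of_all _ hC))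
  have e1 : ∀ s, gaussianPDFReal 0 1 s • (s * h s) = -(h s * -(s * gaussianPDFReal 0 1 s)) :=
    fun s => by rw [smul_eq_mul]; ring
  have e2 : ∀ s, gaussianPDFReal 0 1 s • h' s = h' s * gaussianPDFReal 0 1 s :=
    fun s => by rw [smul_eq_mul]; ring
  simp only [e1, e2]
  rw [integral_neg, key, neg_neg]

variable (κ) in
/-- The standard Gaussian law on `κ → ℝ`. -/
noncomputable abbrev gaussPi : Measure (κ → ℝ) := Measure.pi fun _ => gaussianReal 0 1

/-- Gaussian integration by parts in one coordinate. -/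
lemma integral_mul_coord (e : κ) {a g g' : (κ → ℝ) → ℝ}
    (ha : ∀ x s, a (Function.update x e s) = a x)
    (hd : ∀ x s, HasDerivAt (fun s => g (Function.update x e s)) (g' (Function.update x e s)) s)
    {C : ℝ} (hC : ∀ x, |g x| ≤ C) (hC' : ∀ x, ∃ C', ∀ s, |g' (Function.update x e s)| ≤ C')
    (h1 : Integrable (fun x => x e * a x * g x) (gaussPi κ))
    (h2 : Integrable (fun x => a x * g' x) (gaussPi κ)) :
    ∫ x, x e * a x * g x ∂(gaussPi κ) = ∫ x, a x * g' x ∂(gaussPi κ) := by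
  rw [integral_update_pi _ _ e (fun _ _ => rfl) h1, integral_update_pi _ _ e (fun _ _ => rfl) h2]
  congr 1; funext x
  obtain ⟨C', hC'⟩ := hC' x
  simp only [ha, Function.update_self]
  have e1 : ∀ s, s * a x * g (Function.update x e s) = a x * (s * g (Function.update x e s)) :=
    fun s => by ring
  simp only [e1]
  rw [integral_const_mul, integral_const_mul,
    integral_id_mul_gaussian (hd x) (fun s => hC _) hC']

end

/-- A function of finitely many real variables with bounded continuous derivatives up to order
two; `f1` and `f2` are its partial derivatives. -/
structure SmoothTest (J : Type*) [Fintype J] (C : ℝ) where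
  /-- The function. -/
  f : (J → ℝ) → ℝ
  /-- The first partial derivatives. -/
  f1 : J → (J → ℝ) → ℝ
  /-- The second partial derivatives. -/
  f2 : J → J → (J → ℝ) → ℝ
  hasFDerivAt : ∀ y, HasFDerivAt f
    (∑ i, f1 i y • (ContinuousLinearMap.proj i : (J → ℝ) →L[ℝ] ℝ)) y
  hasFDerivAt1 : ∀ i y, HasFDerivAt (f1 i)
    (∑ j, f2 i j y • (ContinuousLinearMap.proj j : (J → ℝ) →L[ℝ] ℝ)) y
  continuous2 : ∀ i j, Continuous (f2 i j)
  bound : ∀ y, |f y| ≤ C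
  bound1 : ∀ i y, |f1 i y| ≤ C
  bound2 : ∀ i j y, |f2 i j y| ≤ C

section
variable {J : Type*} [Fintype J] {C : ℝ} (G : SmoothTest J C)

lemma SmoothTest.continuous : Continuous G.f :=
  continuous_iff_continuousAt.2 fun y => (G.hasFDerivAt y).continuousAt

lemma SmoothTest.continuous1 (i : J) : Continuous (G.f1 i) :=
  continuous_iff_continuousAt.2 fun y => (G.hasFDerivAt1 i y).continuousAt

variable {κ : Type*} [Fintype κ] [DecidableEq κ]

/-- Integration by parts for the product of a homogeneous multi-affine function `P` of degree `q`
and a function of multi-affine functions. -/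
lemma SmoothTest.integral_euler {P : (κ → ℝ) → ℝ} {q : ℝ}
    (hE : ∀ x, q * P x = ∑ e, x e * slope P e x)
    (hP2 : ∀ e, MemLp (slope P e) 2 (gaussPi κ)) {H : J → (κ → ℝ) → ℝ}
    (hH : ∀ j, MultiAffine (H j)) (hHm : ∀ j, Measurable (H j))
    (hH2 : ∀ j e, MemLp (slope (H j) e) 2 (gaussPi κ)) (i : J) :
    q * ∫ x, P x * G.f1 i (fun j => H j x) ∂(gaussPi κ) = ∑ j, ∫ x,
      G.f2 i j (fun j => H j x) * ∑ e, slope P e x * slope (H j) e x ∂(gaussPi κ) := by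
  have hHm' : Measurable fun x => fun j => H j x := measurable_pi_lambda _ hHm
  have hm1 : AEStronglyMeasurable (fun x => G.f1 i fun j => H j x) (gaussPi κ) :=
    ((G.continuous1 i).measurable.comp hHm').aestronglyMeasurable
  have hm2 : ∀ j, AEStronglyMeasurable (fun x => G.f2 i j fun j => H j x) (gaussPi κ) :=
    fun j => ((G.continuous2 i j).measurable.comp hHm').aestronglyMeasurable
  have hx : ∀ e : κ, MemLp (fun x : κ → ℝ => x e) 2 (gaussPi κ) := fun e =>
    (memLp_id_gaussianReal (μ := 0) (v := 1) 2).comp_measurePreserving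
      (measurePreserving_eval (fun _ : κ => gaussianReal 0 1) e)
  have i1 : ∀ e, Integrable (fun x => x e * slope P e x * G.f1 i (fun j => H j x)) (gaussPi κ) :=
    fun e => ((hx e).integrable_mul (hP2 e)).mul_bdd hm1 (ae_of_all _ fun x => G.bound1 i _)
  have i2 : ∀ e j, Integrable
      (fun x => slope P e x * (G.f2 i j (fun j => H j x) * slope (H j) e x)) (gaussPi κ) := by
    intro e j
    have := ((hP2 e).integrable_mul (hH2 j e)).bdd_mul (hm2 j)
      (ae_of_all _ fun x => G.bound2 i j _)
    refine this.congr (ae_of_all _ fun x => ?_)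
    simp only [Pi.mul_apply]; ring
  rw [← integral_const_mul]
  have e0 : ∀ x, q * (P x * G.f1 i fun j => H j x) =
      ∑ e, x e * slope P e x * G.f1 i (fun j => H j x) := by
    intro x; rw [← mul_assoc, hE, Finset.sum_mul]
  simp only [e0]
  have e3 : ∀ j, ∫ x, G.f2 i j (fun j => H j x) * ∑ e, slope P e x * slope (H j) e x ∂(gaussPi κ) =
      ∑ e, ∫ x, slope P e x * (G.f2 i j (fun j => H j x) * slope (H j) e x) ∂(gaussPi κ) := by
    intro j
    rw [← integral_finsetSum _ fun e _ => i2 e j]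
    congr 1; funext x
    rw [Finset.mul_sum]
    exact Finset.sum_congr rfl fun e _ => by ring
  simp only [e3]
  rw [integral_finsetSum _ fun e _ => i1 e, Finset.sum_comm]
  refine Finset.sum_congr rfl fun e _ => ?_
  rw [integral_mul_coord e (a := slope P e) (g := fun x => G.f1 i fun j => H j x)
    (g' := fun x => ∑ j, G.f2 i j (fun j => H j x) * slope (H j) e x)
    (fun x s => slope_update P e x s) ?_ (fun x => G.bound1 i _) ?_ (i1 e) ?_]
  · rw [← integral_finsetSum _ fun j _ => i2 e j]
    simp only [Finset.mul_sum]
  · intro x s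
    have h1 : HasDerivAt (fun s => fun j => H j (Function.update x e s))
        (fun j => slope (H j) e x) s := hasDerivAt_pi.2 fun j => (hH j).hasDerivAt x e s
    have h2 := (G.hasFDerivAt1 i _).comp_hasDerivAt s h1
    refine h2.congr_deriv ?_
    simp [slope_update]
  · intro x
    refine ⟨∑ j, C * |slope (H j) e x|, fun s => ?_⟩
    refine (Finset.abs_sum_le_sum_abs _ _).trans (Finset.sum_le_sum fun j _ => ?_)
    rw [abs_mul, slope_update]
    exact mul_le_mul_of_nonneg_right (G.bound2 i j _) (abs_nonneg _)
  · simp only [Finset.mul_sum]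
    exact integrable_finsetSum _ fun j _ => i2 e j

/-- Homogeneous multi-affine functions `P` of independent Gaussians are compared to homogeneous
ones `Z` of degree one in other coordinates along the path `cos θ Z + sin θ P`. The error is
governed by the fluctuation of the matrix of the inner products of the gradients of `P`. -/
lemma SmoothTest.abs_sub_le_of_gradients (hC : 0 ≤ C) (y : J → ℝ) {Z P : J → (κ → ℝ) → ℝ}
    {q : J → ℝ} (hq : ∀ i, q i ≠ 0) {c : J → J → ℝ}
    (hZ : ∀ i, MultiAffine (Z i)) (hP : ∀ i, MultiAffine (P i))
    (hZE : ∀ i x, Z i x = ∑ e, x e * slope (Z i) e x)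
    (hPE : ∀ i x, q i * P i x = ∑ e, x e * slope (P i) e x)
    (hZm : ∀ i, Measurable (Z i)) (hPm : ∀ i, Measurable (P i))
    (hZi : ∀ i, Integrable (Z i) (gaussPi κ)) (hPi : ∀ i, Integrable (P i) (gaussPi κ))
    (hZ2 : ∀ i e, MemLp (slope (Z i) e) 2 (gaussPi κ))
    (hP2 : ∀ i e, MemLp (slope (P i) e) 2 (gaussPi κ))
    (horth : ∀ i j x, ∑ e, slope (Z i) e x * slope (P j) e x = 0)
    (hcov : ∀ i j x, ∑ e, slope (Z i) e x * slope (Z j) e x = c i j) :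
    |∫ x, G.f (fun j => y j + P j x) ∂(gaussPi κ) - ∫ x, G.f (fun j => y j + Z j x) ∂(gaussPi κ)| ≤
      2 * C * ∑ i, ∑ j, ∫ x, |(q i)⁻¹ * ∑ e, slope (P i) e x * slope (P j) e x - c i j|
        ∂(gaussPi κ) := by
  set H : ℝ → J → (κ → ℝ) → ℝ := fun θ j x => y j + Real.cos θ * Z j x + Real.sin θ * P j x
    with hHdef
  have hHaff : ∀ θ j, MultiAffine (H θ j) := fun θ j => (hZ j).combination (hP j) _ _ _
  have hHm : ∀ θ j, Measurable (H θ j) := fun θ j =>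
    (((hZm j).const_mul _).const_add _).add ((hPm j).const_mul _)
  have hHs : ∀ θ j e x, slope (H θ j) e x =
      Real.cos θ * slope (Z j) e x + Real.sin θ * slope (P j) e x :=
    fun θ j e x => slope_combination _ _ _ _ _ _ _
  have hH2 : ∀ θ j e, MemLp (slope (H θ j) e) 2 (gaussPi κ) := by
    intro θ j e
    have : slope (H θ j) e = fun x => Real.cos θ * slope (Z j) e x + Real.sin θ * slope (P j) e x :=
      funext fun x => hHs θ j e x
    rw [this]
    exact ((hZ2 j e).const_mul _).add ((hP2 j e).const_mul _)
  have hHm' : ∀ θ, Measurable fun x => fun j => H θ j x := fun θ => measurable_pi_lambda _ (hHm θ)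
  have hm0 : ∀ θ, AEStronglyMeasurable (fun x => G.f fun j => H θ j x) (gaussPi κ) :=
    fun θ => (G.continuous.measurable.comp (hHm' θ)).aestronglyMeasurable
  have hm1 : ∀ θ i, AEStronglyMeasurable (fun x => G.f1 i fun j => H θ j x) (gaussPi κ) :=
    fun θ i => ((G.continuous1 i).measurable.comp (hHm' θ)).aestronglyMeasurable
  have hm2 : ∀ θ i j, AEStronglyMeasurable (fun x => G.f2 i j fun j => H θ j x) (gaussPi κ) :=
    fun θ i j => ((G.continuous2 i j).measurable.comp (hHm' θ)).aestronglyMeasurable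
  set Γ : J → J → (κ → ℝ) → ℝ := fun i j x => (q i)⁻¹ * ∑ e, slope (P i) e x * slope (P j) e x
    with hΓdef
  have hΓi : ∀ i j, Integrable (fun x => Γ i j x - c i j) (gaussPi κ) := fun i j =>
    ((integrable_finsetSum _ fun e _ => (hP2 i e).integrable_mul (hP2 j e)).const_mul _).sub
      (integrable_const _)
  have hΓc : ∀ θ i j, Integrable (fun x => G.f2 i j (fun j => H θ j x) * Γ i j x) (gaussPi κ) :=
    fun θ i j => ((integrable_finsetSum _ fun e _ =>
      (hP2 i e).integrable_mul (hP2 j e)).const_mul _).bdd_mul (hm2 θ i j)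
      (ae_of_all _ fun x => G.bound2 i j _)
  have h2i : ∀ θ i j, Integrable (fun x => G.f2 i j (fun j => H θ j x)) (gaussPi κ) :=
    fun θ i j => Integrable.of_bound (hm2 θ i j) C (ae_of_all _ fun x => G.bound2 i j _)
  -- the derivative along the path
  have hder : ∀ θ, HasDerivAt (fun θ => ∫ x, G.f (fun j => H θ j x) ∂(gaussPi κ))
      (∫ x, ∑ i, G.f1 i (fun j => H θ j x) * (-Real.sin θ * Z i x + Real.cos θ * P i x)
        ∂(gaussPi κ)) θ := by
    intro θ
    refine (hasDerivAt_integral_of_dominated_loc_of_deriv_le (s := Set.univ)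
      (F := fun θ x => G.f fun j => H θ j x)
      (F' := fun θ x => ∑ i, G.f1 i (fun j => H θ j x) * (-Real.sin θ * Z i x + Real.cos θ * P i x))
      (bound := fun x => ∑ i, C * (|Z i x| + |P i x|)) Filter.univ_mem
      (Eventually.of_forall hm0)
      (Integrable.of_bound (hm0 θ) C (ae_of_all _ fun x => G.bound _)) ?_ ?_ ?_ ?_).2
    · have hmm : ∀ i, AEStronglyMeasurable (fun x => G.f1 i (fun j => H θ j x) *
          (-Real.sin θ * Z i x + Real.cos θ * P i x)) (gaussPi κ) := fun i =>
        (hm1 θ i).mul (((hZm i).const_mul _).add ((hPm i).const_mul _)).aestronglyMeasurable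
      exact Finset.aestronglyMeasurable_fun_sum _ fun i _ => hmm i
    · refine ae_of_all _ fun x θ _ => ?_
      refine (Finset.abs_sum_le_sum_abs _ _).trans (Finset.sum_le_sum fun i _ => ?_)
      rw [abs_mul]
      refine mul_le_mul (G.bound1 i _) ((abs_add_le _ _).trans ?_) (abs_nonneg _) hC
      rw [abs_mul, abs_mul, abs_neg]
      exact add_le_add (mul_le_of_le_one_left (abs_nonneg _) (Real.abs_sin_le_one _))
        (mul_le_of_le_one_left (abs_nonneg _) (Real.abs_cos_le_one _))
    · exact integrable_finsetSum _ fun i _ => ((hZi i).abs.add (hPi i).abs).const_mul _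
    · refine ae_of_all _ fun x θ _ => ?_
      have h1 : HasDerivAt (fun θ => fun j => H θ j x)
          (fun j => -Real.sin θ * Z j x + Real.cos θ * P j x) θ := by
        refine hasDerivAt_pi.2 fun j => ?_
        have := (((Real.hasDerivAt_cos θ).mul_const (Z j x)).const_add (y j)).add
          ((Real.hasDerivAt_sin θ).mul_const (P j x))
        exact this
      have h2 := (G.hasFDerivAt _).comp_hasDerivAt θ h1
      refine h2.congr_deriv ?_
      simp
  -- integration by parts
  have hval : ∀ θ, ∫ x, ∑ i, G.f1 i (fun j => H θ j x) *
      (-Real.sin θ * Z i x + Real.cos θ * P i x) ∂(gaussPi κ) = Real.sin θ * Real.cos θ *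
      ∑ i, ∑ j, ∫ x, G.f2 i j (fun j => H θ j x) * (Γ i j x - c i j) ∂(gaussPi κ) := by
    intro θ
    have iZ : ∀ i, Integrable (fun x => Z i x * G.f1 i (fun j => H θ j x)) (gaussPi κ) := fun i =>
      (hZi i).mul_bdd (hm1 θ i) (ae_of_all _ fun x => G.bound1 i _)
    have iP : ∀ i, Integrable (fun x => P i x * G.f1 i (fun j => H θ j x)) (gaussPi κ) := fun i =>
      (hPi i).mul_bdd (hm1 θ i) (ae_of_all _ fun x => G.bound1 i _)
    have e1 : ∀ i x, G.f1 i (fun j => H θ j x) * (-Real.sin θ * Z i x + Real.cos θ * P i x) =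
        -Real.sin θ * (Z i x * G.f1 i (fun j => H θ j x)) +
          Real.cos θ * (P i x * G.f1 i (fun j => H θ j x)) := fun i x => by ring
    simp only [e1]
    have i6 : ∀ i, Integrable (fun x => -Real.sin θ * (Z i x * G.f1 i (fun j => H θ j x)) +
          Real.cos θ * (P i x * G.f1 i (fun j => H θ j x))) (gaussPi κ) := fun i =>
      ((iZ i).const_mul _).add ((iP i).const_mul _)
    rw [integral_finsetSum _ fun i _ => i6 i, Finset.mul_sum]
    refine Finset.sum_congr rfl fun i _ => ?_
    rw [integral_add ((iZ i).const_mul _) ((iP i).const_mul _), integral_const_mul,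
      integral_const_mul]
    have kZ := G.integral_euler (q := 1) (fun x => by rw [one_mul]; exact hZE i x) (hZ2 i)
      (hHaff θ) (hHm θ) (hH2 θ) i
    have kP := G.integral_euler (hPE i) (hP2 i) (hHaff θ) (hHm θ) (hH2 θ) i
    have sZ : ∀ j x, ∑ e, slope (Z i) e x * slope (H θ j) e x = Real.cos θ * c i j := by
      intro j x
      have : ∀ e, slope (Z i) e x * slope (H θ j) e x =
          Real.cos θ * (slope (Z i) e x * slope (Z j) e x) +
          Real.sin θ * (slope (Z i) e x * slope (P j) e x) := fun e => by rw [hHs]; ring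
      simp only [this]
      rw [Finset.sum_add_distrib, ← Finset.mul_sum, ← Finset.mul_sum, hcov, horth]
      ring
    have sP : ∀ j x, ∑ e, slope (P i) e x * slope (H θ j) e x =
        Real.sin θ * (q i * Γ i j x) := by
      intro j x
      have : ∀ e, slope (P i) e x * slope (H θ j) e x =
          Real.cos θ * (slope (Z j) e x * slope (P i) e x) +
          Real.sin θ * (slope (P i) e x * slope (P j) e x) := fun e => by rw [hHs]; ring
      simp only [this]
      rw [Finset.sum_add_distrib, ← Finset.mul_sum, ← Finset.mul_sum, horth, hΓdef,
        mul_inv_cancel_left₀ (hq i)]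
      ring
    simp only [sZ, sP, one_mul] at kZ kP
    have kP' : ∫ x, P i x * G.f1 i (fun j => H θ j x) ∂(gaussPi κ) =
        Real.sin θ * ∑ j, ∫ x, G.f2 i j (fun j => H θ j x) * Γ i j x ∂(gaussPi κ) := by
      refine mul_left_cancel₀ (hq i) ?_
      rw [kP, ← mul_assoc, Finset.mul_sum]
      refine Finset.sum_congr rfl fun j _ => ?_
      rw [← integral_const_mul]
      congr 1; funext x; ring
    rw [kZ, kP', Finset.mul_sum, Finset.mul_sum, Finset.mul_sum, Finset.mul_sum,
      ← Finset.sum_add_distrib]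
    refine Finset.sum_congr rfl fun j _ => ?_
    have e5 : ∀ x, G.f2 i j (fun j => H θ j x) * (Γ i j x - c i j) =
        G.f2 i j (fun j => H θ j x) * Γ i j x - G.f2 i j (fun j => H θ j x) * c i j :=
      fun x => by ring
    simp only [e5]
    rw [integral_sub (hΓc θ i j) ((h2i θ i j).mul_const _), integral_mul_const,
      integral_mul_const]
    ring
  have hbound : ∀ θ, |Real.sin θ * Real.cos θ *
      ∑ i, ∑ j, ∫ x, G.f2 i j (fun j => H θ j x) * (Γ i j x - c i j) ∂(gaussPi κ)| ≤
      C * ∑ i, ∑ j, ∫ x, |Γ i j x - c i j| ∂(gaussPi κ) := by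
    intro θ
    rw [abs_mul, abs_mul]
    have s1 : |Real.sin θ| * |Real.cos θ| ≤ 1 :=
      mul_le_one₀ (Real.abs_sin_le_one _) (abs_nonneg _) (Real.abs_cos_le_one _)
    refine (mul_le_of_le_one_left (abs_nonneg _) s1).trans ?_
    rw [Finset.mul_sum]
    refine (Finset.abs_sum_le_sum_abs _ _).trans (Finset.sum_le_sum fun i _ => ?_)
    rw [Finset.mul_sum]
    refine (Finset.abs_sum_le_sum_abs _ _).trans (Finset.sum_le_sum fun j _ => ?_)
    rw [← integral_const_mul]
    refine (abs_integral_le_integral_abs).trans (integral_mono_of_nonneg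
      (ae_of_all _ fun x => abs_nonneg _) ((hΓi i j).abs.const_mul _) (ae_of_all _ fun x => ?_))
    simp only [abs_mul]
    exact mul_le_mul_of_nonneg_right (G.bound2 i j _) (abs_nonneg _)
  have hfin := Convex.norm_image_sub_le_of_norm_hasDerivWithin_le (s := Set.univ)
    (fun θ _ => (hder θ).hasDerivWithinAt)
    (C := C * ∑ i, ∑ j, ∫ x, |Γ i j x - c i j| ∂(gaussPi κ))
    (fun θ _ => by rw [hval θ]; exact hbound θ) convex_univ
    (Set.mem_univ (0 : ℝ)) (Set.mem_univ (Real.pi / 2))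
  have e0 : ∀ j x, H 0 j x = y j + Z j x := fun j x => by simp [hHdef]
  have e1 : ∀ j x, H (Real.pi / 2) j x = y j + P j x := fun j x => by simp [hHdef]
  simp only [e0, e1, sub_zero, Real.norm_eq_abs] at hfin
  refine hfin.trans ?_
  have hnn : 0 ≤ C * ∑ i, ∑ j, ∫ x, |Γ i j x - c i j| ∂(gaussPi κ) :=
    mul_nonneg hC (Finset.sum_nonneg fun i _ => Finset.sum_nonneg fun j _ =>
      integral_nonneg fun x => abs_nonneg _)
  have hpi : |Real.pi / 2| ≤ 2 := by
    rw [abs_of_nonneg (by positivity)]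
    linarith [Real.pi_le_four]
  nlinarith [mul_le_mul_of_nonneg_left hpi hnn]

end

end CycleStat

namespace CycleStat

/-! ### Smoothing of test functions -/

section
variable {r : ℕ}

lemma abs_convolution_le {F g : (Fin r → ℝ) → ℝ} (hF : ∀ y, |F y| ≤ 1)
    (hg : HasCompactSupport g) (hgc : Continuous g) (x : Fin r → ℝ) :
    |(convolution F g (ContinuousLinearMap.lsmul ℝ ℝ) volume) x| ≤ ∫ t, |g t| := by
  rw [convolution_eq_swap]
  have hi : Integrable g volume := hgc.integrable_of_hasCompactSupport hg
  rw [← Real.norm_eq_abs]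
  refine norm_integral_le_of_norm_le (f := fun t => ContinuousLinearMap.lsmul ℝ ℝ (F (x - t)) (g t))
    hi.abs
    (ae_of_all _ fun t => ?_)
  simp only [ContinuousLinearMap.lsmul_apply, smul_eq_mul, Real.norm_eq_abs, abs_mul]
  exact mul_le_of_le_one_left (abs_nonneg _) (hF _)

/-- The `i`-th partial derivative. -/
noncomputable def partialDeriv (g : (Fin r → ℝ) → ℝ) (i : Fin r) (y : Fin r → ℝ) : ℝ :=
  fderiv ℝ g y (Pi.single i 1)

lemma HasCompactSupport.partialDeriv {g : (Fin r → ℝ) → ℝ} (hg : HasCompactSupport g) (i : Fin r) :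
    HasCompactSupport (partialDeriv g i) :=
  (hg.fderiv ℝ).comp_left (g := fun L : (Fin r → ℝ) →L[ℝ] ℝ => L (Pi.single i 1)) (by simp)

lemma contDiff_partialDeriv {g : (Fin r → ℝ) → ℝ} {k : ℕ} (hg : ContDiff ℝ (k + 1 : ℕ) g)
    (i : Fin r) : ContDiff ℝ (k : ℕ) (partialDeriv g i) := by
  have : ContDiff ℝ (k : ℕ) (fderiv ℝ g) := hg.fderiv_right (by norm_cast)
  exact this.clm_apply contDiff_const

lemma hasFDerivAt_convolution_partialDeriv {F g : (Fin r → ℝ) → ℝ} (hF : Continuous F)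
    (hg : HasCompactSupport g) (hgd : ContDiff ℝ 1 g) (y : Fin r → ℝ) :
    HasFDerivAt (convolution F g (ContinuousLinearMap.lsmul ℝ ℝ) volume)
      (∑ i, convolution F (partialDeriv g i) (ContinuousLinearMap.lsmul ℝ ℝ) volume y •
        (ContinuousLinearMap.proj i : (Fin r → ℝ) →L[ℝ] ℝ)) y := by
  have h := hg.hasFDerivAt_convolution_right (ContinuousLinearMap.lsmul ℝ ℝ)
    (hF.locallyIntegrable (μ := volume)) hgd y
  refine h.congr_fderiv ?_
  refine ContinuousLinearMap.ext fun v => ?_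
  have hv : v = ∑ i, v i • (Pi.single i 1 : Fin r → ℝ) := by
    ext j; simp [Finset.sum_apply, Pi.single_apply]
  conv_lhs => rw [hv]
  rw [map_sum]
  simp only [map_smul, sum_apply, smul_apply,
    ContinuousLinearMap.proj_apply]
  refine Finset.sum_congr rfl fun i _ => ?_
  rw [convolution_precompR_apply _ (hF.locallyIntegrable) (hg.fderiv ℝ)
    (hgd.continuous_fderiv (by norm_num)), smul_eq_mul, smul_eq_mul, mul_comm]
  rfl

/-- Bounded Lipschitz functions are uniformly close to functions with two derivatives that are
bounded in terms of the distance. -/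
lemma exists_smoothTest (r : ℕ) {ε : ℝ} (hε : 0 < ε) : ∃ C : ℝ, 0 ≤ C ∧
    ∀ F : (Fin r → ℝ) → ℝ, LipschitzWith 1 F → (∀ y, |F y| ≤ 1) →
      ∃ G : SmoothTest (Fin r) C, ∀ y, |F y - G.f y| ≤ ε := by
  let b : ContDiffBump (0 : Fin r → ℝ) := ⟨ε / 2, ε, by positivity, by linarith⟩
  let g : (Fin r → ℝ) → ℝ := b.normed volume
  have hg : HasCompactSupport g := b.hasCompactSupport_normed
  have hgd : ContDiff ℝ (2 : ℕ) g := b.contDiff_normed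
  have hgd1 : ∀ i, ContDiff ℝ (1 : ℕ) (partialDeriv g i) := fun i => contDiff_partialDeriv hgd i
  have hgd2 : ∀ i j, Continuous (partialDeriv (partialDeriv g i) j) := fun i j =>
    (contDiff_partialDeriv (k := 0) (hgd1 i) j).continuous
  have hg1 := fun i => HasCompactSupport.partialDeriv hg i
  have hg2 := fun i j => HasCompactSupport.partialDeriv (hg1 i) j
  have n0 : 0 ≤ ∫ t, |g t| := integral_nonneg fun t => abs_nonneg _
  have n1 : ∀ i, 0 ≤ ∫ t, |partialDeriv g i t| := fun i => integral_nonneg fun t => abs_nonneg _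
  have n2 : ∀ i j, 0 ≤ ∫ t, |partialDeriv (partialDeriv g i) j t| :=
    fun i j => integral_nonneg fun t => abs_nonneg _
  have n1' : 0 ≤ ∑ i, ∫ t, |partialDeriv g i t| := Finset.sum_nonneg fun i _ => n1 i
  have n2' : 0 ≤ ∑ i, ∑ j, ∫ t, |partialDeriv (partialDeriv g i) j t| :=
    Finset.sum_nonneg fun i _ => Finset.sum_nonneg fun j _ => n2 i j
  refine ⟨(∫ t, |g t|) + (∑ i, ∫ t, |partialDeriv g i t|) +
    ∑ i, ∑ j, ∫ t, |partialDeriv (partialDeriv g i) j t|, by positivity, fun F hF hF1 => ?_⟩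
  have hFc := hF.continuous
  refine ⟨⟨convolution F g (ContinuousLinearMap.lsmul ℝ ℝ) volume,
    fun i => convolution F (partialDeriv g i) (ContinuousLinearMap.lsmul ℝ ℝ) volume,
    fun i j => convolution F (partialDeriv (partialDeriv g i) j)
      (ContinuousLinearMap.lsmul ℝ ℝ) volume,
    fun y => hasFDerivAt_convolution_partialDeriv hFc hg (hgd.of_le (by norm_num)) y,
    fun i y => hasFDerivAt_convolution_partialDeriv hFc (hg1 i) (hgd1 i) y,
    fun i j => (hg2 i j).continuous_convolution_right _ hFc.locallyIntegrable (hgd2 i j),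
    fun y => (abs_convolution_le hF1 hg hgd.continuous y).trans (by linarith),
    fun i y => (abs_convolution_le hF1 (hg1 i) (hgd1 i).continuous y).trans ?_,
    fun i j y => (abs_convolution_le hF1 (hg2 i j) (hgd2 i j) y).trans ?_⟩, fun y => ?_⟩
  · have := Finset.single_le_sum (fun i _ => n1 i) (Finset.mem_univ i)
    linarith
  · have h1 := Finset.single_le_sum (fun j _ => n2 i j) (Finset.mem_univ j)
    have h2 := Finset.single_le_sum (f := fun i => ∑ j, ∫ t, |partialDeriv (partialDeriv g i) j t|)
      (fun i _ => Finset.sum_nonneg fun j _ => n2 i j) (Finset.mem_univ i)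
    linarith
  · have h0 : ∀ x ∈ Metric.ball y b.rOut, dist (F x) (F y) ≤ ε := by
      intro x hx
      have := hF.dist_le_mul x y
      rw [NNReal.coe_one, one_mul] at this
      exact this.trans (Metric.mem_ball.1 hx).le
    have h1 := ContDiffBump.dist_normed_convolution_le (μ := volume)
      hFc.aestronglyMeasurable h0
    rw [dist_comm, Real.dist_eq] at h1
    have e : convolution F g (ContinuousLinearMap.lsmul ℝ ℝ) volume y =
        convolution (b.normed volume) F (ContinuousLinearMap.lsmul ℝ ℝ) volume y := by
      rw [convolution_eq_swap, convolution_def]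
      congr 1; funext t
      simp [g, mul_comm]
    show |F y - convolution F g (ContinuousLinearMap.lsmul ℝ ℝ) volume y| ≤ ε
    rw [e]; exact h1

end

end CycleStat

namespace CycleStat

/-! ### Poisson approximation by replacement of the summands -/

lemma abs_integral_le_of_abs_le {Ω : Type*} [MeasurableSpace Ω] {P : Measure Ω} {f g : Ω → ℝ}
    (hg : Integrable g P) (h : ∀ x, |f x| ≤ g x) : |∫ x, f x ∂P| ≤ ∫ x, g x ∂P :=
  norm_integral_le_of_norm_le (f := f) hg (ae_of_all _ h)

lemma abs_integral_le_const {Ω : Type*} [MeasurableSpace Ω] {P : Measure Ω}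
    [IsProbabilityMeasure P] {f : Ω → ℝ} {C : ℝ} (h : ∀ x, |f x| ≤ C) : |∫ x, f x ∂P| ≤ C := by
  simpa using norm_integral_le_of_norm_le_const (μ := P) (f := f) (ae_of_all _ h)

/-- First order bounds for the exponential function at negative arguments. -/
lemma one_sub_le_exp_neg_le {a : ℝ} (ha : 0 ≤ a) :
    1 - a ≤ Real.exp (-a) ∧ Real.exp (-a) ≤ 1 - a + a ^ 2 := by
  have h1 := Real.add_one_le_exp (-a)
  have h2 := Real.add_one_le_exp a
  refine ⟨by linarith, ?_⟩
  have h3 : Real.exp (-a) * Real.exp a = 1 := by rw [← Real.exp_add]; simp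
  have h4 := Real.exp_pos (-a)
  have h5 : Real.exp (-a) * (1 + a) ≤ 1 := by nlinarith
  have h6 : Real.exp (-a) * (1 + a) ≤ (1 - a + a ^ 2) * (1 + a) := by nlinarith [pow_nonneg ha 3]
  exact le_of_mul_le_mul_right h6 (by linarith)

/-- A Poisson variable of small mean is close to a Bernoulli variable. -/
lemma abs_integral_poissonReal_le {a : ℝ} (ha : 0 ≤ a) {g : ℝ → ℝ} (hg : Measurable g)
    (hg1 : ∀ s, |g s| ≤ 1) :
    |∫ s, g s ∂(poissonReal a) - (g 0 + a * (g 1 - g 0))| ≤ 4 * a ^ 2 := by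
  rw [poissonReal, integral_map .of_discrete hg.aestronglyMeasurable]
  set P := poissonMeasure a.toNNReal
  have hP : ∀ k : ℕ, P.real {k} = Real.exp (-a) * a ^ k / k ! := fun k => by
    rw [poissonMeasure_real_singleton, Real.coe_toNNReal _ ha]
  have hI : ∀ k : ℕ, ∫ N, Set.indicator {k} (1 : ℕ → ℝ) N ∂P = P.real {k} := fun k =>
    integral_indicator_one (measurableSet_singleton k)
  have iI : ∀ k : ℕ, Integrable (Set.indicator {k} (1 : ℕ → ℝ)) P := fun k =>
    (integrable_const (1 : ℝ)).indicator (measurableSet_singleton k)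
  have ig : Integrable (fun N : ℕ => g N) P := Integrable.of_bound
    Measurable.of_discrete.aestronglyMeasurable 1 (ae_of_all _ fun N => hg1 N)
  set rest : ℕ → ℝ := fun N => g N - g 0 - (g 1 - g 0) * Set.indicator {1} (1 : ℕ → ℝ) N
  have irest : Integrable rest P := (ig.sub (integrable_const _)).sub ((iI 1).const_mul _)
  have e1 : ∫ N : ℕ, g N ∂P = ∫ N, rest N ∂P + (g 0 + (g 1 - g 0) * P.real {1}) := by
    have e2 : ∫ N, rest N ∂P = ∫ N : ℕ, g N ∂P - g 0 - (g 1 - g 0) * P.real {1} := by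
      have h1 : Integrable (fun N : ℕ => g N - g 0) P := ig.sub (integrable_const _)
      simp only [rest]
      rw [integral_sub h1 ((iI 1).const_mul _), integral_sub ig (integrable_const _),
        integral_const_mul, hI 1]
      simp
    rw [e2]; ring
  have hrest : ∀ N, |rest N| ≤
      2 * (1 - Set.indicator {0} (1 : ℕ → ℝ) N - Set.indicator {1} (1 : ℕ → ℝ) N) := by
    intro N
    rcases N with _ | _ | N
    · simp [rest]
    · simp [rest]
    · have h0 := abs_le.1 (hg1 ((N + 1 + 1 : ℕ) : ℝ))
      have h1 := abs_le.1 (hg1 0)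
      simp [rest, abs_le] at h0 h1 ⊢
      constructor <;> linarith
  have hrest' : |∫ N, rest N ∂P| ≤ 2 * (1 - P.real {0} - P.real {1}) := by
    have h1 : Integrable (fun N : ℕ => 1 - Set.indicator {0} (1 : ℕ → ℝ) N) P :=
      (integrable_const _).sub (iI 0)
    have h2 : Integrable (fun N : ℕ => 2 * (1 - Set.indicator {0} (1 : ℕ → ℝ) N -
        Set.indicator {1} (1 : ℕ → ℝ) N)) P := (h1.sub (iI 1)).const_mul 2
    have := abs_integral_le_of_abs_le h2 hrest
    rw [integral_const_mul, integral_sub h1 (iI 1), integral_sub (integrable_const _) (iI 0), hI,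
      hI] at this
    simpa using this
  have hP0 := hP 0
  have hP1 := hP 1
  simp at hP0 hP1
  obtain ⟨b1, b2⟩ := one_sub_le_exp_neg_le ha
  rw [hP0, hP1] at hrest'
  rw [hP1] at e1
  have b3 : |g 1 - g 0| ≤ 2 := by
    have h0 := abs_le.1 (hg1 0)
    have h1 := abs_le.1 (hg1 1)
    rw [abs_le]; constructor <;> linarith
  have b4 : |(g 1 - g 0) * (Real.exp (-a) * a - a)| ≤ 2 * a ^ 2 := by
    have h5 : Real.exp (-a) ≤ 1 := Real.exp_le_one_iff.2 (by linarith)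
    rw [abs_mul]
    refine mul_le_mul b3 ?_ (abs_nonneg _) zero_le_two
    rw [abs_le]; constructor <;> nlinarith
  have e3 : ∫ N : ℕ, g N ∂P - (g 0 + a * (g 1 - g 0)) =
      ∫ N, rest N ∂P + (g 1 - g 0) * (Real.exp (-a) * a - a) := by rw [e1]; ring
  rw [e3]
  refine (abs_add_le _ _).trans ?_
  have b5 : 2 * (1 - Real.exp (-a) - Real.exp (-a) * a) ≤ 2 * a ^ 2 := by nlinarith
  linarith

lemma poissonReal_conv {a b : ℝ} (ha : 0 ≤ a) (hb : 0 ≤ b) :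
    (poissonReal a).conv (poissonReal b) = poissonReal (a + b) := by
  unfold poissonReal
  rw [map_cast_poissonMeasure_conv, Real.toNNReal_add ha hb]

section
variable {r : ℕ}

/-- Adding an independent variable to one coordinate of a vector with independent coordinates. -/
lemma integral_add_single_pi (μ : Fin r → Measure ℝ) [∀ i, IsProbabilityMeasure (μ i)] (e : Fin r)
    (ν : Measure ℝ) [IsProbabilityMeasure ν] (μ' : Fin r → Measure ℝ)
    [∀ i, IsProbabilityMeasure (μ' i)] (he : μ' e = (μ e).conv ν) (hne : ∀ i, i ≠ e → μ i = μ' i)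
    {f : (Fin r → ℝ) → ℝ} (hf : Measurable f) {C : ℝ} (hC : ∀ y, |f y| ≤ C) :
    ∫ y, f y ∂(Measure.pi μ') = ∫ y, ∫ s, f (y + Pi.single e s) ∂ν ∂(Measure.pi μ) := by
  have hsingle : Measurable fun s : ℝ => (Pi.single e s : Fin r → ℝ) :=
    (measurable_update' (a := e)).comp (measurable_const.prodMk measurable_id)
  have hm : Measurable fun q : (Fin r → ℝ) × ℝ => f (q.1 + Pi.single e q.2) :=
    hf.comp (measurable_fst.add (hsingle.comp measurable_snd))
  have hg : StronglyMeasurable fun (y : Fin r → ℝ) => ∫ s, f (y + (Pi.single e s : Fin r → ℝ)) ∂ν :=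
    StronglyMeasurable.integral_prod_right' (ν := ν) (f := fun q : (Fin r → ℝ) × ℝ =>
      f (q.1 + Pi.single e q.2)) hm.stronglyMeasurable
  have hgb : ∀ y, |∫ s, f (y + (Pi.single e s : Fin r → ℝ)) ∂ν| ≤ C := fun y =>
    abs_integral_le_const fun s => hC _
  rw [integral_update_pi μ' μ e hne (Integrable.of_bound hf.aestronglyMeasurable C
      (ae_of_all _ hC)), integral_update_pi μ μ e (fun _ _ => rfl)
      (Integrable.of_bound hg.aestronglyMeasurable C (ae_of_all _ hgb))]
  congr 1; funext y
  rw [he]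
  have hfy : Measurable fun s => f (Function.update y e s) := hf.comp (measurable_update y)
  rw [integral_conv (Integrable.of_bound hfy.aestronglyMeasurable C (ae_of_all _ fun s => hC _))]
  congr 1; funext s; congr 1; funext s'; congr 1
  ext i
  by_cases hi : i = e
  · subst hi; simp
  · simp [hi]

variable {Ω τ : Type*} [MeasurableSpace Ω] [Finite Ω] [MeasurableSingletonClass Ω]
  {P : Measure Ω} [IsProbabilityMeasure P]

/-- The vector of the sums of the `X t` over the `t` of each class. -/
def classSum (c : τ → Fin r) (X : τ → Ω → ℝ) (A : Finset τ) (x : Ω) : Fin r → ℝ :=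
  ∑ t ∈ A, Pi.single (c t) (X t x)

/-- Replacing one indicator by a Poisson variable of the same mean. -/
lemma abs_replace_le {c : τ → Fin r} {X : τ → Ω → ℝ} (hX : ∀ t x, X t x = 0 ∨ X t x = 1)
    (rel : τ → τ → Prop) [DecidableRel rel] (A : Finset τ) (t : τ)
    (hind : ∀ h : (Fin r → ℝ) → ℝ,
      ∫ x, X t x * h (classSum c X (A.filter fun s => ¬ rel t s) x) ∂P =
        (∫ x, X t x ∂P) * ∫ x, h (classSum c X (A.filter fun s => ¬ rel t s) x) ∂P)
    {F : (Fin r → ℝ) → ℝ} (hF : Measurable F) (hF1 : ∀ y, |F y| ≤ 1) :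
    |∫ x, F (classSum c X A x + Pi.single (c t) (X t x)) ∂P -
      ∫ x, ∫ s, F (classSum c X A x + Pi.single (c t) s) ∂(poissonReal (∫ x, X t x ∂P)) ∂P| ≤
    4 * (∫ x, X t x ∂P) ^ 2 + 4 * ∑ s ∈ A.filter (rel t),
      (∫ x, X t x * X s x ∂P + (∫ x, X t x ∂P) * ∫ x, X s x ∂P) := by
  set a := ∫ x, X t x ∂P with ha
  have hX0 : ∀ t x, 0 ≤ X t x := fun t x => by rcases hX t x with h | h <;> simp [h]
  have ha0 : 0 ≤ a := integral_nonneg fun x => hX0 t x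
  have int : ∀ f : Ω → ℝ, Integrable f P := fun f => Integrable.of_finite
  set D : (Fin r → ℝ) → ℝ := fun y => F (y + Pi.single (c t) 1) - F y with hD
  have hD2 : ∀ y, |D y| ≤ 2 := fun y => by
    refine (abs_sub _ _).trans ?_
    linarith [hF1 (y + Pi.single (c t) 1), hF1 y]
  set W : Ω → Fin r → ℝ := classSum c X A with hW
  set V : Ω → Fin r → ℝ := classSum c X (A.filter fun s => ¬ rel t s) with hV
  have hDVW : ∀ x, |D (W x) - D (V x)| ≤ 4 * ∑ s ∈ A.filter (rel t), X s x := by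
    intro x
    by_cases h0 : ∀ s ∈ A.filter (rel t), X s x = 0
    · have : W x = V x := by
        simp only [hW, hV, classSum]
        rw [← Finset.sum_filter_add_sum_filter_not A (rel t)]
        rw [Finset.sum_eq_zero, zero_add]
        intro s hs; rw [h0 s hs, Pi.single_zero]
      rw [this, sub_self, abs_zero]
      exact mul_nonneg (by norm_num) (Finset.sum_nonneg fun s _ => hX0 s x)
    · push Not at h0
      obtain ⟨s, hs, hs0⟩ := h0
      have h1 : X s x = 1 := (hX s x).resolve_left hs0
      have h2 := Finset.single_le_sum (f := fun s => X s x) (fun s _ => hX0 s x) hs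
      refine (abs_sub _ _).trans ?_
      linarith [hD2 (W x), hD2 (V x)]
  have e1 : ∫ x, F (W x + Pi.single (c t) (X t x)) ∂P =
      ∫ x, F (W x) ∂P + ∫ x, X t x * D (W x) ∂P := by
    rw [← integral_add (int _) (int _)]
    congr 1; funext x
    rcases hX t x with h | h <;> simp [h, hD]
  have e2 : ∫ x, X t x * D (W x) ∂P - a * ∫ x, D (W x) ∂P =
      ∫ x, X t x * (D (W x) - D (V x)) ∂P - a * ∫ x, (D (W x) - D (V x)) ∂P := by
    have h1 : ∫ x, X t x * (D (W x) - D (V x)) ∂P =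
        ∫ x, X t x * D (W x) ∂P - ∫ x, X t x * D (V x) ∂P := by
      rw [← integral_sub (int _) (int _)]
      simp only [mul_sub]
    have h2 : ∫ x, (D (W x) - D (V x)) ∂P = ∫ x, D (W x) ∂P - ∫ x, D (V x) ∂P :=
      integral_sub (int _) (int _)
    rw [h1, h2, hind D]
    ring
  have b1 : |∫ x, X t x * (D (W x) - D (V x)) ∂P| ≤
      4 * ∑ s ∈ A.filter (rel t), ∫ x, X t x * X s x ∂P := by
    rw [← integral_finsetSum _ fun s _ => int _, ← integral_const_mul]
    refine abs_integral_le_of_abs_le (int _) fun x => ?_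
    rw [abs_mul, abs_of_nonneg (hX0 t x), ← Finset.mul_sum]
    have := mul_le_mul_of_nonneg_left (hDVW x) (hX0 t x)
    linarith
  have b2 : |a * ∫ x, (D (W x) - D (V x)) ∂P| ≤
      4 * ∑ s ∈ A.filter (rel t), a * ∫ x, X s x ∂P := by
    rw [abs_mul, abs_of_nonneg ha0, ← Finset.mul_sum, ← integral_finsetSum _ fun s _ => int _]
    have : |∫ x, (D (W x) - D (V x)) ∂P| ≤ 4 * ∫ x, ∑ s ∈ A.filter (rel t), X s x ∂P := by
      rw [← integral_const_mul]
      exact abs_integral_le_of_abs_le (int _) hDVW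
    have := mul_le_mul_of_nonneg_left this ha0
    linarith
  have hs : Measurable fun s : ℝ => (Pi.single (c t) s : Fin r → ℝ) :=
    (measurable_update' (a := c t)).comp (measurable_const.prodMk measurable_id)
  have b3 : |∫ x, (∫ s, F (W x + Pi.single (c t) s) ∂(poissonReal a) - (F (W x) + a * D (W x))) ∂P|
      ≤ 4 * a ^ 2 := by
    refine abs_integral_le_const fun x => ?_
    have := abs_integral_poissonReal_le ha0 (g := fun s => F (W x + Pi.single (c t) s))
      (hF.comp (measurable_const.add hs)) (fun s => hF1 _)
    simpa [hD] using this
  rw [integral_sub (int _) (int _), integral_add (int _) (int _), integral_const_mul] at b3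
  rw [Finset.sum_add_distrib, e1]
  have e3 : ∀ i1 i2 i3 i4 i5 : ℝ, i1 + i2 - i3 = -(i3 - (i1 + i4)) + (i2 - i4) := by
    intros; ring
  rw [e3 _ _ _ (a * ∫ x, D (W x) ∂P) 0, e2]
  refine (abs_add_le _ _).trans ?_
  rw [abs_neg]
  have := abs_sub (∫ x, X t x * (D (W x) - D (V x)) ∂P) (a * ∫ x, (D (W x) - D (V x)) ∂P)
  linarith

/-- A vector of sums of indicators, with an independent vector added, is compared to a vector of
independent Poisson variables, with the same vector added. Here `law a i` is the law of the `i`-th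
coordinate of the latter when the mean of the Poisson variable is `a i`. -/
lemma abs_classSum_sub_le [DecidableEq τ] {c : τ → Fin r} {X : τ → Ω → ℝ}
    (hX : ∀ t x, X t x = 0 ∨ X t x = 1) (rel : τ → τ → Prop) [DecidableRel rel] (S : Finset τ)
    (hind : ∀ t ∈ S, ∀ B ⊆ S, (∀ s ∈ B, ¬ rel t s) → ∀ h : (Fin r → ℝ) → ℝ,
      ∫ x, X t x * h (classSum c X B x) ∂P =
        (∫ x, X t x ∂P) * ∫ x, h (classSum c X B x) ∂P)
    (law : ℝ → Fin r → Measure ℝ) [∀ a i, IsProbabilityMeasure (law a i)]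
    (hlaw : ∀ t ∈ S, ∀ a, law a (c t) = poissonReal a)
    {F : (Fin r → ℝ) → ℝ} (hF : Measurable F) (hF1 : ∀ y, |F y| ≤ 1) :
    |∫ x, ∫ v, F (classSum c X S x + v) ∂(Measure.pi (law 0)) ∂P -
      ∫ y, F y ∂(Measure.pi fun i => law (∑ t ∈ S.filter (fun t => c t = i), ∫ x, X t x ∂P) i)| ≤
    ∑ t ∈ S, (4 * (∫ x, X t x ∂P) ^ 2 + 4 * ∑ s ∈ S.filter (fun s => s ≠ t ∧ rel t s),
      (∫ x, X t x * X s x ∂P + (∫ x, X t x ∂P) * ∫ x, X s x ∂P)) := by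
  have hX0 : ∀ t x, 0 ≤ X t x := fun t x => by rcases hX t x with h | h <;> simp [h]
  have hI0 : ∀ t, 0 ≤ ∫ x, X t x ∂P := fun t => integral_nonneg fun x => hX0 t x
  have hII0 : ∀ t s, 0 ≤ ∫ x, X t x * X s x ∂P :=
    fun t s => integral_nonneg fun x => mul_nonneg (hX0 t x) (hX0 s x)
  have int : ∀ f : Ω → ℝ, Integrable f P := fun f => Integrable.of_finite
  suffices H : ∀ A ⊆ S, ∀ F : (Fin r → ℝ) → ℝ, Measurable F → (∀ y, |F y| ≤ 1) →
      |∫ x, ∫ v, F (classSum c X A x + v) ∂(Measure.pi (law 0)) ∂P -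
      ∫ y, F y ∂(Measure.pi fun i => law (∑ t ∈ A.filter (fun t => c t = i), ∫ x, X t x ∂P) i)| ≤
    ∑ t ∈ A, (4 * (∫ x, X t x ∂P) ^ 2 + 4 * ∑ s ∈ S.filter (fun s => s ≠ t ∧ rel t s),
      (∫ x, X t x * X s x ∂P + (∫ x, X t x ∂P) * ∫ x, X s x ∂P)) from H S subset_rfl F hF hF1
  clear hF hF1 F
  intro A
  induction A using Finset.induction_on with
  | empty => intro _ F _ _; simp [classSum]
  | insert t A ht ih =>
    intro hA F hF hF1
    have htS : t ∈ S := hA (Finset.mem_insert_self _ _)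
    have hAS : A ⊆ S := (Finset.subset_insert _ _).trans hA
    set a := ∫ x, X t x ∂P with ha
    have hs : Measurable fun s : ℝ => (Pi.single (c t) s : Fin r → ℝ) :=
      (measurable_update' (a := c t)).comp (measurable_const.prodMk measurable_id)
    -- the test function in which the new variable has been averaged out
    set F₁ : (Fin r → ℝ) → ℝ := fun y => ∫ s, F (y + Pi.single (c t) s) ∂(poissonReal a) with hF₁
    have hm : Measurable fun q : (Fin r → ℝ) × ℝ => F (q.1 + Pi.single (c t) q.2) :=
      hF.comp (measurable_fst.add (hs.comp measurable_snd))
    have hF₁m : Measurable F₁ :=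
      (StronglyMeasurable.integral_prod_right' (f := fun q : (Fin r → ℝ) × ℝ =>
        F (q.1 + Pi.single (c t) q.2)) hm.stronglyMeasurable).measurable
    have hF₁1 : ∀ y, |F₁ y| ≤ 1 := fun y =>
      abs_integral_le_const fun s => hF1 _
    have hih := ih hAS F₁ hF₁m hF₁1
    have hlim : ∫ y, F₁ y ∂(Measure.pi fun i =>
        law (∑ t ∈ A.filter (fun t => c t = i), ∫ x, X t x ∂P) i) =
        ∫ y, F y ∂(Measure.pi fun i =>
          law (∑ t ∈ (insert t A).filter (fun t => c t = i), ∫ x, X t x ∂P) i) := by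
      refine (integral_add_single_pi _ (c t) (poissonReal a) _ ?_ ?_ hF hF1).symm
      · rw [hlaw t htS, hlaw t htS, poissonReal_conv (Finset.sum_nonneg fun s _ => hI0 s) (hI0 t),
          Finset.filter_insert, if_pos rfl, Finset.sum_insert (by simp [ht]), add_comm]
      · intro i hi
        rw [Finset.filter_insert, if_neg (Ne.symm hi)]
    -- the sum of the old variables and of the independent vector
    set H : (Fin r → ℝ) → ℝ := fun y => ∫ v, F (y + v) ∂(Measure.pi (law 0)) with hH
    have hHm : Measurable H :=
      (StronglyMeasurable.integral_prod_right' (f := fun q : (Fin r → ℝ) × (Fin r → ℝ) =>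
        F (q.1 + q.2)) (hF.comp (measurable_fst.add measurable_snd)).stronglyMeasurable).measurable
    have hH1 : ∀ y, |H y| ≤ 1 := fun y =>
      abs_integral_le_const fun s => hF1 _
    have hstep := abs_replace_le (P := P) (c := c) hX rel A t (fun h => hind t htS _
      ((Finset.filter_subset _ _).trans hAS) (fun s hs => (Finset.mem_filter.1 hs).2) h) hHm hH1
    have e1 : ∀ x, classSum c X (insert t A) x = classSum c X A x + Pi.single (c t) (X t x) := by
      intro x
      rw [classSum, Finset.sum_insert ht, add_comm]; rfl
    have e2 : ∀ x, ∫ s, H (classSum c X A x + Pi.single (c t) s) ∂(poissonReal a) =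
        ∫ v, F₁ (classSum c X A x + v) ∂(Measure.pi (law 0)) := by
      intro x
      simp only [hH, hF₁]
      rw [integral_integral_swap]
      · congr 1; funext v; congr 1; funext s; congr 1; abel
      · refine Integrable.of_bound (Measurable.aestronglyMeasurable ?_) 1
          (ae_of_all _ fun q => hF1 _)
        exact hF.comp ((measurable_const.add (hs.comp measurable_fst)).add measurable_snd)
    rw [← ha] at hstep
    simp only [e2] at hstep
    rw [Finset.sum_insert ht, ← hlim]
    simp only [e1]
    have hsub : ∑ s ∈ A.filter (rel t), (∫ x, X t x * X s x ∂P + a * ∫ x, X s x ∂P) ≤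
        ∑ s ∈ S.filter (fun s => s ≠ t ∧ rel t s),
          (∫ x, X t x * X s x ∂P + a * ∫ x, X s x ∂P) := by
      refine Finset.sum_le_sum_of_subset_of_nonneg ?_ fun s _ _ =>
        add_nonneg (hII0 t s) (mul_nonneg (hI0 t) (hI0 s))
      intro s hs
      obtain ⟨h1, h2⟩ := Finset.mem_filter.1 hs
      exact Finset.mem_filter.2 ⟨hAS h1, fun h => ht (h ▸ h1), h2⟩
    refine (abs_sub_le _ (∫ x, ∫ v, F₁ (classSum c X A x + v) ∂(Measure.pi (law 0)) ∂P) _).trans ?_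
    refine add_le_add (hstep.trans ?_) hih
    linarith

end

end CycleStat

namespace CycleStat

/-! ### Variables with moments of all orders -/

section
variable {Ω : Type*} [MeasurableSpace Ω] {P : Measure Ω}

/-- The variable has moments of all orders. -/
def AllLp (f : Ω → ℝ) (P : Measure Ω) : Prop := ∀ q : ℕ, MemLp f q P

lemma AllLp.integrable {f : Ω → ℝ} (h : AllLp f P) : Integrable f P := by
  have := h 1
  rwa [Nat.cast_one, memLp_one_iff_integrable] at this

lemma AllLp.memLp_two {f : Ω → ℝ} (h : AllLp f P) : MemLp f 2 P := h 2

lemma AllLp.mul {f g : Ω → ℝ} (hf : AllLp f P) (hg : AllLp g P) : AllLp (fun x => f x * g x) P := by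
  intro q
  have : ENNReal.HolderTriple ((2 * q : ℕ) : ℝ≥0∞) ((2 * q : ℕ) : ℝ≥0∞) (q : ℝ≥0∞) := by
    constructor
    rw [← two_mul]
    push_cast
    rw [ENNReal.mul_inv (by simp) (by simp), ← mul_assoc,
      ENNReal.mul_inv_cancel (by simp) (by simp), one_mul]
  exact (hg (2 * q)).mul (hf (2 * q))

lemma AllLp.add {f g : Ω → ℝ} (hf : AllLp f P) (hg : AllLp g P) : AllLp (fun x => f x + g x) P :=
  fun q => (hf q).add (hg q)

lemma AllLp.sub {f g : Ω → ℝ} (hf : AllLp f P) (hg : AllLp g P) : AllLp (fun x => f x - g x) P :=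
  fun q => (hf q).sub (hg q)

lemma AllLp.of_bound [IsFiniteMeasure P] {f : Ω → ℝ} (hf : Measurable f) {C : ℝ}
    (h : ∀ x, |f x| ≤ C) : AllLp f P :=
  fun _ => MemLp.of_bound hf.aestronglyMeasurable C (ae_of_all _ h)

lemma AllLp.const [IsFiniteMeasure P] (c : ℝ) : AllLp (fun _ : Ω => c) P := fun _ => memLp_const c

lemma AllLp.const_mul {f : Ω → ℝ} (hf : AllLp f P) (c : ℝ) : AllLp (fun x => c * f x) P :=
  fun q => (hf q).const_mul c

lemma AllLp.sum {τ : Type*} (S : Finset τ) {f : τ → Ω → ℝ} (hf : ∀ t ∈ S, AllLp (f t) P) :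
    AllLp (fun x => ∑ t ∈ S, f t x) P := fun q => memLp_finsetSum S fun t ht => hf t ht q

lemma AllLp.prod [IsFiniteMeasure P] {τ : Type*} (S : Finset τ) {f : τ → Ω → ℝ}
    (hf : ∀ t ∈ S, AllLp (f t) P) : AllLp (fun x => ∏ t ∈ S, f t x) P := by
  classical
  induction S using Finset.induction_on with
  | empty => simpa using AllLp.const (P := P) 1
  | insert t S ht ih =>
    simp only [Finset.prod_insert ht]
    exact (hf t (Finset.mem_insert_self _ _)).mul
      (ih fun s hs => hf s (Finset.mem_insert_of_mem hs))

lemma AllLp.pow [IsFiniteMeasure P] {f : Ω → ℝ} (hf : AllLp f P) (a : ℕ) :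
    AllLp (fun x => f x ^ a) P := by
  have := AllLp.prod (P := P) (Finset.range a) (f := fun _ => f) fun _ _ => hf
  simpa using this

lemma AllLp.comp {Ω' : Type*} [MeasurableSpace Ω'] {P' : Measure Ω'} {f : Ω → ℝ} (hf : AllLp f P)
    {g : Ω' → Ω} (hg : MeasurePreserving g P' P) : AllLp (fun x => f (g x)) P' :=
  fun q => (hf q).comp_measurePreserving hg

end

/-! ### Gaussian moments -/

lemma allLp_gaussianReal : AllLp (fun x : ℝ => x) (gaussianReal 0 1) :=
  fun q => memLp_id_gaussianReal' q (by simp)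

/-- The moments of the standard Gaussian law. -/
noncomputable def gaussMoment (a : ℕ) : ℝ := ∫ x, x ^ a ∂(gaussianReal 0 1)

lemma gaussMoment_zero : gaussMoment 0 = 1 := by simp [gaussMoment]

lemma gaussMoment_two : gaussMoment 2 = 1 := by
  have h1 := variance_id_gaussianReal (μ := 0) (v := 1)
  rw [variance_eq_integral measurable_id.aemeasurable] at h1
  simpa [gaussMoment] using h1

lemma gaussMoment_odd {a : ℕ} (ha : Odd a) : gaussMoment a = 0 := by
  have h1 : (gaussianReal 0 1).map (fun x : ℝ => -x) = gaussianReal 0 1 := by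
    rw [gaussianReal_map_neg, neg_zero]
  have h2 : gaussMoment a = -gaussMoment a := by
    conv_lhs => rw [gaussMoment, ← h1]
    rw [integral_map measurable_neg.aemeasurable (by fun_prop)]
    simp only [ha.neg_pow]
    rw [integral_neg]; rfl
  linarith

lemma gaussMoment_one : gaussMoment 1 = 0 := gaussMoment_odd odd_one

lemma integrable_gaussBound : Integrable (fun x : ℝ => (1 + x ^ 2) ^ 4) (gaussianReal 0 1) :=
  (((AllLp.const 1).add (allLp_gaussianReal.pow 2)).pow 4).integrable

lemma abs_gaussMoment_le {a : ℕ} (ha : a ≤ 8) : |gaussMoment a| ≤ gaussBound := by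
  refine abs_integral_le_of_abs_le integrable_gaussBound fun x => ?_
  rw [abs_pow]
  rcases le_total |x| 1 with h | h
  · exact (pow_le_one₀ (abs_nonneg _) h).trans (one_le_pow₀ (by nlinarith [sq_nonneg x]))
  · refine (pow_le_pow_right₀ h ha).trans ?_
    rw [show 8 = 2 * 4 from rfl, pow_mul, sq_abs]
    exact pow_le_pow_left₀ (sq_nonneg x) (by linarith) 4

lemma one_le_gaussBound : 1 ≤ gaussBound := by
  have := abs_gaussMoment_le (a := 0) (by norm_num)
  rwa [gaussMoment_zero, abs_one] at this

lemma integral_one_add_sq_pow_le {a : ℕ} (ha : a ≤ 4) :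
    ∫ x, (1 + x ^ 2) ^ a ∂(gaussianReal 0 1) ≤ gaussBound := by
  refine integral_mono (((AllLp.const 1).add (allLp_gaussianReal.pow 2)).pow a).integrable
    integrable_gaussBound fun x => ?_
  exact pow_le_pow_right₀ (by nlinarith [sq_nonneg x]) ha

section
variable {κ : Type*} [Fintype κ]

lemma allLp_coord (q : κ) : AllLp (fun x : κ → ℝ => x q) (gaussPi κ) :=
  allLp_gaussianReal.comp (measurePreserving_eval (fun _ : κ => gaussianReal 0 1) q)

lemma integral_prod_gaussPi (w : κ → ℝ → ℝ) :
    ∫ x, ∏ q, w q (x q) ∂(gaussPi κ) = ∏ q, ∫ t, w q t ∂(gaussianReal 0 1) :=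
  integral_fintype_prod_eq_prod (fun q => w q)

lemma integral_prod_pow (a : κ → ℕ) :
    ∫ x, ∏ q, x q ^ a q ∂(gaussPi κ) = ∏ q, gaussMoment (a q) :=
  integral_prod_gaussPi fun q t => t ^ a q

/-- A monomial of independent Gaussians with exponents at most eight on a set `A`. -/
lemma abs_integral_prod_pow_le {a : κ → ℕ} (ha : ∀ q, a q ≤ 8) {A : Finset κ}
    (hA : ∀ q, q ∉ A → a q = 0) :
    |∫ x, ∏ q, x q ^ a q ∂(gaussPi κ)| ≤ gaussBound ^ A.card := by
  rw [integral_prod_pow, ← Finset.prod_subset (Finset.subset_univ A), Finset.abs_prod]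
  · exact (Finset.prod_le_prod (fun _ _ => abs_nonneg _) fun q _ =>
      abs_gaussMoment_le (ha q)).trans_eq (Finset.prod_const _)
  · intro q _ hq; rw [hA q hq, gaussMoment_zero]

variable [DecidableEq κ]

lemma prod_mul_prod_eq (A B : Finset κ) (f g : κ → ℝ) :
    (∏ q ∈ A, f q) * ∏ q ∈ B, g q =
      ∏ q, ((if q ∈ A then f q else 1) * if q ∈ B then g q else 1) := by
  rw [Finset.prod_mul_distrib]
  simp [Finset.prod_ite_mem]

/-- The mixed moments of products of shifted Gaussians. -/
lemma integral_shifted (A B : Finset κ) (y z : κ → ℝ) :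
    ∫ x, (∏ q ∈ A, (y q + x q)) * ∏ q ∈ B, (z q + x q) ∂(gaussPi κ) =
      (∏ q ∈ A ∩ B, (1 + y q * z q)) * (∏ q ∈ A \ B, y q) * ∏ q ∈ B \ A, z q := by
  have e0 : ∀ x : κ → ℝ, (∏ q ∈ A, (y q + x q)) * ∏ q ∈ B, (z q + x q) =
      ∏ q, ((if q ∈ A then y q + x q else 1) * if q ∈ B then z q + x q else 1) :=
    fun x => prod_mul_prod_eq A B _ _
  simp only [e0]
  rw [integral_prod_gaussPi fun q t => (if q ∈ A then y q + t else 1) *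
    if q ∈ B then z q + t else 1]
  have i1 : Integrable (fun t : ℝ => t) (gaussianReal 0 1) := allLp_gaussianReal.integrable
  have i2 : Integrable (fun t : ℝ => t ^ 2) (gaussianReal 0 1) :=
    (allLp_gaussianReal.pow 2).integrable
  have m1 : ∫ t, t ∂(gaussianReal 0 1) = 0 := by
    simpa only [gaussMoment, pow_one] using gaussMoment_one
  have m2 : ∫ t, t ^ 2 ∂(gaussianReal 0 1) = 1 := gaussMoment_two
  have hl : ∀ a : ℝ, ∫ t, (a + t) ∂(gaussianReal 0 1) = a := fun a => by
    rw [integral_add (integrable_const _) i1, m1]; simp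
  have hq : ∀ a b : ℝ, ∫ t, (a + t) * (b + t) ∂(gaussianReal 0 1) = 1 + a * b := fun a b => by
    have e : ∀ t : ℝ, (a + t) * (b + t) = (a * b + (a + b) * t) + t ^ 2 := fun t => by ring
    have i3 : Integrable (fun t : ℝ => a * b + (a + b) * t) (gaussianReal 0 1) :=
      (integrable_const _).add (i1.const_mul _)
    simp only [e]
    rw [integral_add i3 i2, integral_add (integrable_const _) (i1.const_mul _),
      integral_const, integral_const_mul, m1, m2]
    simp; ring
  have key : ∀ q, ∫ t, ((if q ∈ A then y q + t else 1) * if q ∈ B then z q + t else 1)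
      ∂(gaussianReal 0 1) = (if q ∈ A ∩ B then 1 + y q * z q else 1) *
        (if q ∈ A \ B then y q else 1) * if q ∈ B \ A then z q else 1 := by
    intro q
    by_cases hA : q ∈ A <;> by_cases hB : q ∈ B <;> simp [hA, hB, hl, hq]
  have hite : ∀ (S : Finset κ) (f : κ → ℝ), ∏ q, (if q ∈ S then f q else 1) = ∏ q ∈ S, f q :=
    fun S f => by rw [Finset.prod_ite_mem, Finset.univ_inter]
  rw [Finset.prod_congr rfl fun q _ => key q]
  simp only [Finset.prod_mul_distrib]
  rw [hite, hite, hite]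

end

section
variable {n p : ℕ}

/-- Reading the noise matrix as a vector. -/
lemma measurePreserving_curry_gauss (n p : ℕ) :
    MeasurePreserving (fun (x : Fin n × Fin p → ℝ) i j => x (i, j)) (gaussPi (Fin n × Fin p))
      (Measure.pi fun _ : Fin n => Measure.pi fun _ : Fin p => gaussianReal 0 1) := by
  have h := Measure.infinitePi_map_curry (ι := Fin n) (κ := Fin p)
    (fun _ _ => gaussianReal 0 1)
  simp only [Measure.infinitePi_eq_pi] at h
  refine ⟨?_, ?_⟩
  · exact (MeasurableEquiv.curry (Fin n) (Fin p) ℝ).measurable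
  · exact h

end

end CycleStat

namespace CycleStat

variable {m n p : ℕ}

/-! ### The contribution of the signal -/

lemma prod_zero_of_nonempty {α : Type*} {A : Finset α} (hA : A.Nonempty) :
    ∏ _q ∈ A, (0 : ℝ) = 0 := by
  rw [Finset.prod_const, zero_pow hA.card_ne_zero]

section
variable {κ : Type*} [Fintype κ]

lemma allLp_prod_shifted (A : Finset κ) (y : κ → ℝ) :
    AllLp (fun x : κ → ℝ => ∏ q ∈ A, (y q + x q)) (gaussPi κ) :=
  AllLp.prod A fun q _ => (AllLp.const _).add (allLp_coord q)

lemma allLp_prod_coord (A : Finset κ) :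
    AllLp (fun x : κ → ℝ => ∏ q ∈ A, x q) (gaussPi κ) := AllLp.prod A fun q _ => allLp_coord q

variable [DecidableEq κ]

/-- Given the labels and the latent vector, the mean of a product of covariates is the product of
their means. -/
lemma integral_prod_shifted_sub {A : Finset κ} (hA : A.Nonempty) (y : κ → ℝ) :
    ∫ x, (∏ q ∈ A, (y q + x q) - ∏ q ∈ A, x q) ∂(gaussPi κ) = ∏ q ∈ A, y q := by
  rw [integral_sub (allLp_prod_shifted A y).integrable (allLp_prod_coord A).integrable]
  have h1 := integral_shifted A ∅ y 0
  have h2 := integral_shifted A ∅ 0 0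
  simp only [Finset.prod_empty, mul_one, Finset.inter_empty, Finset.sdiff_empty, one_mul,
    Finset.empty_sdiff, Pi.zero_apply, zero_add] at h1 h2
  rw [h1, h2, prod_zero_of_nonempty hA, sub_zero]

/-- The covariance, over the noise, of two products of the same number of variables from which the
pure noise part has been removed. -/
lemma integral_shifted_sub_mul {A B : Finset κ} (hAB : A.card = B.card)
    (y : κ → ℝ) :
    ∫ x, (∏ q ∈ A, (y q + x q) - ∏ q ∈ A, x q) * (∏ q ∈ B, (y q + x q) - ∏ q ∈ B, x q)
      ∂(gaussPi κ) = (∏ q ∈ A ∩ B, (1 + y q * y q)) * (∏ q ∈ A \ B, y q) * ∏ q ∈ B \ A, y q -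
        if A = B then 1 else 0 := by
  have e : ∀ x : κ → ℝ,
      (∏ q ∈ A, (y q + x q) - ∏ q ∈ A, x q) * (∏ q ∈ B, (y q + x q) - ∏ q ∈ B, x q) =
      ((∏ q ∈ A, (y q + x q)) * ∏ q ∈ B, (y q + x q) - (∏ q ∈ A, (y q + x q)) * ∏ q ∈ B, x q) -
      ((∏ q ∈ A, x q) * ∏ q ∈ B, (y q + x q) - (∏ q ∈ A, x q) * ∏ q ∈ B, x q) := fun x => by ring
  have i1 := ((allLp_prod_shifted A y).mul (allLp_prod_shifted B y)).integrable
  have i2 := ((allLp_prod_shifted A y).mul (allLp_prod_coord B)).integrable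
  have i3 := ((allLp_prod_coord A).mul (allLp_prod_shifted B y)).integrable
  have i4 := ((allLp_prod_coord A).mul (allLp_prod_coord B)).integrable
  have h1 := integral_shifted A B y y
  have h2 := integral_shifted A B y 0
  have h3 := integral_shifted A B 0 y
  have h4 := integral_shifted A B 0 0
  simp only [Pi.zero_apply, zero_add, mul_zero, zero_mul, add_zero, Finset.prod_const_one,
    one_mul] at h2 h3 h4
  have i12 : Integrable (fun x : κ → ℝ => (∏ q ∈ A, (y q + x q)) * ∏ q ∈ B, (y q + x q) -
      (∏ q ∈ A, (y q + x q)) * ∏ q ∈ B, x q) (gaussPi κ) := i1.sub i2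
  have i34 : Integrable (fun x : κ → ℝ => (∏ q ∈ A, x q) * ∏ q ∈ B, (y q + x q) -
      (∏ q ∈ A, x q) * ∏ q ∈ B, x q) (gaussPi κ) := i3.sub i4
  simp only [e]
  rw [integral_sub i12 i34, integral_sub i1 i2, integral_sub i3 i4, h1, h2, h3, h4]
  by_cases hc : A = B
  · subst hc; simp
  · have n1 : (A \ B).Nonempty := by
      rw [Finset.sdiff_nonempty]
      exact fun h => hc (Finset.eq_of_subset_of_card_le h hAB.ge)
    have n2 : (B \ A).Nonempty := by
      rw [Finset.sdiff_nonempty]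
      exact fun h => hc (Finset.eq_of_subset_of_card_le h hAB.le).symm
    rw [prod_zero_of_nonempty n1, prod_zero_of_nonempty n2, if_neg hc]
    ring

end

/-- The number of links of a covariate in a set of covariate links. -/
def colCount (A : Finset (Fin n × Fin p)) (v : Fin p) : ℕ := (A.filter fun q => q.2 = v).card

lemma prod_col_eq (A : Finset (Fin n × Fin p)) (f : Fin p → ℝ) :
    ∏ q ∈ A, f q.2 = ∏ v, f v ^ colCount A v := by
  rw [← Finset.prod_fiberwise' A Prod.snd f]
  simp [colCount]

/-- Each latent variable occurs twice in the weight of a cycle, so that its contribution is its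
second moment, which is one. -/
lemma integral_prod_col {A : Finset (Fin n × Fin p)}
    (h : ∀ v, colCount A v = 0 ∨ colCount A v = 2) :
    ∫ u, ∏ q ∈ A, u q.2 ∂(gaussPi (Fin p)) = 1 := by
  simp only [prod_col_eq]
  rw [integral_prod_pow]
  refine Finset.prod_eq_one fun v _ => ?_
  rcases h v with h | h <;> rw [h]
  · exact gaussMoment_zero
  · exact gaussMoment_two

lemma allLp_prod_one_add_sq (A : Finset (Fin n × Fin p)) :
    AllLp (fun u : Fin p → ℝ => ∏ q ∈ A, (1 + u q.2 ^ 2)) (gaussPi (Fin p)) :=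
  AllLp.prod A fun q _ => (AllLp.const _).add ((allLp_coord q.2).pow 2)

lemma integral_prod_one_add_sq_le {A : Finset (Fin n × Fin p)} (h : ∀ v, colCount A v ≤ 4) :
    ∫ u, ∏ q ∈ A, (1 + u q.2 ^ 2) ∂(gaussPi (Fin p)) ≤ gaussBound ^ A.card := by
  have e : ∀ u : Fin p → ℝ, ∏ q ∈ A, (1 + u q.2 ^ 2) = ∏ v, (1 + u v ^ 2) ^ colCount A v :=
    fun u => prod_col_eq A fun v => 1 + u v ^ 2
  simp only [e]
  rw [integral_prod_gaussPi fun v t => (1 + t ^ 2) ^ colCount A v,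
    Finset.card_eq_sum_card_fiberwise (f := Prod.snd) (t := Finset.univ) (fun _ _ => by simp),
    ← Finset.prod_pow_eq_pow_sum]
  refine Finset.prod_le_prod (fun v _ => integral_nonneg fun t => by positivity) fun v _ => ?_
  rcases Nat.eq_zero_or_pos (colCount A v) with h0 | h0
  · rw [h0]
    simpa using one_le_pow₀ one_le_gaussBound
  · refine (integral_one_add_sq_pow_le (h v)).trans ?_
    exact le_self_pow₀ one_le_gaussBound (by unfold colCount at h0; omega)

section
variable {K : CycleType m} {E : Finset (Link m n p)}

lemma colCount_covSet (hE : IsRing E) (v : Fin p) :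
    colCount (covSet E) v = 0 ∨ colCount (covSet E) v = 2 := by
  rcases Nat.eq_zero_or_pos (colCount (covSet E) v) with h | h
  · exact Or.inl h
  right
  obtain ⟨⟨i, v'⟩, hq⟩ := Finset.card_pos.1 h
  obtain ⟨hq', rfl⟩ := Finset.mem_filter.1 hq
  rw [← hE.factor _ (mem_covSet.1 hq'), colCount]
  refine Finset.card_bij (fun q _ => (q.1, Sum.inr q.2)) ?_ ?_ ?_
  · intro q hq
    obtain ⟨h1, h2⟩ := Finset.mem_filter.1 hq
    exact Finset.mem_filter.2 ⟨mem_covSet.1 h1, by rw [h2]⟩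
  · intro q _ q' _ e; simpa [Prod.ext_iff] using e
  · rintro ⟨a, b⟩ hb
    obtain ⟨h1, h2⟩ := Finset.mem_filter.1 hb
    simp only at h2
    subst h2
    exact ⟨(a, v'), Finset.mem_filter.2 ⟨mem_covSet.2 h1, rfl⟩, rfl⟩

lemma colCount_union_le (A B : Finset (Fin n × Fin p)) (v : Fin p) :
    colCount (A ∪ B) v ≤ colCount A v + colCount B v := by
  unfold colCount
  rw [Finset.filter_union]
  exact Finset.card_union_le _ _

lemma mem_varSet_of_mem_netSet (hE : MinDegTwo E) {f : Fin m × Pair n} (hf : f ∈ netSet E) :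
    f.2.1.1 ∈ varSet E ∧ f.2.1.2 ∈ varSet E := by
  classical
  have h1 := hE.net_deg hf
  have h2 : (E.filter fun q => q.2 = Sum.inl f) ⊆
      ({(f.2.1.1, Sum.inl f), (f.2.1.2, Sum.inl f)} : Finset (Link m n p)) := by
    rintro ⟨a, b⟩ hq
    obtain ⟨h3, h4⟩ := Finset.mem_filter.1 hq
    simp only at h4
    subst h4
    have := hE.incident _ h3
    simp only [Incident] at this
    rcases this with h | h <;> simp [h]
  have h3 := Finset.eq_of_subset_of_card_le h2 (by rw [h1]; exact Finset.card_le_two)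
  constructor
  · have : ((f.2.1.1, Sum.inl f) : Link m n p) ∈ E.filter fun q => q.2 = Sum.inl f := by
      rw [h3]; simp
    exact mem_varSet.2 ⟨_, (Finset.mem_filter.1 this).1⟩
  · have : ((f.2.1.2, Sum.inl f) : Link m n p) ∈ E.filter fun q => q.2 = Sum.inl f := by
      rw [h3]; simp
    exact mem_varSet.2 ⟨_, (Finset.mem_filter.1 this).1⟩

lemma mem_varSet_of_mem_covSet {q : Fin n × Fin p} (hq : q ∈ covSet E) : q.1 ∈ varSet E :=
  mem_varSet.2 ⟨_, mem_covSet.1 hq⟩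

lemma mem_colSet_of_mem_covSet {q : Fin n × Fin p} (hq : q ∈ covSet E) : q.2 ∈ colSet E :=
  mem_colSet.2 ⟨_, mem_covSet.1 hq⟩

lemma edgeInd_congr (hE : MinDegTwo E) {y y' : Graph m n}
    (h : ∀ r (e : Pair n), e.1.1 ∈ varSet E → e.1.2 ∈ varSet E → y.2 r e = y'.2 r e) :
    edgeInd (netSet E) y = edgeInd (netSet E) y' := by
  unfold edgeInd
  refine Finset.prod_congr rfl fun f hf => ?_
  obtain ⟨h1, h2⟩ := mem_varSet_of_mem_netSet hE hf
  rw [h _ _ h1 h2]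

lemma disjoint_supp {E' : Finset (Link m n p)} (h : Disjoint (supp E) (supp E')) :
    Disjoint (varSet E) (varSet E') ∧ Disjoint (colSet E) (colSet E') := by
  simp only [supp, Finset.disjoint_left] at h ⊢
  constructor
  · intro a ha hb
    exact h (Finset.inl_mem_disjSum.2 ha) (Finset.inl_mem_disjSum.2 hb)
  · intro a ha hb
    exact h (Finset.inr_mem_disjSum.2 ha) (Finset.inr_mem_disjSum.2 hb)

lemma disjoint_covSet {E' : Finset (Link m n p)} (h : Disjoint (supp E) (supp E')) :
    Disjoint (covSet E) (covSet E') := by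
  rw [Finset.disjoint_left]
  intro q hq hq'
  exact Finset.disjoint_left.1 (disjoint_supp h).1 (mem_varSet_of_mem_covSet hq)
    (mem_varSet_of_mem_covSet hq')

/-- The networks and labels on disjoint cycles are independent. -/
lemma integral_edgeInd_mul_disjoint (d lam : Fin m → ℝ) {E' : Finset (Link m n p)}
    (hE : MinDegTwo E) (hE' : MinDegTwo E') (hd : Disjoint (varSet E) (varSet E'))
    (g g' : (Fin n → Bool) → ℝ)
    (hg : ∀ σ σ' : Fin n → Bool, (∀ i ∈ varSet E, σ i = σ' i) → g σ = g σ')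
    (hg' : ∀ σ σ' : Fin n → Bool, (∀ i ∈ varSet E', σ i = σ' i) → g' σ = g' σ') :
    ∫ y, (edgeInd (netSet E) y * g y.1) * (edgeInd (netSet E') y * g' y.1) ∂(graphLaw m n d lam) =
      (∫ y, edgeInd (netSet E) y * g y.1 ∂(graphLaw m n d lam)) *
        ∫ y, edgeInd (netSet E') y * g' y.1 ∂(graphLaw m n d lam) := by
  have hd' : ∀ i ∈ varSet E', i ∉ varSet E := fun i hi hi' => Finset.disjoint_left.1 hd hi' hi
  refine integral_mul_of_separated d lam (varSet E) _ _ ?_ ?_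
  · intro y y' h1 h2
    rw [edgeInd_congr hE h2, hg _ _ h1]
  · intro y y' h1 h2
    rw [edgeInd_congr hE' fun r e ha hb => h2 r e (hd' _ ha) (hd' _ hb),
      hg' _ _ fun i hi => h1 i (hd' i hi)]

end

end CycleStat

namespace CycleStat

variable {m n p : ℕ}

/-! ### First and second moments of the signal -/

/-- The sample space with the noise matrix read as a vector. -/
abbrev Flat (m n p : ℕ) : Type := Graph m n × ((Fin p → ℝ) × (Fin n × Fin p → ℝ))

/-- The law of the model on `Flat`. -/
noncomputable abbrev flatLaw (m n p : ℕ) (d lam : Fin m → ℝ) : Measure (Flat m n p) :=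
  (graphLaw m n d lam).prod ((gaussPi (Fin p)).prod (gaussPi (Fin n × Fin p)))

lemma measurePreserving_flat (d lam : Fin m → ℝ) :
    MeasurePreserving (fun z : Flat m n p => ((z.1, (z.2.1, fun i j => z.2.2 (i, j))) :
      Sample m n p)) (flatLaw m n p d lam) (modelLaw m n p d lam) :=
  (MeasurePreserving.id (graphLaw m n d lam)).prod
    ((MeasurePreserving.id (gaussPi (Fin p))).prod (measurePreserving_curry_gauss n p))

lemma integral_flatLaw (d lam : Fin m → ℝ) {f : Flat m n p → ℝ}
    (hf : Integrable f (flatLaw m n p d lam)) :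
    ∫ z, f z ∂(flatLaw m n p d lam) = ∫ y, ∫ u, ∫ x, f (y, (u, x)) ∂(gaussPi (Fin n × Fin p))
      ∂(gaussPi (Fin p)) ∂(graphLaw m n d lam) := by
  rw [integral_prod _ hf]
  exact integral_congr_ae (hf.prod_right_ae.mono fun y hy => integral_prod _ hy)

/-- The mean of a covariate entry given the labels and the latent vector. -/
noncomputable def signal (mu : ℝ) (y : Graph m n) (u : Fin p → ℝ) (q : Fin n × Fin p) : ℝ :=
  √(mu / n) * spin (y.1 q.1) * u q.2

/-- The weight of a cycle minus the weight that it has without the signal. -/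
noncomputable def signalPart (mu : ℝ) (E : Finset (Link m n p)) (z : Flat m n p) : ℝ :=
  edgeInd (netSet E) z.1 * (∏ q ∈ covSet E, (signal mu z.1 z.2.1 q + z.2.2 q) -
    ∏ q ∈ covSet E, z.2.2 q)

section
variable {d lam : Fin m → ℝ} {mu : ℝ} {k : ℕ} {X : ℝ}

lemma allLp_graph (f : Graph m n → ℝ) :
    AllLp (fun z : Flat m n p => f z.1) (flatLaw m n p d lam) := by
  have : AllLp f (graphLaw m n d lam) := fun q => MemLp.of_discrete
  exact this.comp measurePreserving_fst

lemma allLp_latent (v : Fin p) :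
    AllLp (fun z : Flat m n p => z.2.1 v) (flatLaw m n p d lam) :=
  ((allLp_coord v).comp measurePreserving_fst).comp measurePreserving_snd

lemma allLp_noise (q : Fin n × Fin p) :
    AllLp (fun z : Flat m n p => z.2.2 q) (flatLaw m n p d lam) :=
  ((allLp_coord q).comp measurePreserving_snd).comp measurePreserving_snd

lemma allLp_signal (mu : ℝ) (q : Fin n × Fin p) :
    AllLp (fun z : Flat m n p => signal mu z.1 z.2.1 q) (flatLaw m n p d lam) :=
  (allLp_graph fun y => √(mu / n) * spin (y.1 q.1)).mul (allLp_latent q.2)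

lemma allLp_signalPart (mu : ℝ) (E : Finset (Link m n p)) :
    AllLp (signalPart mu E) (flatLaw m n p d lam) :=
  (allLp_graph (edgeInd (netSet E))).mul ((AllLp.prod _ fun q _ =>
    (allLp_signal mu q).add (allLp_noise q)).sub (AllLp.prod _ fun q _ => allLp_noise q))

lemma prod_signal (hmu : 0 ≤ mu) (A : Finset (Fin n × Fin p)) {l : ℕ} (hA : A.card = 2 * l)
    (y : Graph m n) (u : Fin p → ℝ) :
    ∏ q ∈ A, signal mu y u q = (mu / n) ^ l * (∏ q ∈ A, spin (y.1 q.1)) * ∏ q ∈ A, u q.2 := by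
  simp only [signal, Finset.prod_mul_distrib, Finset.prod_const, hA]
  rw [pow_mul, Real.sq_sqrt (by positivity)]

lemma covSet_nonempty {K : CycleType m} (hK : 2 ≤ size K) (hl : K.2 ≠ 0) {E : Finset (Link m n p)}
    (hE : E ∈ loops m n p K) : (covSet E).Nonempty := by
  rw [← Finset.card_pos, card_covSet hK hE]; omega

/-- The mean of the signal part of a cycle, a closed form that is the same for all the cycles of a
type. The condition `ℓ ≠ 0` makes the other term of the average over the labels vanish. -/
lemma integral_signalPart (h : IsScale d lam mu n p k X) {K : CycleType m} (hK : 2 ≤ size K)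
    (hl : K.2 ≠ 0) {E : Finset (Link m n p)} (hE : E ∈ loops m n p K) :
    ∫ z, signalPart mu E z ∂(flatLaw m n p d lam) =
      (mu / n) ^ K.2 * ((∏ r, (lam r * √(d r)) ^ K.1 r) / n ^ (∑ r, K.1 r)) := by
  have hr := isRing_of_mem_loops hK hE
  rw [integral_flatLaw d lam (allLp_signalPart mu E).integrable]
  simp only [signalPart]
  simp only [integral_const_mul, integral_prod_shifted_sub (covSet_nonempty hK hl hE),
    prod_signal h.mu_nonneg _ (card_covSet hK hE),
    integral_prod_col (colCount_covSet hr)]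
  have e : ∀ y : Graph m n, edgeInd (netSet E) y * ((mu / n) ^ K.2 *
      (∏ q ∈ covSet E, spin (y.1 q.1)) * 1) = (mu / n) ^ K.2 *
      (edgeInd (netSet E) y * ∏ q ∈ covSet E, spin (y.1 q.1)) := fun y => by ring
  simp only [e]
  rw [integral_const_mul, (integral_edgeInd_loop h.d_nonneg h.lam_nonneg h.lam_le h.n_pos
    (fun j => (h.d_le j).trans h.le_n) hK hE).2, zero_pow hl, mul_zero, zero_add]

/-- Cycles without common nodes have uncorrelated signal parts, since they involve different labels,
edges, latent variables and noise variables. -/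
lemma integral_signalPart_mul_disjoint (h : IsScale d lam mu n p k X) {K : CycleType m}
    (hK : 2 ≤ size K) (hl : K.2 ≠ 0) {E E' : Finset (Link m n p)} (hE : E ∈ loops m n p K)
    (hE' : E' ∈ loops m n p K) (hd : Disjoint (supp E) (supp E')) :
    ∫ z, signalPart mu E z * signalPart mu E' z ∂(flatLaw m n p d lam) =
      (∫ z, signalPart mu E z ∂(flatLaw m n p d lam)) *
        ∫ z, signalPart mu E' z ∂(flatLaw m n p d lam) := by
  have hr := isRing_of_mem_loops hK hE
  have hr' := isRing_of_mem_loops hK hE'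
  have hcd := disjoint_covSet hd
  have hne : covSet E ≠ covSet E' := by
    intro he
    rw [he] at hcd
    exact (covSet_nonempty hK hl hE').ne_empty (disjoint_self.1 hcd)
  rw [integral_signalPart h hK hl hE, integral_signalPart h hK hl hE', integral_flatLaw d lam
    ((allLp_signalPart mu E).mul (allLp_signalPart mu E')).integrable]
  have e1 : ∀ (y : Graph m n) (u : Fin p → ℝ) (x : Fin n × Fin p → ℝ),
      signalPart mu E (y, u, x) * signalPart mu E' (y, u, x) =
      (edgeInd (netSet E) y * edgeInd (netSet E') y) *
        ((∏ q ∈ covSet E, (signal mu y u q + x q) - ∏ q ∈ covSet E, x q) *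
        (∏ q ∈ covSet E', (signal mu y u q + x q) - ∏ q ∈ covSet E', x q)) := by
    intro y u x; simp only [signalPart]; ring
  have e2 : ∀ (y : Graph m n) (u : Fin p → ℝ),
      (∏ q ∈ covSet E ∩ covSet E', (1 + signal mu y u q * signal mu y u q)) *
        (∏ q ∈ covSet E \ covSet E', signal mu y u q) *
        ∏ q ∈ covSet E' \ covSet E, signal mu y u q - (if covSet E = covSet E' then 1 else 0) =
      ((mu / n) ^ K.2 * (∏ q ∈ covSet E, spin (y.1 q.1)) *
        ((mu / n) ^ K.2 * ∏ q ∈ covSet E', spin (y.1 q.1))) *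
          ∏ q ∈ covSet E ∪ covSet E', u q.2 := by
    intro y u
    rw [if_neg hne, Finset.disjoint_iff_inter_eq_empty.1 hcd, Finset.prod_empty,
      Finset.sdiff_eq_self_of_disjoint hcd, Finset.sdiff_eq_self_of_disjoint hcd.symm,
      prod_signal h.mu_nonneg _ (card_covSet hK hE),
      prod_signal h.mu_nonneg _ (card_covSet hK hE'), Finset.prod_union hcd]
    ring
  -- disjoint cycles use different latent variables
  have hcol : ∀ v,
      colCount (covSet E ∪ covSet E') v = 0 ∨ colCount (covSet E ∪ covSet E') v = 2 := by
    intro v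
    have h1 : colCount (covSet E ∪ covSet E') v =
        colCount (covSet E) v + colCount (covSet E') v := by
      unfold colCount
      rw [Finset.filter_union, Finset.card_union_of_disjoint
        (Finset.disjoint_filter_filter hcd)]
    have h2 : colCount (covSet E) v = 0 ∨ colCount (covSet E') v = 0 := by
      by_contra hcon
      push Not at hcon
      obtain ⟨q, hq⟩ := Finset.card_pos.1 (Nat.pos_of_ne_zero hcon.1)
      obtain ⟨q', hq'⟩ := Finset.card_pos.1 (Nat.pos_of_ne_zero hcon.2)
      obtain ⟨a1, a2⟩ := Finset.mem_filter.1 hq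
      obtain ⟨b1, b2⟩ := Finset.mem_filter.1 hq'
      refine Finset.disjoint_left.1 (disjoint_supp hd).2 (mem_colSet_of_mem_covSet a1) ?_
      rw [a2, ← b2]
      exact mem_colSet_of_mem_covSet b1
    have h3 := colCount_covSet hr v
    have h4 := colCount_covSet hr' v
    omega
  simp only [e1, integral_const_mul,
    integral_shifted_sub_mul ((card_covSet hK hE).trans (card_covSet hK hE').symm), e2,
    integral_prod_col hcol]
  have e3 : ∀ y : Graph m n, edgeInd (netSet E) y * edgeInd (netSet E') y *
      ((mu / n) ^ K.2 * (∏ q ∈ covSet E, spin (y.1 q.1)) *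
        ((mu / n) ^ K.2 * ∏ q ∈ covSet E', spin (y.1 q.1)) * 1) =
      ((mu / n) ^ K.2 * (mu / n) ^ K.2) *
        ((edgeInd (netSet E) y * ∏ q ∈ covSet E, spin (y.1 q.1)) *
        (edgeInd (netSet E') y * ∏ q ∈ covSet E', spin (y.1 q.1))) := fun y => by ring
  simp only [e3]
  have hloop := fun (F : Finset (Link m n p)) (hF : F ∈ loops m n p K) =>
    (integral_edgeInd_loop h.d_nonneg h.lam_nonneg h.lam_le h.n_pos
    (fun j => (h.d_le j).trans h.le_n) hK hF).2
  rw [integral_const_mul, integral_edgeInd_mul_disjoint d lam hr.minDegTwo hr'.minDegTwo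
    (disjoint_supp hd).1 (fun σ => ∏ q ∈ covSet E, spin (σ q.1))
    (fun σ => ∏ q ∈ covSet E', spin (σ q.1))
    (fun σ σ' hσ => Finset.prod_congr rfl fun q hq => by rw [hσ _ (mem_varSet_of_mem_covSet hq)])
    (fun σ σ' hσ => Finset.prod_congr rfl fun q hq => by rw [hσ _ (mem_varSet_of_mem_covSet hq)]),
    hloop E hE, hloop E' hE', zero_pow hl, mul_zero, zero_add]
  ring

end

end CycleStat

namespace CycleStat

/-! ### Concentration of the signal -/

variable {m n p : ℕ}

lemma one_le_prod_of_one_le {α : Type*} {A : Finset α} {f : α → ℝ} (h : ∀ q, 1 ≤ f q) :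
    1 ≤ ∏ q ∈ A, f q := by
  have := Finset.prod_le_prod (s := A) (f := fun _ => (1 : ℝ)) (fun _ _ => zero_le_one)
    fun q _ => h q
  simpa using this

section
variable {d lam : Fin m → ℝ} {mu : ℝ} {k : ℕ} {X : ℝ}

lemma signal_sq (hmu : 0 ≤ mu) (y : Graph m n) (u : Fin p → ℝ) (q : Fin n × Fin p) :
    signal mu y u q * signal mu y u q = (n : ℝ)⁻¹ * (mu * u q.2 ^ 2) := by
  have h1 : √(mu / n) * √(mu / n) = mu / n := Real.mul_self_sqrt (by positivity)
  have h2 := spin_mul_self (y.1 q.1)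
  calc signal mu y u q * signal mu y u q
      = (√(mu / n) * √(mu / n)) * (spin (y.1 q.1) * spin (y.1 q.1)) * u q.2 ^ 2 := by
        unfold signal; ring
    _ = _ := by rw [h1, h2]; ring

lemma abs_signal_le (hmu : 0 ≤ mu) (y : Graph m n) (u : Fin p → ℝ) (q : Fin n × Fin p) :
    |signal mu y u q| ≤ √(n : ℝ)⁻¹ * ((1 + mu) * (1 + u q.2 ^ 2)) := by
  rw [signal, abs_mul, abs_mul, abs_spin, mul_one, abs_of_nonneg (Real.sqrt_nonneg _),
    div_eq_inv_mul, Real.sqrt_mul (by positivity), mul_assoc]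
  refine mul_le_mul_of_nonneg_left ?_ (Real.sqrt_nonneg _)
  refine mul_le_mul ?_ ?_ (abs_nonneg _) (by positivity)
  · rw [Real.sqrt_le_left (by positivity)]; nlinarith
  · have := sq_abs (u q.2)
    nlinarith [sq_nonneg (|u q.2| - 1)]

lemma IsScale.one_add_signal_sq_le (h : IsScale d lam mu n p k X) (y : Graph m n) (u : Fin p → ℝ)
    (q : Fin n × Fin p) : 1 + signal mu y u q * signal mu y u q ≤ (1 + mu) * (1 + u q.2 ^ 2) := by
  rw [signal_sq h.mu_nonneg]
  have h1 : (n : ℝ)⁻¹ * (mu * u q.2 ^ 2) ≤ mu * u q.2 ^ 2 :=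
    mul_le_of_le_one_left (mul_nonneg h.mu_nonneg (sq_nonneg _)) h.inv_le_one
  have := h.mu_nonneg
  nlinarith [sq_nonneg (u q.2)]

/-- A product of factors `1 + w t` without its constant term is at most proportional to `w`. -/
lemma prod_one_add_mul_sub_one_le {α : Type*} {w : ℝ} (hw : 0 ≤ w) (hw1 : w ≤ 1) (A : Finset α)
    {t : α → ℝ} (ht : ∀ q, 0 ≤ t q) :
    ∏ q ∈ A, (1 + w * t q) - 1 ≤ w * (∏ q ∈ A, (1 + t q) - 1) := by
  classical
  induction A using Finset.induction_on with
  | empty => simp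
  | insert a A ha ih =>
    rw [Finset.prod_insert ha, Finset.prod_insert ha]
    have h1 : ∏ q ∈ A, (1 + w * t q) ≤ ∏ q ∈ A, (1 + t q) := by
      refine Finset.prod_le_prod (fun q _ => ?_) fun q _ => ?_
      · have := mul_nonneg hw (ht q); linarith
      · have := mul_le_of_le_one_left (ht q) hw1; linarith
    have h2 := mul_le_mul_of_nonneg_left h1 (mul_nonneg hw (ht a))
    nlinarith

/-- The covariance, over the noise, of the signal parts of two cycles with covariate links `A`
and `B`. -/
noncomputable def signalCov (mu : ℝ) (A B : Finset (Fin n × Fin p)) (y : Graph m n)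
    (u : Fin p → ℝ) : ℝ :=
  (∏ q ∈ A ∩ B, (1 + signal mu y u q * signal mu y u q)) * (∏ q ∈ A \ B, signal mu y u q) *
    ∏ q ∈ B \ A, signal mu y u q - if A = B then 1 else 0

/-- Each covariate link that belongs to only one of the two cycles contributes a signal, and hence a
factor `n⁻¹ᐟ²`. -/
lemma IsScale.abs_signalCov_le (h : IsScale d lam mu n p k X) (A B : Finset (Fin n × Fin p))
    (y : Graph m n) (u : Fin p → ℝ) :
    |signalCov mu A B y u| ≤ √(n : ℝ)⁻¹ ^ ((A \ B).card + (B \ A).card) *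
      ∏ q ∈ A ∪ B, ((1 + mu) * (1 + u q.2 ^ 2)) := by
  have hmu := h.mu_nonneg
  have hone : ∀ q, 1 ≤ 1 + signal mu y u q * signal mu y u q := fun q => by
    linarith [mul_self_nonneg (signal mu y u q)]
  have hA : ∏ q ∈ A ∩ B, (1 + signal mu y u q * signal mu y u q) ≤
      ∏ q ∈ A ∩ B, ((1 + mu) * (1 + u q.2 ^ 2)) :=
    Finset.prod_le_prod (fun q _ => zero_le_one.trans (hone q))
      fun q _ => h.one_add_signal_sq_le y u q
  have h1 : 1 ≤ ∏ q ∈ A ∩ B, (1 + signal mu y u q * signal mu y u q) :=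
    one_le_prod_of_one_le fun q => hone q
  unfold signalCov
  split_ifs with hc
  · subst hc
    simp only [Finset.sdiff_self, Finset.prod_empty, mul_one, Finset.card_empty, add_zero, pow_zero,
      one_mul, Finset.inter_self, Finset.union_self] at *
    rw [abs_of_nonneg (by linarith)]
    linarith
  · have hs : ∀ S : Finset (Fin n × Fin p), |∏ q ∈ S, signal mu y u q| ≤
        √(n : ℝ)⁻¹ ^ S.card * ∏ q ∈ S, ((1 + mu) * (1 + u q.2 ^ 2)) := by
      intro S
      rw [Finset.abs_prod, ← Finset.prod_const, ← Finset.prod_mul_distrib]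
      exact Finset.prod_le_prod (fun _ _ => abs_nonneg _) fun q _ => abs_signal_le hmu y u q
    have hU : ∏ q ∈ A ∪ B, ((1 + mu) * (1 + u q.2 ^ 2)) =
        (∏ q ∈ A ∩ B, ((1 + mu) * (1 + u q.2 ^ 2))) * (∏ q ∈ A \ B, ((1 + mu) * (1 + u q.2 ^ 2))) *
          ∏ q ∈ B \ A, ((1 + mu) * (1 + u q.2 ^ 2)) := by
      rw [← Finset.prod_union, ← Finset.prod_union]
      · congr 1; ext q; simp only [Finset.mem_union, Finset.mem_inter, Finset.mem_sdiff]; tauto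
      · rw [Finset.disjoint_left]; intro q; simp only [Finset.mem_union, Finset.mem_inter,
          Finset.mem_sdiff]; tauto
      · rw [Finset.disjoint_left]; intro q; simp only [Finset.mem_inter, Finset.mem_sdiff]; tauto
    rw [sub_zero, abs_mul, abs_mul, hU, pow_add, abs_of_nonneg (zero_le_one.trans h1)]
    have p1 : ∀ S : Finset (Fin n × Fin p), 0 ≤ ∏ q ∈ S, ((1 + mu) * (1 + u q.2 ^ 2)) :=
      fun S => Finset.prod_nonneg fun q _ => by positivity
    calc _ ≤ (∏ q ∈ A ∩ B, ((1 + mu) * (1 + u q.2 ^ 2))) *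
          (√(n : ℝ)⁻¹ ^ (A \ B).card * ∏ q ∈ A \ B, ((1 + mu) * (1 + u q.2 ^ 2))) *
          (√(n : ℝ)⁻¹ ^ (B \ A).card * ∏ q ∈ B \ A, ((1 + mu) * (1 + u q.2 ^ 2))) := by
          refine mul_le_mul (mul_le_mul hA (hs _) (abs_nonneg _) (p1 _)) (hs _) (abs_nonneg _) ?_
          exact mul_nonneg (p1 _) (mul_nonneg (by positivity) (p1 _))
      _ = _ := by ring

/-- For equal cycles no link is left over, and the smallness comes from the removal of the pure
noise part. -/
lemma IsScale.abs_signalCov_self_le (h : IsScale d lam mu n p k X) (A : Finset (Fin n × Fin p))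
    (y : Graph m n) (u : Fin p → ℝ) :
    |signalCov mu A A y u| ≤ (n : ℝ)⁻¹ * ∏ q ∈ A, ((1 + mu) * (1 + u q.2 ^ 2)) := by
  have hmu := h.mu_nonneg
  have hone : ∀ q, 1 ≤ 1 + signal mu y u q * signal mu y u q := fun q => by
    linarith [mul_self_nonneg (signal mu y u q)]
  have h1 : 1 ≤ ∏ q ∈ A, (1 + signal mu y u q * signal mu y u q) :=
    one_le_prod_of_one_le fun q => hone q
  have h2 := prod_one_add_mul_sub_one_le h.inv_nonneg h.inv_le_one A
    (t := fun q => mu * u q.2 ^ 2) (fun q => by positivity)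
  have h3 : ∏ q ∈ A, (1 + mu * u q.2 ^ 2) ≤ ∏ q ∈ A, ((1 + mu) * (1 + u q.2 ^ 2)) := by
    refine Finset.prod_le_prod (fun q _ => by positivity) fun q _ => ?_
    nlinarith [sq_nonneg (u q.2)]
  simp only [signalCov, Finset.sdiff_self, Finset.prod_empty, mul_one, Finset.inter_self, if_true]
  rw [abs_of_nonneg (by linarith)]
  simp only [signal_sq hmu]
  refine h2.trans (mul_le_mul_of_nonneg_left (by linarith) h.inv_nonneg)

/-- A bound for the covariance given the labels and the latent vector yields a bound for the
expectation, in which each edge of the networks contributes a factor `1 / n`. The exponent bounds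
the number of the factors: `N ≤ 4 k` covariate links that cost `X ^ 3` each, and `2 k` edges. -/
lemma IsScale.abs_integral_signalPart_mul_le (h : IsScale d lam mu n p k X) {K : CycleType m}
    (hK : 2 ≤ size K) (hk : size K ≤ k) {E E' : Finset (Link m n p)}
    (hE : E ∈ loops m n p K) (hE' : E' ∈ loops m n p K) {c : ℝ} (hc : 0 ≤ c)
    (hcov : ∀ (y : Graph m n) u, |signalCov mu (covSet E) (covSet E') y u| ≤
      c * ∏ q ∈ covSet E ∪ covSet E', ((1 + mu) * (1 + u q.2 ^ 2))) :
    |∫ z, signalPart mu E z * signalPart mu E' z ∂(flatLaw m n p d lam)| ≤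
      c * X ^ (14 * k) * (n : ℝ)⁻¹ ^ (netSet (E ∪ E')).card := by
  have hr := isRing_of_mem_loops hK hE
  have hr' := isRing_of_mem_loops hK hE'
  have hmu := h.mu_nonneg
  have hX := h.pos
  set N := (covSet E ∪ covSet E').card with hN
  have hN4 : N ≤ 4 * k := by
    have h1 := Finset.card_union_le (covSet E) (covSet E')
    rw [card_covSet hK hE, card_covSet hK hE'] at h1
    have : K.2 ≤ size K := Nat.le_add_left _ _
    omega
  have hnet : (netSet (E ∪ E')).card ≤ 2 * k := by
    rw [netSet_union]
    have h1 := Finset.card_union_le (netSet E) (netSet E')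
    rw [card_netSet hK hE, card_netSet hK hE'] at h1
    have : ∑ r, K.1 r ≤ size K := Nat.le_add_right _ _
    omega
  rw [integral_flatLaw d lam ((allLp_signalPart mu E).mul (allLp_signalPart mu E')).integrable]
  have e1 : ∀ (y : Graph m n) (u : Fin p → ℝ) (x : Fin n × Fin p → ℝ),
      signalPart mu E (y, u, x) * signalPart mu E' (y, u, x) =
      edgeInd (netSet (E ∪ E')) y *
        ((∏ q ∈ covSet E, (signal mu y u q + x q) - ∏ q ∈ covSet E, x q) *
        (∏ q ∈ covSet E', (signal mu y u q + x q) - ∏ q ∈ covSet E', x q)) := by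
    intro y u x
    rw [netSet_union, ← edgeInd_mul]
    simp only [signalPart]; ring
  simp only [e1, integral_const_mul,
    integral_shifted_sub_mul ((card_covSet hK hE).trans (card_covSet hK hE').symm)]
  have hu : ∀ y : Graph m n, |∫ u, signalCov mu (covSet E) (covSet E') y u ∂(gaussPi (Fin p))| ≤
      c * X ^ (12 * k) := by
    intro y
    refine (abs_integral_le_of_abs_le ?_ (hcov y)).trans ?_
    · simp only [Finset.prod_mul_distrib]
      exact (((allLp_prod_one_add_sq _).const_mul _).const_mul _).integrable
    · simp only [Finset.prod_mul_distrib, Finset.prod_const]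
      rw [integral_const_mul, integral_const_mul]
      refine mul_le_mul_of_nonneg_left ?_ hc
      have h1 := integral_prod_one_add_sq_le (A := covSet E ∪ covSet E') fun v => by
        have h1 := colCount_union_le (covSet E) (covSet E') v
        have h2 := colCount_covSet hr v
        have h3 := colCount_covSet hr' v
        omega
      have h0 : 0 ≤ gaussBound := zero_le_one.trans one_le_gaussBound
      calc _ ≤ (1 + mu) ^ N * gaussBound ^ N := mul_le_mul_of_nonneg_left h1 (by positivity)
        _ ≤ (X ^ 2) ^ N * X ^ N := by
          have : 1 + mu ≤ X ^ 2 := by nlinarith [h.mu_le, h.two_le]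
          have := h.gauss_le
          gcongr
        _ = X ^ (3 * N) := by rw [← pow_mul, ← pow_add]; congr 1; ring
        _ ≤ _ := h.pow_le_pow (by omega)
  have hint : Integrable (fun y => edgeInd (netSet (E ∪ E')) y * (c * X ^ (12 * k)))
      (graphLaw m n d lam) := Integrable.of_finite
  refine (abs_integral_le_of_abs_le hint fun y => ?_).trans ?_
  · rw [abs_mul, abs_of_nonneg (edgeInd_nonneg _ _)]
    exact mul_le_mul_of_nonneg_left (hu y) (edgeInd_nonneg _ _)
  · rw [integral_mul_const]
    calc _ ≤ (X ^ (netSet (E ∪ E')).card * (n : ℝ)⁻¹ ^ (netSet (E ∪ E')).card) *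
          (c * X ^ (12 * k)) := mul_le_mul_of_nonneg_right (h.integral_edgeInd_le _) (by positivity)
      _ ≤ (X ^ (2 * k) * (n : ℝ)⁻¹ ^ (netSet (E ∪ E')).card) * (c * X ^ (12 * k)) := by
          have := h.pow_le_pow hnet
          gcongr
      _ = _ := by
          rw [show 14 * k = 2 * k + 12 * k by ring, pow_add]; ring

/-- The signal part of the statistic concentrates at its mean. -/
lemma IsScale.integral_sq_signalPart_le (h : IsScale d lam mu n p k X) {K : CycleType m}
    (hK : 2 ≤ size K) (hk : size K ≤ k) (hl : K.2 ≠ 0) (c : ℝ) :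
    ∫ z, (∑ E ∈ loops m n p K, (n : ℝ)⁻¹ ^ K.2 * signalPart mu E z - c) ^ 2
      ∂(flatLaw m n p d lam) ≤
      ((loops m n p K).card * ((n : ℝ)⁻¹ ^ K.2 * ((mu / n) ^ K.2 *
        ((∏ r, (lam r * √(d r)) ^ K.1 r) / n ^ (∑ r, K.1 r)))) - c) ^ 2 +
      2 * (n : ℝ)⁻¹ * X ^ (18 * k) := by
  classical
  have hX := h.pos
  have hw := h.inv_nonneg
  have hm := integral_sq_sum_sub_le (P := flatLaw m n p d lam) (loops m n p K)
    (fun E z => (n : ℝ)⁻¹ ^ K.2 * signalPart mu E z)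
    (fun _ => (n : ℝ)⁻¹ ^ K.2 * ((mu / n) ^ K.2 *
        ((∏ r, (lam r * √(d r)) ^ K.1 r) / n ^ (∑ r, K.1 r)))) c
    (fun E E' => ¬ Disjoint (supp E) (supp E'))
    (fun E _ => ((allLp_signalPart mu E).const_mul _).integrable)
    (fun E _ E' _ =>
      (((allLp_signalPart mu E).const_mul _).mul ((allLp_signalPart mu E').const_mul _)).integrable)
    (fun E hE => by rw [integral_const_mul, integral_signalPart h hK hl hE])
    (fun E _ => by
      have := h.mu_nonneg
      have : 0 ≤ ∏ r, (lam r * √(d r)) ^ K.1 r := Finset.prod_nonneg fun r _ =>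
        pow_nonneg (mul_nonneg (h.lam_nonneg r) (Real.sqrt_nonneg _)) _
      positivity)
    (fun E hE E' hE' hd => by
      have e : ∀ z : Flat m n p, (n : ℝ)⁻¹ ^ K.2 * signalPart mu E z *
          ((n : ℝ)⁻¹ ^ K.2 * signalPart mu E' z) = ((n : ℝ)⁻¹ ^ K.2 * (n : ℝ)⁻¹ ^ K.2) *
          (signalPart mu E z * signalPart mu E' z) := fun z => by ring
      simp only [e]
      rw [integral_const_mul, integral_signalPart_mul_disjoint h hK hl hE hE' (not_not.1 hd),
        integral_signalPart h hK hl hE, integral_signalPart h hK hl hE']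
      ring)
  rw [Finset.sum_const, nsmul_eq_mul] at hm
  refine hm.trans (add_le_add_right ?_ _)
  have e : ∀ (E E' : Finset (Link m n p)) (z : Flat m n p), (n : ℝ)⁻¹ ^ K.2 * signalPart mu E z *
      ((n : ℝ)⁻¹ ^ K.2 * signalPart mu E' z) = (n : ℝ)⁻¹ ^ (2 * K.2) *
      (signalPart mu E z * signalPart mu E' z) := fun E E' z => by ring
  simp only [e, integral_const_mul, abs_mul]
  simp only [abs_of_nonneg (pow_nonneg hw (2 * K.2))]
  -- only pairs of cycles that meet contribute to the variance: the diagonal has an additional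
  -- factor `1 / n` in the covariance, the other pairs have fewer nodes than links
  have key := h.sum_meet_le hK hk hK hk (A := X ^ (14 * k)) (by positivity)
    (a := fun E E' => (n : ℝ)⁻¹ ^ (2 * K.2) *
      |∫ z, signalPart mu E z * signalPart mu E' z ∂(flatLaw m n p d lam)|) ?_ ?_
  · refine le_trans (le_of_eq ?_) (key.trans (le_of_eq ?_))
    · rfl
    · rw [show 18 * k = 14 * k + 4 * k by ring, pow_add]; ring
  · intro E hE _
    have h1 := h.abs_integral_signalPart_mul_le hK hk hE hE hw (fun y u => by
      rw [Finset.union_self]; exact h.abs_signalCov_self_le _ y u)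
    rw [Finset.union_self] at h1
    calc _ ≤ (n : ℝ)⁻¹ ^ (2 * K.2) * ((n : ℝ)⁻¹ * X ^ (14 * k) * (n : ℝ)⁻¹ ^ (netSet E).card) :=
          mul_le_mul_of_nonneg_left h1 (by positivity)
      _ = _ := by rw [unionWeight, card_covSet hK hE, pow_add]; ring
  · intro E hE E' hE' _ _
    have h1 := h.abs_integral_signalPart_mul_le hK hk hE hE' (by positivity)
      (fun y u => h.abs_signalCov_le _ _ y u)
    have c1 := card_covSet hK hE
    have c2 := card_covSet hK hE'
    -- both cycles have the same number of covariate links, so the power of `n⁻¹ᐟ²` is even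
    have c3 := Finset.card_sdiff_add_card (covSet E) (covSet E')
    have c4 := Finset.card_sdiff_add_card (covSet E') (covSet E)
    rw [Finset.union_comm] at c4
    have c5 : (covSet E \ covSet E').card + (covSet E' \ covSet E).card =
        2 * (covSet E \ covSet E').card := by omega
    rw [c5, pow_mul, Real.sq_sqrt hw] at h1
    calc _ ≤ (n : ℝ)⁻¹ ^ (2 * K.2) * ((n : ℝ)⁻¹ ^ (covSet E \ covSet E').card * X ^ (14 * k) *
          (n : ℝ)⁻¹ ^ (netSet (E ∪ E')).card) := mul_le_mul_of_nonneg_left h1 (by positivity)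
      _ = _ := by
          rw [unionWeight, covSet_union, ← c3, c2, pow_add, pow_add]; ring

end

end CycleStat

namespace CycleStat

/-! ### Inner products of gradients of Gaussian monomials -/

section
variable {κ : Type*} [Fintype κ]

lemma allLp_monomial (a : κ → ℕ) : AllLp (fun x : κ → ℝ => ∏ q, x q ^ a q) (gaussPi κ) :=
  AllLp.prod _ fun q _ => (allLp_coord q).pow _

lemma abs_prod_gaussMoment_le {a : κ → ℕ} (ha : ∀ q, a q ≤ 8) {A : Finset κ}
    (hA : ∀ q, q ∉ A → a q = 0) : |∏ q, gaussMoment (a q)| ≤ gaussBound ^ A.card := by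
  rw [← integral_prod_pow]; exact abs_integral_prod_pow_le ha hA

end

section
variable {κ : Type*} [DecidableEq κ]

/-- The derivative of the monomial `∏ q ∈ A, x q` in the coordinate `e`. -/
def monoDeriv (A : Finset κ) (e : κ) (x : κ → ℝ) : ℝ := if e ∈ A then ∏ q ∈ A.erase e, x q else 0

lemma prod_update_eq (A : Finset κ) (x : κ → ℝ) (e : κ) (s : ℝ) :
    ∏ q ∈ A, Function.update x e s q =
      (if e ∈ A then 0 else ∏ q ∈ A, x q) + s * monoDeriv A e x := by
  unfold monoDeriv
  by_cases he : e ∈ A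
  · rw [if_pos he, if_pos he, ← Finset.mul_prod_erase A _ he, Function.update_self, zero_add]
    congr 1
    exact Finset.prod_congr rfl fun q hq => by
      rw [Function.update_of_ne (Finset.mem_erase.1 hq).1]
  · rw [if_neg he, if_neg he, mul_zero, add_zero]
    exact Finset.prod_congr rfl fun q hq => by
      rw [Function.update_of_ne (ne_of_mem_of_not_mem hq he)]

lemma slope_sum_mono {τ : Type*} (S : Finset τ) (A : τ → Finset κ) (a : τ → ℝ) (e : κ) (x : κ → ℝ) :
    slope (fun x => ∑ t ∈ S, a t * ∏ q ∈ A t, x q) e x = ∑ t ∈ S, a t * monoDeriv (A t) e x := by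
  simp only [slope, prod_update_eq]
  rw [← Finset.sum_sub_distrib]
  exact Finset.sum_congr rfl fun t _ => by ring

lemma multiAffine_sum_mono {τ : Type*} (S : Finset τ) (A : τ → Finset κ) (a : τ → ℝ) :
    MultiAffine (fun x : κ → ℝ => ∑ t ∈ S, a t * ∏ q ∈ A t, x q) := by
  intro x e s
  rw [slope_sum_mono]
  simp only [prod_update_eq]
  rw [Finset.mul_sum, ← Finset.sum_add_distrib]
  exact Finset.sum_congr rfl fun t _ => by ring

/-- The exponents of a square-free monomial. -/
def expo (A : Finset κ) (q : κ) : ℕ := if q ∈ A then 1 else 0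

lemma expo_le_one (A : Finset κ) (q : κ) : expo A q ≤ 1 := by unfold expo; split_ifs <;> simp

variable [Fintype κ]

lemma sum_mul_monoDeriv (A : Finset κ) (x : κ → ℝ) :
    ∑ e, x e * monoDeriv A e x = A.card * ∏ q ∈ A, x q := by
  unfold monoDeriv
  simp only [mul_ite, mul_zero]
  rw [Finset.sum_ite_mem, Finset.univ_inter, Finset.sum_congr rfl fun e he =>
    Finset.mul_prod_erase A x he, Finset.sum_const, nsmul_eq_mul]

/-- The inner product of the gradients of two monomials. -/
def gradInner (A B : Finset κ) (x : κ → ℝ) : ℝ := ∑ e, monoDeriv A e x * monoDeriv B e x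

lemma gradInner_eq (A B : Finset κ) (x : κ → ℝ) :
    gradInner A B x = ∑ e ∈ A ∩ B, (∏ q ∈ A.erase e, x q) * ∏ q ∈ B.erase e, x q := by
  unfold gradInner monoDeriv
  rw [← Finset.sum_subset (Finset.subset_univ (A ∩ B))]
  · refine Finset.sum_congr rfl fun e he => ?_
    obtain ⟨h1, h2⟩ := Finset.mem_inter.1 he
    rw [if_pos h1, if_pos h2]
  · intro e _ he
    by_cases h1 : e ∈ A
    · have h2 : e ∉ B := fun h => he (Finset.mem_inter.2 ⟨h1, h⟩)
      rw [if_neg h2, mul_zero]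
    · rw [if_neg h1, zero_mul]

lemma prod_eq_prod_pow_expo (A : Finset κ) (x : κ → ℝ) : ∏ q ∈ A, x q = ∏ q, x q ^ expo A q := by
  simp only [expo, pow_ite, pow_one, pow_zero]
  rw [Finset.prod_ite_mem, Finset.univ_inter]

lemma sum_expo (A : Finset κ) : ∑ q, expo A q = A.card := by simp [expo]

lemma gradInner_mul_gradInner (A B C D : Finset κ) (x : κ → ℝ) :
    gradInner A B x * gradInner C D x = ∑ e ∈ A ∩ B, ∑ e' ∈ C ∩ D,
      ∏ q, x q ^ (expo (A.erase e) q + expo (B.erase e) q + expo (C.erase e') q +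
        expo (D.erase e') q) := by
  rw [gradInner_eq, gradInner_eq, Finset.sum_mul_sum]
  refine Finset.sum_congr rfl fun e _ => Finset.sum_congr rfl fun e' _ => ?_
  rw [prod_eq_prod_pow_expo (A.erase e), prod_eq_prod_pow_expo (B.erase e),
    prod_eq_prod_pow_expo (C.erase e'), prod_eq_prod_pow_expo (D.erase e'),
    ← Finset.prod_mul_distrib, ← Finset.prod_mul_distrib, ← Finset.prod_mul_distrib]
  exact Finset.prod_congr rfl fun q _ => by rw [pow_add, pow_add, pow_add]; ring

lemma allLp_monoDeriv (A : Finset κ) (e : κ) : AllLp (monoDeriv A e) (gaussPi κ) := by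
  unfold monoDeriv
  by_cases h : e ∈ A
  · simp only [if_pos h]; exact AllLp.prod _ fun q _ => allLp_coord q
  · simp only [if_neg h]; exact AllLp.const 0

lemma allLp_gradInner (A B : Finset κ) : AllLp (gradInner A B) (gaussPi κ) :=
  AllLp.sum _ fun e _ => (allLp_monoDeriv A e).mul (allLp_monoDeriv B e)

lemma integral_gradInner_mul (A B C D : Finset κ) :
    ∫ x, gradInner A B x * gradInner C D x ∂(gaussPi κ) = ∑ e ∈ A ∩ B, ∑ e' ∈ C ∩ D,
      ∏ q, gaussMoment (expo (A.erase e) q + expo (B.erase e) q + expo (C.erase e') q +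
        expo (D.erase e') q) := by
  simp only [gradInner_mul_gradInner]
  rw [integral_finsetSum _ fun e _ => integrable_finsetSum _ fun e' _ =>
    (allLp_monomial _).integrable]
  refine Finset.sum_congr rfl fun e _ => ?_
  rw [integral_finsetSum _ fun e' _ => (allLp_monomial _).integrable]
  exact Finset.sum_congr rfl fun e' _ => integral_prod_pow _

lemma integral_gradInner_self (A : Finset κ) : ∫ x, gradInner A A x ∂(gaussPi κ) = A.card := by
  have e1 : ∀ x : κ → ℝ, gradInner A A x = ∑ e ∈ A, ∏ q, x q ^ (2 * expo (A.erase e) q) := by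
    intro x
    rw [gradInner_eq, Finset.inter_self]
    refine Finset.sum_congr rfl fun e _ => ?_
    rw [prod_eq_prod_pow_expo, ← Finset.prod_mul_distrib]
    exact Finset.prod_congr rfl fun q _ => by rw [two_mul, pow_add]
  simp only [e1]
  rw [integral_finsetSum _ fun e _ => (allLp_monomial _).integrable]
  simp only [integral_prod_pow]
  rw [Finset.sum_congr rfl (g := fun _ => (1 : ℝ)), Finset.sum_const, nsmul_eq_mul, mul_one]
  intro e _
  refine Finset.prod_eq_one fun q _ => ?_
  unfold expo
  split_ifs
  · exact gaussMoment_two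
  · exact gaussMoment_zero

lemma integral_gradInner_self_mul_disjoint {A B : Finset κ} (h : Disjoint A B) :
    ∫ x, gradInner A A x * gradInner B B x ∂(gaussPi κ) = A.card * B.card := by
  rw [integral_gradInner_mul, Finset.inter_self, Finset.inter_self]
  rw [Finset.sum_congr rfl (g := fun _ => (B.card : ℝ)), Finset.sum_const, nsmul_eq_mul]
  intro e _
  rw [Finset.sum_congr rfl (g := fun _ => (1 : ℝ)), Finset.sum_const, nsmul_eq_mul, mul_one]
  intro e' _
  refine Finset.prod_eq_one fun q _ => ?_
  unfold expo
  by_cases h1 : q ∈ A.erase e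
  · have h2 : q ∉ B.erase e' := fun h2 =>
      Finset.disjoint_left.1 h (Finset.mem_of_mem_erase h1) (Finset.mem_of_mem_erase h2)
    rw [if_pos h1, if_neg h2]; exact gaussMoment_two
  · by_cases h2 : q ∈ B.erase e'
    · rw [if_neg h1, if_pos h2]; exact gaussMoment_two
    · rw [if_neg h1, if_neg h2]; exact gaussMoment_zero

/-- The mean of a product of two inner products of gradients. It is nonzero only if every link is
used at least twice. -/
lemma abs_integral_gradInner_mul_le (A B C D : Finset κ) :
    |∫ x, gradInner A B x * gradInner C D x ∂(gaussPi κ)| ≤ A.card * C.card *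
      (if 2 * (A ∪ B ∪ C ∪ D).card ≤ A.card + B.card + C.card + D.card then
        gaussBound ^ (A ∪ B ∪ C ∪ D).card else 0) := by
  have hg : 0 ≤ gaussBound := zero_le_one.trans one_le_gaussBound
  set R : ℝ := if 2 * (A ∪ B ∪ C ∪ D).card ≤ A.card + B.card + C.card + D.card then
        gaussBound ^ (A ∪ B ∪ C ∪ D).card else 0 with hR
  have hR0 : 0 ≤ R := by rw [hR]; split_ifs <;> positivity
  have key : ∀ e ∈ A ∩ B, ∀ e' ∈ C ∩ D,
      |∏ q, gaussMoment (expo (A.erase e) q + expo (B.erase e) q + expo (C.erase e') q +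
        expo (D.erase e') q)| ≤ R := by
    intro e he e' he'
    set a : κ → ℕ := fun q => expo (A.erase e) q + expo (B.erase e) q + expo (C.erase e') q +
        expo (D.erase e') q with ha
    by_cases hodd : ∃ q, Odd (a q)
    · obtain ⟨q, hq⟩ := hodd
      rw [Finset.prod_eq_zero (Finset.mem_univ q) (gaussMoment_odd hq), abs_zero]
      exact hR0
    · push Not at hodd
      have hcard : 2 * (A ∪ B ∪ C ∪ D).card ≤ A.card + B.card + C.card + D.card := by
        have h1 : ∑ q, (expo A q + expo B q + expo C q + expo D q) =
            A.card + B.card + C.card + D.card := by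
          simp only [Finset.sum_add_distrib, sum_expo]
        rw [← h1, mul_comm, ← smul_eq_mul, ← Finset.sum_const]
        refine (Finset.sum_le_sum fun q hq => ?_).trans
          (Finset.sum_le_sum_of_subset (Finset.subset_univ _))
        obtain ⟨a1, a2⟩ := Finset.mem_inter.1 he
        obtain ⟨b1, b2⟩ := Finset.mem_inter.1 he'
        by_cases h2 : q = e
        · subst h2; simp [expo, a1, a2]; omega
        by_cases h3 : q = e'
        · subst h3; simp only [expo, if_pos b1, if_pos b2]; omega
        have hev := hodd q
        have e1 : a q = expo A q + expo B q + expo C q + expo D q := by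
          simp [ha, expo, h2, h3]
        rw [Nat.not_odd_iff_even, e1] at hev
        have hpos : 0 < expo A q + expo B q + expo C q + expo D q := by
          simp only [Finset.mem_union] at hq
          rcases hq with ((hq | hq) | hq) | hq <;> simp [expo, hq]
        obtain ⟨c, hc⟩ := hev
        omega
      rw [hR, if_pos hcard]
      refine abs_prod_gaussMoment_le (fun q => ?_) fun q hq => ?_
      · have h1 := expo_le_one (A.erase e) q
        have h2 := expo_le_one (B.erase e) q
        have h3 := expo_le_one (C.erase e') q
        have h4 := expo_le_one (D.erase e') q
        omega
      · simp only [Finset.mem_union, not_or] at hq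
        simp [expo, hq]
  rw [integral_gradInner_mul]
  calc _ ≤ ∑ e ∈ A ∩ B, ∑ e' ∈ C ∩ D, R :=
        (Finset.abs_sum_le_sum_abs _ _).trans (Finset.sum_le_sum fun e he =>
          (Finset.abs_sum_le_sum_abs _ _).trans (Finset.sum_le_sum fun e' he' => key e he e' he'))
    _ = (A ∩ B).card * ((C ∩ D).card * R) := by simp
    _ ≤ A.card * (C.card * R) := by
        have h1 : ((A ∩ B).card : ℝ) ≤ A.card := by
          exact_mod_cast Finset.card_le_card Finset.inter_subset_left
        have h2 : ((C ∩ D).card : ℝ) ≤ C.card := by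
          exact_mod_cast Finset.card_le_card Finset.inter_subset_left
        gcongr
    _ = _ := by ring

end

end CycleStat

namespace CycleStat

variable {m n p : ℕ}

/-! ### Fluctuations of the matrix of gradients -/

/-- The joint law of the labels, the networks and the noise. -/
noncomputable abbrev noiseLaw (m n p : ℕ) (d lam : Fin m → ℝ) :
    Measure (Graph m n × (Fin n × Fin p → ℝ)) :=
  (graphLaw m n d lam).prod (gaussPi (Fin n × Fin p))

section
variable {d lam : Fin m → ℝ} {mu : ℝ} {k : ℕ} {X : ℝ}

lemma allLp_graph_noise {f : Graph m n → ℝ} {g : (Fin n × Fin p → ℝ) → ℝ}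
    (hg : AllLp g (gaussPi (Fin n × Fin p))) :
    AllLp (fun z => f z.1 * g z.2) (noiseLaw m n p d lam) := by
  have : AllLp f (graphLaw m n d lam) := fun q => MemLp.of_discrete
  exact (this.comp measurePreserving_fst).mul (hg.comp measurePreserving_snd)

lemma integral_graph_noise (f : Graph m n → ℝ) (g : (Fin n × Fin p → ℝ) → ℝ) :
    ∫ z, f z.1 * g z.2 ∂(noiseLaw m n p d lam) =
      (∫ y, f y ∂(graphLaw m n d lam)) * ∫ x, g x ∂(gaussPi (Fin n × Fin p)) :=
  integral_prod_mul f g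

/-- The contribution of a cycle to the squared norm of the gradient. -/
noncomputable def gradPart (E : Finset (Link m n p)) (z : Graph m n × (Fin n × Fin p → ℝ)) : ℝ :=
  edgeInd (netSet E) z.1 * gradInner (covSet E) (covSet E) z.2

lemma allLp_gradPart (E : Finset (Link m n p)) : AllLp (gradPart E) (noiseLaw m n p d lam) :=
  allLp_graph_noise (allLp_gradInner _ _)

/-- The mean squared gradient of a cycle: a product of `2 ℓ` standard Gaussian variables has the
mean squared gradient `2 ℓ`. -/
lemma IsScale.integral_gradPart (h : IsScale d lam mu n p k X) {K : CycleType m} (hK : 2 ≤ size K)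
    (hl : K.2 ≠ 0) {E : Finset (Link m n p)} (hE : E ∈ loops m n p K) :
    ∫ z, gradPart E z ∂(noiseLaw m n p d lam) =
      (∏ r, d r ^ K.1 r) / n ^ (∑ r, K.1 r) * (2 * K.2 : ℕ) := by
  simp only [gradPart]
  rw [integral_graph_noise (edgeInd (netSet E)) (gradInner (covSet E) (covSet E)),
    integral_gradInner_self, card_covSet hK hE, (integral_edgeInd_loop h.d_nonneg h.lam_nonneg
    h.lam_le h.n_pos (fun j => (h.d_le j).trans h.le_n) hK hE).1, zero_pow hl, mul_zero, add_zero]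

/-- Cycles without common nodes have uncorrelated squared gradients. -/
lemma IsScale.integral_gradPart_mul_disjoint (h : IsScale d lam mu n p k X) {K : CycleType m}
    (hK : 2 ≤ size K) (hl : K.2 ≠ 0) {E E' : Finset (Link m n p)} (hE : E ∈ loops m n p K)
    (hE' : E' ∈ loops m n p K) (hd : Disjoint (supp E) (supp E')) :
    ∫ z, gradPart E z * gradPart E' z ∂(noiseLaw m n p d lam) =
      (∫ z, gradPart E z ∂(noiseLaw m n p d lam)) *
        ∫ z, gradPart E' z ∂(noiseLaw m n p d lam) := by
  have e : ∀ z : Graph m n × (Fin n × Fin p → ℝ), gradPart E z * gradPart E' z =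
      (edgeInd (netSet E) z.1 * edgeInd (netSet E') z.1) *
      (gradInner (covSet E) (covSet E) z.2 * gradInner (covSet E') (covSet E') z.2) := fun z => by
    simp only [gradPart]; ring
  have hloop := fun (F : Finset (Link m n p)) (hF : F ∈ loops m n p K) =>
    (integral_edgeInd_loop h.d_nonneg h.lam_nonneg h.lam_le h.n_pos
    (fun j => (h.d_le j).trans h.le_n) hK hF).1
  have hm := integral_edgeInd_mul_disjoint d lam (isRing_of_mem_loops hK hE).minDegTwo
    (isRing_of_mem_loops hK hE').minDegTwo (disjoint_supp hd).1 (fun _ => 1) (fun _ => 1)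
    (fun _ _ _ => rfl) (fun _ _ _ => rfl)
  simp only [mul_one] at hm
  rw [h.integral_gradPart hK hl hE, h.integral_gradPart hK hl hE']
  simp only [e]
  rw [integral_graph_noise (fun y => edgeInd (netSet E) y * edgeInd (netSet E') y)
    (fun x => gradInner (covSet E) (covSet E) x * gradInner (covSet E') (covSet E') x), hm,
    hloop E hE, hloop E' hE', zero_pow hl,
    integral_gradInner_self_mul_disjoint (disjoint_covSet hd), card_covSet hK hE,
    card_covSet hK hE']
  ring

lemma card_covSet_le {K : CycleType m} (hK : 2 ≤ size K) (hk : size K ≤ k)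
    {E : Finset (Link m n p)} (hE : E ∈ loops m n p K) : (covSet E).card ≤ 2 * k := by
  rw [card_covSet hK hE]
  have : K.2 ≤ size K := Nat.le_add_left _ _
  omega

lemma card_netSet_le {K : CycleType m} (hK : 2 ≤ size K) (hk : size K ≤ k)
    {E : Finset (Link m n p)} (hE : E ∈ loops m n p K) : (netSet E).card ≤ k := by
  rw [card_netSet hK hE]
  have : ∑ r, K.1 r ≤ size K := Nat.le_add_right _ _
  omega

lemma IsScale.gaussBound_pow_le (h : IsScale d lam mu n p k X) {a b : ℕ} (hab : a ≤ b) :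
    gaussBound ^ a ≤ X ^ b :=
  (pow_le_pow_left₀ (zero_le_one.trans one_le_gaussBound) h.gauss_le _).trans (h.pow_le_pow hab)

/-- The second moments of the squared gradients: each of the at most `4 k` Gaussian variables
contributes a moment of bounded order, and each of the at most `2 k` edges a factor `X / n`. -/
lemma IsScale.abs_integral_gradPart_mul_le (h : IsScale d lam mu n p k X) {K : CycleType m}
    (hK : 2 ≤ size K) (hk : size K ≤ k) {E E' : Finset (Link m n p)}
    (hE : E ∈ loops m n p K) (hE' : E' ∈ loops m n p K) :
    |∫ z, gradPart E z * gradPart E' z ∂(noiseLaw m n p d lam)| ≤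
      (2 * K.2 : ℕ) ^ 2 * X ^ (6 * k) * (n : ℝ)⁻¹ ^ (netSet (E ∪ E')).card := by
  have hX := h.pos
  have e : ∀ z : Graph m n × (Fin n × Fin p → ℝ), gradPart E z * gradPart E' z =
      edgeInd (netSet (E ∪ E')) z.1 *
      (gradInner (covSet E) (covSet E) z.2 * gradInner (covSet E') (covSet E') z.2) := fun z => by
    rw [netSet_union, ← edgeInd_mul]
    simp only [gradPart]; ring
  simp only [e]
  rw [integral_graph_noise (edgeInd (netSet (E ∪ E')))
    (fun x => gradInner (covSet E) (covSet E) x * gradInner (covSet E') (covSet E') x), abs_mul,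
    abs_of_nonneg (integral_nonneg fun y => edgeInd_nonneg _ y)]
  have hnet : (netSet (E ∪ E')).card ≤ 2 * k := by
    rw [netSet_union]
    have h1 := Finset.card_union_le (netSet E) (netSet E')
    have h2 := card_netSet_le hK hk hE
    have h3 := card_netSet_le hK hk hE'
    omega
  have hcov : (covSet E ∪ covSet E ∪ covSet E' ∪ covSet E').card ≤ 4 * k := by
    have h0 : covSet E ∪ covSet E ∪ covSet E' ∪ covSet E' = covSet E ∪ covSet E' := by
      ext q; simp
    rw [h0]
    have h1 := Finset.card_union_le (covSet E) (covSet E')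
    have h2 := card_covSet_le hK hk hE
    have h3 := card_covSet_le hK hk hE'
    omega
  have hg : |∫ x, gradInner (covSet E) (covSet E) x * gradInner (covSet E') (covSet E') x
      ∂(gaussPi (Fin n × Fin p))| ≤ (2 * K.2 : ℕ) ^ 2 * X ^ (4 * k) := by
    refine (abs_integral_gradInner_mul_le _ _ _ _).trans ?_
    rw [card_covSet hK hE, card_covSet hK hE', sq]
    refine mul_le_mul_of_nonneg_left ?_ (by positivity)
    split_ifs
    · exact h.gaussBound_pow_le hcov
    · positivity
  calc _ ≤ (X ^ (netSet (E ∪ E')).card * (n : ℝ)⁻¹ ^ (netSet (E ∪ E')).card) *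
        ((2 * K.2 : ℕ) ^ 2 * X ^ (4 * k)) :=
        mul_le_mul (h.integral_edgeInd_le _) hg (abs_nonneg _) (by positivity)
    _ ≤ (X ^ (2 * k) * (n : ℝ)⁻¹ ^ (netSet (E ∪ E')).card) *
        ((2 * K.2 : ℕ) ^ 2 * X ^ (4 * k)) := by
        have := h.pow_le_pow hnet
        gcongr
    _ = _ := by rw [show 6 * k = 2 * k + 4 * k by ring, pow_add]; ring

/-- The diagonal of the matrix of gradients concentrates. -/
lemma IsScale.integral_sq_gradPart_le (h : IsScale d lam mu n p k X) {K : CycleType m}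
    (hK : 2 ≤ size K) (hk : size K ≤ k) (hl : K.2 ≠ 0) {τ : ℝ} (c : ℝ) :
    ∫ z, (∑ E ∈ loops m n p K, ((2 * K.2 : ℕ) : ℝ)⁻¹ * (τ * (n : ℝ)⁻¹ ^ K.2) ^ 2 * gradPart E z
        - c) ^ 2 ∂(noiseLaw m n p d lam) ≤
      ((loops m n p K).card * ((τ * (n : ℝ)⁻¹ ^ K.2) ^ 2 *
        ((∏ r, d r ^ K.1 r) / n ^ (∑ r, K.1 r))) - c) ^ 2 +
      2 * τ ^ 4 * (n : ℝ)⁻¹ * X ^ (10 * k) := by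
  classical
  have hX := h.pos
  have hw := h.inv_nonneg
  have hq : ((2 * K.2 : ℕ) : ℝ) ≠ 0 := by
    have : 2 * K.2 ≠ 0 := by omega
    exact_mod_cast this
  set q : ℝ := ((2 * K.2 : ℕ) : ℝ) with hqdef
  set s : ℝ := (τ * (n : ℝ)⁻¹ ^ K.2) ^ 2 with hs
  have hs0 : 0 ≤ s := sq_nonneg _
  have hq0 : 0 ≤ q := by rw [hqdef]; positivity
  have hmean : ∀ E ∈ loops m n p K, ∫ z, q⁻¹ * s * gradPart E z ∂(noiseLaw m n p d lam) =
      s * ((∏ r, d r ^ K.1 r) / n ^ (∑ r, K.1 r)) := by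
    intro E hE
    rw [integral_const_mul, h.integral_gradPart hK hl hE, ← hqdef]
    field_simp
  have e : ∀ (E E' : Finset (Link m n p)) (z : Graph m n × (Fin n × Fin p → ℝ)),
      q⁻¹ * s * gradPart E z * (q⁻¹ * s * gradPart E' z) = (q⁻¹ * s) ^ 2 *
      (gradPart E z * gradPart E' z) := fun E E' z => by ring
  have hm := integral_sq_sum_sub_le (P := noiseLaw m n p d lam) (loops m n p K)
    (fun E z => q⁻¹ * s * gradPart E z)
    (fun _ => s * ((∏ r, d r ^ K.1 r) / n ^ (∑ r, K.1 r))) c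
    (fun E E' => ¬ Disjoint (supp E) (supp E'))
    (fun E _ => ((allLp_gradPart E).const_mul _).integrable)
    (fun E _ E' _ =>
      (((allLp_gradPart E).const_mul _).mul ((allLp_gradPart E').const_mul _)).integrable)
    hmean
    (fun E _ => by
      have : 0 ≤ ∏ r, d r ^ K.1 r := Finset.prod_nonneg fun r _ => pow_nonneg (h.d_nonneg r) _
      positivity)
    (fun E hE E' hE' hd => by
      have a := hmean E hE
      have b := hmean E' hE'
      rw [integral_const_mul] at a b
      simp only [e]
      rw [integral_const_mul, h.integral_gradPart_mul_disjoint hK hl hE hE' (not_not.1 hd)]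
      calc _ = (q⁻¹ * s * ∫ z, gradPart E z ∂(noiseLaw m n p d lam)) *
            (q⁻¹ * s * ∫ z, gradPart E' z ∂(noiseLaw m n p d lam)) := by ring
        _ = _ := by rw [a, b])
  rw [Finset.sum_const, nsmul_eq_mul] at hm
  refine hm.trans (add_le_add_right ?_ _)
  simp only [e, integral_const_mul, abs_mul]
  simp only [abs_of_nonneg (sq_nonneg (q⁻¹ * s))]
  have hbase : ∀ E ∈ loops m n p K, ∀ E' ∈ loops m n p K, (q⁻¹ * s) ^ 2 *
      |∫ z, gradPart E z * gradPart E' z ∂(noiseLaw m n p d lam)| ≤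
      τ ^ 4 * X ^ (6 * k) * ((n : ℝ)⁻¹ ^ (4 * K.2) * (n : ℝ)⁻¹ ^ (netSet (E ∪ E')).card) := by
    intro E hE E' hE'
    refine (mul_le_mul_of_nonneg_left (h.abs_integral_gradPart_mul_le hK hk hE hE')
      (sq_nonneg _)).trans (le_of_eq ?_)
    rw [← hqdef, hs, show 4 * K.2 = K.2 * 4 by ring, pow_mul]
    field_simp
    ring
  have hpow : ∀ a b : ℕ, a ≤ b → (n : ℝ)⁻¹ ^ b ≤ (n : ℝ)⁻¹ ^ a := fun a b hab =>
    pow_le_pow_of_le_one hw h.inv_le_one hab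
  have key := h.sum_meet_le hK hk hK hk (A := τ ^ 4 * X ^ (6 * k)) (by positivity)
    (a := fun E E' => (q⁻¹ * s) ^ 2 *
      |∫ z, gradPart E z * gradPart E' z ∂(noiseLaw m n p d lam)|) ?_ ?_
  · refine le_trans (le_of_eq rfl) (key.trans (le_of_eq ?_))
    rw [show 10 * k = 6 * k + 4 * k by ring, pow_add]; ring
  · intro E hE _
    refine (hbase E hE E hE).trans (mul_le_mul_of_nonneg_left ?_ (by positivity))
    rw [unionWeight, Finset.union_self, ← pow_add, ← pow_succ']
    refine hpow _ _ ?_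
    rw [card_covSet hK hE]; omega
  · intro E hE E' hE' _ _
    refine (hbase E hE E' hE').trans (mul_le_mul_of_nonneg_left ?_ (by positivity))
    rw [unionWeight, ← pow_add]
    refine hpow _ _ ?_
    have h1 := Finset.card_union_le (covSet E) (covSet E')
    rw [← covSet_union, card_covSet hK hE, card_covSet hK hE'] at h1
    omega

open Classical in
/-- The contribution of pairs of distinct cycles to the matrix of gradients. -/
noncomputable def crossPart (m n p : ℕ) (K K' : CycleType m)
    (z : Graph m n × (Fin n × Fin p → ℝ)) : ℝ :=
  ∑ E ∈ loops m n p K, ∑ E' ∈ loops m n p K', if E ≠ E' then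
    edgeInd (netSet E ∪ netSet E') z.1 * gradInner (covSet E) (covSet E') z.2 else 0

lemma allLp_crossPart (K K' : CycleType m) :
    AllLp (crossPart m n p K K') (noiseLaw m n p d lam) := by
  classical
  refine AllLp.sum _ fun E _ => AllLp.sum _ fun E' _ => ?_
  by_cases hc : E ≠ E'
  · simp only [if_pos hc]; exact allLp_graph_noise (allLp_gradInner _ _)
  · simp only [if_neg hc]; exact AllLp.const 0

lemma gradInner_eq_zero {κ : Type*} [DecidableEq κ] [Fintype κ] {A B : Finset κ}
    (h : Disjoint A B) (x : κ → ℝ) : gradInner A B x = 0 := by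
  rw [gradInner_eq, Finset.disjoint_iff_inter_eq_empty.1 h, Finset.sum_empty]

/-- The normalization contributes a factor `1 / n` for every two covariate links of the four cycles.
This is at least one factor for each link of their union, because the mean of the product is zero
unless the links of the union are covered twice on average. -/
lemma IsScale.abs_integral_gradInner_pair_le (h : IsScale d lam mu n p k X) {K K' : CycleType m}
    (hK : 2 ≤ size K) (hk : size K ≤ k) (hl : K.2 ≠ 0) (hK' : 2 ≤ size K') (hk' : size K' ≤ k)
    {τ τ' : ℝ} {E₁ E₂ E₃ E₄ : Finset (Link m n p)} (h₁ : E₁ ∈ loops m n p K)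
    (h₂ : E₂ ∈ loops m n p K') (h₃ : E₃ ∈ loops m n p K) (h₄ : E₄ ∈ loops m n p K') :
    (((2 * K.2 : ℕ) : ℝ)⁻¹ * ((τ * (n : ℝ)⁻¹ ^ K.2) * (τ' * (n : ℝ)⁻¹ ^ K'.2))) ^ 2 *
      |∫ x, gradInner (covSet E₁) (covSet E₂) x * gradInner (covSet E₃) (covSet E₄) x
        ∂(gaussPi (Fin n × Fin p))| ≤
      τ ^ 2 * τ' ^ 2 * X ^ (8 * k) * (n : ℝ)⁻¹ ^ (covSet (E₁ ∪ E₂ ∪ E₃ ∪ E₄)).card := by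
  have hX := h.pos
  have hw := h.inv_nonneg
  have hq : ((2 * K.2 : ℕ) : ℝ) ≠ 0 := by
    have : 2 * K.2 ≠ 0 := by omega
    exact_mod_cast this
  set q : ℝ := ((2 * K.2 : ℕ) : ℝ) with hqdef
  have hcovU : covSet (E₁ ∪ E₂ ∪ E₃ ∪ E₄) = covSet E₁ ∪ covSet E₂ ∪ covSet E₃ ∪ covSet E₄ := by
    rw [covSet_union, covSet_union, covSet_union]
  have hcov : (covSet (E₁ ∪ E₂ ∪ E₃ ∪ E₄)).card ≤ 8 * k := by
    rw [hcovU]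
    have a1 := Finset.card_union_le (covSet E₁ ∪ covSet E₂ ∪ covSet E₃) (covSet E₄)
    have a2 := Finset.card_union_le (covSet E₁ ∪ covSet E₂) (covSet E₃)
    have a3 := Finset.card_union_le (covSet E₁) (covSet E₂)
    have b1 := card_covSet_le hK hk h₁
    have b2 := card_covSet_le hK' hk' h₂
    have b3 := card_covSet_le hK hk h₃
    have b4 := card_covSet_le hK' hk' h₄
    omega
  have hg := abs_integral_gradInner_mul_le (covSet E₁) (covSet E₂) (covSet E₃) (covSet E₄)
  rw [card_covSet hK h₁, card_covSet hK' h₂, card_covSet hK h₃, card_covSet hK' h₄, ← hqdef,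
    ← hcovU] at hg
  generalize (covSet (E₁ ∪ E₂ ∪ E₃ ∪ E₄)).card = c at hg hcov ⊢
  refine (mul_le_mul_of_nonneg_left hg (sq_nonneg _)).trans ?_
  split_ifs with hcard
  · have e5 : (q⁻¹ * ((τ * (n : ℝ)⁻¹ ^ K.2) * (τ' * (n : ℝ)⁻¹ ^ K'.2))) ^ 2 *
          (q * q * gaussBound ^ c) =
        τ ^ 2 * τ' ^ 2 * gaussBound ^ c * (n : ℝ)⁻¹ ^ (2 * K.2 + 2 * K'.2) := by
      rw [pow_add, mul_comm 2 K.2, mul_comm 2 K'.2, pow_mul, pow_mul]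
      generalize (n : ℝ)⁻¹ ^ K.2 = a
      generalize (n : ℝ)⁻¹ ^ K'.2 = b
      field_simp
    rw [e5]
    have b1 := h.gaussBound_pow_le hcov
    have b2 : (n : ℝ)⁻¹ ^ (2 * K.2 + 2 * K'.2) ≤ (n : ℝ)⁻¹ ^ c :=
      pow_le_pow_of_le_one hw h.inv_le_one (by omega)
    have := one_le_gaussBound
    gcongr
  · rw [mul_zero, mul_zero]; positivity

/-- The contribution of four cycles to the second moment of `crossPart`. -/
lemma IsScale.integral_cross_pair_le (h : IsScale d lam mu n p k X) {K K' : CycleType m}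
    (hK : 2 ≤ size K) (hk : size K ≤ k) (hl : K.2 ≠ 0) (hK' : 2 ≤ size K') (hk' : size K' ≤ k)
    {τ τ' : ℝ} {E₁ E₂ E₃ E₄ : Finset (Link m n p)} (h₁ : E₁ ∈ loops m n p K)
    (h₂ : E₂ ∈ loops m n p K') (h₃ : E₃ ∈ loops m n p K) (h₄ : E₄ ∈ loops m n p K') :
    (((2 * K.2 : ℕ) : ℝ)⁻¹ * ((τ * (n : ℝ)⁻¹ ^ K.2) * (τ' * (n : ℝ)⁻¹ ^ K'.2))) ^ 2 *
      ∫ z, edgeInd (netSet (E₁ ∪ E₂ ∪ E₃ ∪ E₄)) z.1 *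
        (gradInner (covSet E₁) (covSet E₂) z.2 * gradInner (covSet E₃) (covSet E₄) z.2)
        ∂(noiseLaw m n p d lam) ≤
      τ ^ 2 * τ' ^ 2 * X ^ (12 * k) * unionWeight (E₁ ∪ E₂ ∪ E₃ ∪ E₄) := by
  have hX := h.pos
  have hw := h.inv_nonneg
  rw [integral_graph_noise (edgeInd (netSet (E₁ ∪ E₂ ∪ E₃ ∪ E₄)))
    (fun x => gradInner (covSet E₁) (covSet E₂) x * gradInner (covSet E₃) (covSet E₄) x)]
  have hg' := h.abs_integral_gradInner_pair_le hK hk hl hK' hk' (τ := τ) (τ' := τ') h₁ h₂ h₃ h₄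
  have hnet : (netSet (E₁ ∪ E₂ ∪ E₃ ∪ E₄)).card ≤ 4 * k := by
    rw [netSet_union, netSet_union, netSet_union]
    have a1 := Finset.card_union_le (netSet E₁ ∪ netSet E₂ ∪ netSet E₃) (netSet E₄)
    have a2 := Finset.card_union_le (netSet E₁ ∪ netSet E₂) (netSet E₃)
    have a3 := Finset.card_union_le (netSet E₁) (netSet E₂)
    have b1 := card_netSet_le hK hk h₁
    have b2 := card_netSet_le hK' hk' h₂
    have b3 := card_netSet_le hK hk h₃
    have b4 := card_netSet_le hK' hk' h₄
    omega
  have hI : 0 ≤ ∫ y, edgeInd (netSet (E₁ ∪ E₂ ∪ E₃ ∪ E₄)) y ∂(graphLaw m n d lam) :=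
    integral_nonneg fun y => edgeInd_nonneg _ y
  have hI' := h.integral_edgeInd_le (netSet (E₁ ∪ E₂ ∪ E₃ ∪ E₄))
  have hX' := h.pow_le_pow hnet
  unfold unionWeight
  rw [show 12 * k = 4 * k + 8 * k by ring, pow_add, pow_add]
  have hQ0 := sq_nonneg (((2 * K.2 : ℕ) : ℝ)⁻¹ * ((τ * (n : ℝ)⁻¹ ^ K.2) * (τ' * (n : ℝ)⁻¹ ^ K'.2)))
  generalize (((2 * K.2 : ℕ) : ℝ)⁻¹ * ((τ * (n : ℝ)⁻¹ ^ K.2) * (τ' * (n : ℝ)⁻¹ ^ K'.2))) ^ 2 = Q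
    at hg' hQ0 ⊢
  generalize hJ : ∫ x, gradInner (covSet E₁) (covSet E₂) x *
    gradInner (covSet E₃) (covSet E₄) x ∂(gaussPi (Fin n × Fin p)) = J at hg' ⊢
  generalize ∫ y, edgeInd (netSet (E₁ ∪ E₂ ∪ E₃ ∪ E₄)) y ∂(graphLaw m n d lam) = I at hI hI' ⊢
  -- the integral `J` may be negative, in which case there is nothing to prove
  by_cases hQ : Q * J ≤ 0
  · calc Q * (I * J) = I * (Q * J) := by ring
      _ ≤ 0 := mul_nonpos_of_nonneg_of_nonpos hI hQ
      _ ≤ _ := by positivity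
  · push Not at hQ
    have hQJ : Q * J ≤ τ ^ 2 * τ' ^ 2 * X ^ (8 * k) *
        (n : ℝ)⁻¹ ^ (covSet (E₁ ∪ E₂ ∪ E₃ ∪ E₄)).card := by
      exact (mul_le_mul_of_nonneg_left (le_abs_self _) hQ0).trans hg'
    calc Q * (I * J) = I * (Q * J) := by ring
      _ ≤ (X ^ (4 * k) * (n : ℝ)⁻¹ ^ (netSet (E₁ ∪ E₂ ∪ E₃ ∪ E₄)).card) *
          (τ ^ 2 * τ' ^ 2 * X ^ (8 * k) * (n : ℝ)⁻¹ ^ (covSet (E₁ ∪ E₂ ∪ E₃ ∪ E₄)).card) := by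
          refine mul_le_mul (hI'.trans ?_) hQJ hQ.le (by positivity)
          gcongr
      _ = _ := by ring

/-- Pairs of distinct cycles do not contribute to the matrix of gradients: in the second moment
every link is used twice, and two distinct cycles share a link. -/
lemma IsScale.integral_sq_crossPart_le (h : IsScale d lam mu n p k X) {K K' : CycleType m}
    (hK : 2 ≤ size K) (hk : size K ≤ k) (hl : K.2 ≠ 0) (hK' : 2 ≤ size K') (hk' : size K' ≤ k)
    {τ τ' : ℝ} :
    ∫ z, (((2 * K.2 : ℕ) : ℝ)⁻¹ * ((τ * (n : ℝ)⁻¹ ^ K.2) * (τ' * (n : ℝ)⁻¹ ^ K'.2)) *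
      crossPart m n p K K' z) ^ 2 ∂(noiseLaw m n p d lam) ≤
      τ ^ 2 * τ' ^ 2 * (n : ℝ)⁻¹ * X ^ (20 * k) := by
  classical
  have hX := h.pos
  have hw := h.inv_nonneg
  have hq : ((2 * K.2 : ℕ) : ℝ) ≠ 0 := by
    have : 2 * K.2 ≠ 0 := by omega
    exact_mod_cast this
  set q : ℝ := ((2 * K.2 : ℕ) : ℝ) with hqdef
  have hq0 : 0 ≤ q := by rw [hqdef]; positivity
  set s : ℝ := (τ * (n : ℝ)⁻¹ ^ K.2) * (τ' * (n : ℝ)⁻¹ ^ K'.2) with hs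
  set term : Finset (Link m n p) → Finset (Link m n p) → Graph m n × (Fin n × Fin p → ℝ) → ℝ :=
    fun E E' z => if E ≠ E' then
      edgeInd (netSet E ∪ netSet E') z.1 * gradInner (covSet E) (covSet E') z.2 else 0 with hterm
  have hterm_int : ∀ E E' F F', Integrable (fun z => term E E' z * term F F' z)
      (noiseLaw m n p d lam) := by
    have h1 : ∀ E E', AllLp (term E E') (noiseLaw m n p d lam) := by
      intro E E'
      by_cases hc : E ≠ E'
      · simp only [hterm, if_pos hc]; exact allLp_graph_noise (allLp_gradInner _ _)
      · simp only [hterm, if_neg hc]; exact AllLp.const 0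
    exact fun E E' F F' => ((h1 E E').mul (h1 F F')).integrable
  have e1 : ∀ z, (q⁻¹ * s * crossPart m n p K K' z) ^ 2 = (q⁻¹ * s) ^ 2 *
      ∑ E₁ ∈ loops m n p K, ∑ E₂ ∈ loops m n p K', ∑ E₃ ∈ loops m n p K, ∑ E₄ ∈ loops m n p K',
        term E₁ E₂ z * term E₃ E₄ z := by
    intro z
    have : crossPart m n p K K' z = ∑ E ∈ loops m n p K, ∑ E' ∈ loops m n p K', term E E' z := rfl
    rw [mul_pow, this, sq (∑ E ∈ loops m n p K, ∑ E' ∈ loops m n p K', term E E' z)]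
    congr 1
    simp only [Finset.sum_mul, Finset.mul_sum]
    exact Finset.sum_congr rfl fun _ _ => Finset.sum_congr rfl fun _ _ =>
      Finset.sum_congr rfl fun _ _ => Finset.sum_congr rfl fun _ _ => mul_comm _ _
  simp only [e1]
  rw [integral_const_mul, integral_finsetSum _ fun E₁ _ => integrable_finsetSum _ fun E₂ _ =>
    integrable_finsetSum _ fun E₃ _ => integrable_finsetSum _ fun E₄ _ => hterm_int _ _ _ _]
  have e2 : ∀ E₁, ∫ z, ∑ E₂ ∈ loops m n p K', ∑ E₃ ∈ loops m n p K, ∑ E₄ ∈ loops m n p K',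
        term E₁ E₂ z * term E₃ E₄ z ∂(noiseLaw m n p d lam) =
      ∑ E₂ ∈ loops m n p K', ∑ E₃ ∈ loops m n p K, ∑ E₄ ∈ loops m n p K',
        ∫ z, term E₁ E₂ z * term E₃ E₄ z ∂(noiseLaw m n p d lam) := by
    intro E₁
    rw [integral_finsetSum _ fun E₂ _ =>
      integrable_finsetSum _ fun E₃ _ => integrable_finsetSum _ fun E₄ _ => hterm_int _ _ _ _]
    refine Finset.sum_congr rfl fun E₂ _ => ?_
    rw [integral_finsetSum _ fun E₃ _ => integrable_finsetSum _ fun E₄ _ => hterm_int _ _ _ _]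
    refine Finset.sum_congr rfl fun E₃ _ => ?_
    rw [integral_finsetSum _ fun E₄ _ => hterm_int _ _ _ _]
  simp only [e2]
  have hmain : ∀ E₁ ∈ loops m n p K, ∀ E₂ ∈ loops m n p K', ∀ E₃ ∈ loops m n p K,
      ∀ E₄ ∈ loops m n p K', (q⁻¹ * s) ^ 2 *
        ∫ z, term E₁ E₂ z * term E₃ E₄ z ∂(noiseLaw m n p d lam) ≤
      τ ^ 2 * τ' ^ 2 * X ^ (12 * k) * (if E₁ ≠ E₂ ∧ ¬ Disjoint (supp E₁) (supp E₂) then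
        unionWeight (E₁ ∪ E₂ ∪ E₃ ∪ E₄) else 0) := by
    intro E₁ h₁ E₂ h₂ E₃ h₃ E₄ h₄
    have hu := unionWeight_nonneg (E₁ ∪ E₂ ∪ E₃ ∪ E₄)
    by_cases hc : E₁ ≠ E₂ ∧ ¬ Disjoint (supp E₁) (supp E₂)
    · rw [if_pos hc]
      by_cases hc' : E₃ ≠ E₄
      · have e3 : ∀ z, term E₁ E₂ z * term E₃ E₄ z = edgeInd (netSet (E₁ ∪ E₂ ∪ E₃ ∪ E₄)) z.1 *
            (gradInner (covSet E₁) (covSet E₂) z.2 * gradInner (covSet E₃) (covSet E₄) z.2) := by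
          intro z
          simp only [hterm, if_pos hc.1, if_pos hc']
          rw [netSet_union, netSet_union, netSet_union, Finset.union_assoc (_ ∪ _),
            ← edgeInd_mul (netSet E₁ ∪ netSet E₂)]
          ring
        simp only [e3]
        exact h.integral_cross_pair_le hK hk hl hK' hk' h₁ h₂ h₃ h₄
      · simp only [hterm, if_neg hc', mul_zero, integral_zero]
        positivity
    · rw [if_neg hc, mul_zero]
      have : ∀ z, term E₁ E₂ z = 0 := by
        intro z
        by_cases h0 : E₁ ≠ E₂
        · have hd : Disjoint (supp E₁) (supp E₂) := by
            by_contra hd; exact hc ⟨h0, hd⟩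
          simp only [hterm, if_pos h0]
          rw [gradInner_eq_zero (disjoint_covSet hd), mul_zero]
        · simp only [hterm, if_neg h0]
      simp only [this, zero_mul, integral_zero, mul_zero, le_refl]
  have hsum := h.sum_quadruple_le hK hk hK' hk'
  calc _ ≤ ∑ E₁ ∈ loops m n p K, ∑ E₂ ∈ loops m n p K', ∑ E₃ ∈ loops m n p K,
        ∑ E₄ ∈ loops m n p K', τ ^ 2 * τ' ^ 2 * X ^ (12 * k) *
        (if E₁ ≠ E₂ ∧ ¬ Disjoint (supp E₁) (supp E₂) then
        unionWeight (E₁ ∪ E₂ ∪ E₃ ∪ E₄) else 0) := by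
        simp only [Finset.mul_sum]
        exact Finset.sum_le_sum fun E₁ h₁ => Finset.sum_le_sum fun E₂ h₂ =>
          Finset.sum_le_sum fun E₃ h₃ => Finset.sum_le_sum fun E₄ h₄ =>
            hmain E₁ h₁ E₂ h₂ E₃ h₃ E₄ h₄
    _ ≤ τ ^ 2 * τ' ^ 2 * X ^ (12 * k) * ((n : ℝ)⁻¹ * X ^ (8 * k)) := by
        simp only [← Finset.mul_sum]
        exact mul_le_mul_of_nonneg_left hsum (by positivity)
    _ = _ := by rw [show 20 * k = 12 * k + 8 * k by ring, pow_add]; ring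

end

end CycleStat

namespace CycleStat

variable {m n p : ℕ}

/-! ### Rates of convergence of the parameters -/

lemma descFactorial_div_pow (n : ℕ) (s : ℕ) (hn : 0 < n) :
    0 ≤ (n.descFactorial s : ℝ) / n ^ s ∧ (n.descFactorial s : ℝ) / n ^ s ≤ 1 ∧
      1 - (n.descFactorial s : ℝ) / n ^ s ≤ s ^ 2 * (n : ℝ)⁻¹ := by
  have hn' : (0 : ℝ) < n := by exact_mod_cast hn
  refine ⟨by positivity, ?_, ?_⟩
  · rw [div_le_one (by positivity)]
    exact_mod_cast Nat.descFactorial_le_pow n s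
  · induction s with
    | zero => simp
    | succ s ih =>
      have h1 : (n.descFactorial s : ℝ) / n ^ s ≤ 1 := by
        rw [div_le_one (by positivity)]
        exact_mod_cast Nat.descFactorial_le_pow n s
      have h0 : 0 ≤ (n.descFactorial s : ℝ) / n ^ s := by positivity
      have e : (n.descFactorial (s + 1) : ℝ) / n ^ (s + 1) =
          (n.descFactorial s : ℝ) / n ^ s * (((n - s : ℕ) : ℝ) * (n : ℝ)⁻¹) := by
        rw [Nat.descFactorial_succ]; push_cast; field_simp; ring
      have h2 : 1 - s * (n : ℝ)⁻¹ ≤ ((n - s : ℕ) : ℝ) * (n : ℝ)⁻¹ := by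
        have : (n : ℝ) - s ≤ ((n - s : ℕ) : ℝ) := by
          rw [sub_le_iff_le_add]; exact_mod_cast (by omega : n ≤ n - s + s)
        calc 1 - s * (n : ℝ)⁻¹ = (n - s) * (n : ℝ)⁻¹ := by field_simp
          _ ≤ _ := by gcongr
      rw [e]
      have hs : (0 : ℝ) ≤ s * (n : ℝ)⁻¹ := by positivity
      have hi : (0 : ℝ) ≤ (n : ℝ)⁻¹ := by positivity
      push_cast
      nlinarith [mul_le_mul_of_nonneg_left h2 h0, mul_le_mul_of_nonneg_right h1 hs]

/-- A relative error `δ` of a number becomes at most `l 2 ^ l δ` for its `l`-th power. -/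
lemma abs_pow_sub_one_le {ρ δ : ℝ} (h : |ρ - 1| ≤ δ) (hδ : δ ≤ 1 / 2) (l : ℕ) :
    |ρ ^ l - 1| ≤ l * 2 ^ l * δ := by
  have hδ0 : 0 ≤ δ := (abs_nonneg _).trans h
  have hρ : |ρ| ≤ 2 := by
    have := abs_sub_abs_le_abs_sub ρ 1
    rw [abs_one] at this; linarith
  induction l with
  | zero => simp
  | succ l ih =>
    calc |ρ ^ (l + 1) - 1| = |ρ * (ρ ^ l - 1) + (ρ - 1)| := by congr 1; ring
      _ ≤ |ρ * (ρ ^ l - 1)| + |ρ - 1| := abs_add_le _ _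
      _ ≤ 2 * (l * 2 ^ l * δ) + δ := by rw [abs_mul]; gcongr
      _ ≤ _ := by
        have : (1 : ℝ) ≤ 2 ^ (l + 1) := one_le_pow₀ (by norm_num)
        push_cast
        rw [pow_succ] at this ⊢
        nlinarith [mul_le_mul_of_nonneg_right this hδ0]

/-- The number `g` replaces the ratio `n / p`, with relative precision `δ`, which is also an upper
bound for `1 / n`. -/
structure IsRatio (g : ℝ) (n p : ℕ) (δ : ℝ) : Prop where
  inv_le : (n : ℝ)⁻¹ ≤ δ
  close : |g * p / n - 1| ≤ δ
  le_half : δ ≤ 1 / 2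

section
variable {d lam : Fin m → ℝ} {mu : ℝ} {k : ℕ} {X g δ : ℝ}

lemma IsScale.k_le (h : IsScale d lam mu n p k X) : 8 * (k : ℝ) + 1 ≤ X := by
  have h1 := h.letters
  have hn : (0 : ℝ) < n := by exact_mod_cast h.n_pos
  have e : (n + p) * (n : ℝ)⁻¹ = 1 + p * (n : ℝ)⁻¹ := by field_simp
  have h2 : 0 ≤ p * (n : ℝ)⁻¹ := by positivity
  have h3 : (0 : ℝ) ≤ m := by positivity
  rw [e] at h1; push_cast at h1; linarith

lemma IsScale.p_div_le (h : IsScale d lam mu n p k X) : p * (n : ℝ)⁻¹ ≤ X := by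
  have h1 := h.letters
  have hn : (0 : ℝ) < n := by exact_mod_cast h.n_pos
  have e : (n + p) * (n : ℝ)⁻¹ = 1 + p * (n : ℝ)⁻¹ := by field_simp
  have h3 : (0 : ℝ) ≤ m := by positivity
  have h4 : (0 : ℝ) ≤ (8 * k : ℕ) := by positivity
  rw [e] at h1; linarith

lemma IsRatio.nonneg (hg : IsRatio g n p δ) : 0 ≤ δ := (abs_nonneg _).trans hg.close

/-- The ratio is bounded above and below in terms of the scale. -/
lemma IsScale.ratio_bounds (h : IsScale d lam mu n p k X) (hg : IsRatio g n p δ) :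
    0 < g ∧ g ≤ X ^ 2 ∧ g⁻¹ ≤ X ^ 2 := by
  have hn : (0 : ℝ) < n := by exact_mod_cast h.n_pos
  have hp : (0 : ℝ) < p := by exact_mod_cast h.p_pos
  have hX := h.two_le
  have h1 := abs_le.1 (hg.close.trans hg.le_half)
  have h2 : 1 / 2 ≤ g * p / n := by linarith
  have h3 : g * p / n ≤ 3 / 2 := by linarith
  have h4 := h.p_div_le
  rw [← div_eq_mul_inv, div_le_iff₀ hn] at h4
  rw [le_div_iff₀ hn] at h2
  rw [div_le_iff₀ hn] at h3
  have hg0 : 0 < g := by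
    by_contra hneg; push Not at hneg
    nlinarith
  refine ⟨hg0, ?_, ?_⟩
  · have : g * p ≤ X ^ 2 * p := by nlinarith [h.n_le]
    exact le_of_mul_le_mul_right this hp
  · rw [inv_le_iff_one_le_mul₀ hg0]
    have : 1 / 2 * (n : ℝ) ≤ g * X * n := by nlinarith
    have := le_of_mul_le_mul_right this hn
    nlinarith

section
variable {K : CycleType m}

lemma one_le_coeff (hK : 2 ≤ size K) : 1 ≤ coeff K * (2 * size K) := by
  have hs : (0 : ℝ) < size K := by exact_mod_cast (by omega : 0 < size K)
  have h1 : (K.2)! * ∏ j, (K.1 j)! ∣ (size K)! := by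
    rw [size, add_comm]
    exact (mul_dvd_mul_left _ (Nat.prod_factorial_dvd_factorial_sum _ _)).trans
      (Nat.factorial_mul_factorial_dvd_factorial_add _ _)
  have h2 : ((K.2)! * ∏ j, ((K.1 j)! : ℝ)) ≤ (size K)! := by
    exact_mod_cast Nat.le_of_dvd (Nat.factorial_pos _) h1
  have h3 : (0 : ℝ) < (K.2)! * ∏ j, ((K.1 j)! : ℝ) :=
    mul_pos (by exact_mod_cast Nat.factorial_pos _)
      (Finset.prod_pos fun j _ => by exact_mod_cast Nat.factorial_pos _)
  have e : coeff K * (2 * size K) = (size K)! / ((K.2)! * ∏ j, ((K.1 j)! : ℝ)) := by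
    unfold coeff; field_simp
  rw [e, one_le_div h3]
  exact h2

lemma coeff_pos (hK : 2 ≤ size K) : 0 < coeff K := by
  have hs : (0 : ℝ) < size K := by exact_mod_cast (by omega : 0 < size K)
  have := one_le_coeff hK
  by_contra hneg; push Not at hneg
  nlinarith

lemma IsScale.coeff_le (h : IsScale d lam mu n p k X) (hK : 2 ≤ size K) (hk : size K ≤ k) :
    coeff K ≤ X ^ k := by
  have hs : (2 : ℝ) ≤ size K := by exact_mod_cast hK
  have h1 : (1 : ℝ) ≤ (K.2)! * ∏ j, ((K.1 j)! : ℝ) := by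
    exact_mod_cast Nat.one_le_iff_ne_zero.2 (mul_ne_zero (Nat.factorial_ne_zero _)
      (Finset.prod_ne_zero_iff.2 fun j _ => Nat.factorial_ne_zero _))
  have h2 : ((size K)! : ℝ) ≤ X ^ k := by
    have a1 : ((size K)! : ℝ) ≤ (size K : ℝ) ^ size K := by
      exact_mod_cast Nat.factorial_le_pow _
    have a2 : (size K : ℝ) ≤ X := by
      have : (size K : ℝ) ≤ k := by exact_mod_cast hk
      have := h.k_le
      linarith
    exact a1.trans ((pow_le_pow_left₀ (by positivity) a2 _).trans (h.pow_le_pow hk))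
  unfold coeff
  calc 1 / (2 * (size K : ℝ)) * ((size K)! / ((K.2)! * ∏ j, ((K.1 j)! : ℝ)))
      ≤ 1 * ((size K)! : ℝ) := by
        refine mul_le_mul ?_ (div_le_self (by positivity) h1) (by positivity) zero_le_one
        rw [div_le_one (by positivity)]; linarith
    _ ≤ _ := by rw [one_mul]; exact h2

lemma IsScale.prod_d (h : IsScale d lam mu n p k X) (K : CycleType m) (hk : size K ≤ k) :
    1 ≤ ∏ j, d j ^ K.1 j ∧ ∏ j, d j ^ K.1 j ≤ X ^ k := by
  constructor
  · exact Finset.one_le_prod fun j _ => one_le_pow₀ (h.one_lt_d j).le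
  · calc ∏ j, d j ^ K.1 j ≤ ∏ j, X ^ K.1 j :=
        Finset.prod_le_prod (fun j _ => pow_nonneg (h.d_nonneg j) _) fun j _ =>
          pow_le_pow_left₀ (h.d_nonneg j) (by linarith [h.d_le j, h.d_nonneg j]) _
      _ = X ^ ∑ j, K.1 j := Finset.prod_pow_eq_pow_sum _ _ _
      _ ≤ _ := h.pow_le_pow (by unfold size at hk; omega)

lemma IsScale.prod_lam (h : IsScale d lam mu n p k X) (K : CycleType m) (hk : size K ≤ k) :
    0 ≤ ∏ j, (lam j * √(d j)) ^ K.1 j ∧ ∏ j, (lam j * √(d j)) ^ K.1 j ≤ X ^ k := by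
  have h0 : ∀ j, 0 ≤ lam j * √(d j) := fun j => mul_nonneg (h.lam_nonneg j) (Real.sqrt_nonneg _)
  refine ⟨Finset.prod_nonneg fun j _ => pow_nonneg (h0 j) _, ?_⟩
  refine (Finset.prod_le_prod (fun j _ => pow_nonneg (h0 j) _) fun j _ =>
    pow_le_pow_left₀ (h0 j) ?_ _).trans (h.prod_d K hk).2
  calc lam j * √(d j) ≤ √(d j) * √(d j) := by gcongr; exact h.lam_le j
    _ = d j := Real.mul_self_sqrt (h.d_nonneg j)

/-- The number of cycles, compared with its asymptotic value. -/
noncomputable def countRatio (g : ℝ) (n p : ℕ) (K : CycleType m) : ℝ :=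
  (n.descFactorial (size K) : ℝ) / n ^ size K * ((p.descFactorial K.2 : ℝ) / p ^ K.2) *
    (g * p / n) ^ K.2

lemma IsScale.abs_countRatio_sub_one_le (h : IsScale d lam mu n p k X) (hg : IsRatio g n p δ)
    (hK : 2 ≤ size K) (hk : size K ≤ k) : |countRatio g n p K - 1| ≤ X ^ (3 * k) * δ := by
  have hn : (0 : ℝ) < n := by exact_mod_cast h.n_pos
  have hp : (0 : ℝ) < p := by exact_mod_cast h.p_pos
  have hδ := hg.nonneg
  have hX := h.two_le
  obtain ⟨a0, a1, a2⟩ := descFactorial_div_pow n (size K) h.n_pos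
  obtain ⟨b0, b1, b2⟩ := descFactorial_div_pow p K.2 h.p_pos
  have hc := abs_pow_sub_one_le hg.close hg.le_half K.2
  unfold countRatio
  generalize (n.descFactorial (size K) : ℝ) / n ^ size K = A at a0 a1 a2 ⊢
  generalize (p.descFactorial K.2 : ℝ) / p ^ K.2 = B at b0 b1 b2 ⊢
  generalize (g * p / n) ^ K.2 = ρ at hc ⊢
  have hk' : (k : ℝ) ≤ X := by linarith [h.k_le, (by positivity : (0 : ℝ) ≤ k)]
  have hs : (size K : ℝ) ≤ X := le_trans (by exact_mod_cast hk) hk'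
  have hl : (K.2 : ℝ) ≤ X := le_trans (by exact_mod_cast (by unfold size; omega)) hs
  have hinv : (p : ℝ)⁻¹ ≤ X * δ := by
    rw [inv_le_iff_one_le_mul₀ hp]
    have h1 : (1 : ℝ) ≤ δ * n := (inv_le_iff_one_le_mul₀ hn).1 hg.inv_le
    nlinarith [mul_le_mul_of_nonneg_left h.n_le hδ]
  have a3 : 1 - A ≤ X ^ 2 * δ := a2.trans (by gcongr; exact hg.inv_le)
  have b3 : 1 - B ≤ X ^ 2 * (X * δ) := b2.trans (by gcongr)
  have c3 : |ρ - 1| ≤ X * X ^ k * δ := by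
    refine hc.trans ?_
    gcongr
    exact (pow_le_pow_left₀ (by norm_num) hX _).trans
      (h.pow_le_pow (by unfold size at hk; omega))
  have hk2 : 2 ≤ k := hK.trans hk
  have hx1 : X * X ^ k ≤ X ^ (2 * k) := by
    rw [← pow_succ']; exact h.pow_le_pow (by omega)
  have hx2 : X ^ 2 ≤ X ^ (2 * k) := h.pow_le_pow (by omega)
  have hx3 : X ^ 3 ≤ X ^ (2 * k) := h.pow_le_pow (by omega)
  have hx4 : 3 * X ^ (2 * k) ≤ X ^ (3 * k) := by
    have h4 : X ^ 2 ≤ X ^ k := h.pow_le_pow hk2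
    rw [show 3 * k = k + 2 * k by ring, pow_add]
    have : 3 ≤ X ^ k := by nlinarith
    gcongr
  calc |A * B * ρ - 1| = |-(1 - A) - A * (1 - B) + A * B * (ρ - 1)| := by congr 1; ring
    _ ≤ |-(1 - A) - A * (1 - B)| + |A * B * (ρ - 1)| := abs_add_le _ _
    _ ≤ (1 - A) + (1 - B) + |ρ - 1| := by
      have h1 : |-(1 - A) - A * (1 - B)| ≤ (1 - A) + (1 - B) := by
        rw [abs_le]; constructor <;> nlinarith
      have h2 : |A * B * (ρ - 1)| ≤ 1 * |ρ - 1| := by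
        rw [abs_mul, abs_of_nonneg (mul_nonneg a0 b0)]
        gcongr
        nlinarith
      linarith
    _ ≤ 3 * X ^ (2 * k) * δ := by nlinarith
    _ ≤ _ := by gcongr

end

section
variable {K : CycleType m}

lemma IsScale.stdDev_sq (h : IsScale d lam mu n p k X) (hg : IsRatio g n p δ) (hK : 2 ≤ size K) :
    stdDev d g K ^ 2 = coeff K / g ^ K.2 * ∏ j, d j ^ K.1 j := by
  have := (h.ratio_bounds hg).1
  have := coeff_pos hK
  exact Real.sq_sqrt (mul_nonneg (by positivity)
    (Finset.prod_nonneg fun j _ => pow_nonneg (h.d_nonneg j) _))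

lemma IsScale.inv_stdDev_sq_le (h : IsScale d lam mu n p k X) (hg : IsRatio g n p δ)
    (hK : 2 ≤ size K) (hk : size K ≤ k) : (stdDev d g K)⁻¹ ^ 2 ≤ X ^ (3 * k) := by
  obtain ⟨g0, g1, -⟩ := h.ratio_bounds hg
  have hX := h.two_le
  have hc := coeff_pos hK
  have hd := (h.prod_d K hk).1
  have h1 := one_le_coeff hK
  have hs : 2 * (size K : ℝ) ≤ X := by
    have : (size K : ℝ) ≤ k := by exact_mod_cast hk
    linarith [h.k_le, (by positivity : (0 : ℝ) ≤ k)]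
  rw [inv_pow, h.stdDev_sq hg hK, inv_le_iff_one_le_mul₀ (by positivity)]
  have h2 : g ^ K.2 ≤ X ^ (2 * k) := by
    rw [pow_mul]
    refine (pow_le_pow_left₀ g0.le g1 _).trans (pow_le_pow_right₀ ?_ (by unfold size at hk; omega))
    nlinarith
  have h3 : X ≤ X ^ k := by
    calc X = X ^ 1 := (pow_one X).symm
      _ ≤ _ := h.pow_le_pow (by omega)
  have h4 : 1 ≤ X ^ (3 * k) * coeff K / g ^ K.2 := by
    rw [le_div_iff₀ (by positivity), one_mul]
    calc g ^ K.2 ≤ X ^ (2 * k) * (coeff K * (2 * size K)) :=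
          h2.trans (le_mul_of_one_le_right (by positivity) h1)
      _ ≤ X ^ (2 * k) * (coeff K * X ^ k) := by gcongr; linarith
      _ = _ := by rw [show 3 * k = 2 * k + k by ring, pow_add]; ring
  calc (1 : ℝ) ≤ X ^ (3 * k) * coeff K / g ^ K.2 * 1 := by linarith
    _ ≤ X ^ (3 * k) * coeff K / g ^ K.2 * ∏ j, d j ^ K.1 j := by
      refine mul_le_mul_of_nonneg_left hd ?_
      positivity
    _ = _ := by ring

lemma IsScale.altMean_bounds (h : IsScale d lam mu n p k X) (hg : IsRatio g n p δ)
    (hK : 2 ≤ size K) (hk : size K ≤ k) :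
    0 ≤ altMean d lam mu g K ∧ altMean d lam mu g K ≤ X ^ (5 * k) := by
  obtain ⟨g0, -, g1⟩ := h.ratio_bounds hg
  have hX := h.two_le
  have hc := coeff_pos hK
  have hc' := h.coeff_le hK hk
  obtain ⟨l0, l1⟩ := h.prod_lam K hk
  have hm := h.mu_nonneg
  have hm' : mu / g ≤ X ^ 3 := by
    rw [div_eq_mul_inv, show X ^ 3 = X * X ^ 2 by ring]
    have := h.mu_le
    gcongr
  have h1 : (mu / g) ^ K.2 ≤ X ^ (3 * k) := by
    rw [pow_mul]
    refine (pow_le_pow_left₀ (by positivity) hm' _).trans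
      (pow_le_pow_right₀ ?_ (by unfold size at hk; omega))
    exact one_le_pow₀ h.one_le
  unfold altMean
  refine ⟨by positivity, ?_⟩
  rw [show 5 * k = k + k + 3 * k by ring, pow_add, pow_add]
  gcongr

/-- The variance of the noise part, in units of its limit. -/
lemma IsScale.card_loops_mul_sq (h : IsScale d lam mu n p k X) (hg : IsRatio g n p δ)
    (hK : Admissible K) (hk : size K ≤ k) :
    (loops m n p K).card * (((stdDev d g K)⁻¹ * (n : ℝ)⁻¹ ^ K.2) ^ 2 *
        ((∏ r, d r ^ K.1 r) / n ^ (∑ r, K.1 r))) = countRatio g n p K := by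
  have hn : (0 : ℝ) < n := by exact_mod_cast h.n_pos
  have hp : (0 : ℝ) < p := by exact_mod_cast h.p_pos
  have g0 := (h.ratio_bounds hg).1
  have hc := coeff_pos hK.1
  have hd := (h.prod_d K hk).1
  have hd0 : 0 < ∏ j, d j ^ K.1 j := by linarith
  rw [card_loops hK, mul_pow, inv_pow, h.stdDev_sq hg hK.1, countRatio,
    show (n : ℝ) ^ size K = n ^ (∑ r, K.1 r) * n ^ K.2 by rw [size, pow_add], inv_pow, div_pow,
    mul_pow]
  generalize ∏ j, d j ^ K.1 j = D at hd0 ⊢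
  generalize (n.descFactorial (size K) : ℝ) = a
  generalize (p.descFactorial K.2 : ℝ) = b
  generalize coeff K = c at hc ⊢
  field_simp

/-- The mean of the signal part, in units of its limit. -/
lemma IsScale.card_loops_mul_signal (h : IsScale d lam mu n p k X) (hg : IsRatio g n p δ)
    (hK : Admissible K) :
    (loops m n p K).card * ((n : ℝ)⁻¹ ^ K.2 * ((mu / n) ^ K.2 *
      ((∏ r, (lam r * √(d r)) ^ K.1 r) / n ^ (∑ r, K.1 r)))) =
      altMean d lam mu g K * countRatio g n p K := by
  have hn : (0 : ℝ) < n := by exact_mod_cast h.n_pos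
  have hp : (0 : ℝ) < p := by exact_mod_cast h.p_pos
  have g0 := (h.ratio_bounds hg).1
  rw [card_loops hK, altMean, countRatio,
    show (n : ℝ) ^ size K = n ^ (∑ r, K.1 r) * n ^ K.2 by rw [size, pow_add], inv_pow, div_pow,
    div_pow, div_pow, mul_pow]
  generalize ∏ r, (lam r * √(d r)) ^ K.1 r = D
  generalize (n.descFactorial (size K) : ℝ) = a
  generalize (p.descFactorial K.2 : ℝ) = b
  generalize coeff K = c
  field_simp

/-- The expected number of cycles without covariate wedges is at most its limit, and close to
it. -/
lemma IsScale.card_loops_mul_rate (h : IsScale d lam mu n p k X) (hδ : (n : ℝ)⁻¹ ≤ δ)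
    (hK : Admissible K) (hk : size K ≤ k) (hl : K.2 = 0) :
    (loops m n p K).card * ((∏ r, d r ^ K.1 r + ∏ r, (lam r * √(d r)) ^ K.1 r) /
      n ^ (∑ r, K.1 r)) ≤ altRate d lam K ∧
    altRate d lam K - (loops m n p K).card * ((∏ r, d r ^ K.1 r +
      ∏ r, (lam r * √(d r)) ^ K.1 r) / n ^ (∑ r, K.1 r)) ≤ X ^ (4 * k) * δ := by
  have hn : (0 : ℝ) < n := by exact_mod_cast h.n_pos
  obtain ⟨a0, a1, a2⟩ := descFactorial_div_pow n (size K) h.n_pos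
  have hc := coeff_pos hK.1
  have hc' := h.coeff_le hK.1 hk
  obtain ⟨d0, d1⟩ := h.prod_d K hk
  obtain ⟨l0, l1⟩ := h.prod_lam K hk
  have hX := h.two_le
  have hs : (size K : ℝ) ≤ X := by
    have : (size K : ℝ) ≤ k := by exact_mod_cast hk
    linarith [h.k_le, (by positivity : (0 : ℝ) ≤ k)]
  have e : (loops m n p K).card * ((∏ r, d r ^ K.1 r + ∏ r, (lam r * √(d r)) ^ K.1 r) /
      n ^ (∑ r, K.1 r)) = altRate d lam K * ((n.descFactorial (size K) : ℝ) / n ^ size K) := by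
    rw [card_loops hK, altRate, hl, Nat.descFactorial_zero,
      show (n : ℝ) ^ size K = n ^ (∑ r, K.1 r) by rw [size, hl, add_zero]]
    push_cast; ring
  have hr0 : 0 ≤ altRate d lam K := by unfold altRate; positivity
  have hr1 : altRate d lam K ≤ X ^ k * (X ^ k + X ^ k) := by unfold altRate; gcongr
  rw [e]
  constructor
  · exact mul_le_of_le_one_right hr0 a1
  · calc altRate d lam K - altRate d lam K * ((n.descFactorial (size K) : ℝ) / n ^ size K)
        = altRate d lam K * (1 - (n.descFactorial (size K) : ℝ) / n ^ size K) := by ring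
      _ ≤ X ^ k * (X ^ k + X ^ k) * (X ^ 2 * δ) := by
        refine mul_le_mul hr1 (a2.trans ?_) (by linarith) (by positivity)
        gcongr
      _ = 2 * X ^ 2 * X ^ (2 * k) * δ := by rw [show 2 * k = k + k by ring, pow_add]; ring
      _ ≤ X ^ (2 * k) * X ^ (2 * k) * δ := by
        have hk2 := hK.1.trans hk
        have : X * X ^ 2 ≤ X ^ (2 * k) := by
          rw [← pow_succ']; exact h.pow_le_pow (by omega)
        have hδ0 : 0 ≤ δ := h.inv_nonneg.trans hδ
        have : 2 * X ^ 2 ≤ X ^ (2 * k) := by nlinarith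
        gcongr
      _ = _ := by rw [show 4 * k = 2 * k + 2 * k by ring, pow_add]

end
end

end CycleStat

namespace CycleStat

/-! ### Gaussian limits for homogeneous polynomials of Gaussian variables -/

section
variable {α β : Type*} [DecidableEq α] [DecidableEq β]

lemma monoDeriv_map_inl (A : Finset α) (e : α) (x : α ⊕ β → ℝ) :
    monoDeriv (A.map Function.Embedding.inl) (Sum.inl e) x =
      monoDeriv A e (fun q => x (Sum.inl q)) := by
  unfold monoDeriv
  have : (Sum.inl e : α ⊕ β) ∈ A.map Function.Embedding.inl ↔ e ∈ A := by simp
  simp only [this]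
  split_ifs
  · have h : (A.map Function.Embedding.inl).erase (Sum.inl e : α ⊕ β) =
        (A.erase e).map Function.Embedding.inl := (Finset.map_erase _ _ _).symm
    rw [h, Finset.prod_map]; rfl
  · rfl

lemma monoDeriv_map_inr (A : Finset α) (e : β) (x : α ⊕ β → ℝ) :
    monoDeriv (A.map Function.Embedding.inl) (Sum.inr e) x = 0 := by
  unfold monoDeriv
  rw [if_neg (by simp)]

lemma slope_const_mul_coord (c : ℝ) (q e : α) (x : α → ℝ) :
    slope (fun x => c * x q) e x = if e = q then c else 0 := by
  unfold slope
  by_cases h : e = q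
  · subst h; simp
  · simp only [if_neg h, Function.update_of_ne (Ne.symm h), sub_self]

end

section
variable {α β : Type*} [Fintype α] [Fintype β]

lemma measurePreserving_inl : MeasurePreserving (fun (x : α ⊕ β → ℝ) (q : α) => x (Sum.inl q))
    (gaussPi (α ⊕ β)) (gaussPi α) :=
  measurePreserving_fst.comp
    (measurePreserving_sumPiEquivProdPi (fun _ : α ⊕ β => gaussianReal 0 1))

lemma measurePreserving_inr : MeasurePreserving (fun (x : α ⊕ β → ℝ) (q : β) => x (Sum.inr q))
    (gaussPi (α ⊕ β)) (gaussPi β) :=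
  measurePreserving_snd.comp
    (measurePreserving_sumPiEquivProdPi (fun _ : α ⊕ β => gaussianReal 0 1))

variable [DecidableEq α] [DecidableEq β]

lemma gradInner_map_inl (A B : Finset α) (x : α ⊕ β → ℝ) :
    gradInner (A.map Function.Embedding.inl) (B.map Function.Embedding.inl) x =
      gradInner A B (fun q => x (Sum.inl q)) := by
  simp only [gradInner, Fintype.sum_sum_type, monoDeriv_map_inl, monoDeriv_map_inr, mul_zero,
    Finset.sum_const_zero, add_zero]

/-- Polynomials of independent Gaussian variables whose gradients have inner products that
concentrate at the covariances of independent Gaussian variables are close in law to these. -/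
lemma SmoothTest.abs_sub_le_of_monomials {τ : Type*} {C : ℝ} (hC : 0 ≤ C) (G : SmoothTest β C)
    (y : β → ℝ) (T : β → Finset τ) (A : τ → Finset α) (a : β → τ → ℝ) (l : β → ℕ)
    (hl : ∀ i, ∀ t ∈ T i, (A t).card = l i) (h0 : ∀ i, l i = 0 → ∀ t ∈ T i, a i t = 0)
    (c : β → ℝ) :
    |∫ x, G.f (fun i => y i + ∑ t ∈ T i, a i t * ∏ q ∈ A t, x q) ∂(gaussPi α) -
      ∫ v, G.f (fun i => y i + c i * v i) ∂(gaussPi β)| ≤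
    2 * C * ∑ i, ∑ j, ∫ x, |(l i : ℝ)⁻¹ * ∑ t ∈ T i, ∑ s ∈ T j,
      a i t * a j s * gradInner (A t) (A s) x - (if i = j then c i * c i else 0)| ∂(gaussPi α) := by
  -- the Euler relation needs a nonzero degree; polynomials of degree zero vanish by `h0`, and
  -- satisfy it with any degree
  set q : β → ℝ := fun i => if l i = 0 then 1 else l i with hq
  -- the polynomials and the limiting variables live on a common space, in separate coordinates
  set P : β → (α ⊕ β → ℝ) → ℝ := fun i x =>
    ∑ t ∈ T i, a i t * ∏ q ∈ (A t).map Function.Embedding.inl, x q with hP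
  set Z : β → (α ⊕ β → ℝ) → ℝ := fun i x => c i * x (Sum.inr i) with hZ
  have hPs : ∀ i e x, slope (P i) e x =
      ∑ t ∈ T i, a i t * monoDeriv ((A t).map Function.Embedding.inl) e x :=
    fun i e x => slope_sum_mono _ _ _ _ _
  have hZs : ∀ i e x, slope (Z i) e x = if e = Sum.inr i then c i else 0 :=
    fun i e x => slope_const_mul_coord _ _ _ _
  have hPL : ∀ i, AllLp (P i) (gaussPi (α ⊕ β)) := fun i => AllLp.sum _ fun t _ =>
    (AllLp.prod _ fun q _ => allLp_coord q).const_mul _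
  have hP1 : ∀ i x, P i x = ∑ t ∈ T i, a i t * ∏ q ∈ A t, x (Sum.inl q) := fun i x =>
    Finset.sum_congr rfl fun t _ => by rw [Finset.prod_map]; rfl
  have hinner : ∀ i j x, ∑ e, slope (P i) e x * slope (P j) e x = ∑ t ∈ T i, ∑ s ∈ T j,
      a i t * a j s * gradInner (A t) (A s) (fun q => x (Sum.inl q)) := by
    intro i j x
    simp only [hPs, Finset.sum_mul_sum]
    rw [Finset.sum_comm]
    refine Finset.sum_congr rfl fun t _ => ?_
    rw [Finset.sum_comm]
    refine Finset.sum_congr rfl fun s _ => ?_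
    rw [← gradInner_map_inl (β := β), gradInner, Finset.mul_sum]
    exact Finset.sum_congr rfl fun e _ => by ring
  have key := G.abs_sub_le_of_gradients (κ := α ⊕ β) hC y (Z := Z) (P := P) (q := q)
    (c := fun i j => if i = j then c i * c i else 0)
    (fun i => by simp only [hq]; split_ifs with h <;> simp [h])
    (fun i x e s => by
      rw [hZs]
      by_cases h : e = Sum.inr i
      · subst h; simp [hZ, mul_comm]
      · simp [hZ, h, Function.update_of_ne (Ne.symm h)])
    (fun i => multiAffine_sum_mono _ _ _)
    (fun i x => by simp only [hZs]; simp [hZ, mul_comm])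
    (fun i x => by
      simp only [hPs, Finset.mul_sum]
      rw [Finset.sum_comm, hP, Finset.mul_sum]
      refine Finset.sum_congr rfl fun t ht => ?_
      by_cases h : l i = 0
      · simp [h0 i h t ht]
      · have e1 : ∀ e, x e * (a i t * monoDeriv ((A t).map Function.Embedding.inl) e x) =
            a i t * (x e * monoDeriv ((A t).map Function.Embedding.inl) e x) := fun e => by ring
        simp only [e1]
        rw [← Finset.mul_sum, sum_mul_monoDeriv, Finset.card_map, hl i t ht]
        simp only [hq, if_neg h]; ring)
    (fun i => (measurable_pi_apply _).const_mul _)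
    (fun i => by fun_prop)
    (fun i => ((allLp_coord _).const_mul _).integrable)
    (fun i => (hPL i).integrable)
    (fun i e => by
      simp only [show slope (Z i) e = fun x => if e = Sum.inr i then c i else 0 from
        funext fun x => hZs i e x]
      exact (AllLp.const _).memLp_two)
    (fun i e => by
      rw [show slope (P i) e = fun x => _ from funext fun x => hPs i e x]
      exact (AllLp.sum _ fun t _ => (allLp_monoDeriv _ _).const_mul _).memLp_two)
    (fun i j x => by
      simp [hZs, hPs, monoDeriv_map_inr])
    (fun i j x => by
      simp only [hZs]
      by_cases h : i = j
      · subst h; simp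
      · simp [h, Ne.symm h])
  have hGm : Measurable G.f := G.continuous.measurable
  have eP : ∫ x, G.f (fun j => y j + P j x) ∂(gaussPi (α ⊕ β)) =
      ∫ x, G.f (fun i => y i + ∑ t ∈ T i, a i t * ∏ q ∈ A t, x q) ∂(gaussPi α) := by
    rw [← (measurePreserving_inl (α := α) (β := β)).map_eq, integral_map
      (measurePreserving_inl (α := α) (β := β)).measurable.aemeasurable]
    · simp only [hP1]
    · exact (hGm.comp (by fun_prop)).aestronglyMeasurable
  have eZ : ∫ x, G.f (fun j => y j + Z j x) ∂(gaussPi (α ⊕ β)) =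
      ∫ v, G.f (fun i => y i + c i * v i) ∂(gaussPi β) := by
    rw [← (measurePreserving_inr (α := α) (β := β)).map_eq, integral_map
      (measurePreserving_inr (α := α) (β := β)).measurable.aemeasurable]
    exact (hGm.comp (by fun_prop)).aestronglyMeasurable
  rw [eP, eZ] at key
  refine key.trans (le_of_eq ?_)
  congr 1
  refine Finset.sum_congr rfl fun i _ => Finset.sum_congr rfl fun j _ => ?_
  have hgm : Measurable fun x : α → ℝ => |(l i : ℝ)⁻¹ * ∑ t ∈ T i, ∑ s ∈ T j,
      a i t * a j s * gradInner (A t) (A s) x - (if i = j then c i * c i else 0)| := by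
    simp only [gradInner_eq]; fun_prop
  rw [← (measurePreserving_inl (α := α) (β := β)).map_eq, integral_map
      (measurePreserving_inl (α := α) (β := β)).measurable.aemeasurable hgm.aestronglyMeasurable]
  simp only [hinner]
  by_cases h : l i = 0
  · have : ∀ x : α → ℝ, ∑ t ∈ T i, ∑ s ∈ T j, a i t * a j s * gradInner (A t) (A s) x = 0 :=
      fun x => Finset.sum_eq_zero fun t ht => Finset.sum_eq_zero fun s _ => by
        rw [h0 i h t ht]; ring
    simp only [this, mul_zero]
  · simp only [hq, if_neg h]

end

/-- The mean of the absolute value is at most the root of the second moment. -/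
lemma integral_abs_le_of_sq_le {Ω : Type*} [MeasurableSpace Ω] {P : Measure Ω}
    [IsProbabilityMeasure P] {f : Ω → ℝ} (hf : MemLp f 2 P) {s : ℝ} (hs : 0 < s)
    (h : ∫ x, f x ^ 2 ∂P ≤ s ^ 2) : ∫ x, |f x| ∂P ≤ s := by
  -- the inequality between the arithmetic and the geometric mean
  have h1 : ∀ x, |f x| ≤ (2 * s)⁻¹ * f x ^ 2 + s / 2 := by
    intro x
    have h2 : (2 * s)⁻¹ * f x ^ 2 + s / 2 - |f x| = (2 * s)⁻¹ * (|f x| - s) ^ 2 := by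
      rw [sub_sq, sq_abs]; field_simp; ring
    have h3 : 0 ≤ (2 * s)⁻¹ * (|f x| - s) ^ 2 := by positivity
    linarith
  have hi : Integrable (fun x => (2 * s)⁻¹ * f x ^ 2) P := hf.integrable_sq.const_mul _
  calc ∫ x, |f x| ∂P ≤ ∫ x, ((2 * s)⁻¹ * f x ^ 2 + s / 2) ∂P :=
        integral_mono_of_nonneg (ae_of_all _ fun x => abs_nonneg _)
          (hi.add (integrable_const _)) (ae_of_all _ h1)
    _ = (2 * s)⁻¹ * ∫ x, f x ^ 2 ∂P + s / 2 := by
        rw [integral_add hi (integrable_const _), integral_const_mul]; simp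
    _ ≤ (2 * s)⁻¹ * s ^ 2 + s / 2 := by gcongr
    _ = s := by field_simp; ring

variable {m n p r : ℕ}

/-- The part of a statistic that involves only the networks and the noise, multiplied by `τ`. -/
noncomputable def noisePart (τ : ℝ) (K : CycleType m) (z : Graph m n × (Fin n × Fin p → ℝ)) : ℝ :=
  ∑ E ∈ loops m n p K, τ * (n : ℝ)⁻¹ ^ K.2 * edgeInd (netSet E) z.1 * ∏ q ∈ covSet E, z.2 q

/-- The inverse of the standard deviation if `ℓ > 0`, and zero if `ℓ = 0`. With this factor the
noise part of a type without covariate wedges is zero, so that both kinds of types can be treated as one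
vector. -/
noncomputable def invStd (d : Fin m → ℝ) (g : ℝ) (K : CycleType m) : ℝ :=
  if K.2 = 0 then 0 else (stdDev d g K)⁻¹

lemma poissonReal_zero : poissonReal 0 = Measure.dirac 0 := by
  refine Measure.ext_of_charFun (funext fun t => ?_)
  rw [poissonReal, charFun_map_cast_poissonMeasure]
  simp

/-- A Poisson variable of mean zero and a standard Gaussian variable are both a constant multiple of
a standard Gaussian variable, with the constants zero and one. -/
lemma map_mask_gauss (K : CycleType m) :
    (gaussianReal 0 1).map (fun s => (if K.2 = 0 then (0 : ℝ) else 1) * s) = limitLaw 0 K := by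
  unfold limitLaw
  split_ifs
  · simp only [zero_mul]
    rw [poissonReal_zero, Measure.map_const, measure_univ, one_smul]
  · simp only [one_mul]
    exact Measure.map_id

lemma integral_mask_gauss (K : Fin r → CycleType m) {f : (Fin r → ℝ) → ℝ} (hf : Measurable f) :
    ∫ v, f (fun i => (if (K i).2 = 0 then (0 : ℝ) else 1) * v i) ∂(gaussPi (Fin r)) =
      ∫ v, f v ∂(Measure.pi fun i => limitLaw 0 (K i)) := by
  have h : (gaussPi (Fin r)).map (fun v i => (if (K i).2 = 0 then (0 : ℝ) else 1) * v i) =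
      Measure.pi fun i => limitLaw 0 (K i) := by
    have hp : ∀ i : Fin r, IsProbabilityMeasure ((gaussianReal 0 1).map
        (fun s : ℝ => (if (K i).2 = 0 then (0 : ℝ) else 1) * s)) := fun i =>
      Measure.isProbabilityMeasure_map (by fun_prop)
    rw [gaussPi, Measure.pi_map_pi (fun i => by fun_prop)]
    simp only [map_mask_gauss]
  rw [← h, integral_map (measurable_pi_lambda _ fun i =>
    (measurable_pi_apply i).const_mul _).aemeasurable hf.aestronglyMeasurable]

section
variable {d lam : Fin m → ℝ} {mu : ℝ} {k : ℕ} {X g δ : ℝ}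

lemma sq_mul_sqrt (a : ℝ) {δ : ℝ} (hδ : 0 ≤ δ) : (a * √δ) ^ 2 = a ^ 2 * δ := by
  rw [mul_pow, Real.sq_sqrt hδ]

lemma IsRatio.pos (h : IsScale d lam mu n p k X) (hg : IsRatio g n p δ) : 0 < δ := by
  have hn : (0 : ℝ) < n := by exact_mod_cast h.n_pos
  exact (by positivity : (0 : ℝ) < (n : ℝ)⁻¹).trans_le hg.inv_le

/-- The deviation of the inner product of the gradients of two noise parts, divided by the degree
`2 ℓ`, from its limit: the contribution of the pairs of distinct cycles, and the fluctuation of the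
diagonal around one. For `ℓ = 0` both vanish, by `0⁻¹ = 0` and the condition `ℓ ≠ 0`. -/
noncomputable def gradError (d : Fin m → ℝ) (g : ℝ) (K K' : CycleType m)
    (z : Graph m n × (Fin n × Fin p → ℝ)) : ℝ :=
  ((2 * K.2 : ℕ) : ℝ)⁻¹ * ((invStd d g K * (n : ℝ)⁻¹ ^ K.2) * (invStd d g K' * (n : ℝ)⁻¹ ^ K'.2)) *
      crossPart m n p K K' z +
    if K = K' ∧ K.2 ≠ 0 then
      ∑ E ∈ loops m n p K, ((2 * K.2 : ℕ) : ℝ)⁻¹ * (invStd d g K * (n : ℝ)⁻¹ ^ K.2) ^ 2 *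
        gradPart E z - 1
    else 0

lemma allLp_gradError (K K' : CycleType m) :
    AllLp (gradError d g K K' : Graph m n × (Fin n × Fin p → ℝ) → ℝ) (noiseLaw m n p d lam) := by
  refine AllLp.add ((allLp_crossPart K K').const_mul _) ?_
  by_cases h : K = K' ∧ K.2 ≠ 0
  · simp only [if_pos h]
    exact AllLp.sub (AllLp.sum _ fun E _ => (allLp_gradPart E).const_mul _) (AllLp.const 1)
  · simp only [if_neg h]; exact AllLp.const 0

lemma IsScale.invStd_sq_le (h : IsScale d lam mu n p k X) (hg : IsRatio g n p δ)
    {K : CycleType m} (hK : 2 ≤ size K) (hk : size K ≤ k) : invStd d g K ^ 2 ≤ X ^ (3 * k) := by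
  have := h.pos
  unfold invStd
  split_ifs
  · rw [zero_pow two_ne_zero]; positivity
  · exact h.inv_stdDev_sq_le hg hK hk

/-- The inner products of the gradients of the noise parts concentrate. -/
lemma IsScale.integral_abs_gradError_le (h : IsScale d lam mu n p k X) (hg : IsRatio g n p δ)
    {K K' : CycleType m} (hK : Admissible K) (hk : size K ≤ k) (hK' : 2 ≤ size K')
    (hk' : size K' ≤ k) :
    ∫ z, |gradError d g K K' z| ∂(noiseLaw m n p d lam) ≤ 2 * (X ^ (13 * k) * √δ) := by
  have hX := h.pos
  have hδ := IsRatio.pos h hg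
  have hs : 0 < X ^ (13 * k) * √δ := by have := Real.sqrt_pos.2 hδ; positivity
  have hδ1 := hg.le_half
  have hτ := h.invStd_sq_le hg hK.1 hk
  have hτ' := h.invStd_sq_le hg hK' hk'
  have hinv := hg.inv_le
  by_cases hl : K.2 = 0
  · have : ∀ z : Graph m n × (Fin n × Fin p → ℝ), gradError d g K K' z = 0 := by
      intro z; simp [gradError, hl]
    simp only [this, abs_zero, integral_zero]; positivity
  have h1 : ∫ z, |((2 * K.2 : ℕ) : ℝ)⁻¹ * ((invStd d g K * (n : ℝ)⁻¹ ^ K.2) *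
      (invStd d g K' * (n : ℝ)⁻¹ ^ K'.2)) * crossPart m n p K K' z| ∂(noiseLaw m n p d lam) ≤
      X ^ (13 * k) * √δ := by
    refine integral_abs_le_of_sq_le ((allLp_crossPart K K').const_mul _).memLp_two hs ?_
    rw [sq_mul_sqrt _ hδ.le, ← pow_mul]
    refine (h.integral_sq_crossPart_le hK.1 hk hl hK' hk').trans ?_
    calc invStd d g K ^ 2 * invStd d g K' ^ 2 * (n : ℝ)⁻¹ * X ^ (20 * k)
        ≤ X ^ (3 * k) * X ^ (3 * k) * δ * X ^ (20 * k) := by gcongr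
      _ = _ := by rw [show 13 * k * 2 = 3 * k + 3 * k + 20 * k by ring, pow_add, pow_add]; ring
  have h2 : ∫ z, |if K = K' ∧ K.2 ≠ 0 then ∑ E ∈ loops m n p K, ((2 * K.2 : ℕ) : ℝ)⁻¹ *
      (invStd d g K * (n : ℝ)⁻¹ ^ K.2) ^ 2 * gradPart E z - 1 else 0| ∂(noiseLaw m n p d lam) ≤
      X ^ (13 * k) * √δ := by
    by_cases hc : K = K' ∧ K.2 ≠ 0
    · simp only [if_pos hc]
      refine integral_abs_le_of_sq_le (AllLp.sub (AllLp.sum _ fun E _ =>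
        (allLp_gradPart E).const_mul _) (AllLp.const 1)).memLp_two hs ?_
      rw [sq_mul_sqrt _ hδ.le, ← pow_mul]
      refine (h.integral_sq_gradPart_le hK.1 hk hl 1).trans ?_
      have e : invStd d g K = (stdDev d g K)⁻¹ := if_neg hl
      rw [e] at hτ ⊢
      rw [h.card_loops_mul_sq hg hK hk]
      have b1 := h.abs_countRatio_sub_one_le hg hK.1 hk
      have b2 : (countRatio g n p K - 1) ^ 2 ≤ X ^ (6 * k) * δ := by
        rw [← sq_abs]
        calc _ ≤ (X ^ (3 * k) * δ) ^ 2 := pow_le_pow_left₀ (abs_nonneg _) b1 2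
          _ = X ^ (6 * k) * (δ * δ) := by rw [show 6 * k = 3 * k * 2 by ring, pow_mul]; ring
          _ ≤ X ^ (6 * k) * (δ * 1) := by gcongr; linarith
          _ = _ := by ring
      have b3 : 2 * (stdDev d g K)⁻¹ ^ 4 * (n : ℝ)⁻¹ * X ^ (10 * k) ≤ 2 * X ^ (16 * k) * δ := by
        calc 2 * (stdDev d g K)⁻¹ ^ 4 * (n : ℝ)⁻¹ * X ^ (10 * k)
            = 2 * ((stdDev d g K)⁻¹ ^ 2 * (stdDev d g K)⁻¹ ^ 2) * (n : ℝ)⁻¹ * X ^ (10 * k) := by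
              ring
          _ ≤ 2 * (X ^ (3 * k) * X ^ (3 * k)) * δ * X ^ (10 * k) := by gcongr
          _ = _ := by
            rw [show 16 * k = 3 * k + 3 * k + 10 * k by ring, pow_add, pow_add]; ring
      have b4 : X ^ (6 * k) ≤ X ^ (16 * k) := h.pow_le_pow (by omega)
      -- a power of the scale absorbs the numerical constant
      have hX3 : 3 ≤ X ^ (10 * k) := by
        have : X ^ 2 ≤ X ^ (10 * k) := h.pow_le_pow (by have := hK.1; omega)
        nlinarith [h.two_le]
      calc _ ≤ X ^ (6 * k) * δ + 2 * X ^ (16 * k) * δ := add_le_add b2 b3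
        _ ≤ X ^ (16 * k) * δ + 2 * X ^ (16 * k) * δ := by gcongr
        _ = 3 * X ^ (16 * k) * δ := by ring
        _ ≤ X ^ (10 * k) * X ^ (16 * k) * δ := by gcongr
        _ = _ := by rw [show 13 * k * 2 = 10 * k + 16 * k by ring, pow_add]
    · simp only [if_neg hc, abs_zero, integral_zero]; exact hs.le
  have i1 := ((allLp_crossPart (m := m) (n := n) (p := p) (d := d) (lam := lam) K K').const_mul
    (((2 * K.2 : ℕ) : ℝ)⁻¹ * ((invStd d g K * (n : ℝ)⁻¹ ^ K.2) *
      (invStd d g K' * (n : ℝ)⁻¹ ^ K'.2)))).integrable.abs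
  have i2 : Integrable (fun z : Graph m n × (Fin n × Fin p → ℝ) => |if K = K' ∧ K.2 ≠ 0 then
      ∑ E ∈ loops m n p K, ((2 * K.2 : ℕ) : ℝ)⁻¹ *
      (invStd d g K * (n : ℝ)⁻¹ ^ K.2) ^ 2 * gradPart E z - 1 else 0|)
      (noiseLaw m n p d lam) := by
    by_cases hc : K = K' ∧ K.2 ≠ 0
    · simp only [if_pos hc]
      exact (AllLp.sub (AllLp.sum _ fun E _ =>
        (allLp_gradPart E).const_mul _) (AllLp.const 1)).integrable.abs
    · simp only [if_neg hc]; exact (integrable_const _)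
  calc ∫ z, |gradError d g K K' z| ∂(noiseLaw m n p d lam) ≤ _ :=
        integral_mono_of_nonneg (ae_of_all _ fun z => abs_nonneg _) (i1.add i2)
          (ae_of_all _ fun z => abs_add_le _ _)
    _ ≤ _ := by
        have := integral_add i1 i2
        simp only [Pi.add_apply]
        rw [this]; linarith

/-- The inner products of the gradients of the noise parts, for fixed networks. -/
lemma gradError_eq {K : Fin r → CycleType m} (hK : ∀ i, 2 ≤ size (K i))
    (hinj : Function.Injective K) (i j : Fin r) (y : Graph m n) (x : Fin n × Fin p → ℝ) :
    ((2 * (K i).2 : ℕ) : ℝ)⁻¹ * ∑ E ∈ loops m n p (K i), ∑ E' ∈ loops m n p (K j),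
      (invStd d g (K i) * (n : ℝ)⁻¹ ^ (K i).2 * edgeInd (netSet E) y) *
      (invStd d g (K j) * (n : ℝ)⁻¹ ^ (K j).2 * edgeInd (netSet E') y) *
        gradInner (covSet E) (covSet E') x -
      (if i = j then (if (K i).2 = 0 then (0 : ℝ) else 1) * (if (K i).2 = 0 then (0 : ℝ) else 1)
        else 0) =
    gradError d g (K i) (K j) (y, x) := by
  classical
  set s : ℝ := (invStd d g (K i) * (n : ℝ)⁻¹ ^ (K i).2) * (invStd d g (K j) * (n : ℝ)⁻¹ ^ (K j).2)
    with hs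
  have e1 : ∀ E E' : Finset (Link m n p),
      (invStd d g (K i) * (n : ℝ)⁻¹ ^ (K i).2 * edgeInd (netSet E) y) *
      (invStd d g (K j) * (n : ℝ)⁻¹ ^ (K j).2 * edgeInd (netSet E') y) *
        gradInner (covSet E) (covSet E') x =
      s * (if E ≠ E' then edgeInd (netSet E ∪ netSet E') y * gradInner (covSet E) (covSet E') x
        else 0) + s * (if E = E' then gradPart E (y, x) else 0) := by
    intro E E'
    by_cases h : E = E'
    · subst h
      have := edgeInd_mul (netSet E) (netSet E) y
      rw [Finset.union_self] at this
      simp only [ne_eq, not_true, if_false, if_true, gradPart, hs]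
      nth_rw 3 [← this]
      ring
    · simp only [ne_eq, h, not_false_iff, if_true, if_false, hs]
      rw [← edgeInd_mul]; ring
  simp only [e1, Finset.sum_add_distrib, ← Finset.mul_sum]
  unfold gradError crossPart
  rw [mul_add, add_sub_assoc, ← mul_assoc, ← hs]
  congr 1
  by_cases hij : i = j
  · subst hij
    by_cases hl : (K i).2 = 0
    · simp [hl]
    · simp only [Finset.sum_ite_eq, hl, if_true, if_false, ne_eq, not_false_iff, and_self, mul_one]
      congr 1
      rw [Finset.mul_sum, Finset.mul_sum]
      refine Finset.sum_congr rfl fun E hE => ?_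
      rw [if_pos hE, hs]; ring
  · have hne : K i ≠ K j := fun h => hij (hinj h)
    rw [if_neg hij, if_neg (fun h => hne h.1), sub_zero]
    have : ∑ E ∈ loops m n p (K i), ∑ E' ∈ loops m n p (K j),
        (if E = E' then gradPart E (y, x) else 0) = 0 :=
      Finset.sum_eq_zero fun E hE => Finset.sum_eq_zero fun E' hE' =>
        if_neg (ne_of_mem_loops (hK i) (hK j) hne hE hE')
    rw [this, mul_zero, mul_zero]

lemma measurable_noisePart (τ : ℝ) (K : CycleType m) :
    Measurable (noisePart τ K : Graph m n × (Fin n × Fin p → ℝ) → ℝ) :=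
  Finset.measurable_sum _ fun E _ =>
    (((measurable_of_finite (edgeInd (netSet E))).comp measurable_fst).const_mul _).mul
      (Finset.measurable_prod _ fun q _ => (measurable_pi_apply q).comp measurable_snd)

/-- The noise parts of the statistics with covariate wedges are asymptotically independent standard
Gaussian variables that do not depend on the networks. -/
lemma IsScale.abs_noisePart_sub_le (h : IsScale d lam mu n p k X) (hg : IsRatio g n p δ)
    {K : Fin r → CycleType m} (hinj : Function.Injective K) (hK : ∀ i, Admissible (K i))
    (hk : ∀ i, size (K i) ≤ k) {C : ℝ} (hC : 0 ≤ C) (G : SmoothTest (Fin r) C)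
    (V : Graph m n → Fin r → ℝ) :
    |∫ z, G.f (fun i => V z.1 i + noisePart (invStd d g (K i)) (K i) z) ∂(noiseLaw m n p d lam) -
      ∫ y, ∫ v, G.f (fun i => V y i + v i) ∂(Measure.pi fun i => limitLaw 0 (K i))
        ∂(graphLaw m n d lam)| ≤ 2 * C * (r ^ 2 * (2 * (X ^ (13 * k) * √δ))) := by
  classical
  have hGm := G.continuous.measurable
  have hm : Measurable fun z : Graph m n × (Fin n × Fin p → ℝ) =>
      G.f (fun i => V z.1 i + noisePart (invStd d g (K i)) (K i) z) := by
    refine hGm.comp (measurable_pi_lambda _ fun i => Measurable.add ?_ (measurable_noisePart _ _))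
    exact (measurable_of_finite fun y : Graph m n => V y i).comp measurable_fst
  have hint : Integrable (fun z => G.f (fun i => V z.1 i +
      noisePart (invStd d g (K i)) (K i) z)) (noiseLaw m n p d lam) :=
    (AllLp.of_bound hm fun z => G.bound _).integrable
  rw [integral_prod _ hint]
  -- for fixed networks the noise parts are homogeneous polynomials of Gaussian variables
  have hcond : ∀ y : Graph m n,
      |∫ x, G.f (fun i => V y i + noisePart (invStd d g (K i)) (K i) (y, x))
          ∂(gaussPi (Fin n × Fin p)) -
        ∫ v, G.f (fun i => V y i + v i) ∂(Measure.pi fun i => limitLaw 0 (K i))| ≤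
      2 * C * ∑ i, ∑ j, ∫ x, |gradError d g (K i) (K j) (y, x)| ∂(gaussPi (Fin n × Fin p)) := by
    intro y
    have h1 := SmoothTest.abs_sub_le_of_monomials (α := Fin n × Fin p) hC G (V y)
      (fun i => loops m n p (K i)) covSet
      (fun i E => invStd d g (K i) * (n : ℝ)⁻¹ ^ (K i).2 * edgeInd (netSet E) y)
      (fun i => 2 * (K i).2) (fun i E hE => card_covSet (hK i).1 hE)
      (fun i hl E _ => by simp [invStd, show (K i).2 = 0 by omega])
      (fun i => if (K i).2 = 0 then (0 : ℝ) else 1)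
    rw [integral_mask_gauss K (f := fun v => G.f (fun i => V y i + v i))
      (hGm.comp (by fun_prop))] at h1
    refine h1.trans (le_of_eq ?_)
    congr 1
    refine Finset.sum_congr rfl fun i _ => Finset.sum_congr rfl fun j _ => ?_
    refine integral_congr_ae (ae_of_all _ fun x => ?_)
    simp only
    rw [← gradError_eq (fun i => (hK i).1) hinj i j y x]
  rw [← integral_sub (Integrable.of_finite) (Integrable.of_finite)]
  refine (abs_integral_le_of_abs_le Integrable.of_finite hcond).trans ?_
  rw [integral_const_mul]
  refine mul_le_mul_of_nonneg_left ?_ (by positivity)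
  rw [integral_finsetSum _ fun i _ => Integrable.of_finite]
  calc ∑ i, ∫ y, ∑ j, ∫ x, |gradError d g (K i) (K j) (y, x)| ∂(gaussPi (Fin n × Fin p))
        ∂(graphLaw m n d lam)
      = ∑ i, ∑ j, ∫ z, |gradError d g (K i) (K j) z| ∂(noiseLaw m n p d lam) := by
        refine Finset.sum_congr rfl fun i _ => ?_
        rw [integral_finsetSum _ fun i _ => Integrable.of_finite]
        refine Finset.sum_congr rfl fun j _ => ?_
        exact (integral_prod _ (allLp_gradError (K i) (K j)).integrable.abs).symm
    _ ≤ ∑ i : Fin r, ∑ j : Fin r, 2 * (X ^ (13 * k) * √δ) :=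
        Finset.sum_le_sum fun i _ => Finset.sum_le_sum fun j _ =>
          h.integral_abs_gradError_le hg (hK i) (hk i) (hK j).1 (hk j)
    _ = _ := by simp; ring

end

end CycleStat

namespace CycleStat

variable {m n p r : ℕ}

/-! ### Poisson limits for the numbers of cycles in the networks -/

/-- Raising one Poisson mean by `t` amounts to adding an independent Poisson variable of mean `t`,
which is zero with probability close to `1 - t`. -/
lemma abs_integral_limitLaw_update_le (K : Fin r → CycleType m) {a b : Fin r → ℝ} (e : Fin r)
    (hne : ∀ i, i ≠ e → a i = b i) (ha : 0 ≤ a e) (hab : a e ≤ b e) {η : ℝ} (hb : b e - a e ≤ η)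
    {F : (Fin r → ℝ) → ℝ} (hF : Measurable F) (hF1 : ∀ y, |F y| ≤ 1) :
    |∫ y, F y ∂(Measure.pi fun i => limitLaw (a i) (K i)) -
      ∫ y, F y ∂(Measure.pi fun i => limitLaw (b i) (K i))| ≤ 6 * η := by
  have hη : 0 ≤ η := by linarith
  by_cases hl : (K e).2 = 0
  swap
  · have : (fun i => limitLaw (a i) (K i)) = fun i => limitLaw (b i) (K i) := by
      funext i
      by_cases hi : i = e
      · subst hi; simp [limitLaw, hl]
      · rw [hne i hi]
    rw [this, sub_self, abs_zero]; positivity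
  have hconv : limitLaw (b e) (K e) = (limitLaw (a e) (K e)).conv (poissonReal (b e - a e)) := by
    simp only [limitLaw, if_pos hl]
    rw [poissonReal_conv ha (by linarith), add_sub_cancel]
  rw [integral_add_single_pi (fun i => limitLaw (a i) (K i)) e (poissonReal (b e - a e))
    (fun i => limitLaw (b i) (K i)) hconv (fun i hi => by simp only [hne i hi]) hF hF1]
  have hmeas : Measurable fun q : (Fin r → ℝ) × ℝ => F (q.1 + Pi.single e q.2) :=
    hF.comp (measurable_fst.add ((measurable_pi_lambda _ fun i => by
      by_cases hi : i = e
      · subst hi; simpa using measurable_id'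
      · simp [hi]).comp measurable_snd))
  have hsm : ∀ y, Measurable fun s => F (y + Pi.single e s) := fun y =>
    hmeas.comp (measurable_prodMk_left (x := y))
  have hin : Integrable (fun y => ∫ s, F (y + Pi.single e s) ∂(poissonReal (b e - a e)))
      (Measure.pi fun i => limitLaw (a i) (K i)) :=
    Integrable.of_bound (hmeas.stronglyMeasurable.integral_prod_right.aestronglyMeasurable) 1
      (ae_of_all _ fun y => abs_integral_le_const fun s => hF1 _)
  have hiF : Integrable F (Measure.pi fun i => limitLaw (a i) (K i)) :=
    Integrable.of_bound hF.aestronglyMeasurable 1 (ae_of_all _ hF1)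
  rw [← integral_sub hiF hin]
  refine abs_integral_le_const fun y => ?_
  have h1 := abs_integral_poissonReal_le (by linarith : 0 ≤ b e - a e) (hsm y) fun s => hF1 _
  have h2 : |∫ s, F (y + Pi.single e s) ∂(poissonReal (b e - a e))| ≤ 1 :=
    abs_integral_le_const fun s => hF1 _
  generalize ∫ s, F (y + Pi.single e s) ∂(poissonReal (b e - a e)) = I at h1 h2 ⊢
  simp only [Pi.single_zero, add_zero] at h1
  have h3 := abs_le.1 h1
  have h4 := abs_le.1 (hF1 y)
  have h5 := abs_le.1 (hF1 (y + Pi.single e 1))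
  have h6 := abs_le.1 h2
  generalize F (y + Pi.single e 1) = u at h3 h5
  generalize F y = v at h3 h4 ⊢
  set t := b e - a e
  have ht : 0 ≤ t := by linarith
  -- the Bernoulli approximation is only useful for small `t`; otherwise the trivial bound suffices
  rcases le_total t 1 with h7 | h7
  · rw [abs_le]; constructor <;> nlinarith
  · rw [abs_le]; constructor <;> linarith

/-- The product of the limit laws depends continuously on the Poisson means. -/
lemma abs_integral_limitLaw_sub_le (K : Fin r → CycleType m) {a b : Fin r → ℝ}
    (ha : ∀ i, (K i).2 = 0 → 0 ≤ a i) (hab : ∀ i, (K i).2 = 0 → a i ≤ b i) {η : ℝ} (hη : 0 ≤ η)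
    (hb : ∀ i, (K i).2 = 0 → b i - a i ≤ η)
    {F : (Fin r → ℝ) → ℝ} (hF : Measurable F) (hF1 : ∀ y, |F y| ≤ 1) :
    |∫ y, F y ∂(Measure.pi fun i => limitLaw (a i) (K i)) -
      ∫ y, F y ∂(Measure.pi fun i => limitLaw (b i) (K i))| ≤ r * (6 * η) := by
  classical
  have h : ∀ A : Finset (Fin r), |∫ y, F y ∂(Measure.pi fun i => limitLaw (a i) (K i)) -
      ∫ y, F y ∂(Measure.pi fun i => limitLaw (if i ∈ A then b i else a i) (K i))| ≤
      A.card * (6 * η) := by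
    intro A
    induction A using Finset.induction_on with
    | empty => simp
    | insert e A he ih =>
      have hstep : |∫ y, F y ∂(Measure.pi fun i => limitLaw (if i ∈ A then b i else a i) (K i)) -
          ∫ y, F y ∂(Measure.pi fun i => limitLaw (if i ∈ insert e A then b i else a i) (K i))| ≤
          6 * η := by
        by_cases hl : (K e).2 = 0
        · refine abs_integral_limitLaw_update_le K e (fun i hi => ?_) ?_ ?_ ?_ hF hF1
          · simp [Finset.mem_insert, hi]
          · simpa [he] using ha e hl
          · simpa [he] using hab e hl
          · simpa [he] using hb e hl
        · have : (fun i => limitLaw (if i ∈ A then b i else a i) (K i)) =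
              fun i => limitLaw (if i ∈ insert e A then b i else a i) (K i) := by
            funext i
            by_cases hi : i = e
            · subst hi; simp [limitLaw, hl]
            · simp [Finset.mem_insert, hi]
          rw [this, sub_self, abs_zero]; positivity
      rw [Finset.card_insert_of_notMem he]
      push_cast
      refine (abs_sub_le _ _ _).trans ((add_le_add ih hstep).trans (le_of_eq ?_))
      ring
  simpa using h Finset.univ

/-- The number of cycles of a type without covariate wedges, and zero for the other types. -/
noncomputable def countPart (K : CycleType m) (n p : ℕ) (y : Graph m n) : ℝ :=
  if K.2 = 0 then ∑ E ∈ loops m n p K, edgeInd (netSet E) y else 0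

section
variable {d lam : Fin m → ℝ} {mu : ℝ} {k : ℕ} {X g δ : ℝ}

/-- The cycles without covariate wedges, of the given types. -/
noncomputable def netLoops (n p : ℕ) (K : Fin r → CycleType m) :
    Finset (Σ _ : Fin r, Finset (Link m n p)) :=
  (Finset.univ.filter fun i => (K i).2 = 0).sigma fun i => loops m n p (K i)

lemma mem_netLoops {K : Fin r → CycleType m} {t : Σ _ : Fin r, Finset (Link m n p)} :
    t ∈ netLoops n p K ↔ (K t.1).2 = 0 ∧ t.2 ∈ loops m n p (K t.1) := by
  simp [netLoops]

/-- The vector of the numbers of cycles as a sum of indicators that each affect one coordinate. -/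
lemma classSum_netLoops (K : Fin r → CycleType m) (y : Graph m n) :
    classSum (fun t : Σ _ : Fin r, Finset (Link m n p) => t.1) (fun t => edgeInd (netSet t.2))
      (netLoops n p K) y = fun i => countPart (K i) n p y := by
  funext i
  rw [classSum, Finset.sum_apply, netLoops, Finset.sum_sigma]
  simp only [Pi.single_apply, Finset.sum_filter, countPart]
  have : ∀ j : Fin r, (∑ E ∈ loops m n p (K j), if i = j then edgeInd (netSet E) y else 0) =
      if i = j then ∑ E ∈ loops m n p (K j), edgeInd (netSet E) y else 0 := by
    intro j; split_ifs <;> simp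
  simp only [this]
  rw [Finset.sum_eq_single i]
  · simp
  · intro j _ hj; simp [Ne.symm hj]
  · simp

lemma sum_netLoops (K : Fin r → CycleType m) (f : (Σ _ : Fin r, Finset (Link m n p)) → ℝ)
    (i : Fin r) : ∑ t ∈ netLoops n p K with t.1 = i, f t =
      if (K i).2 = 0 then ∑ E ∈ loops m n p (K i), f ⟨i, E⟩ else 0 := by
  rw [Finset.sum_filter, netLoops, Finset.sum_sigma, Finset.sum_filter, Finset.sum_eq_single i]
  · simp
  · intro j _ hj; simp [hj]
  · simp

lemma covSet_eq_empty {K : CycleType m} (hK : 2 ≤ size K) (hl : K.2 = 0)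
    {E : Finset (Link m n p)} (hE : E ∈ loops m n p K) : covSet E = ∅ := by
  rw [← Finset.card_eq_zero, card_covSet hK hE, hl]

lemma IsScale.prob_le (h : IsScale d lam mu n p k X) {K : CycleType m} (hK : 2 ≤ size K)
    (hk : size K ≤ k) {E : Finset (Link m n p)} (hE : E ∈ loops m n p K) :
    ∫ y, edgeInd (netSet E) y ∂(graphLaw m n d lam) ≤ X ^ k * (n : ℝ)⁻¹ ^ (netSet E).card := by
  refine (h.integral_edgeInd_le _).trans ?_
  have := h.pow_le_pow (card_netSet_le hK hk hE)
  have := h.inv_nonneg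
  gcongr

/-- The squared probabilities of the cycles have a small sum, as every cycle is rare. -/
lemma IsScale.sum_sq_prob_le (h : IsScale d lam mu n p k X) {K : CycleType m} (hK : 2 ≤ size K)
    (hk : size K ≤ k) (hl : K.2 = 0) :
    ∑ E ∈ loops m n p K, 4 * (∫ y, edgeInd (netSet E) y ∂(graphLaw m n d lam)) ^ 2 ≤
      4 * X ^ (4 * k) * (n : ℝ)⁻¹ := by
  have hX := h.pos
  have hw := h.inv_nonneg
  have h1 : ∀ E ∈ loops m n p K, 4 * (∫ y, edgeInd (netSet E) y ∂(graphLaw m n d lam)) ^ 2 ≤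
      4 * X ^ (2 * k) * (n : ℝ)⁻¹ * unionWeight E := by
    intro E hE
    have hc : (netSet E).card = size K := by rw [card_netSet hK hE, size, hl, add_zero]
    calc 4 * (∫ y, edgeInd (netSet E) y ∂(graphLaw m n d lam)) ^ 2
        ≤ 4 * (X ^ k * (n : ℝ)⁻¹ ^ (netSet E).card) ^ 2 := by
          have := h.prob_le hK hk hE
          have : 0 ≤ ∫ y, edgeInd (netSet E) y ∂(graphLaw m n d lam) :=
            integral_nonneg fun y => edgeInd_nonneg _ y
          gcongr
      _ = 4 * X ^ (2 * k) * ((n : ℝ)⁻¹ ^ (netSet E).card * (n : ℝ)⁻¹ ^ (netSet E).card) := by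
          rw [mul_comm 2 k, pow_mul]; ring
      _ ≤ 4 * X ^ (2 * k) * ((n : ℝ)⁻¹ * unionWeight E) := by
          rw [unionWeight, covSet_eq_empty hK hl hE, Finset.card_empty, add_zero]
          have : (n : ℝ)⁻¹ ^ (netSet E).card ≤ (n : ℝ)⁻¹ :=
            pow_le_of_le_one hw h.inv_le_one (by omega)
          gcongr
      _ = _ := by ring
  refine (Finset.sum_le_sum h1).trans ?_
  rw [← Finset.mul_sum]
  have h2 := h.sum_unionWeight_le hK hk
  calc _ ≤ 4 * X ^ (2 * k) * (n : ℝ)⁻¹ * X ^ (2 * k) := by gcongr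
    _ = _ := by rw [show 4 * k = 2 * k + 2 * k by ring, pow_add]; ring

/-- The probability that two cycles are both present, whether computed from the joint law or as if
they were independent, is governed by the size of their union. -/
lemma IsScale.pair_prob_le (h : IsScale d lam mu n p k X) {K K' : CycleType m} (hK : 2 ≤ size K)
    (hk : size K ≤ k) (hl : K.2 = 0) (hK' : 2 ≤ size K') (hk' : size K' ≤ k) (hl' : K'.2 = 0)
    {E E' : Finset (Link m n p)} (hE : E ∈ loops m n p K) (hE' : E' ∈ loops m n p K') :
    ∫ y, edgeInd (netSet E) y * edgeInd (netSet E') y ∂(graphLaw m n d lam) +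
      (∫ y, edgeInd (netSet E) y ∂(graphLaw m n d lam)) *
        ∫ y, edgeInd (netSet E') y ∂(graphLaw m n d lam) ≤
      2 * X ^ (2 * k) * unionWeight (E ∪ E') := by
  classical
  have hX := h.pos
  have hw := h.inv_nonneg
  have hcard := Finset.card_union_le (netSet E) (netSet E')
  have e : unionWeight (E ∪ E') = (n : ℝ)⁻¹ ^ (netSet E ∪ netSet E').card := by
    rw [unionWeight, covSet_union, netSet_union, covSet_eq_empty hK hl hE,
      covSet_eq_empty hK' hl' hE', Finset.union_self, Finset.card_empty, add_zero]
  have h1 : ∫ y, edgeInd (netSet E) y * edgeInd (netSet E') y ∂(graphLaw m n d lam) ≤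
      X ^ (2 * k) * unionWeight (E ∪ E') := by
    simp only [edgeInd_mul]
    rw [e]
    refine (h.integral_edgeInd_le _).trans ?_
    have a1 := card_netSet_le hK hk hE
    have a2 := card_netSet_le hK' hk' hE'
    have := h.pow_le_pow (show (netSet E ∪ netSet E').card ≤ 2 * k by omega)
    gcongr
  have h2 : (∫ y, edgeInd (netSet E) y ∂(graphLaw m n d lam)) *
      ∫ y, edgeInd (netSet E') y ∂(graphLaw m n d lam) ≤ X ^ (2 * k) * unionWeight (E ∪ E') := by
    calc _ ≤ (X ^ k * (n : ℝ)⁻¹ ^ (netSet E).card) * (X ^ k * (n : ℝ)⁻¹ ^ (netSet E').card) :=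
          mul_le_mul (h.prob_le hK hk hE) (h.prob_le hK' hk' hE')
            (integral_nonneg fun y => edgeInd_nonneg _ y) (by positivity)
      _ = X ^ (2 * k) * (n : ℝ)⁻¹ ^ ((netSet E).card + (netSet E').card) := by
          rw [show 2 * k = k + k by ring, pow_add, pow_add]; ring
      _ ≤ _ := by
          rw [e]
          exact mul_le_mul_of_nonneg_left (pow_le_pow_of_le_one hw h.inv_le_one hcard)
            (by positivity)
  linarith

lemma sum_netLoops_le (K : Fin r → CycleType m) (f : (Σ _ : Fin r, Finset (Link m n p)) → ℝ)
    (hf : ∀ t, 0 ≤ f t) :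
    ∑ t ∈ netLoops n p K, f t ≤ ∑ i, ∑ E ∈ loops m n p (K i), f ⟨i, E⟩ := by
  rw [netLoops, Finset.sum_sigma]
  exact Finset.sum_le_sum_of_subset_of_nonneg (Finset.filter_subset _ _)
    fun i _ _ => Finset.sum_nonneg fun E _ => hf _

open Classical in
/-- The order of magnitude of the contribution of a pair of distinct cycles that meet. -/
noncomputable def pairWeight (E E' : Finset (Link m n p)) : ℝ :=
  if E ≠ E' ∧ ¬ Disjoint (supp E) (supp E') then unionWeight (E ∪ E') else 0

lemma pairWeight_nonneg (E E' : Finset (Link m n p)) : 0 ≤ pairWeight E E' := by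
  have := unionWeight_nonneg (E ∪ E')
  unfold pairWeight
  split_ifs
  · convert this
  · exact le_rfl

lemma IsScale.sum_netLoops_pair_le (h : IsScale d lam mu n p k X) {K : Fin r → CycleType m}
    (hK : ∀ i, Admissible (K i)) (hk : ∀ i, size (K i) ≤ k) :
    ∑ t ∈ netLoops n p K, ∑ s ∈ netLoops n p K, pairWeight t.2 s.2 ≤
      r ^ 2 * ((n : ℝ)⁻¹ * X ^ (4 * k)) := by
  calc _ ≤ ∑ t ∈ netLoops n p K, ∑ j, ∑ E' ∈ loops m n p (K j), pairWeight t.2 E' :=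
        Finset.sum_le_sum fun t _ =>
          sum_netLoops_le K (fun s => pairWeight t.2 s.2) fun s => pairWeight_nonneg _ _
    _ ≤ ∑ i, ∑ E ∈ loops m n p (K i), ∑ j, ∑ E' ∈ loops m n p (K j), pairWeight E E' :=
        sum_netLoops_le K (fun t => ∑ j, ∑ E' ∈ loops m n p (K j), pairWeight t.2 E') fun t =>
          Finset.sum_nonneg fun j _ => Finset.sum_nonneg fun E' _ => pairWeight_nonneg _ _
    _ = ∑ i, ∑ j, ∑ E ∈ loops m n p (K i), ∑ E' ∈ loops m n p (K j), pairWeight E E' :=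
        Finset.sum_congr rfl fun i _ => Finset.sum_comm
    _ ≤ ∑ i : Fin r, ∑ j : Fin r, (n : ℝ)⁻¹ * X ^ (4 * k) :=
        Finset.sum_le_sum fun i _ => Finset.sum_le_sum fun j _ =>
          h.sum_pair_le (hK i).1 (hk i) (hK j).1 (hk j)
    _ = _ := by simp; ring

open Classical in
/-- The error terms of the Poisson approximation: two distinct cycles that meet have fewer vertices
than edges. -/
lemma IsScale.local_dependence_le (h : IsScale d lam mu n p k X) (hδ : (n : ℝ)⁻¹ ≤ δ)
    {K : Fin r → CycleType m} (hinj : Function.Injective K) (hK : ∀ i, Admissible (K i))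
    (hk : ∀ i, size (K i) ≤ k) :
    ∑ t ∈ netLoops n p K, (4 * (∫ y, edgeInd (netSet t.2) y ∂(graphLaw m n d lam)) ^ 2 +
      4 * ∑ s ∈ netLoops n p K with s ≠ t ∧ ¬ Disjoint (supp t.2) (supp s.2),
        (∫ y, edgeInd (netSet t.2) y * edgeInd (netSet s.2) y ∂(graphLaw m n d lam) +
          (∫ y, edgeInd (netSet t.2) y ∂(graphLaw m n d lam)) *
          ∫ y, edgeInd (netSet s.2) y ∂(graphLaw m n d lam))) ≤
      12 * r ^ 2 * (X ^ (6 * k) * δ) := by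
  classical
  have hX := h.pos
  have hw := h.inv_nonneg
  have hδ0 : 0 ≤ δ := hw.trans hδ
  have hpair : ∀ t ∈ netLoops n p K, ∀ s ∈ netLoops n p K,
      (if s ≠ t ∧ ¬ Disjoint (supp t.2) (supp s.2) then
        (∫ y, edgeInd (netSet t.2) y * edgeInd (netSet s.2) y ∂(graphLaw m n d lam) +
          (∫ y, edgeInd (netSet t.2) y ∂(graphLaw m n d lam)) *
          ∫ y, edgeInd (netSet s.2) y ∂(graphLaw m n d lam)) else 0) ≤
      2 * X ^ (2 * k) * pairWeight t.2 s.2 := by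
    intro t ht s hs
    obtain ⟨ht1, ht2⟩ := mem_netLoops.1 ht
    obtain ⟨hs1, hs2⟩ := mem_netLoops.1 hs
    by_cases hc : s ≠ t ∧ ¬ Disjoint (supp t.2) (supp s.2)
    · have hne : t.2 ≠ s.2 := by
        intro he
        by_cases hij : t.1 = s.1
        · exact hc.1 (Sigma.ext hij.symm (heq_of_eq he.symm))
        · exact ne_of_mem_loops (hK _).1 (hK _).1 (fun h => hij (hinj h)) ht2 hs2 he
      rw [if_pos hc, pairWeight, if_pos ⟨hne, hc.2⟩]
      convert h.pair_prob_le (hK _).1 (hk _) ht1 (hK _).1 (hk _) hs1 ht2 hs2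
    · rw [if_neg hc]
      have := pairWeight_nonneg t.2 s.2
      positivity
  have hr : (r : ℝ) ≤ r ^ 2 := by exact_mod_cast Nat.le_self_pow two_ne_zero r
  rw [Finset.sum_add_distrib]
  have a1 : ∑ t ∈ netLoops n p K, 4 * (∫ y, edgeInd (netSet t.2) y ∂(graphLaw m n d lam)) ^ 2 ≤
      r * (4 * X ^ (4 * k) * (n : ℝ)⁻¹) := by
    rw [netLoops, Finset.sum_sigma]
    refine (Finset.sum_le_sum fun i hi => h.sum_sq_prob_le (hK i).1 (hk i)
      (Finset.mem_filter.1 hi).2).trans ?_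
    rw [Finset.sum_const, nsmul_eq_mul]
    refine mul_le_mul_of_nonneg_right ?_ (by positivity)
    exact_mod_cast (Finset.card_filter_le _ _).trans (by simp)
  have a2 : ∑ t ∈ netLoops n p K, ∑ s ∈ netLoops n p K with
      s ≠ t ∧ ¬ Disjoint (supp t.2) (supp s.2),
      (∫ y, edgeInd (netSet t.2) y * edgeInd (netSet s.2) y ∂(graphLaw m n d lam) +
        (∫ y, edgeInd (netSet t.2) y ∂(graphLaw m n d lam)) *
        ∫ y, edgeInd (netSet s.2) y ∂(graphLaw m n d lam)) ≤
      r ^ 2 * (2 * X ^ (2 * k) * ((n : ℝ)⁻¹ * X ^ (4 * k))) := by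
    simp only [Finset.sum_filter]
    refine (Finset.sum_le_sum fun t ht => Finset.sum_le_sum fun s hs => hpair t ht s hs).trans ?_
    simp only [← Finset.mul_sum]
    have b1 := h.sum_netLoops_pair_le hK hk
    calc _ ≤ 2 * X ^ (2 * k) * (r ^ 2 * ((n : ℝ)⁻¹ * X ^ (4 * k))) := by gcongr
      _ = _ := by ring
  have a3 : X ^ (4 * k) ≤ X ^ (6 * k) := h.pow_le_pow (by omega)
  have a4 := mul_le_mul_of_nonneg_left a2 (zero_le_four (α := ℝ))
  rw [Finset.mul_sum] at a4
  calc _ ≤ r * (4 * X ^ (4 * k) * (n : ℝ)⁻¹) +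
        4 * (r ^ 2 * (2 * X ^ (2 * k) * ((n : ℝ)⁻¹ * X ^ (4 * k)))) := by linarith
    _ ≤ r ^ 2 * (4 * X ^ (6 * k) * δ) + 4 * (r ^ 2 * (2 * X ^ (2 * k) * (δ * X ^ (4 * k)))) := by
        gcongr
    _ = _ := by rw [show 6 * k = 2 * k + 4 * k by ring, pow_add]; ring

/-- The numbers of cycles without covariate wedges are asymptotically independent Poisson
variables. -/
lemma IsScale.abs_countPart_sub_le (h : IsScale d lam mu n p k X) (hδ : (n : ℝ)⁻¹ ≤ δ)
    {K : Fin r → CycleType m} (hinj : Function.Injective K) (hK : ∀ i, Admissible (K i))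
    (hk : ∀ i, size (K i) ≤ k) {F : (Fin r → ℝ) → ℝ} (hF : Measurable F) (hF1 : ∀ y, |F y| ≤ 1) :
    |∫ y, ∫ v, F ((fun i => countPart (K i) n p y) + v) ∂(Measure.pi fun i => limitLaw 0 (K i))
        ∂(graphLaw m n d lam) -
      ∫ y, F y ∂(Measure.pi fun i => limitLaw (altRate d lam (K i)) (K i))| ≤
    18 * r ^ 2 * (X ^ (6 * k) * δ) := by
  classical
  have hX := h.pos
  have hw := h.inv_nonneg
  have hδ0 : 0 ≤ δ := hw.trans hδ
  have h1 := abs_classSum_sub_le (P := graphLaw m n d lam)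
    (c := fun t : Σ _ : Fin r, Finset (Link m n p) => t.1) (X := fun t => edgeInd (netSet t.2))
    (fun t y => edgeInd_eq_zero_or_one _ y) (fun t s => ¬ Disjoint (supp t.2) (supp s.2))
    (netLoops n p K) (fun t ht B hB hrel f => by
      have hring : ∀ s ∈ netLoops n p K, MinDegTwo s.2 := fun s hs =>
        (isRing_of_mem_loops (hK s.1).1 (mem_netLoops.1 hs).2).minDegTwo
      refine integral_mul_of_separated d lam (varSet t.2) _ _ ?_ ?_
      · intro y y' _ h2
        exact edgeInd_congr (hring t ht) h2
      · intro y y' _ h2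
        have : ∀ s ∈ B, edgeInd (netSet s.2) y = edgeInd (netSet s.2) y' := by
          intro s hs
          have hd := (disjoint_supp (not_not.1 (hrel s hs))).1
          have hd' : ∀ i ∈ varSet s.2, i ∉ varSet t.2 := fun i hi hi' =>
            Finset.disjoint_left.1 hd hi' hi
          exact edgeInd_congr (hring s (hB hs)) fun r e ha hb => h2 r e (hd' _ ha) (hd' _ hb)
        simp only [classSum]
        rw [Finset.sum_congr rfl fun s hs => by rw [this s hs]])
    (fun a i => limitLaw a (K i))
    (fun t ht a => by simp [limitLaw, (mem_netLoops.1 ht).1]) hF hF1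
  simp only [classSum_netLoops] at h1
  have hmean : ∀ i, (K i).2 = 0 →
      ∑ t ∈ netLoops n p K with t.1 = i, ∫ y, edgeInd (netSet t.2) y ∂(graphLaw m n d lam) =
      (loops m n p (K i)).card * ((∏ j, d j ^ (K i).1 j + ∏ j, (lam j * √(d j)) ^ (K i).1 j) /
        n ^ (∑ j, (K i).1 j)) := by
    intro i hl
    rw [sum_netLoops K (fun t => ∫ y, edgeInd (netSet t.2) y ∂(graphLaw m n d lam)), if_pos hl,
      Finset.sum_congr rfl fun E hE => (integral_edgeInd_loop h.d_nonneg h.lam_nonneg h.lam_le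
        h.n_pos (fun j => (h.d_le j).trans h.le_n) (hK i).1 hE).1, Finset.sum_const, nsmul_eq_mul,
      hl, pow_zero, mul_one]
  have h2 := abs_integral_limitLaw_sub_le K
    (a := fun i => ∑ t ∈ netLoops n p K with t.1 = i,
      ∫ y, edgeInd (netSet t.2) y ∂(graphLaw m n d lam))
    (b := fun i => altRate d lam (K i)) (η := X ^ (4 * k) * δ)
    (fun i _ => Finset.sum_nonneg fun t _ => integral_nonneg fun y => edgeInd_nonneg _ y)
    (fun i hl => by
      simp only [hmean i hl]
      exact (h.card_loops_mul_rate hδ (hK i) (hk i) hl).1)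
    (by positivity)
    (fun i hl => by
      simp only [hmean i hl]
      exact (h.card_loops_mul_rate hδ (hK i) (hk i) hl).2) hF hF1
  have h3 := h.local_dependence_le hδ hinj hK hk
  have h4 : r * (6 * (X ^ (4 * k) * δ)) ≤ 6 * r ^ 2 * (X ^ (6 * k) * δ) := by
    have hr : (r : ℝ) ≤ r ^ 2 := by exact_mod_cast Nat.le_self_pow two_ne_zero r
    have a3 : X ^ (4 * k) ≤ X ^ (6 * k) := h.pow_le_pow (by omega)
    calc r * (6 * (X ^ (4 * k) * δ)) ≤ r ^ 2 * (6 * (X ^ (6 * k) * δ)) := by gcongr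
      _ = _ := by ring
  refine (abs_sub_le _ _ _).trans ((add_le_add (h1.trans h3) (h2.trans h4)).trans (le_of_eq ?_))
  ring

end

end CycleStat

namespace CycleStat

variable {m n p r : ℕ}

/-! ### Approximation of the joint law of the statistics -/

lemma abs_integral_sub_integral_le {Ω : Type*} [MeasurableSpace Ω] {P : Measure Ω}
    [IsProbabilityMeasure P] {f g : Ω → ℝ} {c : ℝ} (hf : Integrable f P) (hg : Integrable g P)
    (h : ∀ x, |f x - g x| ≤ c) : |∫ x, f x ∂P - ∫ x, g x ∂P| ≤ c := by
  rw [← integral_sub hf hg]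
  exact abs_integral_le_const h

lemma measurable_normStat (mu c s : ℝ) (K : CycleType m) :
    Measurable (normStat mu c s K : Sample m n p → ℝ) := by
  have hw : ∀ (i : Fin n) (f : FactorNode m n p), Measurable fun x => weight mu x i f := by
    intro i f
    rcases f with f | j
    · exact (measurable_of_finite fun y : Graph m n => if y.2 f.1 f.2 then (1 : ℝ) else 0).comp
        measurable_fst
    · have h1 : Measurable fun x : Sample m n p => spin (x.1.1 i) :=
        (measurable_of_finite fun y : Graph m n => spin (y.1 i)).comp measurable_fst
      have h2 : Measurable fun x : Sample m n p => x.2.1 j :=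
        (measurable_pi_apply j).comp (measurable_fst.comp measurable_snd)
      have h3 : Measurable fun x : Sample m n p => x.2.2 i j :=
        (measurable_pi_apply j).comp ((measurable_pi_apply i).comp
          (measurable_snd.comp measurable_snd))
      exact ((h1.const_mul _).mul h2).add h3
  have hc : Measurable (cycleStat mu K : Sample m n p → ℝ) :=
    (Finset.measurable_sum _ fun S _ => Finset.measurable_prod _ fun q _ => hw _ _).const_mul _
  unfold normStat
  split_ifs
  · exact hc
  · exact (hc.sub_const c).div_const s

/-- The sample with the given networks, latent vector and noise. -/
abbrev Flat.sample (z : Flat m n p) : Sample m n p := (z.1, (z.2.1, fun i j => z.2.2 (i, j)))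

lemma cycleStat_flat {K : CycleType m} (hK : 2 ≤ size K) (mu : ℝ) (z : Flat m n p) :
    cycleStat mu K (Flat.sample z) = (n : ℝ)⁻¹ ^ K.2 * ∑ E ∈ loops m n p K,
      edgeInd (netSet E) z.1 * ∏ q ∈ covSet E, (signal mu z.1 z.2.1 q + z.2.2 q) := by
  rw [cycleStat_eq, inv_pow]
  congr 1
  exact Finset.sum_congr rfl fun E hE => prod_weight hK hE mu _

section
variable {d lam : Fin m → ℝ} {mu : ℝ} {k : ℕ} {X g δ : ℝ}

/-- A normalized statistic is the sum of the number of cycles, or the noise part, and a remainder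
that comes from the signal and the centring. -/
lemma normStat_flat {K : CycleType m} (hK : 2 ≤ size K) (mu c g : ℝ) (z : Flat m n p) :
    normStat mu c (stdDev d g K) K (Flat.sample z) =
      countPart K n p z.1 + noisePart (invStd d g K) K (z.1, z.2.2) +
        invStd d g K * (∑ E ∈ loops m n p K, (n : ℝ)⁻¹ ^ K.2 * signalPart mu E z - c) := by
  rw [normStat, cycleStat_flat hK, countPart, noisePart, invStd]
  split_ifs with hl
  · simp only [hl, pow_zero, one_mul, zero_mul, Finset.sum_const_zero, add_zero]
    refine Finset.sum_congr rfl fun E hE => ?_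
    rw [covSet_eq_empty hK hl hE, Finset.prod_empty, mul_one]
  · rw [zero_add, mul_sub, div_eq_inv_mul, mul_sub, ← add_sub_assoc, Finset.mul_sum,
      Finset.mul_sum, Finset.mul_sum, ← Finset.sum_add_distrib]
    congr 1
    refine Finset.sum_congr rfl fun E hE => ?_
    rw [signalPart]; ring

/-- The signal only contributes the mean. -/
lemma IsScale.integral_abs_signal_le (h : IsScale d lam mu n p k X) (hg : IsRatio g n p δ)
    {K : CycleType m} (hK : Admissible K) (hk : size K ≤ k) :
    ∫ z, |invStd d g K * (∑ E ∈ loops m n p K, (n : ℝ)⁻¹ ^ K.2 * signalPart mu E z -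
      altMean d lam mu g K)| ∂(flatLaw m n p d lam) ≤ X ^ (13 * k) * √δ := by
  have hX := h.pos
  have hδ := IsRatio.pos h hg
  have hs : 0 < X ^ (13 * k) * √δ := by have := Real.sqrt_pos.2 hδ; positivity
  by_cases hl : K.2 = 0
  · simp only [invStd, if_pos hl, zero_mul, abs_zero, integral_zero]; exact hs.le
  have hLp : AllLp (fun z : Flat m n p => ∑ E ∈ loops m n p K, (n : ℝ)⁻¹ ^ K.2 * signalPart mu E z -
      altMean d lam mu g K) (flatLaw m n p d lam) :=
    AllLp.sub (AllLp.sum _ fun E _ => (allLp_signalPart mu E).const_mul _) (AllLp.const _)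
  refine integral_abs_le_of_sq_le (hLp.const_mul _).memLp_two hs ?_
  simp only [mul_pow (invStd d g K)]
  rw [integral_const_mul, sq_mul_sqrt _ hδ.le, ← pow_mul]
  have h1 := h.integral_sq_signalPart_le hK.1 hk hl (altMean d lam mu g K)
  rw [h.card_loops_mul_signal hg hK] at h1
  have hτ := h.invStd_sq_le hg hK.1 hk
  obtain ⟨m0, m1⟩ := h.altMean_bounds hg hK.1 hk
  have hc := h.abs_countRatio_sub_one_le hg hK.1 hk
  have hδ1 := hg.le_half
  have hinv := hg.inv_le
  have h2 : (altMean d lam mu g K * countRatio g n p K - altMean d lam mu g K) ^ 2 ≤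
      X ^ (18 * k) * δ := by
    rw [← mul_sub_one, mul_pow, ← sq_abs (countRatio g n p K - 1)]
    calc _ ≤ (X ^ (5 * k)) ^ 2 * (X ^ (3 * k) * δ) ^ 2 := by gcongr
      _ = X ^ (16 * k) * (δ * δ) := by
        rw [show 16 * k = 5 * k * 2 + 3 * k * 2 by ring, pow_add, pow_mul, pow_mul]; ring
      _ ≤ X ^ (18 * k) * (δ * 1) := by
        have := h.pow_le_pow (show 16 * k ≤ 18 * k by omega)
        gcongr
        linarith
      _ = _ := by ring
  -- a power of the scale absorbs the numerical constant
  have hX3 : 3 ≤ X ^ (5 * k) := by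
    have : X ^ 2 ≤ X ^ (5 * k) := h.pow_le_pow (by have := hK.1; omega)
    nlinarith [h.two_le]
  calc _ ≤ X ^ (3 * k) * (X ^ (18 * k) * δ + 2 * δ * X ^ (18 * k)) := by
        refine mul_le_mul hτ (h1.trans (add_le_add h2 (by gcongr)))
          (integral_nonneg fun z => sq_nonneg _) (by positivity)
    _ = 3 * (X ^ (3 * k) * X ^ (18 * k) * δ) := by ring
    _ ≤ X ^ (5 * k) * (X ^ (3 * k) * X ^ (18 * k) * δ) := by gcongr
    _ = _ := by rw [show 13 * k * 2 = 5 * k + (3 * k + 18 * k) by ring, pow_add, pow_add]; ring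

lemma abs_sub_le_sum_of_lipschitz {F : (Fin r → ℝ) → ℝ} (hF : LipschitzWith 1 F)
    (a b : Fin r → ℝ) : |F a - F b| ≤ ∑ i, |a i - b i| := by
  have h := hF.dist_le_mul a b
  rw [Real.dist_eq, NNReal.coe_one, one_mul] at h
  refine h.trans ((dist_pi_le_iff (Finset.sum_nonneg fun i _ => abs_nonneg _)).2 fun i => ?_)
  rw [Real.dist_eq]
  exact Finset.single_le_sum (f := fun i => |a i - b i|) (fun i _ => abs_nonneg _)
    (Finset.mem_univ i)

/-- The statistics, with the sum of the number of cycles and the noise part in their place. -/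
lemma IsScale.abs_normStat_sub_le (h : IsScale d lam mu n p k X) (hg : IsRatio g n p δ)
    {K : Fin r → CycleType m} (hK : ∀ i, Admissible (K i)) (hk : ∀ i, size (K i) ≤ k)
    {F : (Fin r → ℝ) → ℝ} (hF : LipschitzWith 1 F) (hF1 : ∀ y, |F y| ≤ 1) :
    |∫ y, F y ∂((modelLaw m n p d lam).map fun x i =>
        normStat mu (altMean d lam mu g (K i)) (stdDev d g (K i)) (K i) x) -
      ∫ z, F (fun i => countPart (K i) n p z.1 + noisePart (invStd d g (K i)) (K i) z)
        ∂(noiseLaw m n p d lam)| ≤ r * (X ^ (13 * k) * √δ) := by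
  have hFm := hF.continuous.measurable
  have hm : Measurable fun (x : Sample m n p) (i : Fin r) =>
      normStat mu (altMean d lam mu g (K i)) (stdDev d g (K i)) (K i) x :=
    measurable_pi_lambda _ fun i => measurable_normStat _ _ _ _
  have hW : Measurable fun (z : Graph m n × (Fin n × Fin p → ℝ)) (i : Fin r) =>
      countPart (K i) n p z.1 + noisePart (invStd d g (K i)) (K i) z :=
    measurable_pi_lambda _ fun i => Measurable.add
      ((measurable_of_finite fun y : Graph m n => countPart (K i) n p y).comp measurable_fst)
      (measurable_noisePart _ _)
  have hπ : MeasurePreserving (fun z : Flat m n p => (z.1, z.2.2)) (flatLaw m n p d lam)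
      (noiseLaw m n p d lam) := (MeasurePreserving.id _).prod measurePreserving_snd
  have hι := measurePreserving_flat (m := m) (n := n) (p := p) d lam
  have e1 : ∫ y, F y ∂((modelLaw m n p d lam).map fun x i =>
        normStat mu (altMean d lam mu g (K i)) (stdDev d g (K i)) (K i) x) =
      ∫ z, F (fun i => normStat mu (altMean d lam mu g (K i)) (stdDev d g (K i)) (K i)
        (Flat.sample z)) ∂(flatLaw m n p d lam) := by
    rw [integral_map hm.aemeasurable hFm.aestronglyMeasurable, ← hι.map_eq]
    exact integral_map hι.measurable.aemeasurable (hFm.comp hm).aestronglyMeasurable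
  have e2 : ∫ z, F (fun i => countPart (K i) n p z.1 + noisePart (invStd d g (K i)) (K i) z)
        ∂(noiseLaw m n p d lam) =
      ∫ z, F (fun i => countPart (K i) n p z.1 +
        noisePart (invStd d g (K i)) (K i) (z.1, z.2.2)) ∂(flatLaw m n p d lam) := by
    rw [← hπ.map_eq]
    exact integral_map hπ.measurable.aemeasurable (hFm.comp hW).aestronglyMeasurable
  have i1 : Integrable (fun z => F (fun i => normStat mu (altMean d lam mu g (K i))
      (stdDev d g (K i)) (K i) (Flat.sample z))) (flatLaw m n p d lam) :=
    Integrable.of_bound (hFm.comp (hm.comp hι.measurable)).aestronglyMeasurable 1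
      (ae_of_all _ fun z => hF1 _)
  have i2 : Integrable (fun z => F (fun i => countPart (K i) n p z.1 +
      noisePart (invStd d g (K i)) (K i) (z.1, z.2.2))) (flatLaw m n p d lam) :=
    Integrable.of_bound (hFm.comp (hW.comp hπ.measurable)).aestronglyMeasurable 1
      (ae_of_all _ fun z => hF1 _)
  rw [e1, e2, ← integral_sub i1 i2]
  have hLp : ∀ i : Fin r, AllLp (fun z : Flat m n p => invStd d g (K i) *
      (∑ E ∈ loops m n p (K i), (n : ℝ)⁻¹ ^ (K i).2 * signalPart mu E z -
        altMean d lam mu g (K i))) (flatLaw m n p d lam) := fun i =>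
    (AllLp.sub (AllLp.sum _ fun E _ => (allLp_signalPart mu E).const_mul _)
      (AllLp.const _)).const_mul _
  refine (abs_integral_le_of_abs_le (integrable_finsetSum Finset.univ
    fun i _ => (hLp i).integrable.abs) fun z => ?_).trans ?_
  · refine (abs_sub_le_sum_of_lipschitz hF _ _).trans (le_of_eq ?_)
    refine Finset.sum_congr rfl fun i _ => ?_
    rw [normStat_flat (d := d) (hK i).1 mu (altMean d lam mu g (K i)) g z, add_sub_cancel_left]
  · rw [integral_finsetSum _ fun i _ => (hLp i).integrable.abs]
    refine (Finset.sum_le_sum fun i _ => h.integral_abs_signal_le hg (hK i) (hk i)).trans ?_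
    simp

end

/-- The joint law of the statistics is close to the product of the limit laws, with an explicit
error term. -/
theorem exists_blClose (r : ℕ) {ε : ℝ} (hε : 0 < ε) : ∃ M : ℝ, 0 ≤ M ∧
    ∀ {m n p k : ℕ} {d lam : Fin m → ℝ} {mu X g δ : ℝ}, IsScale d lam mu n p k X →
      IsRatio g n p δ → ∀ {K : Fin r → CycleType m}, Function.Injective K →
      (∀ i, Admissible (K i)) → (∀ i, size (K i) ≤ k) →
      BLClose ((modelLaw m n p d lam).map fun x i =>
          normStat mu (altMean d lam mu g (K i)) (stdDev d g (K i)) (K i) x)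
        (Measure.pi fun i => limitLaw (altRate d lam (K i)) (K i))
        (2 * ε + M * (X ^ (13 * k) * √δ)) := by
  obtain ⟨C, hC, hG⟩ := exists_smoothTest r hε
  -- the contributions of the signal, of the noise, and of the cycles in the networks
  refine ⟨r + 4 * C * r ^ 2 + 18 * r ^ 2, by positivity, ?_⟩
  intro m n p k d lam mu X g δ h hg K hinj hK hk F hF hF1
  obtain ⟨G, hGF⟩ := hG F hF hF1
  have hX := h.pos
  have hδ := IsRatio.pos h hg
  have hFm := hF.continuous.measurable
  have hGm := G.continuous.measurable
  -- the signal is removed for the Lipschitz function, the noise is replaced by Gaussian variables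
  -- for its smooth approximation, and the counts by Poisson variables for the Lipschitz function
  have h1 := h.abs_normStat_sub_le hg hK hk hF hF1
  have h3 := h.abs_noisePart_sub_le hg hinj hK hk hC G fun y i => countPart (K i) n p y
  have h5 := h.abs_countPart_sub_le hg.inv_le hinj hK hk hFm hF1
  have hW : Measurable fun (z : Graph m n × (Fin n × Fin p → ℝ)) (i : Fin r) =>
      countPart (K i) n p z.1 + noisePart (invStd d g (K i)) (K i) z :=
    measurable_pi_lambda _ fun i => Measurable.add
      ((measurable_of_finite fun y : Graph m n => countPart (K i) n p y).comp measurable_fst)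
      (measurable_noisePart _ _)
  have h2 : |∫ z, F (fun i => countPart (K i) n p z.1 + noisePart (invStd d g (K i)) (K i) z)
        ∂(noiseLaw m n p d lam) -
      ∫ z, G.f (fun i => countPart (K i) n p z.1 + noisePart (invStd d g (K i)) (K i) z)
        ∂(noiseLaw m n p d lam)| ≤ ε := by
    exact abs_integral_sub_integral_le
      (Integrable.of_bound (hFm.comp hW).aestronglyMeasurable 1 (ae_of_all _ fun z => hF1 _))
      (Integrable.of_bound (hGm.comp hW).aestronglyMeasurable C (ae_of_all _ fun z => G.bound _))
      fun z => hGF _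
  have h4 : |∫ y, ∫ v, G.f (fun i => countPart (K i) n p y + v i)
        ∂(Measure.pi fun i => limitLaw 0 (K i)) ∂(graphLaw m n d lam) -
      ∫ y, ∫ v, F ((fun i => countPart (K i) n p y) + v) ∂(Measure.pi fun i => limitLaw 0 (K i))
        ∂(graphLaw m n d lam)| ≤ ε := by
    refine abs_integral_sub_integral_le Integrable.of_finite Integrable.of_finite fun y => ?_
    have hv : Measurable fun (v : Fin r → ℝ) => (fun i => countPart (K i) n p y) + v :=
      measurable_id.const_add _
    refine abs_integral_sub_integral_le
      (Integrable.of_bound (hGm.comp hv).aestronglyMeasurable C (ae_of_all _ fun z => G.bound _))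
      (Integrable.of_bound (hFm.comp hv).aestronglyMeasurable 1 (ae_of_all _ fun z => hF1 _))
      fun v => ?_
    rw [abs_sub_comm]
    exact hGF _
  have h6 : X ^ (6 * k) * δ ≤ X ^ (13 * k) * √δ := by
    have a1 : X ^ (6 * k) ≤ X ^ (13 * k) := h.pow_le_pow (by omega)
    have a2 : δ ≤ √δ := by
      have := hg.le_half
      exact Real.le_sqrt_of_sq_le (by nlinarith)
    gcongr
  have h7 : (18 : ℝ) * r ^ 2 * (X ^ (6 * k) * δ) ≤ 18 * r ^ 2 * (X ^ (13 * k) * √δ) := by gcongr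
  have t1 := abs_le.1 h1
  have t2 := abs_le.1 h2
  have t3 := abs_le.1 h3
  have t4 := abs_le.1 h4
  have t5 := abs_le.1 h5
  generalize X ^ (13 * k) * √δ = B at *
  have e : 2 * ε + (r + 4 * C * r ^ 2 + 18 * r ^ 2) * B =
      r * B + ε + 2 * C * (r ^ 2 * (2 * B)) + ε + 18 * r ^ 2 * B := by ring
  rw [e, abs_le]
  constructor <;> linarith

end CycleStat

namespace CycleStat

/-! ### Passage to the limit -/

section
variable {r : ℕ} {Ω : ℕ → Type*} [∀ n, MeasurableSpace (Ω n)] {P : (n : ℕ) → Measure (Ω n)}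
  [∀ n, IsProbabilityMeasure (P n)]

/-- Convergence in the bounded Lipschitz metric implies convergence in distribution. -/
lemma tendstoInDistribution_of_blClose {Y : (n : ℕ) → Ω n → Fin r → ℝ}
    (hY : ∀ n, Measurable (Y n)) {Q : Measure (Fin r → ℝ)} [IsProbabilityMeasure Q]
    (h : ∀ ε > 0, ∀ᶠ n in atTop, BLClose ((P n).map (Y n)) Q ε) :
    TendstoInDistribution Y atTop id P Q where
  forall_aemeasurable n := (hY n).aemeasurable
  aemeasurable_limit := aemeasurable_id
  tendsto := by
    refine tendsto_iff_forall_lipschitz_integral_tendsto.2 ?_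
    rintro f ⟨C, hC⟩ ⟨L, hL⟩
    simp only [ProbabilityMeasure.coe_mk, Measure.map_id]
    -- a multiple of the test function is bounded by one and has the Lipschitz constant one
    set M : ℝ := |f 0| + |C| + L + 1 with hM
    have hM0 : 0 < M := by positivity
    have hb : ∀ y, |M⁻¹ * f y| ≤ 1 := by
      intro y
      rw [abs_mul, abs_of_pos (inv_pos.2 hM0), inv_mul_le_iff₀ hM0, mul_one]
      have h1 := hC y 0
      rw [Real.dist_eq] at h1
      have h2 := abs_sub_abs_le_abs_sub (f y) (f 0)
      have h3 := le_abs_self C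
      have h4 : (0 : ℝ) ≤ L := L.2
      linarith
    have hlip : LipschitzWith 1 fun y => M⁻¹ * f y := by
      refine LipschitzWith.of_dist_le_mul fun x y => ?_
      rw [Real.dist_eq, ← mul_sub, abs_mul, abs_of_pos (inv_pos.2 hM0), inv_mul_le_iff₀ hM0,
        NNReal.coe_one, one_mul, ← Real.dist_eq]
      refine (hL.dist_le_mul x y).trans (mul_le_mul_of_nonneg_right ?_ dist_nonneg)
      have := abs_nonneg (f 0)
      have := abs_nonneg C
      linarith
    rw [Metric.tendsto_atTop]
    intro ε hε
    obtain ⟨N, hN⟩ := eventually_atTop.1 (h (ε / (2 * M)) (by positivity))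
    refine ⟨N, fun n hn => ?_⟩
    have h1 := hN n hn _ hlip hb
    rw [integral_const_mul, integral_const_mul, ← mul_sub, abs_mul, abs_of_pos (inv_pos.2 hM0),
      inv_mul_le_iff₀ hM0] at h1
    rw [Real.dist_eq]
    calc _ ≤ M * (ε / (2 * M)) := h1
      _ = ε / 2 := by field_simp
      _ < ε := by linarith

/-- The marginal laws of a sequence of vectors of length one that converges in distribution. -/
lemma tendstoInDistribution_eval {Y : (n : ℕ) → Ω n → Fin 1 → ℝ} {ν : Fin 1 → Measure ℝ}
    [∀ i, IsProbabilityMeasure (ν i)]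
    (h : TendstoInDistribution Y atTop id P (Measure.pi ν)) :
    TendstoInDistribution (fun n x => Y n x 0) atTop (id : ℝ → ℝ) P (ν 0) where
  forall_aemeasurable n := (measurable_pi_apply 0).comp_aemeasurable (h.forall_aemeasurable n)
  aemeasurable_limit := aemeasurable_id
  tendsto := by
    have h1 := (h.continuous_comp (continuous_apply (0 : Fin 1))).tendsto
    have e : (Measure.pi ν).map ((fun y : Fin 1 → ℝ => y 0) ∘ id) = (ν 0).map id := by
      rw [Measure.map_id, Function.comp_id]
      exact (measurePreserving_eval ν 0).map_eq
    exact (congrArg (fun L : ProbabilityMeasure ℝ => Tendsto (β := ProbabilityMeasure ℝ)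
      (fun n => ⟨(P n).map fun x => Y n x 0, Measure.isProbabilityMeasure_map
        ((measurable_pi_apply 0).comp_aemeasurable (h.forall_aemeasurable n))⟩) atTop (𝓝 L))
      (Subtype.ext e)).mp h1

end

section
variable {m : ℕ} {d lam : Fin m → ℝ} {mu γ : ℝ} {p : ℕ → ℕ}

/-- For large `n` a scale is available that is proportional to the size of the cycles. -/
lemma exists_isScale (hd : ∀ j, 1 < d j) (hl0 : ∀ j, 0 ≤ lam j) (hl : ∀ j, lam j ≤ √(d j))
    (hmu : 0 ≤ mu) (hγ : 0 < γ)
    (hp : Tendsto (fun n : ℕ => (n : ℝ) / (p n : ℝ)) atTop (𝓝 γ)) :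
    ∃ A : ℝ, 2 ≤ A ∧ ∀ᶠ n : ℕ in atTop, ∀ k : ℕ, A * (k + 1) ≤ n →
      IsScale d lam mu n (p n) k (A * (k + 1)) := by
  have hd0 : ∀ j, 0 ≤ 2 * d j := fun j => by linarith [hd j]
  have hG := one_le_gaussBound
  have hS : 0 ≤ ∑ j, 2 * d j := Finset.sum_nonneg fun j _ => hd0 j
  have hγ' : 0 < γ⁻¹ := inv_pos.2 hγ
  -- the sum of the bounds that the scale has to satisfy
  refine ⟨2 + gaussBound + (γ + 1) + ∑ j, 2 * d j + mu + (m + 1 + (γ⁻¹ + 1)) + 8, ?_, ?_⟩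
  · have : (0 : ℝ) ≤ m := by positivity
    linarith
  have h1 : ∀ᶠ n : ℕ in atTop, (n : ℝ) / (p n : ℝ) < γ + 1 :=
    hp.eventually (gt_mem_nhds (by linarith))
  have h2 : ∀ᶠ n : ℕ in atTop, ((n : ℝ) / (p n : ℝ))⁻¹ < γ⁻¹ + 1 :=
    (hp.inv₀ hγ.ne').eventually (gt_mem_nhds (by linarith))
  have h3 : ∀ᶠ n : ℕ in atTop, 0 < (n : ℝ) / (p n : ℝ) := hp.eventually (lt_mem_nhds hγ)
  filter_upwards [h1, h2, h3] with n h1 h2 h3 k hk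
  set B : ℝ := 2 + gaussBound + (γ + 1) + ∑ j, 2 * d j + mu + (m + 1 + (γ⁻¹ + 1)) + 8 with hB
  have hm : (0 : ℝ) ≤ m := by positivity
  have hB0 : 0 ≤ B := by linarith
  have hk0 : (0 : ℝ) ≤ k := by positivity
  have hBX : B ≤ B * (k + 1) := le_mul_of_one_le_right hB0 (by linarith)
  have hn : (0 : ℝ) < n := by
    rcases (Nat.cast_nonneg n : (0 : ℝ) ≤ n).lt_or_eq with h | h
    · exact h
    · rw [← h, zero_div] at h3; exact absurd h3 (lt_irrefl 0)
  have hp0 : (0 : ℝ) < p n := by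
    rcases (Nat.cast_nonneg (p n) : (0 : ℝ) ≤ p n).lt_or_eq with h | h
    · exact h
    · rw [← h, div_zero] at h3; exact absurd h3 (lt_irrefl 0)
  refine ⟨by linarith, by linarith, hk, ?_, hd, fun j => ?_, hl0, hl, hmu, by linarith, ?_⟩
  · rw [div_lt_iff₀ hp0] at h1
    exact h1.le.trans (mul_le_mul_of_nonneg_right (by linarith) hp0.le)
  · have := Finset.single_le_sum (f := fun j => 2 * d j) (fun j _ => hd0 j) (Finset.mem_univ j)
    linarith
  · have e : ((n : ℝ) + p n) * (n : ℝ)⁻¹ = 1 + ((n : ℝ) / (p n : ℝ))⁻¹ := by field_simp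
    rw [e]
    push_cast
    nlinarith

/-- The approximation holds uniformly as long as the error term tends to zero. -/
lemma eventually_blClose {g δ X : ℕ → ℝ} {k : ℕ → ℕ}
    (hscale : ∀ᶠ n in atTop, IsScale d lam mu n (p n) (k n) (X n))
    (hratio : ∀ᶠ n in atTop, IsRatio (g n) n (p n) (δ n))
    (hlim : Tendsto (fun n => X n ^ (13 * k n) * √(δ n)) atTop (𝓝 0)) (r : ℕ) {ε : ℝ}
    (hε : 0 < ε) :
    ∀ᶠ n in atTop, ∀ K : Fin r → CycleType m, Function.Injective K →
      (∀ i, Admissible (K i)) → (∀ i, size (K i) ≤ k n) →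
      BLClose ((modelLaw m n (p n) d lam).map fun x i =>
          normStat mu (altMean d lam mu (g n) (K i)) (stdDev d (g n) (K i)) (K i) x)
        (Measure.pi fun i => limitLaw (altRate d lam (K i)) (K i)) ε := by
  obtain ⟨M, hM, hbl⟩ := exists_blClose r (show 0 < ε / 4 by positivity)
  have h1 : ∀ᶠ n in atTop, M * (X n ^ (13 * k n) * √(δ n)) < ε / 2 := by
    have := hlim.const_mul M
    rw [mul_zero] at this
    exact this.eventually (gt_mem_nhds (by positivity))
  filter_upwards [hscale, hratio, h1] with n h2 h3 h4 K hinj hK hk F hF hF1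
  refine (hbl h2 h3 hinj hK hk F hF hF1).trans ?_
  linarith

/-- The statistics of fixed types converge jointly to independent Poisson and Gaussian variables. -/
theorem tendstoInDistribution_normStat (hd : ∀ j, 1 < d j) (hl0 : ∀ j, 0 ≤ lam j)
    (hl : ∀ j, lam j ≤ √(d j)) (hmu : 0 ≤ mu) (hγ : 0 < γ)
    (hp : Tendsto (fun n : ℕ => (n : ℝ) / (p n : ℝ)) atTop (𝓝 γ)) {r : ℕ}
    {K : Fin r → CycleType m} (hinj : Function.Injective K) (hK : ∀ i, Admissible (K i)) :
    TendstoInDistribution (fun n (x : Sample m n (p n)) (i : Fin r) =>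
        normStat mu (altMean d lam mu γ (K i)) (stdDev d γ (K i)) (K i) x) atTop
      (id : (Fin r → ℝ) → (Fin r → ℝ)) (fun n => modelLaw m n (p n) d lam)
      (Measure.pi fun i => limitLaw (altRate d lam (K i)) (K i)) := by
  refine tendstoInDistribution_of_blClose
    (fun n => measurable_pi_lambda _ fun i => measurable_normStat _ _ _ _) fun ε hε => ?_
  obtain ⟨A, hA, hscale⟩ := exists_isScale hd hl0 hl hmu hγ hp
  obtain ⟨k, hk⟩ : ∃ k, ∀ i, size (K i) ≤ k :=
    ⟨∑ i, size (K i), fun i => Finset.single_le_sum (f := fun i => size (K i))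
      (fun _ _ => Nat.zero_le _) (Finset.mem_univ i)⟩
  set δ : ℕ → ℝ := fun n => max (n : ℝ)⁻¹ |γ * p n / n - 1| with hδ
  have hδ0 : Tendsto δ atTop (𝓝 0) := by
    have h1 : Tendsto (fun n : ℕ => |γ * p n / n - 1|) atTop (𝓝 0) := by
      have h2 := ((hp.inv₀ hγ.ne').const_mul γ).sub_const 1
      rw [mul_inv_cancel₀ hγ.ne', sub_self] at h2
      have h3 := h2.abs
      rw [abs_zero] at h3
      refine h3.congr fun n => ?_
      rw [inv_div, mul_div_assoc]
    have h4 := (tendsto_inv_atTop_nhds_zero_nat (𝕜 := ℝ)).max h1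
    rwa [max_self] at h4
  have hs : ∀ᶠ n : ℕ in atTop, IsScale d lam mu n (p n) k (A * (k + 1)) := by
    filter_upwards [hscale, (tendsto_natCast_atTop_atTop (R := ℝ)).eventually
      (eventually_ge_atTop (A * (k + 1)))] with n h1 h2 using h1 k h2
  have hr : ∀ᶠ n : ℕ in atTop, IsRatio γ n (p n) (δ n) := by
    filter_upwards [hδ0.eventually (gt_mem_nhds (show (0 : ℝ) < 1 / 2 by norm_num))] with n hn
    exact ⟨le_max_left _ _, le_max_right _ _, hn.le⟩
  have hlim : Tendsto (fun n => (A * (k + 1)) ^ (13 * k) * √(δ n)) atTop (𝓝 0) := by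
    have h1 := (Real.continuous_sqrt.tendsto 0).comp hδ0
    rw [Real.sqrt_zero] at h1
    have h2 := h1.const_mul ((A * (k + 1)) ^ (13 * k))
    rwa [mul_zero] at h2
  filter_upwards [eventually_blClose (k := fun _ => k) (X := fun _ => A * (k + 1))
    (g := fun _ => γ) hs hr hlim r hε] with n hn using hn K hinj hK hk

/-- A power of the scale with an exponent proportional to the size of the cycles grows more slowly
than any power of `n`, if this size is `O(log^{1/4} n)`: its logarithm is `O(log^{1/2} n)`. -/
lemma eventually_scale_pow_le {A : ℝ} (hA : 2 ≤ A) (C : ℝ) {b : ℝ} (hb : 0 < b) {k : ℕ → ℕ}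
    (hk : ∀ n, (k n : ℝ) ≤ |C| * Real.log n ^ (1 / 4 : ℝ) + 2) :
    ∀ᶠ n : ℕ in atTop, (A * (k n + 1)) ^ (13 * k n) ≤ (n : ℝ) ^ b := by
  set D := |C| + 3 with hD
  have hD0 : 0 < D := by positivity
  have hs : Tendsto (fun n : ℕ => Real.log n ^ (1 / 4 : ℝ)) atTop atTop :=
    (tendsto_rpow_atTop (by norm_num)).comp
      (Real.tendsto_log_atTop.comp tendsto_natCast_atTop_atTop)
  filter_upwards [hs.eventually (eventually_ge_atTop 1),
    hs.eventually (eventually_ge_atTop (13 * A * D ^ 2 / b)), eventually_ge_atTop 1]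
    with n h1 h2 hn
  have hk' := hk n
  set s := Real.log n ^ (1 / 4 : ℝ) with hsdef
  have hn' : (0 : ℝ) < n := by exact_mod_cast hn
  have hlog : 0 ≤ Real.log n := Real.log_natCast_nonneg n
  have hs4 : s ^ 4 = Real.log n := by
    rw [hsdef, ← Real.rpow_natCast, ← Real.rpow_mul hlog]; norm_num
  have hk0 : (0 : ℝ) ≤ k n := by positivity
  have hkD : (k n : ℝ) + 1 ≤ D * s := by rw [hD]; nlinarith
  have hX : A * (k n + 1) ≤ Real.exp (A * (D * s)) := by
    have h3 := Real.add_one_le_exp (A * (D * s))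
    have : A * (k n + 1) ≤ A * (D * s) := by gcongr
    linarith
  calc (A * ((k n : ℝ) + 1)) ^ (13 * k n) ≤ Real.exp (A * (D * s)) ^ (13 * k n) := by gcongr
    _ = Real.exp ((13 * k n : ℕ) * (A * (D * s))) := (Real.exp_nat_mul _ _).symm
    _ ≤ Real.exp (Real.log n * b) := by
      refine Real.exp_le_exp.2 ?_
      push_cast
      rw [div_le_iff₀ hb] at h2
      calc 13 * (k n : ℝ) * (A * (D * s)) ≤ 13 * (D * s) * (A * (D * s)) := by
            gcongr; linarith
        _ = 13 * A * D ^ 2 * s ^ 2 := by ring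
        _ ≤ s * b * s ^ 2 := by gcongr
        _ ≤ s * b * s ^ 3 := by
          have : s ^ 2 ≤ s ^ 3 := pow_le_pow_right₀ h1 (by norm_num)
          gcongr
        _ = _ := by rw [← hs4]; ring
    _ = (n : ℝ) ^ b := (Real.rpow_def_of_pos hn' b).symm

/-- The approximation is uniform for cycles of size `O(log^{1/4} n)`, if the ratio `n / p` is
replaced by a number that is polynomially close to it. -/
theorem exists_uniform_blClose (hd : ∀ j, 1 < d j) (hl0 : ∀ j, 0 ≤ lam j)
    (hl : ∀ j, lam j ≤ √(d j)) (hmu : 0 ≤ mu) (hγ : 0 < γ)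
    (hp : Tendsto (fun n : ℕ => (n : ℝ) / (p n : ℝ)) atTop (𝓝 γ)) {g : ℕ → ℝ} {a : ℝ}
    (ha : 0 < a)
    (hg : (fun n : ℕ => g n - (n : ℝ) / (p n : ℝ)) =O[atTop] fun n : ℕ => (n : ℝ) ^ (-a))
    (r : ℕ) (C : ℝ) {ε : ℝ} (hε : 0 < ε) :
    ∃ N : ℕ, ∀ n ≥ N, ∀ K : Fin r → CycleType m, Function.Injective K →
      (∀ i, Admissible (K i) ∧ (size (K i) : ℝ) ≤ C * Real.log n ^ (1 / 4 : ℝ)) →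
      BLClose ((modelLaw m n (p n) d lam).map fun x i =>
          normStat mu (altMean d lam mu (g n) (K i)) (stdDev d (g n) (K i)) (K i) x)
        (Measure.pi fun i => limitLaw (altRate d lam (K i)) (K i)) ε := by
  obtain ⟨A, hA, hscale⟩ := exists_isScale hd hl0 hl hmu hγ hp
  obtain ⟨c, hc⟩ := hg.bound
  -- the precision is limited by that of `g` and by the error terms of order `1 / n`
  set b := min a 1 with hb
  have hb0 : 0 < b := lt_min ha one_pos
  have hγ' : 0 < γ⁻¹ := inv_pos.2 hγ
  set M := 1 + |c| * (γ⁻¹ + 1) with hM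
  have hM0 : 0 < M := by positivity
  -- an upper bound for the size of the cycles; adding one makes it positive
  set k : ℕ → ℕ := fun n => ⌈|C| * Real.log n ^ (1 / 4 : ℝ)⌉₊ + 1 with hk
  have hlog0 : ∀ n : ℕ, 0 ≤ Real.log n ^ (1 / 4 : ℝ) := fun n =>
    Real.rpow_nonneg (Real.log_natCast_nonneg n) _
  have hk2 : ∀ n, (k n : ℝ) ≤ |C| * Real.log n ^ (1 / 4 : ℝ) + 2 := by
    intro n
    have := (Nat.ceil_lt_add_one (mul_nonneg (abs_nonneg C) (hlog0 n))).le
    rw [hk]; push_cast; linarith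
  -- the factor `√δ` gains `n ^ (-b / 2)`, of which half is needed for the power of the scale
  have hgrow := eventually_scale_pow_le hA C (show 0 < b / 4 by positivity) hk2
  set δ : ℕ → ℝ := fun n => M * (n : ℝ) ^ (-b) with hδ
  have hδ0 : Tendsto δ atTop (𝓝 0) := by
    have := ((tendsto_rpow_neg_atTop hb0).comp (tendsto_natCast_atTop_atTop (R := ℝ))).const_mul M
    rwa [mul_zero] at this
  have hs : ∀ᶠ n : ℕ in atTop, IsScale d lam mu n (p n) (k n) (A * (k n + 1)) := by
    filter_upwards [hscale, hgrow, eventually_ge_atTop 1] with n h1 h2 hn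
    refine h1 _ ?_
    have hn' : (1 : ℝ) ≤ n := by exact_mod_cast hn
    have hX1 : 1 ≤ A * ((k n : ℝ) + 1) := by
      have : (0 : ℝ) ≤ k n := by positivity
      nlinarith
    calc A * ((k n : ℝ) + 1) ≤ (A * ((k n : ℝ) + 1)) ^ (13 * k n) :=
          le_self_pow₀ hX1 (by simp only [hk]; omega)
      _ ≤ (n : ℝ) ^ (b / 4) := h2
      _ ≤ (n : ℝ) ^ (1 : ℝ) :=
          Real.rpow_le_rpow_of_exponent_le hn' (by have : b ≤ 1 := min_le_right _ _; linarith)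
      _ = n := Real.rpow_one _
  have hr : ∀ᶠ n : ℕ in atTop, IsRatio (g n) n (p n) (δ n) := by
    have h2 : ∀ᶠ n : ℕ in atTop, ((n : ℝ) / (p n : ℝ))⁻¹ < γ⁻¹ + 1 :=
      (hp.inv₀ hγ.ne').eventually (gt_mem_nhds (by linarith))
    have h3 : ∀ᶠ n : ℕ in atTop, 0 < (n : ℝ) / (p n : ℝ) := hp.eventually (lt_mem_nhds hγ)
    filter_upwards [hc, h2, h3, eventually_ge_atTop 1,
      hδ0.eventually (gt_mem_nhds (show (0 : ℝ) < 1 / 2 by norm_num))] with n h1 h2 h3 hn h4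
    have hn' : (1 : ℝ) ≤ n := by exact_mod_cast hn
    have hn0 : (0 : ℝ) < n := by linarith
    have hpow : 0 < (n : ℝ) ^ (-b) := Real.rpow_pos_of_pos hn0 _
    refine ⟨?_, ?_, h4.le⟩
    · calc (n : ℝ)⁻¹ = (n : ℝ) ^ (-1 : ℝ) := (Real.rpow_neg_one _).symm
        _ ≤ (n : ℝ) ^ (-b) :=
          Real.rpow_le_rpow_of_exponent_le hn' (neg_le_neg (min_le_right _ _))
        _ ≤ δ n := le_mul_of_one_le_left hpow.le (by
          have : 0 ≤ |c| * (γ⁻¹ + 1) := by positivity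
          linarith)
    · have hp0 : (p n : ℝ) ≠ 0 := by
        intro h; rw [h, div_zero] at h3; exact lt_irrefl 0 h3
      have e : g n * p n / n - 1 = (g n - n / p n) * ((n : ℝ) / (p n : ℝ))⁻¹ := by field_simp
      rw [Real.norm_eq_abs, Real.norm_eq_abs, abs_of_pos (Real.rpow_pos_of_pos hn0 _)] at h1
      rw [e, abs_mul, abs_of_pos (inv_pos.2 h3)]
      calc _ ≤ (|c| * (n : ℝ) ^ (-b)) * (γ⁻¹ + 1) := by
            refine mul_le_mul (h1.trans ?_) h2.le (inv_pos.2 h3).le (by positivity)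
            have : (n : ℝ) ^ (-a) ≤ (n : ℝ) ^ (-b) :=
              Real.rpow_le_rpow_of_exponent_le hn' (neg_le_neg (min_le_left _ _))
            exact mul_le_mul (le_abs_self c) this (Real.rpow_pos_of_pos hn0 _).le (abs_nonneg c)
        _ = |c| * (γ⁻¹ + 1) * (n : ℝ) ^ (-b) := by ring
        _ ≤ δ n := mul_le_mul_of_nonneg_right (by linarith) hpow.le
  have hlim : Tendsto (fun n => (A * (k n + 1)) ^ (13 * k n) * √(δ n)) atTop (𝓝 0) := by
    have h1 : Tendsto (fun n : ℕ => √M * (n : ℝ) ^ (-(b / 4))) atTop (𝓝 0) := by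
      have := ((tendsto_rpow_neg_atTop (show 0 < b / 4 by positivity)).comp
        (tendsto_natCast_atTop_atTop (R := ℝ))).const_mul (√M)
      rwa [mul_zero] at this
    refine squeeze_zero' (Eventually.of_forall fun n => ?_) ?_ h1
    · have : 0 ≤ A * ((k n : ℝ) + 1) := by positivity
      positivity
    · filter_upwards [hgrow, eventually_ge_atTop 1] with n h2 hn
      have hn0 : (0 : ℝ) < n := by exact_mod_cast hn
      have e : √(δ n) = √M * (n : ℝ) ^ (-(b / 2)) := by
        rw [hδ]
        simp only
        rw [Real.sqrt_mul hM0.le, Real.sqrt_eq_rpow ((n : ℝ) ^ (-b)), ← Real.rpow_mul hn0.le]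
        congr 2; ring
      rw [e]
      calc _ ≤ (n : ℝ) ^ (b / 4) * (√M * (n : ℝ) ^ (-(b / 2))) := by gcongr
        _ = √M * ((n : ℝ) ^ (b / 4) * (n : ℝ) ^ (-(b / 2))) := by ring
        _ = _ := by rw [← Real.rpow_add hn0]; congr 2; ring
  obtain ⟨N, hN⟩ := eventually_atTop.1 (eventually_blClose hs hr hlim r hε)
  refine ⟨N, fun n hn K hinj hK => hN n hn K hinj (fun i => (hK i).1) fun i => ?_⟩
  have h1 : (size (K i) : ℝ) ≤ |C| * Real.log n ^ (1 / 4 : ℝ) :=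
    (hK i).2.trans (mul_le_mul_of_nonneg_right (le_abs_self C) (hlog0 n))
  have h2 := Nat.le_ceil (|C| * Real.log n ^ (1 / 4 : ℝ))
  have h3 : size (K i) ≤ ⌈|C| * Real.log n ^ (1 / 4 : ℝ)⌉₊ := by exact_mod_cast h1.trans h2
  simp only [hk]; omega

/-! ### Absence of a signal -/

lemma prod_pow_eq_zero {K : CycleType m} (hK : 2 ≤ size K) (hl : K.2 = 0) :
    ∏ j, ((0 : Fin m → ℝ) j * √(d j)) ^ K.1 j = 0 := by
  have h : ∃ j, K.1 j ≠ 0 := by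
    by_contra hn
    push Not at hn
    simp [size, hl, hn] at hK
  obtain ⟨j, hj⟩ := h
  exact Finset.prod_eq_zero (Finset.mem_univ j) (by simp [hj])

lemma altMean_zero {K : CycleType m} (hK : 2 ≤ size K) (g : ℝ) : altMean d 0 0 g K = 0 := by
  by_cases hl : K.2 = 0
  · rw [altMean, prod_pow_eq_zero hK hl]; ring
  · rw [altMean, zero_div, zero_pow hl, mul_zero]

lemma altRate_zero {K : CycleType m} (hK : 2 ≤ size K) (hl : K.2 = 0) :
    altRate d 0 K = nullRate d K := by
  rw [altRate, nullRate, prod_pow_eq_zero hK hl, add_zero]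

lemma limitLaw_altRate_zero {K : CycleType m} (hK : 2 ≤ size K) :
    limitLaw (altRate d 0 K) K = limitLaw (nullRate d K) K := by
  unfold limitLaw
  split_ifs with hl
  · rw [altRate_zero hK hl]
  · rfl

end

end CycleStat

/-! ### Limit laws under both hypotheses -/

theorem theorem2p2 {m : ℕ} (d : Fin m → ℝ) (hd : ∀ j, 1 < d j)
    (γ : ℝ) (hγ : 0 < γ) (p : ℕ → ℕ)
    (hp : Tendsto (fun n : ℕ => (n : ℝ) / (p n : ℝ)) atTop (𝓝 γ)) :
    -- under the null hypothesis
    ((∀ K : CycleStat.CycleType m, CycleStat.Admissible K → K.2 = 0 →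
        TendstoInDistribution
          (fun n (x : CycleStat.Sample m n (p n)) => CycleStat.cycleStat 0 K x) atTop
          (id : ℝ → ℝ) (fun n => CycleStat.modelLaw m n (p n) d 0)
          (CycleStat.poissonReal (CycleStat.nullRate d K))) ∧
      (∀ K : CycleStat.CycleType m, CycleStat.Admissible K → 0 < K.2 →
        TendstoInDistribution
          (fun n (x : CycleStat.Sample m n (p n)) =>
            CycleStat.cycleStat 0 K x / CycleStat.stdDev d γ K) atTop
          (id : ℝ → ℝ) (fun n => CycleStat.modelLaw m n (p n) d 0) (gaussianReal 0 1)) ∧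
      -- asymptotic independence
      (∀ (r : ℕ) (K : Fin r → CycleStat.CycleType m), Function.Injective K →
        (∀ i, CycleStat.Admissible (K i)) →
        TendstoInDistribution
          (fun n (x : CycleStat.Sample m n (p n)) (i : Fin r) =>
            CycleStat.normStat 0 0 (CycleStat.stdDev d γ (K i)) (K i) x) atTop
          (id : (Fin r → ℝ) → (Fin r → ℝ)) (fun n => CycleStat.modelLaw m n (p n) d 0)
          (Measure.pi fun i => CycleStat.limitLaw (CycleStat.nullRate d (K i)) (K i))) ∧
      -- uniformity for cycle types of size `O(log^{1/4} n)`
      (∀ g : ℕ → ℝ,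
        (∃ a : ℝ, 0 < a ∧
          (fun n : ℕ => g n - (n : ℝ) / (p n : ℝ)) =O[atTop] fun n : ℕ => (n : ℝ) ^ (-a)) →
        ∀ (r : ℕ) (C ε : ℝ), 0 < ε → ∃ N : ℕ, ∀ n ≥ N, ∀ K : Fin r → CycleStat.CycleType m,
          Function.Injective K →
          (∀ i, CycleStat.Admissible (K i) ∧
            (CycleStat.size (K i) : ℝ) ≤ C * Real.log n ^ (1 / 4 : ℝ)) →
          CycleStat.BLClose
            ((CycleStat.modelLaw m n (p n) d 0).map fun x i =>
              CycleStat.normStat 0 0 (CycleStat.stdDev d (g n) (K i)) (K i) x)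
            (Measure.pi fun i => CycleStat.limitLaw (CycleStat.nullRate d (K i)) (K i)) ε)) ∧
    -- under the alternative
    (∀ (lam : Fin m → ℝ) (mu : ℝ), (∀ j, 0 ≤ lam j) → (∀ j, lam j ≤ √(d j)) → 0 ≤ mu →
      ¬ (lam = 0 ∧ mu = 0) →
      (∀ K : CycleStat.CycleType m, CycleStat.Admissible K → K.2 = 0 →
        TendstoInDistribution
          (fun n (x : CycleStat.Sample m n (p n)) => CycleStat.cycleStat mu K x) atTop
          (id : ℝ → ℝ) (fun n => CycleStat.modelLaw m n (p n) d lam)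
          (CycleStat.poissonReal (CycleStat.altRate d lam K))) ∧
      (∀ K : CycleStat.CycleType m, CycleStat.Admissible K → 0 < K.2 →
        TendstoInDistribution
          (fun n (x : CycleStat.Sample m n (p n)) =>
            (CycleStat.cycleStat mu K x - CycleStat.altMean d lam mu γ K) /
              CycleStat.stdDev d γ K) atTop
          (id : ℝ → ℝ) (fun n => CycleStat.modelLaw m n (p n) d lam) (gaussianReal 0 1)) ∧
      -- asymptotic independence
      (∀ (r : ℕ) (K : Fin r → CycleStat.CycleType m), Function.Injective K →
        (∀ i, CycleStat.Admissible (K i)) →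
        TendstoInDistribution
          (fun n (x : CycleStat.Sample m n (p n)) (i : Fin r) =>
            CycleStat.normStat mu (CycleStat.altMean d lam mu γ (K i))
              (CycleStat.stdDev d γ (K i)) (K i) x) atTop
          (id : (Fin r → ℝ) → (Fin r → ℝ)) (fun n => CycleStat.modelLaw m n (p n) d lam)
          (Measure.pi fun i => CycleStat.limitLaw (CycleStat.altRate d lam (K i)) (K i))) ∧
      -- uniformity for cycle types of size `O(log^{1/4} n)`
      (∀ g : ℕ → ℝ,
        (∃ a : ℝ, 0 < a ∧
          (fun n : ℕ => g n - (n : ℝ) / (p n : ℝ)) =O[atTop] fun n : ℕ => (n : ℝ) ^ (-a)) →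
        ∀ (r : ℕ) (C ε : ℝ), 0 < ε → ∃ N : ℕ, ∀ n ≥ N, ∀ K : Fin r → CycleStat.CycleType m,
          Function.Injective K →
          (∀ i, CycleStat.Admissible (K i) ∧
            (CycleStat.size (K i) : ℝ) ≤ C * Real.log n ^ (1 / 4 : ℝ)) →
          CycleStat.BLClose
            ((CycleStat.modelLaw m n (p n) d lam).map fun x i =>
              CycleStat.normStat mu (CycleStat.altMean d lam mu (g n) (K i))
                (CycleStat.stdDev d (g n) (K i)) (K i) x)
            (Measure.pi fun i => CycleStat.limitLaw (CycleStat.altRate d lam (K i)) (K i)) ε)) := by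
  have hz : ∀ j, (0 : ℝ) ≤ (0 : Fin m → ℝ) j := fun _ => le_rfl
  have hz' : ∀ j, (0 : Fin m → ℝ) j ≤ √(d j) := fun _ => Real.sqrt_nonneg _
  have hinj1 : ∀ K : CycleStat.CycleType m, Function.Injective fun _ : Fin 1 => K :=
    fun K => Function.injective_of_subsingleton _
  refine ⟨⟨?_, ?_, ?_, ?_⟩, ?_⟩
  · intro K hK hl
    have h := CycleStat.tendstoInDistribution_eval (CycleStat.tendstoInDistribution_normStat hd hz
      hz' le_rfl hγ hp (hinj1 K) fun _ => hK)
    simpa only [CycleStat.normStat, if_pos hl, CycleStat.altRate_zero hK.1 hl,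
      CycleStat.limitLaw] using h
  · intro K hK hl
    have h := CycleStat.tendstoInDistribution_eval (CycleStat.tendstoInDistribution_normStat hd hz
      hz' le_rfl hγ hp (hinj1 K) fun _ => hK)
    simpa only [CycleStat.normStat, if_neg hl.ne', CycleStat.altMean_zero hK.1, sub_zero,
      CycleStat.limitLaw] using h
  · intro r K hinj hK
    have h := CycleStat.tendstoInDistribution_normStat hd hz hz' le_rfl hγ hp hinj hK
    simpa only [CycleStat.altMean_zero (hK _).1, CycleStat.limitLaw_altRate_zero (hK _).1] using h
  · rintro g ⟨a, ha, hg⟩ r C ε hε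
    obtain ⟨N, hN⟩ := CycleStat.exists_uniform_blClose hd hz hz' le_rfl hγ hp ha hg r C hε
    refine ⟨N, fun n hn K hinj hK => ?_⟩
    have h := hN n hn K hinj hK
    simpa only [CycleStat.altMean_zero (hK _).1.1, CycleStat.limitLaw_altRate_zero (hK _).1.1]
      using h
  · intro lam mu hl0 hl hmu _
    refine ⟨?_, ?_, ?_, ?_⟩
    · intro K hK hl'
      have h := CycleStat.tendstoInDistribution_eval (CycleStat.tendstoInDistribution_normStat hd
        hl0 hl hmu hγ hp (hinj1 K) fun _ => hK)
      simpa only [CycleStat.normStat, if_pos hl', CycleStat.limitLaw] using h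
    · intro K hK hl'
      have h := CycleStat.tendstoInDistribution_eval (CycleStat.tendstoInDistribution_normStat hd
        hl0 hl hmu hγ hp (hinj1 K) fun _ => hK)
      simpa only [CycleStat.normStat, if_neg hl'.ne', CycleStat.limitLaw] using h
    · intro r K hinj hK
      exact CycleStat.tendstoInDistribution_normStat hd hl0 hl hmu hγ hp hinj hK
    · rintro g ⟨a, ha, hg⟩ r C ε hε
      exact CycleStat.exists_uniform_blClose hd hl0 hl hmu hγ hp ha hg r C hε
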